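/- Let $X$ be a compact complex manifold, $E$ and $L$ holomorphic vector bundles on $X$, $r=\operatorname{rk}E$, and let $\theta\in H^0(X,\mathcal{E}nd(E)\otimes L)$ satisfy $\theta\wedge\theta=0$ in $\mathcal{E}nd(E)\otimes\bigwedge^2L$ (so $(E,L,\theta)$ is a Hitchin pair). Let $M^*=\bigoplus_{p+q=*}A_X^{0,p}(\mathcal{E}nd(E)\otimes\bigwedge^qL)$ be the differential graded Lie algebra of smooth forms with $$d(\omega\otimes f)=\bar\partial\omega\otimes f+(-1)^{\deg\omega}\omega\otimes[\theta,f],\qquad [\omega\otimes f,\omega'\otimes f']=(-1)^{\deg\omega'\deg f}\,\omega\wedge\omega'\otimes[f,f']$$ for local holomorphic sections $f,f'$ of $\mathcal{E}nd(E)\otimes\bigwedge^*L$, where $[f,f']=ff'-(-1)^{\deg f\deg f'}f'f$. For $k\ge 1$ let $A_X^{0,*}(\bigodot^kL)[-1]$ be the abelian differential graded Lie algebra whose part of degree $n$ is $A_X^{0,n-1}(\bigodot^kL)$, with differential $\bar\partial$ (the shift changes the grading only). A differential graded Lie algebra $V$ is regarded as the $L_\infty$-algebra with brackets $q_1(x)=-dx$,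 $q_2(x\odot y)=(-1)^{\deg x}[x,y]$ (with $\deg x$ the degree in $V$) and $q_j=0$ for $j\ge3$: they are degree $1$ maps $\bigodot^jV[1]\to V[1]$, and the coderivation $Q$ that they induce on the reduced symmetric coalgebra $\overline{S(V[1])}$ satisfies $Q\circ Q=0$. An $L_\infty$-morphism $V\to W$ is a sequence of degree $0$ linear maps $f_n:\bigodot^nV[1]\to W[1]$, $n\ge1$, such that the induced morphism of coalgebras $F:\overline{S(V[1])}\to\overline{S(W[1])}$ satisfies $F\circ Q=\hat Q\circ F$, where $Q$ and $\hat Q$ are the codifferentials of $V$ and $W$. For $1\le k\le r$ and $n\ge1$ let $g^k_n:\bigodot^n(M[1])\to A_X^{0,*}(\bigodot^kL)$ be the map given on forms $\omega_i\otimes f_i$, with $f_i$ local sections of $\mathcal{E}nd(E)\otimes L$, by $$g^k_n\big((\omega_1\otimes f_1)\odot\cdots\odot(\omega_n\otimes f_n)\big)=\omega_1\wedge\cdots\wedge\omega_n\otimes\big(\text{coefficient of }t_1\cdots t_n\text{ in }\operatorname{tr}\big((\theta+t_1f_1+\cdots+t_nf_n)^k\big)\big),$$ where products are taken in $\mathcal{E}nd(E)\otimes\bigodot^*L$,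 and which vanishes if one of the arguments lies in $A_X^{0,*}(\mathcal{E}nd(E)\otimes\bigwedge^qL)$ with $q\ne1$. Then for every $k\in\{1,\dots,r\}$ both $M$ and $A_X^{0,*}(\bigodot^kL)[-1]$, with the brackets above, are $L_\infty$-algebras, and $\{g^k_n\}_{n\ge1}$ is an $L_\infty$-morphism $$g^k_\infty:\ \bigoplus_{p+q=*}A_X^{0,p}\big(\mathcal{E}nd(E)\otimes\textstyle\bigwedge^qL\big)\longrightarrow A_X^{0,*}\big(\textstyle\bigodot^kL\big)[-1].$$ -/

import Mathlib

open scoped TensorProduct Manifold ContDiff Bundle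

noncomputable section

/-! ## Graded vector spaces, the symmetric coalgebra, `L∞`-algebras and their morphisms

A graded vector space is given by its homogeneous parts `𝒱 n`, `n : ℤ`, which are subspaces of one
ambient vector space `V`.  A homogeneous element is recorded as a pair `(n, v)` with `v ∈ 𝒱 n`. -/

namespace LInf

section General

variable {V W U : Type*} [AddCommGroup V] [Module ℂ V] [AddCommGroup W] [Module ℂ W]
  [AddCommGroup U] [Module ℂ U]

/-- The shift `V[1]`, with `V[1]ⁿ = Vⁿ⁺¹`. -/
def shift (𝒱 : ℤ → Submodule ℂ V) : ℤ → Submodule ℂ V := fun n => 𝒱 (n + 1)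

/-- The tuple `x = ((d₁, v₁), …, (dₙ, vₙ))` consists of homogeneous elements: `vᵢ ∈ 𝒱 dᵢ`. -/
def Homog (𝒱 : ℤ → Submodule ℂ V) {n : ℕ} (x : Fin n → ℤ × V) : Prop :=
  ∀ i, (x i).2 ∈ 𝒱 (x i).1

/-- The Koszul sign of rearranging homogeneous elements of degrees `d₁, …, dₙ` so that the values of
`c` (the position, or the block, to which an element is moved) become increasing, where the order
inside a block is kept: each inversion of `c` contributes `(-1)^(dᵢ dⱼ)`. -/
def koszul {n : ℕ} (d : Fin n → ℤ) (c : Fin n → ℕ) : ℤ :=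
  ∏ i, ∏ j, if i < j ∧ c j < c i then ((d i * d j).negOnePow : ℤ) else 1

/-- The subtuple of `x` with indices in `S`, in increasing order. -/
def sub {α : Type*} {n : ℕ} (x : Fin n → α) (S : Finset (Fin n)) : Fin S.card → α :=
  fun i => x (S.orderEmbOfFin rfl i)

/-- A sequence of operations `φ_k`, `k = 0, 1, 2, …` (only `k ≥ 1` matters), where `φ_k` is given by
its values on `k`-tuples of homogeneous elements. -/
abbrev Ops (V W : Type*) : Type _ := (k : ℕ) → (Fin k → ℤ × V) → W

/-- `φ` is a linear map `⨀ᵏ V → W` of degree `r`: on homogeneous elements it has degree `r`, it is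
linear in every variable, and it is graded symmetric,
`φ(v₁ ⊙ ⋯ ⊙ v_k) = ε(σ) φ(v_{σ(1)} ⊙ ⋯ ⊙ v_{σ(k)})`. -/
structure IsSymMap (𝒱 : ℤ → Submodule ℂ V) (𝒲 : ℤ → Submodule ℂ W) (r : ℤ) {k : ℕ}
    (φ : (Fin k → ℤ × V) → W) : Prop where
  mem : ∀ x, Homog 𝒱 x → φ x ∈ 𝒲 (∑ i, (x i).1 + r)
  map_add : ∀ x, Homog 𝒱 x → ∀ i, ∀ v ∈ 𝒱 (x i).1, ∀ w ∈ 𝒱 (x i).1,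
    φ (Function.update x i ((x i).1, v + w)) =
      φ (Function.update x i ((x i).1, v)) + φ (Function.update x i ((x i).1, w))
  map_smul : ∀ x, Homog 𝒱 x → ∀ i, ∀ a : ℂ, ∀ v ∈ 𝒱 (x i).1,
    φ (Function.update x i ((x i).1, a • v)) = a • φ (Function.update x i ((x i).1, v))
  symm : ∀ x, Homog 𝒱 x → ∀ σ : Equiv.Perm (Fin k),
    φ x = koszul (fun i => (x i).1) (fun i => (σ.symm i : ℕ)) • φ (fun i => x (σ i))

/-- The relations `v ⊗ w = (-1)^(deg v deg w) w ⊗ v` in the tensor algebra of `⨁ₙ 𝒱 n`. -/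
inductive SymRel (𝒱 : ℤ → Submodule ℂ V) :
    TensorAlgebra ℂ (DirectSum ℤ fun n => 𝒱 n) → TensorAlgebra ℂ (DirectSum ℤ fun n => 𝒱 n) → Prop
  | swap (i j : ℤ) (v : 𝒱 i) (w : 𝒱 j) :
      SymRel 𝒱
        (TensorAlgebra.ι ℂ (DirectSum.lof ℂ ℤ (fun n => 𝒱 n) i v) *
          TensorAlgebra.ι ℂ (DirectSum.lof ℂ ℤ (fun n => 𝒱 n) j w))
        (((i * j).negOnePow : ℤ) •
          (TensorAlgebra.ι ℂ (DirectSum.lof ℂ ℤ (fun n => 𝒱 n) j w) *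
            TensorAlgebra.ι ℂ (DirectSum.lof ℂ ℤ (fun n => 𝒱 n) i v)))

/-- The space `S(V) = ⨁ₙ ⨀ⁿ V`, with its product `⊙`. -/
abbrev Sym (𝒱 : ℤ → Submodule ℂ V) : Type _ := RingQuot (SymRel 𝒱)

open Classical in
/-- The element of `S(V)` given by a homogeneous element of `V`. -/
def gen (𝒱 : ℤ → Submodule ℂ V) (a : ℤ × V) : Sym 𝒱 :=
  if h : a.2 ∈ 𝒱 a.1 then
    RingQuot.mkAlgHom ℂ (SymRel 𝒱)
      (TensorAlgebra.ι ℂ (DirectSum.lof ℂ ℤ (fun n => 𝒱 n) a.1 ⟨a.2, h⟩))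
  else 0

/-- The monomial `v₁ ⊙ ⋯ ⊙ vₙ`.  Those with `n ≥ 1` span the reduced symmetric coalgebra. -/
def mon (𝒱 : ℤ → Submodule ℂ V) : Ops V (Sym 𝒱) :=
  fun n x => (List.ofFn fun i : Fin n => gen 𝒱 (x i)).prod

/-- The homogeneous element `φ_{|S|}(v_S)`, where the operations `φ` have degree `r`. -/
def value (r : ℤ) (φ : Ops V W) {n : ℕ} (x : Fin n → ℤ × V) (S : Finset (Fin n)) : ℤ × W :=
  (∑ i ∈ S, (x i).1 + r, φ S.card (sub x S))

/-- Let `Q` be the coderivation of the reduced symmetric coalgebra that is induced by the sequence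
`q` of maps of degree `1`,
`Q(v₁ ⊙ ⋯ ⊙ vₙ) = ∑_S ε(S) q_{|S|}(v_S) ⊙ v_{Sᶜ}`, the sum being over the nonempty `S ⊆ {1, …, n}`
(that is, over all `k ≥ 1` and all `(k, n - k)`-shuffles).  For a linear map `Φ`, given by its values
on monomials, `afterCoder q Φ` is `Φ ∘ Q`, given by its values on monomials. -/
def afterCoder (q : Ops V V) (Φ : Ops V U) : Ops V U := fun n x =>
  ∑ S ∈ (Finset.univ : Finset (Finset (Fin n))) with S.Nonempty,
    koszul (fun i => (x i).1) (fun i => if i ∈ S then 0 else 1) •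
      Φ (Sᶜ.card + 1) (Fin.cons (value 1 q x S) (sub x Sᶜ))

/-- Let `F` be the morphism of reduced symmetric coalgebras that is induced by the sequence `f` of
maps of degree `0`, `F = ∑_m (1/m!) f^{⊙ m} ∘ Δ^{m-1}`, that is,
`F(v₁ ⊙ ⋯ ⊙ vₙ) = ∑_m (1/m!) ∑_c ε(c) f(v_{c⁻¹(1)}) ⊙ ⋯ ⊙ f(v_{c⁻¹(m)})`, where `c` runs over the
surjections `{1, …, n} → {1, …, m}`.  For a linear map `Φ`, given by its values on monomials,
`afterMor f Φ` is `Φ ∘ F`, given by its values on monomials. -/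
def afterMor (f : Ops V W) (Φ : Ops W U) : Ops V U := fun n x =>
  ∑ m ∈ Finset.range (n + 1), ((m.factorial : ℂ)⁻¹) •
    ∑ c ∈ (Finset.univ : Finset (Fin n → Fin m)) with Function.Surjective c,
      koszul (fun i => (x i).1) (fun i => (c i : ℕ)) •
        Φ m (fun j => value 0 f x {i | c i = j})

/-- `(V, q)` is an `L∞`-algebra: `q_k : ⨀ᵏ V[1] → V[1]`, `k ≥ 1`, are linear maps of degree `1`, and
the coderivation `Q` that they induce on the reduced symmetric coalgebra of `V[1]` satisfies
`Q ∘ Q = 0`.  (The degrees in the arguments of `q` are those of `V[1]`.) -/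
structure IsLInftyAlgebra (𝒱 : ℤ → Submodule ℂ V) (q : Ops V V) : Prop where
  isSymMap : ∀ k, 1 ≤ k → IsSymMap (shift 𝒱) (shift 𝒱) 1 (q k)
  codifferential : ∀ n, 1 ≤ n → ∀ x : Fin n → ℤ × V, Homog (shift 𝒱) x →
    afterCoder q (afterCoder q (mon (shift 𝒱))) n x = 0

/-- `f` is an `L∞`-morphism `(V, q) → (W, q')`: both sides are `L∞`-algebras,
`f_k : ⨀ᵏ V[1] → W[1]`, `k ≥ 1`, are linear maps of degree `0`, and the morphism `F` of reduced
symmetric coalgebras that they induce satisfies `F ∘ Q = Q' ∘ F`. -/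
structure IsLInftyMorphism (𝒱 : ℤ → Submodule ℂ V) (q : Ops V V) (𝒲 : ℤ → Submodule ℂ W)
    (q' : Ops W W) (f : Ops V W) : Prop where
  source : IsLInftyAlgebra 𝒱 q
  target : IsLInftyAlgebra 𝒲 q'
  isSymMap : ∀ k, 1 ≤ k → IsSymMap (shift 𝒱) (shift 𝒲) 0 (f k)
  comm : ∀ n, 1 ≤ n → ∀ x : Fin n → ℤ × V, Homog (shift 𝒱) x →
    afterCoder q (afterMor f (mon (shift 𝒲))) n x =
      afterMor f (afterCoder q' (mon (shift 𝒲))) n x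

/-- The brackets of the `L∞`-algebra of a differential graded Lie algebra:
`q₁(x) = -dx`, `q₂(x ⊙ y) = (-1)^(deg x) [x, y]` and `q_k = 0` for `k ≥ 3`.  Here `d n` and
`br n m` are the restrictions of the differential and of the bracket to the elements of degree `n`,
and of degrees `n` and `m`; an element of degree `n` in `V[1]` has degree `n + 1` in `V`. -/
def dglaOps (d : ℤ → V → V) (br : ℤ → ℤ → V → V → V) : Ops V V := fun k =>
  match k with
  | 1 => fun x => - d ((x 0).1 + 1) (x 0).2
  | 2 => fun x => (((x 0).1 + 1).negOnePow : ℤ) • br ((x 0).1 + 1) ((x 1).1 + 1) (x 0).2 (x 1).2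
  | _ => fun _ => 0

end General

end LInf

/-! ## Sections, `(0,p)`-forms and the Dolbeault operator -/

namespace Hitchin

section Algebra

/-- The conjugate-linear functionals on a tangent space: the `(0,1)`-covectors. -/
abbrev ConjDual (T : Type*) [AddCommGroup T] [Module ℂ T] : Type _ := T →ₛₗ[starRingEnd ℂ] ℂ

/-- Pullback of `(0,1)`-covectors along a complex linear map. -/
def ConjDual.pull {T T' : Type*} [AddCommGroup T] [Module ℂ T] [AddCommGroup T'] [Module ℂ T']
    (τ : T' →ₗ[ℂ] T) : ConjDual T →ₗ[ℂ] ConjDual T' where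
  toFun φ := φ.comp τ
  map_add' _ _ := rfl
  map_smul' _ _ := rfl

/-- The algebra `⋀ T̄^*` of `(0,*)`-covectors. -/
abbrev Forms (T : Type*) [AddCommGroup T] [Module ℂ T] : Type _ := ExteriorAlgebra ℂ (ConjDual T)

variable (T E L : Type*) [AddCommGroup T] [Module ℂ T] [AddCommGroup E] [Module ℂ E]
  [AddCommGroup L] [Module ℂ L]

/-- The fibre `End E ⊗ (⋀ T̄^* ⊗ ⋀ L)` of the bundle of `(0,*)`-forms with values in
`End E ⊗ ⋀ L`.  Its product is
`(ω ⊗ f)(ω' ⊗ f') = (-1)^(deg ω' deg f) (ω ∧ ω') ⊗ f f'` for `f, f' ∈ End E ⊗ ⋀ L`. -/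
abbrev EndFib : Type _ :=
  Module.End ℂ E ⊗[ℂ]
    ((fun i : ℕ => ⋀[ℂ]^i (ConjDual T)) ᵍ⊗[ℂ] (fun i : ℕ => ⋀[ℂ]^i L))

/-- The fibre `⋀ T̄^* ⊗ ⨀ L` of the bundle of `(0,*)`-forms with values in `⨀ L`. -/
abbrev SymFib : Type _ := Forms T ⊗[ℂ] SymmetricAlgebra ℂ L

/-- The part `⋀ᵖ T̄^* ⊗ End E ⊗ ⋀^q L`. -/
def endPart (p q : ℕ) : Submodule ℂ (EndFib T E L) :=
  Submodule.span ℂ {z | ∃ (f : Module.End ℂ E) (η : Forms T) (l : ExteriorAlgebra ℂ L),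
    η ∈ ⋀[ℂ]^p (ConjDual T) ∧ l ∈ ⋀[ℂ]^q L ∧ z = f ⊗ₜ[ℂ] (η ᵍ⊗ₜ[ℂ] l)}

/-- The part `⋀ᵖ T̄^* ⊗ ⨀ᵏ L`. -/
def symPart (p k : ℕ) : Submodule ℂ (SymFib T L) :=
  Submodule.span ℂ {z | ∃ (η : Forms T) (s : SymmetricAlgebra ℂ L),
    η ∈ ⋀[ℂ]^p (ConjDual T) ∧ s ∈ (LinearMap.range (SymmetricAlgebra.ι ℂ L)) ^ k ∧
      z = η ⊗ₜ[ℂ] s}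

variable {T E L}
variable {T' E' L' : Type*} [AddCommGroup T'] [Module ℂ T'] [AddCommGroup E'] [Module ℂ E']
  [AddCommGroup L'] [Module ℂ L']

/-- Conjugation `f ↦ e ∘ f ∘ e'`, where `e'` is the inverse of `e`. -/
def conjEnd (e : E →ₗ[ℂ] E') (e' : E' →ₗ[ℂ] E) : Module.End ℂ E →ₗ[ℂ] Module.End ℂ E' :=
  (LinearMap.llcomp ℂ E' E E' e) ∘ₗ (LinearMap.lcomp ℂ E e')

/-- The map of fibres induced by isomorphisms `T → T'`, `E → E'`, `L → L'`; of the first one takes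
the inverse `τ`, of the second one takes also the inverse `e'`. -/
def EndFib.map (τ : T' →ₗ[ℂ] T) (e : E →ₗ[ℂ] E') (e' : E' →ₗ[ℂ] E) (l : L →ₗ[ℂ] L') :
    EndFib T E L →ₗ[ℂ] EndFib T' E' L' :=
  TensorProduct.map (conjEnd e e')
    ((GradedTensorProduct.of ℂ _ _).toLinearMap ∘ₗ
      TensorProduct.map (ExteriorAlgebra.map (ConjDual.pull τ)).toLinearMap
        (ExteriorAlgebra.map l).toLinearMap ∘ₗ
      (GradedTensorProduct.of ℂ _ _).symm.toLinearMap)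

/-- The map of fibres induced by isomorphisms `T → T'`, with inverse `τ`, and `L → L'`. -/
def SymFib.map (τ : T' →ₗ[ℂ] T) (l : L →ₗ[ℂ] L') : SymFib T L →ₗ[ℂ] SymFib T' L' :=
  TensorProduct.map (ExteriorAlgebra.map (ConjDual.pull τ)).toLinearMap
    (SymmetricAlgebra.lift (SymmetricAlgebra.ι ℂ L' ∘ₗ l)).toLinearMap

/-- The inclusion `End E ⊗ L → ⋀ T̄^* ⊗ End E ⊗ ⋀ L`. -/
def inclHiggs : Module.End ℂ E ⊗[ℂ] L →ₗ[ℂ] EndFib T E L :=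
  TensorProduct.map LinearMap.id
    ((GradedTensorProduct.of ℂ _ _).toLinearMap ∘ₗ
      TensorProduct.mk ℂ (Forms T) (ExteriorAlgebra ℂ L) 1 ∘ₗ ExteriorAlgebra.ι ℂ)

/-- The graded commutator `[x, y] = xy - (-1)^(nm) yx` of elements of total degrees `n` and `m`.
In terms of `x = ω ⊗ f` and `y = ω' ⊗ f'` with `f, f' ∈ End E ⊗ ⋀ L` it is
`(-1)^(deg ω' deg f) (ω ∧ ω') ⊗ [f, f']`. -/
def gradedComm {R : Type*} [Ring R] (n m : ℤ) (x y : R) : R :=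
  x * y - ((n * m).negOnePow : ℤ) • (y * x)

/-! ### The polarized trace powers

To compute with `n` arguments `ωᵢ ⊗ fᵢ` without moving forms past each other, the form `ωᵢ` is first
put into the `i`-th factor of the `n`-fold tensor power of `⋀ T̄^*`; at the end the factors are
multiplied in the order `ω₁ ∧ ⋯ ∧ ωₙ`. -/

/-- The algebra `End E ⊗ ((⋀ T̄^*)^{⊗ n} ⊗ ⨀ L)` (an ordinary tensor product of algebras). -/
abbrev Slots (n : ℕ) (T E L : Type*) [AddCommGroup T] [Module ℂ T] [AddCommGroup E] [Module ℂ E]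
    [AddCommGroup L] [Module ℂ L] : Type _ :=
  Module.End ℂ E ⊗[ℂ] ((⨂[ℂ] _ : Fin n, Forms T) ⊗[ℂ] SymmetricAlgebra ℂ L)

/-- `ω ⊗ f ↦ (1 ⊗ ⋯ ⊗ ω ⊗ ⋯ ⊗ 1) ⊗ f`, with `ω` in place `i`, for `f ∈ End E ⊗ L`, and
`ω ⊗ f ↦ 0` for `f ∈ End E ⊗ ⋀^q L` with `q ≠ 1` (`ιInv` is the projection of `⋀ L` to `L`). -/
def place {n : ℕ} (i : Fin n) : EndFib T E L →ₗ[ℂ] Slots n T E L :=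
  TensorProduct.map LinearMap.id
    (TensorProduct.map
        (PiTensorProduct.singleAlgHom (R := ℂ) (A := fun _ : Fin n => Forms T) i).toLinearMap
        (SymmetricAlgebra.ι ℂ L ∘ₗ ExteriorAlgebra.ιInv) ∘ₗ
      (GradedTensorProduct.of ℂ _ _).symm.toLinearMap)

/-- The inclusion of `End E ⊗ L`. -/
def placeHiggs (n : ℕ) : Module.End ℂ E ⊗[ℂ] L →ₗ[ℂ] Slots n T E L :=
  TensorProduct.map LinearMap.id
    (TensorProduct.mk ℂ (⨂[ℂ] _ : Fin n, Forms T) (SymmetricAlgebra ℂ L) 1 ∘ₗ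
      SymmetricAlgebra.ι ℂ L)

/-- `f ⊗ ((ω₁ ⊗ ⋯ ⊗ ωₙ) ⊗ s) ↦ (ω₁ ∧ ⋯ ∧ ωₙ) ⊗ tr(f) s`. -/
def wedgeTrace (n : ℕ) : Slots n T E L →ₗ[ℂ] SymFib T L :=
  (TensorProduct.lid ℂ (SymFib T L)).toLinearMap ∘ₗ
    TensorProduct.map (LinearMap.trace ℂ E)
      (TensorProduct.map
        (PiTensorProduct.lift (MultilinearMap.mkPiAlgebraFin ℂ n (Forms T))) LinearMap.id)

/-- The polynomial `θ + t₁ y₁ + ⋯ + tₙ yₙ` in the central variables `t₁, …, tₙ`, with coefficients in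
the (noncommutative) algebra `Slots`. -/
def higgsPoly (n : ℕ) (θ : Module.End ℂ E ⊗[ℂ] L) (y : Fin n → EndFib T E L) :
    AddMonoidAlgebra (Slots n T E L) (Fin n →₀ ℕ) :=
  AddMonoidAlgebra.single 0 (placeHiggs n θ) +
    ∑ i, AddMonoidAlgebra.single (Finsupp.single i 1) (place i (y i))

/-- The map `g^k_n` on fibres: for `yᵢ = ωᵢ ⊗ fᵢ` with `fᵢ ∈ End E ⊗ L` it is
`(ω₁ ∧ ⋯ ∧ ωₙ) ⊗ (coefficient of t₁ ⋯ tₙ in tr((θ + t₁ f₁ + ⋯ + tₙ fₙ)^k))`, and it vanishes if some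
`fᵢ` lies in `End E ⊗ ⋀^q L` with `q ≠ 1`. -/
def polTrace (k n : ℕ) (θ : Module.End ℂ E ⊗[ℂ] L) (y : Fin n → EndFib T E L) : SymFib T L :=
  wedgeTrace n ((higgsPoly n θ y ^ k).coeff (∑ i, Finsupp.single i 1))

end Algebra

section Calculus

variable {B M : Type*} [NormedAddCommGroup B] [NormedSpace ℂ B] [AddCommGroup M] [Module ℂ M]

/-- The derivative at `y` in the real direction `v` of a function `g` with values in a vector space,
characterized by its pairing with every linear functional. -/
def dirDeriv (g : B → M) (y v : B) : M :=
  Classical.epsilon fun D =>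
    ∀ l : Module.Dual ℂ M, HasLineDerivAt ℝ (fun z => l (g z)) (l D) y v

variable (B) in
/-- The covector `dz̄ᵢ`, for the linear coordinates `zᵢ` of a fixed basis of `B`. -/
def dzbar [FiniteDimensional ℂ B] (i : Fin (Module.finrank ℂ B)) : ConjDual B where
  toFun v := starRingEnd ℂ ((Module.finBasis ℂ B).coord i v)
  map_add' v w := by simp
  map_smul' a v := by simp

/-- `∂g/∂z̄ᵢ = ½ (∂g/∂xᵢ + √-1 ∂g/∂yᵢ)`. -/
def dbarCoord [FiniteDimensional ℂ B] (i : Fin (Module.finrank ℂ B)) (g : B → M) (y : B) : M :=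
  (1 / 2 : ℂ) • (dirDeriv g y (Module.finBasis ℂ B i) +
    Complex.I • dirDeriv g y (Complex.I • Module.finBasis ℂ B i))

variable {X : Type*} [TopologicalSpace X] [ChartedSpace B X] {Fib : X → Type*}
  [∀ x, AddCommGroup (Fib x)] [∀ x, Module ℂ (Fib x)]

/-- The expression of a section `s` in the chart at `x₀` and in the frames around `x₀`; here
`loc x₀ x : Fib x → M` gives the components in the frame around `x₀`. -/
def localRep (loc : ∀ (_ x : X), Fib x →ₗ[ℂ] M) (s : ∀ x, Fib x) (x₀ : X) (y : B) : M :=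
  loc x₀ ((extChartAt 𝓘(ℂ, B) x₀).symm y) (s ((extChartAt 𝓘(ℂ, B) x₀).symm y))

variable (B) in
/-- The domain, in the chart at `x₀`, on which the frames around `x₀` are defined. -/
def localDom (dom : X → Set X) (x₀ : X) : Set B :=
  (extChartAt 𝓘(ℂ, B) x₀).target ∩ (extChartAt 𝓘(ℂ, B) x₀).symm ⁻¹' dom x₀

/-- `s` is a `C^∞` section: all its components are. -/
def IsSmooth (loc : ∀ (_ x : X), Fib x →ₗ[ℂ] M) (dom : X → Set X) (s : ∀ x, Fib x) : Prop :=
  ∀ (x₀ : X) (l : Module.Dual ℂ M),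
    ContDiffOn ℝ ∞ (fun y : B => l (localRep loc s x₀ y)) (localDom B dom x₀)

theorem isSmooth_zero (loc : ∀ (_ x : X), Fib x →ₗ[ℂ] M) (dom : X → Set X) :
    IsSmooth (B := B) loc dom 0 := fun x₀ l => by
  have h : (fun y : B => l (localRep loc 0 x₀ y)) = fun _ => 0 :=
    funext fun y => (congrArg l (LinearMap.map_zero _)).trans l.map_zero
  rw [h]
  exact contDiffOn_const

theorem isSmooth_add {loc : ∀ (_ x : X), Fib x →ₗ[ℂ] M} {dom : X → Set X} {s t : ∀ x, Fib x}
    (hs : IsSmooth (B := B) loc dom s) (ht : IsSmooth (B := B) loc dom t) :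
    IsSmooth (B := B) loc dom (s + t) := fun x₀ l => by
  refine ((hs x₀ l).add (ht x₀ l)).congr fun y _ => ?_
  exact (congrArg l (LinearMap.map_add _ _ _)).trans (l.map_add _ _)

theorem isSmooth_smul {loc : ∀ (_ x : X), Fib x →ₗ[ℂ] M} {dom : X → Set X} {s : ∀ x, Fib x}
    (a : ℂ) (hs : IsSmooth (B := B) loc dom s) : IsSmooth (B := B) loc dom (a • s) := fun x₀ l => by
  refine ((contDiffOn_const (c := a)).mul (hs x₀ l)).congr fun y _ => ?_
  exact (congrArg l (LinearMap.map_smul _ _ _)).trans (l.map_smul _ _)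

/-- `s` is a holomorphic section: all its components are. -/
def IsHolomorphic (loc : ∀ (_ x : X), Fib x →ₗ[ℂ] M) (dom : X → Set X) (s : ∀ x, Fib x) : Prop :=
  ∀ (x₀ : X) (l : Module.Dual ℂ M),
    DifferentiableOn ℂ (fun y : B => l (localRep loc s x₀ y)) (localDom B dom x₀)

/-- The Dolbeault operator `∂̄ s = ∑ᵢ dz̄ᵢ ∧ ∂s/∂z̄ᵢ`, computed at `x` in the chart at `x` and in the
holomorphic frames around `x`.  Here `wedge λ` is the product with the `(0,1)`-covector `λ`, and
`unloc x` is the inverse of `loc x x`. -/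
def dbar [FiniteDimensional ℂ B] (loc : ∀ (_ x : X), Fib x →ₗ[ℂ] M) (unloc : ∀ x, M →ₗ[ℂ] Fib x)
    (wedge : ConjDual B → M → M) (s : ∀ x, Fib x) (x : X) : Fib x :=
  unloc x (∑ i, wedge (dzbar B i)
    (dbarCoord i (localRep (B := B) loc s x) (extChartAt 𝓘(ℂ, B) x x)))

end Calculus

/-! ## The two differential graded Lie algebras and the maps `g^k_n` -/

section Bundles

variable (B : Type*) [NormedAddCommGroup B] [NormedSpace ℂ B] [FiniteDimensional ℂ B]
  {X : Type*} [TopologicalSpace X] [ChartedSpace B X] [IsManifold 𝓘(ℂ, B) ω X]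
  (F : Type*) [NormedAddCommGroup F] [NormedSpace ℂ F]
  (E : X → Type*) [TopologicalSpace (Bundle.TotalSpace F E)] [∀ x, AddCommGroup (E x)]
  [∀ x, Module ℂ (E x)] [∀ x, TopologicalSpace (E x)] [FiberBundle F E] [VectorBundle ℂ F E]
  (G : Type*) [NormedAddCommGroup G] [NormedSpace ℂ G]
  (L : X → Type*) [TopologicalSpace (Bundle.TotalSpace G L)] [∀ x, AddCommGroup (L x)]
  [∀ x, Module ℂ (L x)] [∀ x, TopologicalSpace (L x)] [FiberBundle G L] [VectorBundle ℂ G L]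

/-- The components `V_x → F` of vectors of a vector bundle in the frame around `x₀`. -/
def toFrame (x₀ x : X) : E x →ₗ[ℂ] F := (trivializationAt F E x₀).linearMapAt ℂ x

/-- The inverse `F → V_x` of `toFrame`. -/
def fromFrame (x₀ x : X) : F →ₗ[ℂ] E x := (trivializationAt F E x₀).symmₗ ℂ x

/-- The components `T_x X → B` of tangent vectors in the chart at `x₀`. -/
def toChart (x₀ x : X) : TangentSpace 𝓘(ℂ, B) x →ₗ[ℂ] B :=
  toFrame B (fun x : X => TangentSpace 𝓘(ℂ, B) x) x₀ x

/-- The inverse `B → T_x X` of `toChart`. -/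
def fromChart (x₀ x : X) : B →ₗ[ℂ] TangentSpace 𝓘(ℂ, B) x :=
  fromFrame B (fun x : X => TangentSpace 𝓘(ℂ, B) x) x₀ x

/-- Sections of `End E ⊗ L`. -/
abbrev HiggsSec : Type _ := ∀ x, Module.End ℂ (E x) ⊗[ℂ] L x

/-- (Arbitrary) `(0,*)`-forms on `X` with values in `End E ⊗ ⋀ L`. -/
abbrev EndSec : Type _ := ∀ x : X, EndFib (TangentSpace 𝓘(ℂ, B) x) (E x) (L x)

/-- (Arbitrary) `(0,*)`-forms on `X` with values in `⨀ L`. -/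
abbrev SymSec : Type _ := ∀ x : X, SymFib (TangentSpace 𝓘(ℂ, B) x) (L x)

/-- The set on which the frames of `E` and `L` around `x₀` are both defined. -/
def frameDom (x₀ : X) : Set X :=
  (trivializationAt F E x₀).baseSet ∩ (trivializationAt G L x₀).baseSet

/-- The components, in the chart and the frames around `x₀`, of an element of the fibre at `x` of the
bundle of `(0,*)`-forms with values in `End E ⊗ ⋀ L`. -/
def endLoc (x₀ x : X) : EndFib (TangentSpace 𝓘(ℂ, B) x) (E x) (L x) →ₗ[ℂ] EndFib B F G :=
  EndFib.map (fromChart B x₀ x) (toFrame F E x₀ x) (fromFrame F E x₀ x) (toFrame G L x₀ x)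

/-- The inverse of `endLoc` at `x₀ = x`. -/
def endUnloc (x : X) : EndFib B F G →ₗ[ℂ] EndFib (TangentSpace 𝓘(ℂ, B) x) (E x) (L x) :=
  EndFib.map (toChart B x x) (fromFrame F E x x) (toFrame F E x x) (fromFrame G L x x)

/-- The components, in the chart and the frame around `x₀`, of an element of the fibre at `x` of the
bundle of `(0,*)`-forms with values in `⨀ L`. -/
def symLoc (x₀ x : X) : SymFib (TangentSpace 𝓘(ℂ, B) x) (L x) →ₗ[ℂ] SymFib B G :=
  SymFib.map (fromChart B x₀ x) (toFrame G L x₀ x)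

/-- The inverse of `symLoc` at `x₀ = x`. -/
def symUnloc (x : X) : SymFib B G →ₗ[ℂ] SymFib (TangentSpace 𝓘(ℂ, B) x) (L x) :=
  SymFib.map (toChart B x x) (fromFrame G L x x)

/-- The components, in the frames around `x₀`, of an element of the fibre of `End E ⊗ L` at `x`. -/
def higgsLoc (x₀ x : X) : Module.End ℂ (E x) ⊗[ℂ] L x →ₗ[ℂ] Module.End ℂ F ⊗[ℂ] G :=
  TensorProduct.map (conjEnd (toFrame F E x₀ x) (fromFrame F E x₀ x)) (toFrame G L x₀ x)

/-- `θ` is a holomorphic section of `End E ⊗ L`. -/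
def IsHolomorphicHiggs (θ : HiggsSec E L) : Prop :=
  IsHolomorphic (B := B) (higgsLoc F E G L) (frameDom F E G L) θ

/-- `θ ∧ θ = 0` in `End E ⊗ (L ∧ L)`. -/
def IsIntegrable {E L} [∀ x : X, AddCommGroup (E x)] [∀ x, Module ℂ (E x)]
    [∀ x : X, AddCommGroup (L x)] [∀ x, Module ℂ (L x)] (θ : HiggsSec E L) : Prop :=
  ∀ x, (TensorProduct.map LinearMap.id (ExteriorAlgebra.ι ℂ) (θ x) :
    Module.End ℂ (E x) ⊗[ℂ] ExteriorAlgebra ℂ (L x)) ^ 2 = 0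

/-- The space `A^{0,p}(End E ⊗ ⋀^q L)` of smooth forms. -/
def endForms (p q : ℕ) : Submodule ℂ (EndSec B E L) where
  carrier := {s | IsSmooth (B := B) (endLoc B F E G L) (frameDom F E G L) s ∧
    ∀ x, s x ∈ endPart (TangentSpace 𝓘(ℂ, B) x) (E x) (L x) p q}
  zero_mem' := ⟨isSmooth_zero _ _, fun _ => zero_mem _⟩
  add_mem' := fun hs ht => ⟨isSmooth_add hs.1 ht.1, fun x => add_mem (hs.2 x) (ht.2 x)⟩
  smul_mem' := fun a _ hs => ⟨isSmooth_smul a hs.1, fun x => Submodule.smul_mem _ a (hs.2 x)⟩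

/-- The space `A^{0,p}(⨀ᵏ L)` of smooth forms. -/
def symForms (p k : ℕ) : Submodule ℂ (SymSec B L) where
  carrier := {s | IsSmooth (B := B) (symLoc B G L)
      (fun x₀ => (trivializationAt G L x₀).baseSet) s ∧
    ∀ x, s x ∈ symPart (TangentSpace 𝓘(ℂ, B) x) (L x) p k}
  zero_mem' := ⟨isSmooth_zero _ _, fun _ => zero_mem _⟩
  add_mem' := fun hs ht => ⟨isSmooth_add hs.1 ht.1, fun x => add_mem (hs.2 x) (ht.2 x)⟩
  smul_mem' := fun a _ hs => ⟨isSmooth_smul a hs.1, fun x => Submodule.smul_mem _ a (hs.2 x)⟩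

/-- `∂̄` on `(0,*)`-forms with values in `End E ⊗ ⋀ L`. -/
def endDbar (s : EndSec B E L) : EndSec B E L :=
  dbar (B := B) (endLoc B F E G L) (endUnloc B F E G L)
    (fun φ z => ((1 : Module.End ℂ F) ⊗ₜ[ℂ] (ExteriorAlgebra.ι ℂ φ ᵍ⊗ₜ[ℂ] 1) : EndFib B F G) * z) s

/-- `∂̄` on `(0,*)`-forms with values in `⨀ L`. -/
def symDbar (s : SymSec B L) : SymSec B L :=
  dbar (B := B) (symLoc B G L) (symUnloc B G L)
    (fun φ z => (ExteriorAlgebra.ι ℂ φ ⊗ₜ[ℂ] 1 : SymFib B G) * z) s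

/-- The differential graded Lie algebra `M`: its part of degree `n` is
`Mⁿ = ⨁_{p+q=n} A^{0,p}(End E ⊗ ⋀^q L)`. -/
def endGr (n : ℤ) : Submodule ℂ (EndSec B E L) :=
  ⨆ (p : ℕ) (q : ℕ) (_ : (p : ℤ) + q = n), endForms B F E G L p q

/-- The differential `d x = ∂̄ x + [θ, x]` of `M` in degree `n`. -/
def endDiff (θ : HiggsSec E L) (n : ℤ) (s : EndSec B E L) : EndSec B E L :=
  endDbar B F E G L s + gradedComm 1 n (fun x => inclHiggs (θ x)) s

/-- The brackets of the `L∞`-algebra `M`. -/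
def endOps (θ : HiggsSec E L) : LInf.Ops (EndSec B E L) (EndSec B E L) :=
  LInf.dglaOps (endDiff B F E G L θ) gradedComm

/-- The abelian differential graded Lie algebra `A^{0,*}(⨀ᵏ L)[-1]`: its part of degree `n` is
`A^{0,n-1}(⨀ᵏ L)`. -/
def symGr (k : ℕ) (n : ℤ) : Submodule ℂ (SymSec B L) :=
  ⨆ (p : ℕ) (_ : (p : ℤ) = n - 1), symForms B G L p k

/-- The brackets of the `L∞`-algebra `A^{0,*}(⨀ᵏ L)[-1]`, with differential `∂̄` and bracket `0`. -/
def symOps : LInf.Ops (SymSec B L) (SymSec B L) :=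
  LInf.dglaOps (fun _ => symDbar B G L) (fun _ _ _ _ => 0)

/-- The maps `g^k_n`, `n ≥ 1`. -/
def hitchinOps {E L} [∀ x : X, AddCommGroup (E x)] [∀ x, Module ℂ (E x)]
    [∀ x : X, AddCommGroup (L x)] [∀ x, Module ℂ (L x)] (θ : HiggsSec E L) (k : ℕ) :
    LInf.Ops (EndSec B E L) (SymSec B L) :=
  fun n y x => polTrace k n (θ x) (fun i => (y i).2 x)

end Bundles

end Hitchin

end

noncomputable section
open scoped TensorProduct Manifold ContDiff Bundle

set_option linter.unusedSectionVars false
namespace LInf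

/-! ### Sums over decompositions of a list -/

section ListSums

variable {α M N : Type*} [AddCommMonoid M] [AddCommMonoid N]

/-! The target is abelian, so the coalgebra equation `F ∘ Q = Q̂ ∘ F` follows from its component in
`W[1]` (`isLInftyMorphism_of_abelian`): the signed sum of `g(q(x_S) ⊙ x_{Sᶜ})` over nonempty `S` has
to be `-∂̄ g(x)`. Only sets `S` with one or two elements matter, since the higher brackets of `M`
vanish. They produce three kinds of terms, in which an argument is replaced by `∂̄xᵢ`, by `[θ, xᵢ]`,
or two arguments are replaced by `[xᵢ, xⱼ]`.

The terms with `∂̄xᵢ` add up to `∂̄ g(x)` by the Leibniz rule, because `θ` is holomorphic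
(`coef_dol_polTrace`). The other two kinds cancel because the trace of a power is invariant under
conjugation. Let `zᵢ` be the part of `xᵢ` in `End E ⊗ ⋀⁰L`, and let `W` be the polarized power built
from `θ` and the remaining arguments. The commutator `[zᵢ, W]` is the sum of the words in which one
letter, possibly `θ`, is replaced by its commutator with `zᵢ` (`commutator_wordSum`), and its trace
is zero (`trace_relation`). Since `g` sees only components of degree one in `L`, the brackets `[θ,
xᵢ]` and `[xᵢ, xⱼ]` contribute exactly through such commutators (`letterOne_higgs`,
`letterOne_gradedComm`). The cancellation is assembled in `coef_afterCoder`.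

Signs are removed by a decoration: a homogeneous element of degree `n` is tensored with an element
of parity `n` of an auxiliary exterior algebra. Decorated elements commute, and every Koszul sign
becomes the cost of reordering decorations (`prod_blocks`). Nothing is lost, because the decorations
can be chosen with nonzero product and `u ⊗ e = 0` with `e ≠ 0` forces `u = 0` (`exists_isDec`,
`tmul_eq_zero_of_ne_zero`). Sums over shuffles and surjections become recursive sums over
decompositions of lists. The same device shows that a differential graded Lie algebra is an
`L∞`-algebra (`IsDGLA.codifferential`): in `Q ∘ Q` nested operations vanish by `d² = 0`, Leibniz and
Jacobi, and disjoint operations cancel in pairs.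

The fibres are vector spaces without topology, some of infinite dimension, so the calculus runs on
finite sums of smooth scalar functions times constant vectors (`Tens`). Forms of fixed bidegree are
of this type since their values lie in a finite-dimensional subspace. The operator `∂̄` is defined
at each point by the chart and the frames of that point, and `HolFrames.localRep_dbar` allows any
nearby holomorphic frame to be used instead. This rests on the transition maps being `∂̄`-closed,
whose core is the identity `τ*φ = ∂̄(φ ∘ τ)` for a conjugate-linear functional `φ`
(`pullback_closed`). The Higgs field is assumed complex differentiable only; Cauchy's formula makes
it smooth (`contDiffOn_of_differentiableOn`). The two geometric results are `isDGLA_end`, where `∂̄θ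
= 0` and `θ ∧ θ = 0` enter, and the component equation `afterCoder_hitchinOps`. -/

/-- The sum of `F a t` over all ways to pick an entry `a` of a list, `t` being the rest. -/
def pickSum : List α → (α → List α → M) → M
  | [], _ => 0
  | a :: l, F => F a l + pickSum l fun b t => F b (a :: t)

/-- The sum of `F s t` over all decompositions of a list into a sublist `s` and the rest `t`. -/
def splitSum : List α → (List α → List α → M) → M
  | [], F => F [] []
  | a :: l, F => splitSum l (fun s t => F (a :: s) t) + splitSum l fun s t => F s (a :: t)

/-- The sum of `F b` over all decompositions of a list into `m` sublists `b 0, …, b (m - 1)`. -/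
def colSum (m : ℕ) : List α → ((Fin m → List α) → M) → M
  | [], F => F fun _ => []
  | a :: l, F => ∑ j, colSum m l fun b => F (Function.update b j (a :: b j))

/-- The permutation hypothesis is all the combinatorial information that applications need: it
yields membership of every entry in `l` and the total length. The same holds for the other
congruence lemmas below. -/
theorem pickSum_congr {l : List α} {F G : α → List α → M}
    (h : ∀ a t, (a :: t).Perm l → F a t = G a t) : pickSum l F = pickSum l G := by
  induction l generalizing F G with
  | nil => rfl
  | cons a l ih =>
    simp only [pickSum]
    rw [h a l (List.Perm.refl _), ih fun b t hbt =>
      h b (a :: t) ((List.Perm.swap a b t).trans (hbt.cons a))]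

theorem splitSum_congr {l : List α} {F G : List α → List α → M}
    (h : ∀ s t, (s ++ t).Perm l → F s t = G s t) : splitSum l F = splitSum l G := by
  induction l generalizing F G with
  | nil => exact h _ _ (List.Perm.refl _)
  | cons a l ih =>
    simp only [splitSum]
    rw [ih fun s t hst => h (a :: s) t (hst.cons a),
      ih fun s t hst => h s (a :: t) (List.perm_middle.trans (hst.cons a))]

theorem colSum_congr {m : ℕ} {l : List α} {F G : (Fin m → List α) → M}
    (h : ∀ b, (∀ j, ∀ a ∈ b j, a ∈ l) → ∑ j, (b j).length = l.length → F b = G b) :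
    colSum m l F = colSum m l G := by
  induction l generalizing F G with
  | nil => exact h _ (fun j a ha => ha) (by simp)
  | cons a l ih =>
    simp only [colSum]
    refine Finset.sum_congr rfl fun j _ => ih fun b hb hl => h _ (fun i c hc => ?_) ?_
    rotate_left
    · rw [← Finset.add_sum_erase _ _ (Finset.mem_univ j)] at hl ⊢
      rw [Finset.sum_congr rfl fun i hi => by
        rw [Function.update_of_ne (Finset.ne_of_mem_erase hi)]]
      simp only [Function.update_self, List.length_cons, ← hl]
      ring
    by_cases hij : i = j
    · subst hij
      rw [Function.update_self] at hc
      rcases List.mem_cons.1 hc with h | h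
      · simp [h]
      · exact List.mem_cons_of_mem _ (hb _ _ h)
    · rw [Function.update_of_ne hij] at hc
      exact List.mem_cons_of_mem _ (hb _ _ hc)

theorem pickSum_zero (l : List α) : pickSum l (fun _ _ => (0 : M)) = 0 := by
  induction l with
  | nil => rfl
  | cons a l ih => simp only [pickSum, ih, add_zero]

theorem pickSum_add (l : List α) (F G : α → List α → M) :
    pickSum l (fun a t => F a t + G a t) = pickSum l F + pickSum l G := by
  induction l generalizing F G with
  | nil => simp [pickSum]
  | cons a l ih => simp only [pickSum, ih]; abel

theorem splitSum_zero (l : List α) : splitSum l (fun _ _ => (0 : M)) = 0 := by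
  induction l with
  | nil => rfl
  | cons a l ih => simp only [splitSum, ih, add_zero]

theorem splitSum_add (l : List α) (F G : List α → List α → M) :
    splitSum l (fun a t => F a t + G a t) = splitSum l F + splitSum l G := by
  induction l generalizing F G with
  | nil => simp [splitSum]
  | cons a l ih => simp only [splitSum, ih]; abel

theorem splitSum_sum {ι : Type*} (l : List α) (s : Finset ι) (F : ι → List α → List α → M) :
    splitSum l (fun a t => ∑ i ∈ s, F i a t) = ∑ i ∈ s, splitSum l (F i) := by
  induction l generalizing F with
  | nil => simp [splitSum]
  | cons a l ih => simp only [splitSum, ih, Finset.sum_add_distrib]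

theorem colSum_sum {ι : Type*} (m : ℕ) (l : List α) (s : Finset ι)
    (F : ι → (Fin m → List α) → M) :
    colSum m l (fun b => ∑ i ∈ s, F i b) = ∑ i ∈ s, colSum m l (F i) := by
  induction l generalizing F with
  | nil => simp [colSum]
  | cons a l ih =>
    simp only [colSum, ih]
    exact Finset.sum_comm

theorem map_pickSum (φ : M →+ N) (l : List α) (F : α → List α → M) :
    φ (pickSum l F) = pickSum l fun a t => φ (F a t) := by
  induction l generalizing F with
  | nil => simp [pickSum]
  | cons a l ih => simp only [pickSum, map_add, ih]

theorem map_splitSum (φ : M →+ N) (l : List α) (F : List α → List α → M) :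
    φ (splitSum l F) = splitSum l fun a t => φ (F a t) := by
  induction l generalizing F with
  | nil => simp [splitSum]
  | cons a l ih => simp only [splitSum, map_add, ih]

theorem map_colSum (φ : M →+ N) (m : ℕ) (l : List α) (F : (Fin m → List α) → M) :
    φ (colSum m l F) = colSum m l fun b => φ (F b) := by
  induction l generalizing F with
  | nil => simp [colSum]
  | cons a l ih => simp only [colSum, map_sum, ih]

theorem pickSum_map {β : Type*} (f : β → α) (l : List β) (F : α → List α → M) :
    pickSum (l.map f) F = pickSum l fun a t => F (f a) (t.map f) := by
  induction l generalizing F with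
  | nil => rfl
  | cons a l ih => simp only [List.map_cons, pickSum, ih]

theorem splitSum_swap (l : List α) (F : List α → List α → M) :
    splitSum l F = splitSum l fun s t => F t s := by
  induction l generalizing F with
  | nil => rfl
  | cons a l ih =>
    simp only [splitSum]
    rw [ih, ih fun s t => F s (a :: t), add_comm]

/-- Coassociativity of the unshuffle coproduct: both sides run over the ordered decompositions into
three sublists. -/
theorem splitSum_assoc (l : List α) (F : List α → List α → List α → M) :
    splitSum l (fun s t => splitSum t fun u v => F s u v) =
      splitSum l fun r v => splitSum r fun s u => F s u v := by
  induction l generalizing F with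
  | nil => rfl
  | cons a l ih =>
    simp only [splitSum, splitSum_add, ih]
    abel

/-- The combinatorial content of `F ∘ Q = Q̂ ∘ F`. Choosing blocks and then extracting `s` from
block `j` amounts to extracting `s` first and distributing the rest into blocks. -/
theorem colSum_splitSum (m : ℕ) (j : Fin m) (l : List α)
    (H : List α → (Fin m → List α) → M) :
    colSum m l (fun b => splitSum (b j) fun s u => H s (Function.update b j u)) =
      splitSum l fun s t => colSum m t fun b => H s b := by
  induction l generalizing H with
  | nil => simp [colSum, splitSum]
  | cons a l ih =>
    simp only [colSum, splitSum]
    rw [splitSum_sum, ← ih fun s b => H (a :: s) b]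
    simp only [← ih]
    -- The first entry goes either into block `j`, where the inner sum decides between `s` and the
    -- rest of the block, or into another block, where the two updates commute.
    rw [← Finset.add_sum_erase _ _ (Finset.mem_univ j),
      ← Finset.add_sum_erase (a := j) _ (fun i => colSum m l fun b => splitSum (b j) fun s u =>
        H s (Function.update (Function.update b j u) i (a :: Function.update b j u i)))
        (Finset.mem_univ j)]
    rw [← add_assoc]
    congr 1
    · have h := fun F G : (Fin m → List α) → M => colSum_sum m l Finset.univ ![F, G]
      simp only [Fin.sum_univ_two, Matrix.cons_val_zero, Matrix.cons_val_one] at h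
      rw [← h]
      refine colSum_congr fun b _ _ => ?_
      simp only [Function.update_self, splitSum, Function.update_idem]
    · refine Finset.sum_congr rfl fun i hi => colSum_congr fun b _ _ => ?_
      have hij : j ≠ i := (Finset.ne_of_mem_erase hi).symm
      simp only [Function.update_of_ne hij, Function.update_of_ne hij.symm]
      refine splitSum_congr fun s u _ => ?_
      rw [Function.update_comm hij]

theorem splitSum_one (l : List α) (F : List α → List α → M)
    (h : ∀ s t, s.length ≠ 1 → F s t = 0) : splitSum l F = pickSum l fun a t => F [a] t := by
  induction l generalizing F with
  | nil => exact h _ _ (by simp)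
  | cons a l ih =>
    simp only [splitSum, pickSum]
    rw [ih (fun s t => F s (a :: t)) fun s t hs => h _ _ hs]
    congr 1
    -- Once the first entry has been put into the sublist, the sublist must receive nothing more.
    have key : ∀ (l : List α) (G : List α → List α → M), (∀ s t, s ≠ [] → G s t = 0) →
        splitSum l G = G [] l := by
      intro l
      induction l with
      | nil => intro G _; rfl
      | cons b l ih2 =>
        intro G hG
        simp only [splitSum]
        rw [splitSum_congr (G := fun _ _ => 0) fun s t _ => hG _ _ (by simp), splitSum_zero,
          ih2 _ fun s t hs => hG _ _ hs, zero_add]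
    exact key l _ fun s t hs => h _ _ (by simpa using hs)

/-- Turns a sum over unordered pairs into one over ordered pairs. In the application the bracket of
two arguments is a sum of two commutators, and `G` is the one in which the first argument supplies
the commuting element. -/
theorem splitSum_two (l : List α) (F : List α → List α → M) (G : α → α → List α → M)
    (h : ∀ s t, s.length ≠ 2 → F s t = 0) (hF : ∀ a b t, F [a, b] t = G a b t + G b a t) :
    splitSum l F = pickSum l fun a t => pickSum t fun b u => G a b u := by
  induction l generalizing F G with
  | nil => exact h _ _ (by simp)
  | cons a l ih =>
    simp only [splitSum, pickSum]
    rw [splitSum_one l _ fun s t hs => h _ _ (by simpa using hs),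
      ih (fun s t => F s (a :: t)) (fun b c t => G b c (a :: t)) (fun s t hs => h _ _ hs)
        fun b c t => hF _ _ _]
    simp only [hF, pickSum_add]
    abel

theorem splitSum_split {l : List α} (F : List α → List α → M)
    (h : ∀ s t, s.length ≠ 1 → s.length ≠ 2 → F s t = 0) :
    splitSum l F = splitSum l (fun s t => if s.length = 1 then F s t else 0) +
      splitSum l (fun s t => if s.length = 2 then F s t else 0) := by
  rw [← splitSum_add]
  refine splitSum_congr fun s t _ => ?_
  by_cases h1 : s.length = 1
  · simp [h1]
  · by_cases h2 : s.length = 2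
    · simp [h2]
    · simp [h1, h2, h s t h1 h2]

theorem colSum_two (l : List α) (F : List α → List α → M) :
    colSum 2 l (fun b => F (b 0) (b 1)) = splitSum l F := by
  induction l generalizing F with
  | nil => rfl
  | cons a l ih =>
    simp only [colSum, splitSum, Fin.sum_univ_two]
    rw [← ih, ← ih]
    congr 1

/-- The block with label `j` of the tuple `x` labelled by `c`. -/
def block {n m : ℕ} (x : Fin n → α) (c : Fin n → Fin m) (j : Fin m) : List α :=
  ((List.finRange n).filter (fun i => c i = j)).map x

theorem block_cons {n m : ℕ} (x : Fin (n + 1) → α) (i : Fin m) (c : Fin n → Fin m) (j : Fin m) :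
    block x (Fin.cons i c) j =
      if i = j then x 0 :: block (Fin.tail x) c j else block (Fin.tail x) c j := by
  unfold block
  rw [List.finRange_succ, List.filter_cons, List.filter_map]
  by_cases h : i = j
  · simp [h, Function.comp_def, Fin.tail]
  · simp [h, Function.comp_def, Fin.tail]

/-- Induction on the label of the first entry. This translates sums over labellings into the
recursive form, where the dependent types of subtuples no longer occur. -/
theorem sum_block {n m : ℕ} (x : Fin n → α) (G : (Fin m → List α) → M) :
    ∑ c : Fin n → Fin m, G (block x c) = colSum m (List.ofFn x) G := by
  induction n generalizing G with
  | zero =>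
    simp only [List.ofFn_zero, colSum]
    rw [Fintype.sum_unique]
    rfl
  | succ n ih =>
    rw [List.ofFn_succ, colSum, ← (Fin.consEquiv fun _ : Fin (n + 1) => Fin m).sum_comp,
      Fintype.sum_prod_type]
    refine Finset.sum_congr rfl fun i _ => ?_
    rw [← ih (fun k => x k.succ)]
    refine Finset.sum_congr rfl fun c _ => ?_
    congr 1
    ext1 j
    change block x (Fin.cons i c) j = _
    rw [block_cons]
    by_cases h : i = j
    · subst h
      simp [Fin.tail_def]
    · rw [if_neg h, Function.update_of_ne (Ne.symm h)]
      rfl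

theorem ofFn_sub {n : ℕ} (x : Fin n → α) (S : Finset (Fin n)) :
    List.ofFn (sub x S) = ((List.finRange n).filter (fun i => i ∈ S)).map x := by
  have h : sub x S = x ∘ S.orderEmbOfFin rfl := rfl
  rw [h, ← List.map_ofFn]
  congr 1
  -- Both index lists are increasing and have the same entries, hence they are equal.
  refine List.Perm.eq_of_pairwise' (r := (· ≤ ·)) ?_ ?_ ?_
  · rw [List.pairwise_ofFn]
    intro i j hij
    exact (S.orderEmbOfFin rfl).monotone hij.le
  · exact (List.pairwise_le_finRange n).filter _
  · rw [List.perm_ext_iff_of_nodup]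
    · intro a
      simp only [List.mem_ofFn, List.mem_filter, List.mem_finRange, true_and, decide_eq_true_eq]
      rw [← Set.mem_range, Finset.range_orderEmbOfFin]
      simp
    · exact List.nodup_ofFn.2 (S.orderEmbOfFin rfl).injective
    · exact (List.nodup_finRange n).filter _

theorem ofFn_sub_fiber {n m : ℕ} (x : Fin n → α) (c : Fin n → Fin m) (j : Fin m) :
    List.ofFn (sub x ({i | c i = j} : Finset (Fin n))) = block x c j := by
  rw [ofFn_sub, block]
  simp

/-- A subset is a labelling with two labels, the subset itself being block `0`. -/
theorem sum_sub {n : ℕ} (x : Fin n → α) (G : List α → List α → M) :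
    ∑ S : Finset (Fin n), G (List.ofFn (sub x S)) (List.ofFn (sub x Sᶜ)) =
      splitSum (List.ofFn x) G := by
  rw [← colSum_two, ← sum_block]
  refine (Finset.sum_bij (fun (c : Fin n → Fin 2) _ => ({i | c i = 0} : Finset (Fin n)))
    (fun _ _ => Finset.mem_univ _) ?_ ?_ ?_).symm
  · intro c _ c' _ h
    ext1 i
    have hi := congrArg (fun S => i ∈ S) h
    simp only [Finset.mem_filter, Finset.mem_univ, true_and, eq_iff_iff] at hi
    omega
  · intro S _
    refine ⟨fun i => if i ∈ S then 0 else 1, Finset.mem_univ _, ?_⟩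
    ext i
    simp
  · intro c _
    have h : (({i | c i = 0} : Finset (Fin n)))ᶜ = ({i | c i = 1} : Finset (Fin n)) := by
      ext i
      simp only [Finset.mem_compl, Finset.mem_filter, Finset.mem_univ, true_and]
      omega
    rw [h, ofFn_sub_fiber, ofFn_sub_fiber]

end ListSums

/-! ### Koszul signs -/

section Koszul

variable {A : Type*} [Ring A]

theorem koszul_succ {n : ℕ} (d : Fin (n + 1) → ℤ) (c : Fin (n + 1) → ℕ) :
    koszul d c = (∏ i : Fin n, if c i.succ < c 0 then ((d 0 * d i.succ).negOnePow : ℤ) else 1) *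
      koszul (fun i => d i.succ) (fun i => c i.succ) := by
  simp [koszul, Fin.prod_univ_succ]

/-- The factor `t` sits at the left end of block `j₀`, so moving it to the front passes exactly the
earlier blocks. -/
theorem prod_move_front {m : ℕ} (b : Fin m → A) (s : Fin m → ℤ) (t : A)
    (h : ∀ j, b j * t = s j • (t * b j)) (j₀ : Fin m) :
    (List.ofFn fun j => if j₀ = j then t * b j else b j).prod =
      (∏ j, if j < j₀ then s j else 1) • (t * (List.ofFn b).prod) := by
  induction m with
  | zero => exact j₀.elim0
  | succ m ih =>
    rw [List.ofFn_succ, List.ofFn_succ, List.prod_cons, List.prod_cons, Fin.prod_univ_succ]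
    induction j₀ using Fin.cases with
    | zero => simp [(Fin.succ_ne_zero _).symm, mul_assoc]
    | succ k =>
      have := ih (fun j => b j.succ) (fun j => s j.succ) (fun j => h _) k
      simp only [Fin.succ_inj, Fin.succ_lt_succ_iff, Fin.succ_pos, if_true, Fin.succ_ne_zero,
        if_false]
      rw [this, mul_smul_comm, ← mul_assoc, h, smul_mul_assoc, smul_smul, mul_assoc, mul_comm]

theorem prod_block_comm {n m : ℕ} (d : Fin n → ℤ) (d₀ : ℤ) (e : Fin n → A) (t : A)
    (h : ∀ i, t * e i = ((d₀ * d i).negOnePow : ℤ) • (e i * t)) (c : Fin n → Fin m) (j : Fin m) :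
    (block e c j).prod * t =
      (∏ i, if c i = j then ((d₀ * d i).negOnePow : ℤ) else 1) • (t * (block e c j).prod) := by
  have h' : ∀ i, e i * t = ((d₀ * d i).negOnePow : ℤ) • (t * e i) := fun i => by
    rw [h, smul_smul, ← Units.val_mul, Int.units_mul_self]
    simp
  rw [← List.prod_ofFn, List.ofFn_eq_map]
  unfold block
  induction List.finRange n with
  | nil => simp
  | cons i l ih =>
    rw [List.filter_cons]
    by_cases hi : c i = j
    · simp only [hi, decide_true, if_true, List.map_cons, List.prod_cons]
      rw [mul_assoc, ih, mul_smul_comm, ← mul_assoc, h', smul_mul_assoc, smul_smul, mul_assoc,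
        mul_comm]
    · simpa [hi] using ih

/-- The bridge from Koszul signs to products: for elements that commute up to the graded sign,
sorting them into blocks costs exactly `koszul`. In the induction the first entry passes the entries
with a smaller label, which is the factor split off by `koszul_succ`. -/
theorem prod_blocks {n m : ℕ} (d : Fin n → ℤ) (e : Fin n → A)
    (h : ∀ i j, e i * e j = ((d i * d j).negOnePow : ℤ) • (e j * e i)) (c : Fin n → Fin m) :
    (List.ofFn fun j => (block e c j).prod).prod =
      koszul d (fun i => (c i : ℕ)) • (List.ofFn e).prod := by
  induction n with
  | zero => simp [block, koszul]
  | succ n ih =>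
    obtain ⟨j₀, c, rfl⟩ : ∃ j₀ c', c = Fin.cons j₀ c' := ⟨c 0, Fin.tail c, (Fin.cons_self_tail c).symm⟩
    rw [koszul_succ]
    simp only [Fin.cons_succ, Fin.cons_zero, block_cons]
    have h1 : (fun j => (if j₀ = j then e 0 :: block (Fin.tail e) c j
        else block (Fin.tail e) c j).prod) =
        fun j => if j₀ = j then e 0 * (block (Fin.tail e) c j).prod
          else (block (Fin.tail e) c j).prod := by
      ext j
      split_ifs <;> simp
    rw [h1, prod_move_front _ _ (e 0) (fun j => prod_block_comm (fun i => d i.succ) (d 0)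
      (Fin.tail e) (e 0) (fun i => h _ _) c j), ih (fun i => d i.succ) (Fin.tail e)
      (fun i j => h _ _), List.ofFn_succ, List.prod_cons, mul_smul_comm, smul_smul]
    congr 2
    have h2 : ∀ j, (if j < j₀ then ∏ i, (if c i = j then ((d 0 * d i.succ).negOnePow : ℤ) else 1)
        else 1) = ∏ i, if c i = j then (if j < j₀ then ((d 0 * d i.succ).negOnePow : ℤ) else 1)
          else 1 := by
      intro j
      split_ifs <;> simp
    -- After exchanging the two products, each entry contributes through the single block that
    -- contains it.
    rw [Finset.prod_congr rfl fun j _ => h2 j, Finset.prod_comm]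
    refine Finset.prod_congr rfl fun i _ => ?_
    rw [Finset.prod_ite_eq]
    simp

theorem prod_sub_mul_prod_sub {n : ℕ} (d : Fin n → ℤ) (e : Fin n → A)
    (h : ∀ i j, e i * e j = ((d i * d j).negOnePow : ℤ) • (e j * e i)) (S : Finset (Fin n)) :
    (List.ofFn (sub e S)).prod * (List.ofFn (sub e Sᶜ)).prod =
      koszul d (fun i => if i ∈ S then 0 else 1) • (List.ofFn e).prod := by
  have := prod_blocks d e h (fun i => if i ∈ S then (0 : Fin 2) else 1)
  rw [show (fun i => (((if i ∈ S then (0 : Fin 2) else 1) : Fin 2) : ℕ)) =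
    fun i => if i ∈ S then 0 else 1 by ext i; split_ifs <;> rfl] at this
  rw [← this]
  simp only [List.ofFn_succ, List.ofFn_zero, List.prod_cons, List.prod_nil, mul_one,
    ← ofFn_sub_fiber]
  congr 4 <;> ext i <;> simp

end Koszul

/-! ### Parities in exterior algebras -/

theorem negOnePow_eq_ite (n : ℤ) : (n.negOnePow : ℤ) = if Even n then 1 else -1 := by
  split_ifs with h
  · rw [Int.negOnePow_even n h]; rfl
  · rw [Int.negOnePow_odd n (Int.not_even_iff_odd.1 h)]; rfl

section Parity

variable {M : Type*} [AddCommGroup M] [Module ℂ M]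

variable (M) in
/-- The even (`n` even) or odd (`n` odd) part of the exterior algebra. -/
def par (n : ℤ) : Submodule ℂ (ExteriorAlgebra ℂ M) :=
  CliffordAlgebra.evenOdd (0 : QuadraticForm ℂ M) (n : ZMod 2)

theorem par_congr {n m : ℤ} (h : Even (n - m)) : par M n = par M m := by
  unfold par
  congr 1
  rw [← sub_eq_zero, ← Int.cast_sub, ZMod.intCast_zmod_eq_zero_iff_dvd]
  exact_mod_cast h.two_dvd

theorem one_mem_par : (1 : ExteriorAlgebra ℂ M) ∈ par M 0 := by
  unfold par
  rw [Int.cast_zero]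
  exact Submodule.one_le.1 (CliffordAlgebra.one_le_evenOdd_zero _)

theorem ι_mem_par (v : M) : ExteriorAlgebra.ι ℂ v ∈ par M 1 := by
  unfold par
  rw [Int.cast_one]
  exact CliffordAlgebra.ι_mem_evenOdd_one _ v

theorem mul_mem_par {n m : ℤ} {a b : ExteriorAlgebra ℂ M} (ha : a ∈ par M n) (hb : b ∈ par M m) :
    a * b ∈ par M (n + m) := by
  unfold par at *
  rw [Int.cast_add]
  exact CliffordAlgebra.evenOdd_mul_le _ _ _ (Submodule.mul_mem_mul ha hb)

theorem power_le_par (p : ℕ) : ⋀[ℂ]^p M ≤ par M p := by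
  unfold par
  refine le_iSup_of_le ⟨p, by simp⟩ le_rfl

/-- For the zero quadratic form all vectors are orthogonal, so the graded commutation of orthogonal
parts of Clifford algebras applies to the algebra itself. -/
theorem par_comm {n m : ℤ} {a b : ExteriorAlgebra ℂ M} (ha : a ∈ par M n) (hb : b ∈ par M m) :
    a * b = ((n * m).negOnePow : ℤ) • (b * a) := by
  have h := CliffordAlgebra.map_mul_map_of_isOrtho_of_mem_evenOdd
    (QuadraticMap.Isometry.id (0 : QuadraticForm ℂ M)) (QuadraticMap.Isometry.id _)
    (fun x y => by simp [QuadraticMap.isOrtho_def]) a b ha hb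
  simp only [CliffordAlgebra.map_id, AlgHom.id_apply] at h
  rw [h]
  rw [Units.smul_def]
  congr 1
  have key : ∀ k : ℤ, ((k : ZMod 2) = if Even k then 0 else 1) := by
    intro k
    split_ifs with h
    · rw [ZMod.intCast_zmod_eq_zero_iff_dvd]; exact_mod_cast h.two_dvd
    · obtain ⟨r, rfl⟩ := Int.not_even_iff_odd.1 h
      push_cast
      rw [show (2 : ZMod 2) = 0 from rfl]; simp
  rw [negOnePow_eq_ite, key n, key m]
  by_cases hn : Even n <;> by_cases hm : Even m <;> simp [hn, hm, Int.even_mul]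

end Parity

/-! ### Decorations -/

/-- An exterior algebra; homogeneous elements of degree `n` will be decorated by elements of parity
`n` of it, which makes all the signs disappear. -/
abbrev Dec : Type := ExteriorAlgebra ℂ (ℕ →₀ ℂ)

/-- A list of generators with distinct indices has a nonzero product. -/
theorem prod_ι_ne_zero (l : List ℕ) (hl : l.Nodup) :
    (l.map fun i => ExteriorAlgebra.ι ℂ (Finsupp.single i (1 : ℂ))).prod ≠ (0 : Dec) := by
  -- Contraction with the `i`-th coordinate kills every product that does not involve generator `i`.
  -- Hence it strips the first factor from a product of distinct generators, and the induction can
  -- proceed.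
  have hc : ∀ (i : ℕ) (l : List ℕ), i ∉ l →
      CliffordAlgebra.contractLeft (Q := (0 : QuadraticForm ℂ (ℕ →₀ ℂ)))
        (Finsupp.lapply i : (ℕ →₀ ℂ) →ₗ[ℂ] ℂ)
        (l.map fun i => ExteriorAlgebra.ι ℂ (Finsupp.single i (1 : ℂ))).prod = 0 := by
    intro i l
    induction l with
    | nil =>
      intro _
      rw [List.map_nil, List.prod_nil]
      exact CliffordAlgebra.contractLeft_one (Q := (0 : QuadraticForm ℂ (ℕ →₀ ℂ)))
        (Finsupp.lapply i : (ℕ →₀ ℂ) →ₗ[ℂ] ℂ)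
    | cons j l ih =>
      intro h
      rw [List.map_cons, List.prod_cons]
      erw [CliffordAlgebra.contractLeft_ι_mul]
      rw [ih (fun h' => h (List.mem_cons_of_mem _ h'))]
      have hij : j ≠ i := fun hij => h (by simp [hij])
      simp [hij]
  induction l with
  | nil => simp
  | cons i l ih =>
    rw [List.nodup_cons] at hl
    intro h
    have h2 := congrArg (CliffordAlgebra.contractLeft (Q := (0 : QuadraticForm ℂ (ℕ →₀ ℂ)))
      (Finsupp.lapply i : (ℕ →₀ ℂ) →ₗ[ℂ] ℂ)) h
    rw [List.map_cons, List.prod_cons] at h2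
    erw [CliffordAlgebra.contractLeft_ι_mul] at h2
    rw [hc i l hl.1] at h2
    simp only [Finsupp.lapply_apply, Finsupp.single_eq_same, one_smul, mul_zero, sub_zero,
      map_zero] at h2
    exact ih hl.2 h2

variable {V W U : Type*} [AddCommGroup V] [Module ℂ V] [AddCommGroup W] [Module ℂ W]
  [AddCommGroup U] [Module ℂ U]

/-- Over a field some functional is nonzero on `e`, and applying it to the second factor recovers
`u` up to a nonzero scalar. Every decorated identity is turned back into an undecorated one in this
way. -/
theorem tmul_eq_zero_of_ne_zero {A : Type*} [AddCommGroup A] [Module ℂ A] {e : A} (he : e ≠ 0)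
    {u : U} (h : u ⊗ₜ[ℂ] e = 0) : u = 0 := by
  obtain ⟨φ, hφ⟩ : ∃ φ : Module.Dual ℂ A, φ e ≠ 0 := by
    by_contra hc
    push Not at hc
    exact he ((Module.forall_dual_apply_eq_zero_iff ℂ e).1 hc)
  have h2 := congrArg ((TensorProduct.rid ℂ U).toLinearMap ∘ₗ φ.lTensor U) h
  simpa [hφ] using h2

/-- The decoration of a list of decorated homogeneous elements. -/
def dec {α : Type*} (l : List (α × Dec)) : Dec := (l.map Prod.snd).prod

theorem dec_nil {α : Type*} : dec ([] : List (α × Dec)) = 1 := rfl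

theorem dec_cons {α : Type*} (a : α × Dec) (l : List (α × Dec)) : dec (a :: l) = a.2 * dec l :=
  List.prod_cons

/-- A decorated element whose decoration has the right parity. -/
def IsDec (a : (ℤ × V) × Dec) : Prop := a.2 ∈ par _ a.1.1

/-- Besides the decorations of the arguments, two further odd elements are provided. They accompany
the operations of degree one, which are applied up to two times in `Q ∘ Q`. -/
theorem exists_isDec {n : ℕ} (x : Fin n → ℤ × V) :
    ∃ (e : Fin n → Dec) (η η' : Dec), (∀ i, IsDec (x i, e i)) ∧ η ∈ par _ 1 ∧ η' ∈ par _ 1 ∧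
      η' * (η * (List.ofFn e).prod) ≠ 0 := by
  classical
  set g : ℕ → Dec := fun i => ExteriorAlgebra.ι ℂ (Finsupp.single i (1 : ℂ)) with hg
  -- Generators `0` and `1` are reserved for `η'` and `η`, hence the offset by two. Even elements
  -- need no generator.
  refine ⟨fun i => if Odd (x i).1 then g (i + 2) else 1, g 1, g 0, fun i => ?_, ι_mem_par _,
    ι_mem_par _, ?_⟩
  · unfold IsDec
    dsimp only
    split_ifs with h
    · rw [par_congr (m := 1)]
      · exact ι_mem_par _
      · exact h.sub_odd odd_one
    · rw [par_congr (m := 0)]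
      · exact one_mem_par
      · simpa using h
  · have h1 : ∀ l : List (Fin n), (l.map fun i => if Odd (x i).1 then g (i + 2) else 1).prod =
        (((l.filter fun i => Odd (x i).1).map fun i : Fin n => (i : ℕ) + 2).map g).prod := by
      intro l
      induction l with
      | nil => rfl
      | cons a l ih =>
        rw [List.map_cons, List.prod_cons, ih, List.filter_cons]
        by_cases h : Odd (x a).1
        · simp only [h, decide_true, if_true, List.map_cons, List.prod_cons]
        · simp only [h, decide_false, if_false, one_mul]; simp
    rw [List.ofFn_eq_map, h1]
    have := prod_ι_ne_zero (0 :: 1 :: (((List.finRange n).filter fun i => Odd (x i).1).map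
      fun i : Fin n => (i : ℕ) + 2)) (by
        simp only [List.nodup_cons, List.mem_cons, List.mem_map, List.mem_filter]
        refine ⟨by simp, by simp, ?_⟩
        refine List.Nodup.map (fun i j h => ?_) ((List.nodup_finRange n).filter _)
        simpa [Fin.ext_iff] using h)
    simpa only [List.map_cons, List.prod_cons] using this

/-- The value of a sequence of operations on a list. -/
def app (Φ : Ops V U) (l : List (ℤ × V)) : U := Φ l.length l.get

theorem app_ofFn (Φ : Ops V U) {n : ℕ} (x : Fin n → ℤ × V) : app Φ (List.ofFn x) = Φ n x := by
  -- Passing through the sigma type of tuples avoids transporting `x` along the equality of lengths.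
  have h : ∀ p : Σ n, Fin n → ℤ × V,
      (fun p : Σ n, Fin n → ℤ × V => Φ p.1 p.2) (List.equivSigmaTuple (List.equivSigmaTuple.symm p))
        = Φ p.1 p.2 := fun p => by rw [Equiv.apply_symm_apply]
  exact h ⟨n, x⟩

/-- The decorated value of an operation of degree `r` on a list of decorated elements. -/
def dval (r : ℤ) (φ : Ops V W) (η : Dec) (l : List ((ℤ × V) × Dec)) : (ℤ × W) × Dec :=
  (((l.map fun a => a.1.1).sum + r, app φ (l.map Prod.fst)), η * dec l)

/-- The value of a sequence of operations on a list of decorated elements. -/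
def ev (Φ : Ops V U) (l : List ((ℤ × V) × Dec)) : U ⊗[ℂ] Dec := app Φ (l.map Prod.fst) ⊗ₜ dec l

theorem dec_mem_par {l : List ((ℤ × V) × Dec)} (hl : ∀ a ∈ l, IsDec a) :
    dec l ∈ par _ (l.map fun a => a.1.1).sum := by
  induction l with
  | nil => exact one_mem_par
  | cons a l ih =>
    rw [dec_cons, List.map_cons, List.sum_cons]
    exact mul_mem_par (hl a (by simp)) (ih fun b hb => hl b (by simp [hb]))

theorem isDec_dval {r : ℤ} {η : Dec} (hη : η ∈ par _ r) (φ : Ops V W)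
    {l : List ((ℤ × V) × Dec)} (hl : ∀ a ∈ l, IsDec a) : IsDec (dval r φ η l) := by
  unfold IsDec dval
  rw [add_comm]
  exact mul_mem_par hη (dec_mem_par hl)

theorem exists_eq_ofFn {α : Type*} (l : List α) : ∃ (n : ℕ) (x : Fin n → α), l = List.ofFn x :=
  ⟨l.length, l.get, (List.ofFn_get l).symm⟩

theorem sum_ofFn_sub {n : ℕ} (d : Fin n → ℤ) (S : Finset (Fin n)) :
    (List.ofFn (sub d S)).sum = ∑ i ∈ S, d i := by
  rw [List.sum_ofFn]
  unfold sub
  conv_rhs => rw [← Finset.image_orderEmbOfFin_univ S rfl]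
  rw [Finset.sum_image (fun i _ j _ h => (S.orderEmbOfFin rfl).injective h)]

theorem map_value {n : ℕ} (r : ℤ) (φ : Ops V W) (η : Dec) (z : Fin n → (ℤ × V) × Dec)
    (S : Finset (Fin n)) :
    value r φ (fun i => (z i).1) S = (dval r φ η (List.ofFn (sub z S))).1 := by
  unfold value dval
  have h2 : (List.ofFn (sub z S)).map Prod.fst = List.ofFn (sub (fun i => (z i).1) S) := by
    rw [List.map_ofFn]; rfl
  have h3 : (List.ofFn (sub z S)).map (fun a => a.1.1) = List.ofFn (sub (fun i => (z i).1.1) S) := by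
    rw [List.map_ofFn]; rfl
  rw [h2, h3, app_ofFn, sum_ofFn_sub]

/-- No sign is left on the right: reordering the decorations of `S` before those of its complement
produces `ε(S)`. The decoration `η` stands for the degree-one operation, and `ρ` is kept free for a
second operation applied afterwards. -/
theorem app_afterCoder (q : Ops V V) (Φ : Ops V U) {l : List ((ℤ × V) × Dec)}
    (hl : ∀ a ∈ l, IsDec a) (ρ η : Dec) :
    app (afterCoder q Φ) (l.map Prod.fst) ⊗ₜ[ℂ] (ρ * (η * dec l)) =
      splitSum l fun s t => if s = [] then 0 else
        app Φ ((dval 1 q η s :: t).map Prod.fst) ⊗ₜ[ℂ] (ρ * dec (dval 1 q η s :: t)) := by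
  obtain ⟨n, z, rfl⟩ := exists_eq_ofFn l
  have hz : ∀ i, IsDec (z i) := fun i => hl _ (by simp [List.mem_ofFn])
  rw [List.map_ofFn, app_ofFn, ← sum_sub]
  unfold afterCoder
  rw [TensorProduct.sum_tmul, Finset.sum_filter]
  refine Finset.sum_congr rfl fun S _ => ?_
  have hS : List.ofFn (sub z S) = [] ↔ ¬ S.Nonempty := by
    rw [List.ofFn_eq_nil_iff, Finset.card_eq_zero, Finset.not_nonempty_iff_eq_empty]
  by_cases h : S.Nonempty
  · rw [if_pos h, if_neg (fun h' => hS.1 h' h)]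
    have hK := prod_sub_mul_prod_sub (fun i => (z i).1.1) (fun i => (z i).2)
      (fun i j => par_comm (hz i) (hz j)) S
    have h1 : ∀ T : Finset (Fin n), dec (List.ofFn (sub z T)) =
        (List.ofFn (sub (fun i => (z i).2) T)).prod := by
      intro T
      unfold dec
      rw [List.map_ofFn]; rfl
    have h2 : dec (List.ofFn z) = (List.ofFn fun i => (z i).2).prod := by
      unfold dec
      rw [List.map_ofFn]; rfl
    rw [dec_cons]
    change _ = _ ⊗ₜ (ρ * ((η * dec (List.ofFn (sub z S))) * dec (List.ofFn (sub z Sᶜ))))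
    rw [mul_assoc η, h1, h1, hK, h2, mul_smul_comm, mul_smul_comm, TensorProduct.tmul_smul,
      TensorProduct.smul_tmul']
    congr 2
    rw [← app_ofFn Φ, List.ofFn_succ, List.map_cons]
    simp only [Fin.cons_zero, Fin.cons_succ, List.map_ofFn]
    rw [← map_value 1 q η z S]
    rfl
  · rw [if_neg h, if_pos (hS.2 h)]

/-- The analogue for morphisms. The maps `f` have degree zero, so each block only carries the
product of its own decorations; surjectivity of the labelling becomes nonemptiness of all blocks. -/
theorem app_afterMor (f : Ops V W) (Φ : Ops W U) {l : List ((ℤ × V) × Dec)}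
    (hl : ∀ a ∈ l, IsDec a) (ρ : Dec) :
    app (afterMor f Φ) (l.map Prod.fst) ⊗ₜ[ℂ] (ρ * dec l) =
      ∑ m ∈ Finset.range (l.length + 1), ((m.factorial : ℂ)⁻¹) • colSum m l fun b =>
        if ∀ j, b j ≠ [] then
          app Φ ((List.ofFn fun j => dval 0 f 1 (b j)).map Prod.fst) ⊗ₜ[ℂ]
            (ρ * dec (List.ofFn fun j => dval 0 f 1 (b j)))
        else 0 := by
  obtain ⟨n, z, rfl⟩ := exists_eq_ofFn l
  have hz : ∀ i, IsDec (z i) := fun i => hl _ (by simp [List.mem_ofFn])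
  rw [List.map_ofFn, app_ofFn, List.length_ofFn]
  unfold afterMor
  rw [TensorProduct.sum_tmul]
  refine Finset.sum_congr rfl fun m _ => ?_
  rw [← TensorProduct.smul_tmul', ← sum_block]
  congr 1
  rw [TensorProduct.sum_tmul, Finset.sum_filter]
  refine Finset.sum_congr rfl fun c _ => ?_
  have hc : Function.Surjective c ↔ ∀ j, block z c j ≠ [] := by
    refine forall_congr' fun j => ?_
    simp [block, List.map_eq_nil_iff, List.filter_eq_nil_iff]
  by_cases h : Function.Surjective c
  · rw [if_pos h, if_pos (hc.1 h)]
    have hK := prod_blocks (fun i => (z i).1.1) (fun i => (z i).2)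
      (fun i j => par_comm (hz i) (hz j)) c
    have h2 : dec (List.ofFn z) = (List.ofFn fun i => (z i).2).prod := by
      unfold dec
      rw [List.map_ofFn]; rfl
    have h3 : dec (List.ofFn fun j => dval 0 f 1 (block z c j)) =
        (List.ofFn fun j => (block (fun i => (z i).2) c j).prod).prod := by
      unfold dec
      rw [List.map_ofFn]
      congr 2
      ext1 j
      simp only [Function.comp_apply, dval, one_mul, dec, block, List.map_map]
      rfl
    rw [h3, hK, h2, mul_smul_comm, TensorProduct.tmul_smul, TensorProduct.smul_tmul']
    congr 2
    rw [← app_ofFn Φ, List.map_ofFn]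
    congr 2
    ext1 j
    rw [Function.comp_apply, ← ofFn_sub_fiber, ← map_value 0 f 1 z]
    rfl
  · rw [if_neg h, if_neg fun h' => h (hc.2 h')]

variable {V W U : Type*} [AddCommGroup V] [Module ℂ V] [AddCommGroup W] [Module ℂ W]
  [AddCommGroup U] [Module ℂ U]

/-! ### Decorated monomials -/

section Gen

variable (𝒱 : ℤ → Submodule ℂ V)

/-- `gen` as a linear map on the homogeneous part of degree `n`. -/
def genHom (n : ℤ) : 𝒱 n →ₗ[ℂ] Sym 𝒱 :=
  (RingQuot.mkAlgHom ℂ (SymRel 𝒱)).toLinearMap ∘ₗ TensorAlgebra.ι ℂ ∘ₗ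
    DirectSum.lof ℂ ℤ (fun n => 𝒱 n) n

theorem gen_eq_genHom {n : ℤ} {v : V} (h : v ∈ 𝒱 n) : gen 𝒱 (n, v) = genHom 𝒱 n ⟨v, h⟩ := by
  unfold gen
  rw [dif_pos (show ((n, v) : ℤ × V).2 ∈ 𝒱 ((n, v) : ℤ × V).1 from h)]
  rfl

/-- `gen` is linear only on the elements of a fixed degree and is zero outside. Replacing it by a
globally linear map allows sums of terms of equal degree to be collected inside it. -/
theorem exists_gen_extend (n : ℤ) :
    ∃ g : V →ₗ[ℂ] Sym 𝒱, ∀ v ∈ 𝒱 n, gen 𝒱 (n, v) = g v := by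
  obtain ⟨g, hg⟩ := LinearMap.exists_extend (genHom 𝒱 n)
  refine ⟨g, fun v hv => ?_⟩
  rw [gen_eq_genHom 𝒱 hv, ← hg]
  rfl

theorem gen_zero (n : ℤ) : gen 𝒱 (n, (0 : V)) = 0 := by
  rw [gen_eq_genHom 𝒱 (zero_mem _)]
  exact map_zero (genHom 𝒱 n)

theorem gen_mul_gen (a b : ℤ × V) :
    gen 𝒱 a * gen 𝒱 b = ((a.1 * b.1).negOnePow : ℤ) • (gen 𝒱 b * gen 𝒱 a) := by
  unfold gen
  split_ifs with ha hb hb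
  · have h := RingQuot.mkAlgHom_rel ℂ (SymRel.swap a.1 b.1 ⟨a.2, ha⟩ ⟨b.2, hb⟩)
    rwa [map_mul, map_zsmul, map_mul] at h
  all_goals simp

/-- The element of `S(V) ⊗ Dec` given by a decorated element. -/
def dgen (a : (ℤ × V) × Dec) : Sym 𝒱 ⊗[ℂ] Dec := gen 𝒱 a.1 ⊗ₜ a.2

theorem sgn_mul_self (n : ℤ) : (n.negOnePow : ℤ) * n.negOnePow = 1 := by
  rw [← Units.val_mul, Int.units_mul_self]; rfl

/-- The sign from the symmetric algebra and the sign from the decorations agree, so they cancel. -/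
theorem dgen_comm {a b : (ℤ × V) × Dec} (ha : IsDec a) (hb : IsDec b) :
    dgen 𝒱 a * dgen 𝒱 b = dgen 𝒱 b * dgen 𝒱 a := by
  unfold dgen
  rw [Algebra.TensorProduct.tmul_mul_tmul, Algebra.TensorProduct.tmul_mul_tmul,
    gen_mul_gen, par_comm ha hb, TensorProduct.tmul_smul, TensorProduct.smul_tmul', smul_smul,
    sgn_mul_self, one_smul]

theorem ev_mon (l : List ((ℤ × V) × Dec)) : ev (mon 𝒱) l = (l.map (dgen 𝒱)).prod := by
  have h1 : app (mon 𝒱) (l.map Prod.fst) = ((l.map Prod.fst).map (gen 𝒱)).prod := by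
    obtain ⟨n, x, hx⟩ := exists_eq_ofFn (l.map Prod.fst)
    rw [hx, app_ofFn, List.map_ofFn]
    rfl
  unfold ev
  rw [h1]
  clear h1
  induction l with
  | nil => rfl
  | cons a l ih =>
    rw [List.map_cons, List.map_cons, List.map_cons, List.prod_cons, List.prod_cons, dec_cons, ← ih,
      dgen, Algebra.TensorProduct.tmul_mul_tmul]

theorem ev_mon_cons (a : (ℤ × V) × Dec) (l : List ((ℤ × V) × Dec)) :
    ev (mon 𝒱) (a :: l) = dgen 𝒱 a * ev (mon 𝒱) l := by
  rw [ev_mon, ev_mon, List.map_cons, List.prod_cons]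

end Gen

/-! ### Differential graded Lie algebras -/

/-- The axioms of a differential graded Lie algebra, for a graded space given by subspaces `𝒱 n`. -/
structure IsDGLA (𝒱 : ℤ → Submodule ℂ V) (d : ℤ → V → V) (br : ℤ → ℤ → V → V → V) : Prop where
  d_mem : ∀ n, ∀ v ∈ 𝒱 n, d n v ∈ 𝒱 (n + 1)
  d_add : ∀ n, ∀ v ∈ 𝒱 n, ∀ w ∈ 𝒱 n, d n (v + w) = d n v + d n w
  d_smul : ∀ n, ∀ a : ℂ, ∀ v ∈ 𝒱 n, d n (a • v) = a • d n v
  br_mem : ∀ n m, ∀ v ∈ 𝒱 n, ∀ w ∈ 𝒱 m, br n m v w ∈ 𝒱 (n + m)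
  br_add : ∀ n m, ∀ v ∈ 𝒱 n, ∀ w ∈ 𝒱 n, ∀ u ∈ 𝒱 m, br n m (v + w) u = br n m v u + br n m w u
  br_smul : ∀ n m, ∀ a : ℂ, ∀ v ∈ 𝒱 n, ∀ u ∈ 𝒱 m, br n m (a • v) u = a • br n m v u
  br_symm : ∀ n m, ∀ v ∈ 𝒱 n, ∀ w ∈ 𝒱 m, br n m v w = -(((n * m).negOnePow : ℤ) • br m n w v)
  d_d : ∀ n, ∀ v ∈ 𝒱 n, d (n + 1) (d n v) = 0
  d_br : ∀ n m, ∀ v ∈ 𝒱 n, ∀ w ∈ 𝒱 m, d (n + m) (br n m v w) =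
    br (n + 1) m (d n v) w + (n.negOnePow : ℤ) • br n (m + 1) v (d m w)
  jacobi : ∀ n m k, ∀ u ∈ 𝒱 n, ∀ v ∈ 𝒱 m, ∀ w ∈ 𝒱 k, br n (m + k) u (br m k v w) =
    br (n + m) k (br n m u v) w + ((n * m).negOnePow : ℤ) • br m (n + k) v (br n k u w)

section DGLA

variable {𝒱 : ℤ → Submodule ℂ V} {d : ℤ → V → V} {br : ℤ → ℤ → V → V → V}

theorem IsDGLA.d_zero (h : IsDGLA 𝒱 d br) (n : ℤ) : d n 0 = 0 := by
  simpa using h.d_smul n 0 0 (zero_mem _)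

theorem IsDGLA.d_zsmul (h : IsDGLA 𝒱 d br) (n k : ℤ) {v : V} (hv : v ∈ 𝒱 n) :
    d n (k • v) = k • d n v := by
  simpa only [Int.cast_smul_eq_zsmul] using h.d_smul n (k : ℂ) v hv

theorem IsDGLA.d_neg (h : IsDGLA 𝒱 d br) (n : ℤ) {v : V} (hv : v ∈ 𝒱 n) : d n (-v) = -d n v := by
  simpa using h.d_zsmul n (-1) hv

theorem IsDGLA.br_zsmul (h : IsDGLA 𝒱 d br) (n m k : ℤ) {v w : V} (hv : v ∈ 𝒱 n) (hw : w ∈ 𝒱 m) :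
    br n m (k • v) w = k • br n m v w := by
  simpa only [Int.cast_smul_eq_zsmul] using h.br_smul n m (k : ℂ) v hv w hw

theorem IsDGLA.br_neg (h : IsDGLA 𝒱 d br) (n m : ℤ) {v w : V} (hv : v ∈ 𝒱 n) (hw : w ∈ 𝒱 m) :
    br n m (-v) w = -br n m v w := by
  simpa using h.br_zsmul n m (-1) hv hw

theorem IsDGLA.br_zero (h : IsDGLA 𝒱 d br) (n m : ℤ) {w : V} (hw : w ∈ 𝒱 m) :
    br n m 0 w = 0 := by
  simpa using h.br_smul n m 0 0 (zero_mem _) w hw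

theorem IsDGLA.br_add_right (h : IsDGLA 𝒱 d br) (n m : ℤ) {v u w : V} (hv : v ∈ 𝒱 n)
    (hu : u ∈ 𝒱 m) (hw : w ∈ 𝒱 m) : br n m v (u + w) = br n m v u + br n m v w := by
  rw [h.br_symm n m v hv _ (add_mem hu hw), h.br_add m n u hu w hw v hv, h.br_symm n m v hv u hu,
    h.br_symm n m v hv w hw, smul_add, neg_add]

theorem IsDGLA.br_smul_right (h : IsDGLA 𝒱 d br) (n m : ℤ) (a : ℂ) {v u : V} (hv : v ∈ 𝒱 n)
    (hu : u ∈ 𝒱 m) : br n m v (a • u) = a • br n m v u := by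
  rw [h.br_symm n m v hv _ (Submodule.smul_mem _ a hu), h.br_smul m n a u hu v hv,
    h.br_symm n m v hv u hu, smul_neg, smul_comm]

theorem app_dglaOps_one (a : ℤ × V) : app (dglaOps d br) [a] = -d (a.1 + 1) a.2 := rfl

theorem app_dglaOps_two (a b : ℤ × V) : app (dglaOps d br) [a, b] =
    ((a.1 + 1).negOnePow : ℤ) • br (a.1 + 1) (b.1 + 1) a.2 b.2 := rfl

theorem app_dglaOps_of_ge {l : List (ℤ × V)} (hl : 3 ≤ l.length) :
    app (dglaOps d br) l = 0 := by
  match l, hl with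
  | a :: b :: c :: l, _ => rfl

theorem IsDGLA.app_mem (h : IsDGLA 𝒱 d br) {l : List ((ℤ × V))}
    (hl : ∀ a ∈ l, a.2 ∈ shift 𝒱 a.1) (h0 : l ≠ []) :
    app (dglaOps d br) l ∈ shift 𝒱 ((l.map Prod.fst).sum + 1) := by
  match l, h0 with
  | [a], _ =>
    rw [app_dglaOps_one]
    have := h.d_mem _ _ (hl a (by simp))
    simpa [shift] using this
  | [a, b], _ =>
    rw [app_dglaOps_two]
    have := h.br_mem _ _ _ (hl a (by simp)) _ (hl b (by simp))
    have e : ([a, b].map Prod.fst).sum + 1 + 1 = (a.1 + 1) + (b.1 + 1) := by simp; ring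
    unfold shift
    rw [e]
    exact zsmul_mem this _
  | a :: b :: c :: l, _ =>
    rw [app_dglaOps_of_ge (by simp)]
    exact zero_mem _

theorem dgen_eq_zero {a : (ℤ × V) × Dec} (h : a.1.2 = 0) : dgen 𝒱 a = 0 := by
  obtain ⟨⟨n, v⟩, e⟩ := a
  obtain rfl : v = 0 := h
  unfold dgen
  rw [gen_zero, TensorProduct.zero_tmul]

theorem map_tmul_eq_zero (g : V →ₗ[ℂ] U) {v : V} (e : Dec) (h : v = 0) : g v ⊗ₜ[ℂ] e = 0 := by
  rw [h, map_zero, TensorProduct.zero_tmul]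

/-- Moving `η` or `η'` past `e` costs the same sign, so only the exchange of the two odd elements
remains, whatever the parity of `e`. -/
theorem anticomm {n : ℤ} {η η' e : Dec} (hη : η ∈ par _ 1) (hη' : η' ∈ par _ 1) (he : e ∈ par _ n) :
    η * e * η' = -(η' * e * η) := by
  rw [par_comm hη he, par_comm hη' he, smul_mul_assoc, smul_mul_assoc, mul_assoc, mul_assoc,
    par_comm hη hη']
  simp

/-- The relations between the brackets of a differential graded Lie algebra. -/
theorem IsDGLA.relations (h : IsDGLA 𝒱 d br) {l : List ((ℤ × V) × Dec)}
    (hl : ∀ a ∈ l, IsDec a) (hl' : ∀ a ∈ l, a.1.2 ∈ shift 𝒱 a.1.1) (η η' : Dec) :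
    splitSum l (fun s u => if s = [] then 0 else
      dgen (shift 𝒱) (dval 1 (dglaOps d br) η' (dval 1 (dglaOps d br) η s :: u))) = 0 := by
  -- The number of arguments decides which axiom is used: `d² = 0` for one, the Leibniz rule for
  -- two, the Jacobi identity for three. From four arguments on every term vanishes.
  match l with
  | [] => simp [splitSum]
  | [a] =>
    simp only [splitSum, if_true, add_zero, if_neg (List.cons_ne_nil _ _)]
    refine dgen_eq_zero ?_
    simp only [dval, List.map_cons, List.map_nil, app_dglaOps_one, List.sum_cons, List.sum_nil,
      add_zero]
    have ha := hl' a (by simp)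
    rw [h.d_neg _ (h.d_mem _ _ ha), h.d_d _ _ ha]
    simp
  | [a, b] =>
    obtain ⟨⟨n, v⟩, e⟩ := a
    obtain ⟨⟨m, w⟩, e'⟩ := b
    have hv : v ∈ 𝒱 (n + 1) := hl' ⟨⟨n, v⟩, e⟩ (by simp)
    have hw : w ∈ 𝒱 (m + 1) := hl' ⟨⟨m, w⟩, e'⟩ (by simp)
    have hee : e' * e = ((n * m).negOnePow : ℤ) • (e * e') := by
      rw [mul_comm n m]
      exact par_comm (hl ⟨⟨m, w⟩, e'⟩ (by simp)) (hl ⟨⟨n, v⟩, e⟩ (by simp))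
    simp only [splitSum, if_true, add_zero, if_neg (List.cons_ne_nil _ _)]
    simp only [dgen, dval, List.map_cons, List.map_nil, app_dglaOps_one, List.sum_cons,
      List.sum_nil, app_dglaOps_two, add_zero, dec_cons, dec_nil, mul_one, mul_assoc, hee]
    -- All three terms have this degree in `V[1]`, so they can be added inside the single linear map
    -- `g`.
    obtain ⟨g, hg⟩ := exists_gen_extend (shift 𝒱) (n + m + 1 + 1)
    have e2 : n + 1 + m + 1 = n + m + 1 + 1 := by ring
    have e3 : m + 1 + n + 1 = n + m + 1 + 1 := by ring
    have e5 : n + m + 1 + 1 = (n + 1) + (m + 1) := by ring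
    have e6 : n + m + 1 + 1 + 1 = (n + 1) + (m + 1) + 1 := by ring
    have e7 : n + m + 1 + 1 + 1 = (n + 1 + 1) + (m + 1) := by ring
    have e8 : n + m + 1 + 1 + 1 = (m + 1 + 1) + (n + 1) := by ring
    have hb := h.br_mem _ _ v hv w hw
    have hdv := h.d_mem _ v hv
    have hdw := h.d_mem _ w hw
    simp only [e2, e3]
    rw [e5]
    have hg' : ∀ v ∈ 𝒱 ((n + 1) + (m + 1) + 1), gen (shift 𝒱) (n + 1 + (m + 1), v) = g v := by
      intro v hv
      rw [← e5]
      refine hg v ?_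
      unfold shift
      rw [e6]; exact hv
    rw [hg', hg', hg', mul_smul_comm, mul_smul_comm, TensorProduct.tmul_smul,
      TensorProduct.smul_tmul', ← TensorProduct.add_tmul, ← TensorProduct.add_tmul]
    · rw [← map_zsmul, ← map_add, ← map_add]
      refine map_tmul_eq_zero g _ ?_
      rw [h.d_zsmul _ _ hb, h.d_br _ _ _ hv _ hw, h.br_neg _ _ hdv hw, h.br_neg _ _ hdw hv,
        h.br_symm (m + 1 + 1) (n + 1) _ hdw _ hv]
      generalize br (n + 1 + 1) (m + 1) (d (n + 1) v) w = X
      generalize br (n + 1) (m + 1 + 1) v (d (m + 1) w) = Y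
      simp only [negOnePow_eq_ite, Int.even_add, Int.even_mul]
      by_cases hn : Even n <;> by_cases hm : Even m <;> simp [hn, hm]
    · rw [← e6, e8]
      exact zsmul_mem (h.br_mem _ _ _ (neg_mem hdw) _ hv) _
    · rw [← e6, e7]
      exact zsmul_mem (h.br_mem _ _ _ (neg_mem hdv) _ hw) _
    · exact neg_mem (h.d_mem _ _ (zsmul_mem hb _))
  | [a, b, c] =>
    obtain ⟨⟨n, u⟩, e⟩ := a
    obtain ⟨⟨m, v⟩, e'⟩ := b
    obtain ⟨⟨k, w⟩, e''⟩ := c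
    have hu : u ∈ 𝒱 (n + 1) := hl' ⟨⟨n, u⟩, e⟩ (by simp)
    have hv : v ∈ 𝒱 (m + 1) := hl' ⟨⟨m, v⟩, e'⟩ (by simp)
    have hw : w ∈ 𝒱 (k + 1) := hl' ⟨⟨k, w⟩, e''⟩ (by simp)
    have he : e ∈ par _ n := hl ⟨⟨n, u⟩, e⟩ (by simp)
    have he' : e' ∈ par _ m := hl ⟨⟨m, v⟩, e'⟩ (by simp)
    have he'' : e'' ∈ par _ k := hl ⟨⟨k, w⟩, e''⟩ (by simp)
    simp only [splitSum, if_true, add_zero, if_neg (List.cons_ne_nil _ _)]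
    -- With three arguments only a bracket inside a bracket survives; the terms with a ternary
    -- operation, inner or outer, are zero.
    have hz3 : dgen (shift 𝒱) (dval 1 (dglaOps d br) η' [dval 1 (dglaOps d br) η
        [((n, u), e), ((m, v), e'), ((k, w), e'')]]) = 0 := by
      refine dgen_eq_zero ?_
      simp only [dval, List.map_cons, List.map_nil, app_dglaOps_one]
      rw [app_dglaOps_of_ge (by simp), h.d_zero, neg_zero]
    have hz1 : ∀ x y z, dgen (shift 𝒱) (dval 1 (dglaOps d br) η' [dval 1 (dglaOps d br) η
        [x], y, z]) = 0 := by
      intro x y z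
      refine dgen_eq_zero ?_
      simp only [dval, List.map_cons, List.map_nil]
      rw [app_dglaOps_of_ge (by simp)]
    rw [hz3, hz1, hz1, hz1]
    -- The decorations of all terms are brought into the order `e e' e''`, which makes their
    -- relative signs explicit.
    have h1 : e * (e'' * e') = ((m * k).negOnePow : ℤ) • (e * (e' * e'')) := by
      rw [par_comm he'' he', mul_smul_comm, mul_comm]
    have h2 : e' * (e'' * e) = ((n * (m + k)).negOnePow : ℤ) • (e * (e' * e'')) := by
      rw [← mul_assoc, par_comm (mul_mem_par he' he'') he, mul_comm]
    simp only [dgen, dval, List.map_cons, List.map_nil, List.sum_cons,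
      List.sum_nil, app_dglaOps_two, add_zero, zero_add, dec_cons, dec_nil, mul_one, mul_assoc,
      h1, h2]
    obtain ⟨g, hg⟩ := exists_gen_extend (shift 𝒱) (n + m + k + 1 + 1)
    have a1 : n + m + 1 + k + 1 = n + m + k + 1 + 1 := by ring
    have a2 : n + k + 1 + m + 1 = n + m + k + 1 + 1 := by ring
    have a3 : m + k + 1 + n + 1 = n + m + k + 1 + 1 := by ring
    have hbr := h.br_mem (n + 1) (m + 1) u hu v hv
    have hbr2 := h.br_mem (n + 1) (k + 1) u hu w hw
    have hbr3 := h.br_mem (m + 1) (k + 1) v hv w hw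
    have b1 : n + m + 1 + 1 = (n + 1) + (m + 1) := by ring
    have b2 : n + k + 1 + 1 = (n + 1) + (k + 1) := by ring
    have b3 : m + k + 1 + 1 = (m + 1) + (k + 1) := by ring
    simp only [a1, a2, a3, b1, b2, b3]
    have hg' : ∀ N : ℤ, N = n + m + k + 1 + 1 + 1 → ∀ v ∈ 𝒱 N,
        gen (shift 𝒱) (n + m + k + 1 + 1, v) = g v := by
      rintro N rfl v hv
      exact hg v hv
    rw [hg' ((n + 1) + (m + 1) + (k + 1)) (by ring), hg' ((n + 1) + (k + 1) + (m + 1)) (by ring),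
      hg' ((m + 1) + (k + 1) + (n + 1)) (by ring)]
    rotate_left
    · exact zsmul_mem (h.br_mem _ _ _ (zsmul_mem hbr3 _) _ hu) _
    · exact zsmul_mem (h.br_mem _ _ _ (zsmul_mem hbr2 _) _ hv) _
    · exact zsmul_mem (h.br_mem _ _ _ (zsmul_mem hbr _) _ hw) _
    rw [mul_smul_comm, mul_smul_comm, mul_smul_comm, mul_smul_comm, TensorProduct.tmul_smul,
      TensorProduct.tmul_smul, TensorProduct.smul_tmul', TensorProduct.smul_tmul',
      ← TensorProduct.add_tmul, ← TensorProduct.add_tmul]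
    rw [← map_zsmul, ← map_zsmul, ← map_add, ← map_add]
    refine map_tmul_eq_zero g _ ?_
    rw [h.br_zsmul _ _ _ hbr hw, h.br_zsmul _ _ _ hbr2 hv, h.br_zsmul _ _ _ hbr3 hu,
      h.br_symm _ _ _ hbr2 _ hv, h.br_symm _ _ _ hbr3 _ hu, h.jacobi _ _ _ _ hu _ hv _ hw]
    generalize br (n + 1 + (m + 1)) (k + 1) (br (n + 1) (m + 1) u v) w = X
    generalize br (m + 1) (n + 1 + (k + 1)) v (br (n + 1) (k + 1) u w) = Y
    simp only [negOnePow_eq_ite, Int.even_add, Int.even_mul]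
    by_cases hn : Even n <;> by_cases hm : Even m <;> by_cases hk : Even k <;> simp [hn, hm, hk]
  | a :: b :: c :: x :: l =>
    rw [splitSum_congr (G := fun _ _ => 0), splitSum_zero]
    intro s u hsu
    split_ifs with hs
    · rfl
    · refine dgen_eq_zero ?_
      have hlen := hsu.length_eq
      simp only [List.length_append, List.length_cons] at hlen
      simp only [dval, List.map_cons]
      -- With at least four arguments in total, either the outer operation or the inner one takes
      -- three or more.
      by_cases hu : 2 ≤ u.length
      · rw [app_dglaOps_of_ge (by simpa using hu)]
      · rw [app_dglaOps_of_ge (l := s.map Prod.fst) (by rw [List.length_map]; omega)]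
        match u, hsu with
        | [], _ => rw [List.map_nil, app_dglaOps_one, h.d_zero, neg_zero]
        | [y], hsu =>
          have hy : y ∈ a :: b :: c :: x :: l := hsu.subset (by simp)
          rw [List.map_cons, List.map_nil, app_dglaOps_two]
          rw [h.br_zero _ _ (hl' _ hy), smul_zero]
        | y :: z :: u, _ => simp at hu

/-- The terms of `Q ∘ Q` on a monomial fall into two classes, according to whether the second
operation uses the output of the first. Nested pairs are governed by `IsDGLA.relations`; disjoint
pairs cancel because both operations are odd. -/
theorem IsDGLA.codifferential (h : IsDGLA 𝒱 d br) {n : ℕ} (x : Fin n → ℤ × V)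
    (hx : Homog (shift 𝒱) x) :
    afterCoder (dglaOps d br) (afterCoder (dglaOps d br) (mon (shift 𝒱))) n x = 0 := by
  obtain ⟨e, η, η', he, hη, hη', hne⟩ := exists_isDec x
  refine tmul_eq_zero_of_ne_zero hne ?_
  set q := dglaOps d br with hq
  set l := List.ofFn fun i => (x i, e i) with hl
  have hdec : (List.ofFn e).prod = dec l := by
    rw [hl, dec, List.map_ofFn]; rfl
  have hx' : List.ofFn x = l.map Prod.fst := by rw [hl, List.map_ofFn]; rfl
  have h1 : ∀ a ∈ l, IsDec a := by
    intro a ha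
    obtain ⟨i, rfl⟩ := (List.mem_ofFn' _ _).1 ha
    exact he i
  have h2 : ∀ a ∈ l, a.1.2 ∈ shift 𝒱 a.1.1 := by
    intro a ha
    obtain ⟨i, rfl⟩ := (List.mem_ofFn' _ _).1 ha
    exact hx i
  rw [← app_ofFn (afterCoder q (afterCoder q (mon (shift 𝒱)))) x, hx', hdec, app_afterCoder _ _ h1]
  -- After the first operation, the list starts with its output. The first sum collects the terms
  -- whose second operation includes this output, the second sum those that leave it alone.
  have hstep : splitSum l (fun s t => if s = [] then 0 else
      app (afterCoder q (mon (shift 𝒱))) ((dval 1 q η s :: t).map Prod.fst) ⊗ₜ[ℂ]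
        (η' * dec (dval 1 q η s :: t))) =
      splitSum l (fun s t => splitSum t fun u v => if s = [] then 0 else
        dgen (shift 𝒱) (dval 1 q η' (dval 1 q η s :: u)) * ev (mon (shift 𝒱)) v) +
      splitSum l (fun s t => splitSum t fun u v => if s = [] then 0 else if u = [] then 0 else
        dgen (shift 𝒱) (dval 1 q η' u) *
          (dgen (shift 𝒱) (dval 1 q η s) * ev (mon (shift 𝒱)) v)) := by
    rw [← splitSum_add]
    refine splitSum_congr fun s t hst => ?_
    rw [← splitSum_add]
    split_ifs with hs
    · simp [splitSum_zero]
    · have hst' : ∀ a ∈ s ++ t, a ∈ l := fun a ha => hst.subset ha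
      have := app_afterCoder q (mon (shift 𝒱)) (l := dval 1 q η s :: t) (fun a ha => by
        rcases List.mem_cons.1 ha with rfl | ha
        · exact isDec_dval hη _ fun b hb => h1 b (hst' b (by simp [hb]))
        · exact h1 a (hst' a (by simp [ha]))) 1 η'
      rw [one_mul] at this
      rw [this, splitSum, ← splitSum_add]
      refine splitSum_congr fun u v _ => ?_
      rw [if_neg (List.cons_ne_nil _ _), one_mul]
      change ev (mon (shift 𝒱)) (_ :: _) + _ = _
      rw [ev_mon_cons]
      congr 1
      split_ifs with hu
      · rfl
      · rw [one_mul]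
        change ev (mon (shift 𝒱)) (_ :: _ :: _) = _
        rw [ev_mon_cons, ev_mon_cons]
  rw [hstep]
  -- Regrouping by the set `r` of all arguments of the nested pair isolates the relation for `r`,
  -- multiplied by the untouched monomial.
  have hA : splitSum l (fun s t => splitSum t fun u v => if s = [] then 0 else
        dgen (shift 𝒱) (dval 1 q η' (dval 1 q η s :: u)) * ev (mon (shift 𝒱)) v) = 0 := by
    rw [splitSum_assoc l (fun s u v => if s = [] then 0 else
        dgen (shift 𝒱) (dval 1 q η' (dval 1 q η s :: u)) * ev (mon (shift 𝒱)) v)]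
    rw [splitSum_congr (G := fun _ _ => 0), splitSum_zero]
    intro r v hrv
    have hr : ∀ a ∈ r, a ∈ l := fun a ha => hrv.subset (by simp [ha])
    have := congrArg (· * ev (mon (shift 𝒱)) v)
      (h.relations (l := r) (fun a ha => h1 a (hr a ha)) (fun a ha => h2 a (hr a ha)) η η')
    rw [zero_mul] at this
    refine Eq.trans ?_ this
    have hm := map_splitSum (AddMonoidHom.mulRight (ev (mon (shift 𝒱)) v)) r fun s u =>
      if s = [] then 0 else dgen (shift 𝒱) (dval 1 q η' (dval 1 q η s :: u))
    simp only [AddMonoidHom.coe_mulRight] at hm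
    rw [hm]
    refine splitSum_congr fun s u _ => ?_
    simp only [ite_mul, zero_mul]
  have hB : splitSum l (fun s t => splitSum t fun u v => if s = [] then 0 else if u = [] then 0 else
        dgen (shift 𝒱) (dval 1 q η' u) *
          (dgen (shift 𝒱) (dval 1 q η s) * ev (mon (shift 𝒱)) v)) = 0 := by
    set F : List ((ℤ × V) × Dec) → List ((ℤ × V) × Dec) → List ((ℤ × V) × Dec) →
      Sym (shift 𝒱) ⊗[ℂ] Dec := fun s u v => if s = [] then 0 else if u = [] then 0 else
        dgen (shift 𝒱) (dval 1 q η' u) *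
          (dgen (shift 𝒱) (dval 1 q η s) * ev (mon (shift 𝒱)) v) with hF
    -- Exchanging the two disjoint sets of arguments exchanges `η` and `η'`, which anticommute.
    have hanti : ∀ s u v, (s ++ u ++ v).Perm l → F s u v = (-1 : ℂ) • F u s v := by
      intro s u v hp
      have hp' : ∀ a ∈ s ++ u, a ∈ l := fun a ha => hp.subset (by simp at ha ⊢; tauto)
      simp only [hF]
      by_cases hs : s = []
      · simp only [hs, if_true, ite_self, smul_zero]
      by_cases hu : u = []
      · simp only [hu, if_true, ite_self, smul_zero]
      rw [if_neg hs, if_neg hu, if_neg hs, if_neg hu, ← mul_assoc, ← mul_assoc, ← smul_mul_assoc]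
      congr 1
      have hds : ∀ η, η ∈ par _ 1 → IsDec (dval 1 q η s) := fun η hη =>
        isDec_dval hη _ fun b hb => h1 b (hp' b (by simp [hb]))
      have hdu : ∀ η, η ∈ par _ 1 → IsDec (dval 1 q η u) := fun η hη =>
        isDec_dval hη _ fun b hb => h1 b (hp' b (by simp [hb]))
      rw [dgen_comm _ (hdu _ hη') (hds _ hη)]
      unfold dgen
      rw [Algebra.TensorProduct.tmul_mul_tmul, Algebra.TensorProduct.tmul_mul_tmul,
        ← TensorProduct.tmul_smul, neg_one_smul]
      congr 1
      change (η * dec s) * (η' * dec u) = -((η' * dec s) * (η * dec u))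
      rw [← mul_assoc, anticomm hη hη' (dec_mem_par fun b hb => h1 b (hp' b (by simp [hb])))]
      simp only [neg_mul, mul_assoc]
    have hT : splitSum l (fun s t => splitSum t fun u v => F s u v) =
        (-1 : ℂ) • splitSum l (fun s t => splitSum t fun u v => F s u v) := by
      conv_rhs => rw [splitSum_assoc]
      rw [splitSum_assoc]
      refine Eq.trans (splitSum_congr (G := fun r v => (-1 : ℂ) • splitSum r fun s u => F s u v) ?_) ?_
      rotate_left
      · exact (map_splitSum (DistribSMul.toAddMonoidHom (Sym (shift 𝒱) ⊗[ℂ] Dec) (-1 : ℂ)) l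
          fun r v => splitSum r fun s u => F s u v).symm
      · intro r v hrv
        refine Eq.trans (splitSum_swap _ _) ?_
        refine Eq.trans (splitSum_congr fun s u hsu => ?_)
          (map_splitSum (DistribSMul.toAddMonoidHom (Sym (shift 𝒱) ⊗[ℂ] Dec) (-1 : ℂ)) r
            fun s u => F s u v).symm
        refine hanti u s v (List.Perm.trans ?_ hrv)
        exact (List.perm_append_comm.trans hsu).append_right v
    -- The sum is its own negative, and two is invertible.
    have h2T : (2 : ℂ) • splitSum l (fun s t => splitSum t fun u v => F s u v) = 0 := by
      rw [two_smul]
      nth_rewrite 1 [hT]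
      nth_rewrite 2 [← one_smul ℂ (splitSum l _)]
      rw [← add_smul]
      simp
    rw [← one_smul ℂ (splitSum l _), show (1 : ℂ) = 2⁻¹ * 2 by norm_num, mul_smul, h2T, smul_zero]
  rw [hA, hB, add_zero]

end DGLA

variable {V W U : Type*} [AddCommGroup V] [Module ℂ V] [AddCommGroup W] [Module ℂ W]
  [AddCommGroup U] [Module ℂ U]

section ColumnSums

variable {𝒱 : ℤ → Submodule ℂ V} {d : ℤ → V → V} {br : ℤ → ℤ → V → V → V}

theorem isSymMap_zero {𝒲 : ℤ → Submodule ℂ W} {r : ℤ} {k : ℕ} :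
    IsSymMap 𝒱 𝒲 r (fun _ : Fin k → ℤ × V => (0 : W)) where
  mem _ _ := zero_mem _
  map_add _ _ _ _ _ _ _ := by simp
  map_smul _ _ _ _ _ _ := by simp
  symm _ _ _ := by simp

theorem IsDGLA.isSymMap (h : IsDGLA 𝒱 d br) (k : ℕ) :
    IsSymMap (shift 𝒱) (shift 𝒱) 1 (dglaOps d br k) := by
  match k with
  | 0 => exact isSymMap_zero
  | 1 =>
    refine ⟨fun x hx => ?_, fun x hx i v hv w hw => ?_, fun x hx i a v hv => ?_,
      fun x hx σ => ?_⟩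
    · have := h.d_mem _ _ (hx 0)
      rw [Fin.sum_univ_one]
      exact neg_mem this
    · obtain rfl := Subsingleton.elim i 0
      simp only [dglaOps, Function.update_self]
      rw [h.d_add _ _ hv _ hw, neg_add]
    · obtain rfl := Subsingleton.elim i 0
      simp only [dglaOps, Function.update_self]
      rw [h.d_smul _ _ _ hv, smul_neg]
    · obtain rfl := Subsingleton.elim σ 1
      simp [koszul]
  | 2 =>
    refine ⟨fun x hx => ?_, fun x hx i v hv w hw => ?_, fun x hx i a v hv => ?_,
      fun x hx σ => ?_⟩
    · have := h.br_mem _ _ _ (hx 0) _ (hx 1)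
      have e : ∑ i, (x i).1 + 1 + 1 = ((x 0).1 + 1) + ((x 1).1 + 1) := by
        rw [Fin.sum_univ_two]; ring
      unfold shift
      rw [e]
      exact zsmul_mem this _
    · obtain rfl | rfl : i = 0 ∨ i = 1 := by omega
      · have h1 := hx 1
        simp only [dglaOps, Function.update_self, Function.update_of_ne one_ne_zero]
        rw [h.br_add _ _ _ hv _ hw _ h1, smul_add]
      · have h0 := hx 0
        simp only [dglaOps, Function.update_self, Function.update_of_ne zero_ne_one]
        rw [h.br_add_right _ _ h0 hv hw, smul_add]
    · obtain rfl | rfl : i = 0 ∨ i = 1 := by omega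
      · have h1 := hx 1
        simp only [dglaOps, Function.update_self, Function.update_of_ne one_ne_zero]
        rw [h.br_smul _ _ _ _ hv _ h1, smul_comm]
      · have h0 := hx 0
        simp only [dglaOps, Function.update_self, Function.update_of_ne zero_ne_one]
        rw [h.br_smul_right _ _ _ h0 hv, smul_comm]
    · have hσ : σ = 1 ∨ σ = Equiv.swap 0 1 := by revert σ; decide
      rcases hσ with rfl | rfl
      · have h1 : ∀ y : Fin 2 → ℤ × V, koszul (fun i => (y i).1) (fun i => (i : ℕ)) = 1 := by
          intro y
          simp [koszul, Fin.prod_univ_two]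
        change _ = koszul _ (fun i : Fin 2 => (i : ℕ)) • _
        rw [h1, one_smul]
        rfl
      · have h1 : ∀ y : Fin 2 → ℤ × V,
            koszul (fun i => (y i).1) (fun i => (((Equiv.swap 0 1).symm i : Fin 2) : ℕ)) =
              (((y 0).1 * (y 1).1).negOnePow : ℤ) := by
          intro y
          simp [koszul, Fin.prod_univ_two]
        rw [h1]
        simp only [dglaOps, Equiv.swap_apply_left, Equiv.swap_apply_right]
        -- The factor `(-1)^(deg x)` in the binary operation is what turns graded antisymmetry for
        -- the degrees of `V` into graded symmetry for those of `V[1]`.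
        rw [h.br_symm _ _ _ (hx 0) _ (hx 1)]
        generalize br _ _ _ _ = X
        simp only [negOnePow_eq_ite, Int.even_add, Int.even_mul]
        by_cases hn : Even (x 0).1 <;> by_cases hm : Even (x 1).1 <;> simp [hn, hm]
  | k + 3 => exact isSymMap_zero

/-- A differential graded Lie algebra is an `L∞`-algebra. -/
theorem IsDGLA.isLInftyAlgebra (h : IsDGLA 𝒱 d br) : IsLInftyAlgebra 𝒱 (dglaOps d br) where
  isSymMap k _ := h.isSymMap k
  codifferential _ _ x hx := h.codifferential x hx

end ColumnSums

/-! ### Morphisms to abelian differential graded Lie algebras -/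

/-- The coderivation writes its output at the front of the monomial; commutativity moves it back to
the place of the factor it came from. -/
theorem pickSum_ofFn {A D : Type*} [Semiring A] {m : ℕ} (z : Fin m → D) (g g' : D → A)
    (h : ∀ i j, g' (z i) * g (z j) = g (z j) * g' (z i)) :
    pickSum (List.ofFn z) (fun a t => g' a * (t.map g).prod) =
      ∑ j, (List.ofFn (Function.update (g ∘ z) j (g' (z j)))).prod := by
  induction m with
  | zero => simp [pickSum]
  | succ m ih =>
    rw [List.ofFn_succ, pickSum, Fin.sum_univ_succ]
    congr 1
    · rw [List.ofFn_succ, List.prod_cons, Function.update_self, List.map_ofFn]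
      congr 3
    · have := ih (fun j => z j.succ) fun i j => h _ _
      have hmul := congrArg (g (z 0) * ·) this
      rw [Finset.mul_sum] at hmul
      have h1 := map_pickSum (AddMonoidHom.mulLeft (g (z 0))) (List.ofFn fun j => z j.succ)
        fun a t => g' a * (t.map g).prod
      simp only [AddMonoidHom.coe_mulLeft] at h1
      rw [h1] at hmul
      rw [pickSum_congr (G := fun a t => g (z 0) * (g' a * (t.map g).prod))]
      · rw [hmul]
        refine Finset.sum_congr rfl fun j _ => ?_
        rw [List.ofFn_succ, List.prod_cons, Function.update_of_ne (Fin.succ_ne_zero j).symm]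
        congr 3
        ext1 i
        by_cases hij : i = j
        · subst hij; simp
        · rw [Function.update_of_ne hij,
            Function.update_of_ne (fun h => hij (Fin.succ_injective _ h))]
          rfl
      · intro a t hat
        have ha : a ∈ List.ofFn fun j => z j.succ := hat.subset (by simp)
        obtain ⟨i, rfl⟩ := (List.mem_ofFn' _ _).1 ha
        rw [List.map_cons, List.prod_cons, ← mul_assoc, h, mul_assoc]

variable {𝒱 : ℤ → Submodule ℂ V} {𝒲 : ℤ → Submodule ℂ W}

theorem update_comp {ι α β : Type*} [DecidableEq ι] (g : α → β) (b : ι → α) (j : ι) (a : α) :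
    (fun i => g (Function.update b j a i)) = Function.update (fun i => g (b i)) j (g a) := by
  ext i
  by_cases h : i = j
  · subst h; simp
  · simp [h]

/-- A sequence of maps `f` to an abelian differential graded Lie algebra is an `L∞`-morphism as soon
as the component `f ∘ Q = q'₁ ∘ f` of the equation `F ∘ Q = Q' ∘ F` holds. -/
theorem isLInftyMorphism_of_abelian {q : Ops V V} {d' : ℤ → W → W} {f : Ops V W}
    (hV : IsLInftyAlgebra 𝒱 q) (hW : IsDGLA 𝒲 d' fun _ _ _ _ => 0)
    (hf : ∀ k, 1 ≤ k → IsSymMap (shift 𝒱) (shift 𝒲) 0 (f k))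
    (hrel : ∀ n, 1 ≤ n → ∀ x : Fin n → ℤ × V, Homog (shift 𝒱) x →
      afterCoder q f n x = -d' (∑ i, (x i).1 + 1) (f n x)) :
    IsLInftyMorphism 𝒱 q 𝒲 (dglaOps d' fun _ _ _ _ => 0) f where
  source := hV
  target := hW.isLInftyAlgebra
  isSymMap := hf
  comm n hn x hx := by
    obtain ⟨e, η, η', he, hη, hη', hne'⟩ := exists_isDec x
    have hne : η * (List.ofFn e).prod ≠ 0 := right_ne_zero_of_mul hne'
    rw [← sub_eq_zero]
    refine tmul_eq_zero_of_ne_zero hne ?_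
    rw [TensorProduct.sub_tmul, sub_eq_zero]
    set q' := dglaOps d' (fun _ _ _ _ => (0 : W)) with hq'
    set l := List.ofFn fun i => (x i, e i) with hl
    have hdec : (List.ofFn e).prod = dec l := by
      rw [hl, dec, List.map_ofFn]; rfl
    have hx' : List.ofFn x = l.map Prod.fst := by rw [hl, List.map_ofFn]; rfl
    have h1 : ∀ a ∈ l, IsDec a := by
      intro a ha
      obtain ⟨i, rfl⟩ := (List.mem_ofFn' _ _).1 ha
      exact he i
    have h2 : ∀ a ∈ l, a.1.2 ∈ shift 𝒱 a.1.1 := by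
      intro a ha
      obtain ⟨i, rfl⟩ := (List.mem_ofFn' _ _).1 ha
      exact hx i
    rw [← app_ofFn (afterCoder q (afterMor f (mon (shift 𝒲)))) x,
      ← app_ofFn (afterMor f (afterCoder q' (mon (shift 𝒲)))) x, hx', hdec]
    have hone : (1 : Dec) ∈ par (ℕ →₀ ℂ) 0 := one_mem_par
    -- The hypothesis `hrel` in decorated form, for an arbitrary sublist and inside the symmetric
    -- algebra. It is applied to one block at a time.
    have hL : ∀ r : List ((ℤ × V) × Dec), r ≠ [] → (∀ a ∈ r, a ∈ l) →
        splitSum r (fun s u => if s = [] then 0 else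
          dgen (shift 𝒲) (dval 0 f 1 (dval 1 q η s :: u))) =
        dgen (shift 𝒲) (dval 1 q' η [dval 0 f 1 r]) := by
      intro r hr0 hr
      have hA := app_afterCoder q f (l := r) (fun a ha => h1 a (hr a ha)) 1 η
      have hre : app (afterCoder q f) (r.map Prod.fst) =
          -d' ((r.map fun a => a.1.1).sum + 1) (app f (r.map Prod.fst)) := by
        obtain ⟨m, y, hy⟩ := exists_eq_ofFn (r.map Prod.fst)
        have hm : 1 ≤ m := by
          rcases Nat.eq_zero_or_pos m with rfl | h
          · simp at hy; exact absurd hy hr0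
          · exact h
        have hY : Homog (shift 𝒱) y := by
          intro i
          have : y i ∈ r.map Prod.fst := hy ▸ (List.mem_ofFn' _ _).2 ⟨i, rfl⟩
          obtain ⟨b, hb, hby⟩ := List.mem_map.1 this
          rw [← hby]
          exact h2 b (hr b hb)
        have hsum : (r.map fun a => a.1.1).sum = ∑ i, (y i).1 := by
          have hy' := congrArg (List.map Prod.fst) hy
          rw [List.map_map, List.map_ofFn] at hy'
          rw [← List.sum_ofFn]
          exact congrArg List.sum hy'
        rw [hy, app_ofFn, app_ofFn, hsum]
        exact hrel m hm y hY
      have hdeg : ∀ s u, (s ++ u).Perm r →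
          ((dval 1 q η s :: u).map fun a => a.1.1).sum = (r.map fun a => a.1.1).sum + 1 := by
        intro s u hsu
        rw [← (hsu.map fun a => a.1.1).sum_eq, List.map_append, List.sum_append, List.map_cons,
          List.sum_cons]
        simp only [dval]
        ring
      -- By `hdeg` all terms of the relation have the same degree, one more than that of `r`.
      obtain ⟨g, hg⟩ := exists_gen_extend (shift 𝒲) ((r.map fun a => a.1.1).sum + 1)
      have hsplit := congrArg (TensorProduct.map g (LinearMap.id : Dec →ₗ[ℂ] Dec)) hA
      have hmap := map_splitSum (TensorProduct.map g (LinearMap.id : Dec →ₗ[ℂ] Dec)).toAddMonoidHom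
        r fun s t => if s = [] then 0 else
        app f ((dval 1 q η s :: t).map Prod.fst) ⊗ₜ[ℂ] ((1 : Dec) * dec (dval 1 q η s :: t))
      simp only [LinearMap.toAddMonoidHom_coe] at hmap
      rw [hmap] at hsplit
      have hmemf : ∀ s : List ((ℤ × V) × Dec), s ≠ [] → (∀ a ∈ s, a.1.2 ∈ shift 𝒱 a.1.1) →
          app f (s.map Prod.fst) ∈ shift 𝒲 (s.map fun a => a.1.1).sum := by
        intro s hs0 hs
        have hpos := (hf s.length (List.length_pos_iff.2 hs0)).mem (fun i => (s.get i).1)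
          fun i => hs _ (List.get_mem _ _)
        rw [add_zero, ← app_ofFn f, ← List.sum_ofFn] at hpos
        rwa [show (List.ofFn fun i => (s.get i).1) = s.map Prod.fst by
            rw [← Function.comp_def, ← List.map_ofFn, List.ofFn_get],
          show (List.ofFn fun i => (s.get i).1.1) = s.map fun a => a.1.1 by
            rw [← Function.comp_def (f := fun a : (ℤ × V) × Dec => a.1.1), ← List.map_ofFn,
              List.ofFn_get]] at hpos
      have hmemq : ∀ s : List ((ℤ × V) × Dec), s ≠ [] → (∀ a ∈ s, a.1.2 ∈ shift 𝒱 a.1.1) →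
          app q (s.map Prod.fst) ∈ shift 𝒱 ((s.map fun a => a.1.1).sum + 1) := by
        intro s hs0 hs
        have hpos := (hV.isSymMap s.length (List.length_pos_iff.2 hs0)).mem (fun i => (s.get i).1)
          fun i => hs _ (List.get_mem _ _)
        rw [← app_ofFn q, ← List.sum_ofFn] at hpos
        rwa [show (List.ofFn fun i => (s.get i).1) = s.map Prod.fst by
            rw [← Function.comp_def, ← List.map_ofFn, List.ofFn_get],
          show (List.ofFn fun i => (s.get i).1.1) = s.map fun a => a.1.1 by
            rw [← Function.comp_def (f := fun a : (ℤ × V) × Dec => a.1.1), ← List.map_ofFn,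
              List.ofFn_get]] at hpos
      rw [splitSum_congr (G := fun s t => TensorProduct.map g (LinearMap.id : Dec →ₗ[ℂ] Dec)
        (if s = [] then 0 else app f ((dval 1 q η s :: t).map Prod.fst) ⊗ₜ[ℂ]
          ((1 : Dec) * dec (dval 1 q η s :: t)))), ← hsplit, hre, one_mul, TensorProduct.map_tmul]
      · simp only [dgen, dval, LinearMap.id_apply, List.map_cons, List.map_nil, List.sum_cons,
          List.sum_nil, add_zero, dec_cons, dec_nil, one_mul, mul_one]
        rw [hg]
        · rfl
        · exact neg_mem (hW.d_mem _ _ (hmemf r hr0 fun a ha => h2 a (hr a ha)))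
      · intro s u hsu
        split_ifs with hs
        · rw [map_zero]
        · have hsr : ∀ a ∈ s ++ u, a.1.2 ∈ shift 𝒱 a.1.1 := fun a ha => h2 a (hr a (hsu.subset ha))
          rw [TensorProduct.map_tmul, ← hg]
          · rw [← hdeg s u hsu]
            simp [dgen, dval]
          · rw [← hdeg s u hsu]
            refine hmemf _ (List.cons_ne_nil _ _) fun a ha => ?_
            rcases List.mem_cons.1 ha with rfl | ha
            · exact hmemq s hs fun a ha => hsr a (by simp [ha])
            · exact hsr a (by simp [ha])
    set y : List ((ℤ × V) × Dec) → Sym (shift 𝒲) ⊗[ℂ] Dec :=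
      fun r => dgen (shift 𝒲) (dval 0 f 1 r) with hy
    -- In `F ∘ Q` the output of `q` lies in some block `j`. That block may contain nothing else, so
    -- nonemptiness is required only of the other blocks.
    have hleft : app (afterCoder q (afterMor f (mon (shift 𝒲)))) (l.map Prod.fst) ⊗ₜ[ℂ]
        (η * dec l) = ∑ m ∈ Finset.range (l.length + 1), ((m.factorial : ℂ)⁻¹) • ∑ j,
          splitSum l fun s t => colSum m t fun b =>
            if s = [] then 0 else if ∀ i, i ≠ j → b i ≠ [] then
              (List.ofFn (Function.update (fun i => y (b i)) j
                (y (dval 1 q η s :: b j)))).prod else 0 := by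
      have := app_afterCoder q (afterMor f (mon (shift 𝒲))) h1 1 η
      rw [one_mul] at this
      rw [this, splitSum_congr (G := fun s t => ∑ m ∈ Finset.range (l.length + 1),
        ((m.factorial : ℂ)⁻¹) • ∑ j, colSum m t fun b =>
            if s = [] then 0 else if ∀ i, i ≠ j → b i ≠ [] then
              (List.ofFn (Function.update (fun i => y (b i)) j
                (y (dval 1 q η s :: b j)))).prod else 0), splitSum_sum]
      · refine Finset.sum_congr rfl fun m _ => ?_
        rw [← splitSum_sum]
        have hm := map_splitSum (DistribSMul.toAddMonoidHom (Sym (shift 𝒲) ⊗[ℂ] Dec)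
          ((m.factorial : ℂ)⁻¹)) l fun s t => ∑ j, colSum m t fun b =>
            if s = [] then 0 else if ∀ i, i ≠ j → b i ≠ [] then
              (List.ofFn (Function.update (fun i => y (b i)) j
                (y (dval 1 q η s :: b j)))).prod else 0
        exact hm.symm
      · intro s t hst
        split_ifs with hs
        · symm
          refine Finset.sum_eq_zero fun m _ => ?_
          rw [Finset.sum_eq_zero, smul_zero]
          intro j _
          exact (map_colSum (0 : ℂ →+ Sym (shift 𝒲) ⊗[ℂ] Dec) m t fun _ => 0).symm
        · have hst' : ∀ a ∈ s ++ t, a ∈ l := fun a ha => hst.subset ha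
          have hlen : t.length + 1 ≤ l.length := by
            rw [← hst.length_eq, List.length_append]
            have := List.length_pos_iff.2 hs
            omega
          rw [app_afterMor f (mon (shift 𝒲)) (l := dval 1 q η s :: t) (fun a ha => by
            rcases List.mem_cons.1 ha with rfl | ha
            · exact isDec_dval hη _ fun b hb => h1 b (hst' b (by simp [hb]))
            · exact h1 a (hst' a (by simp [ha])))]
          have hmain : ∀ m, (colSum m (dval 1 q η s :: t) fun b => if ∀ j, b j ≠ [] then
              app (mon (shift 𝒲)) ((List.ofFn fun j => dval 0 f 1 (b j)).map Prod.fst) ⊗ₜ[ℂ]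
                (1 * dec (List.ofFn fun j => dval 0 f 1 (b j))) else 0) =
              ∑ j, colSum m t fun b => if ∀ i, i ≠ j → b i ≠ [] then
                (List.ofFn (Function.update (fun i => y (b i)) j
                  (y (dval 1 q η s :: b j)))).prod else 0 := by
            intro m
            rw [colSum]
            refine Finset.sum_congr rfl fun j _ => ?_
            congr 1
            ext1 b
            have hiff : (∀ i, Function.update b j (dval 1 q η s :: b j) i ≠ []) ↔
                ∀ i, i ≠ j → b i ≠ [] := by
              refine ⟨fun h i hij => by simpa [hij] using h i, fun h i => ?_⟩
              by_cases hij : i = j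
              · subst hij; simp
              · simpa [hij] using h i hij
            by_cases hb : ∀ i, i ≠ j → b i ≠ []
            · rw [if_pos hb, if_pos (hiff.2 hb), one_mul]
              change ev (mon (shift 𝒲)) _ = _
              rw [ev_mon, List.map_ofFn]
              congr 2
              exact update_comp y b j _
            · rw [if_neg hb, if_neg fun h => hb (hiff.1 h)]
          simp only [hmain, List.length_cons]
          -- The list headed by the output of `q` may be shorter than `l`. The additional values of
          -- `m` contribute nothing, since there are then fewer entries than blocks.
          refine Finset.sum_subset (Finset.range_mono (by omega)) fun m _ hm => ?_
          rw [Finset.mem_range, not_lt] at hm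
          rw [← hmain]
          rw [colSum_congr (G := fun _ => 0)]
          · rw [show (colSum m (dval 1 q η s :: t) fun _ => (0 : Sym (shift 𝒲) ⊗[ℂ] Dec)) = 0 from
              (map_colSum (0 : ℂ →+ Sym (shift 𝒲) ⊗[ℂ] Dec) m _ fun _ => 0).symm, smul_zero]
          · intro b _ hlb
            rw [if_neg]
            intro hb
            have : ∑ j : Fin m, 1 ≤ ∑ j, (b j).length :=
              Finset.sum_le_sum fun j _ => List.length_pos_iff.2 (hb j)
            rw [hlb] at this
            simp at this
            omega
    rw [hleft, app_afterMor f (afterCoder q' (mon (shift 𝒲))) h1 η]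
    refine Finset.sum_congr rfl fun m _ => ?_
    congr 1
    -- The target has no bracket, so its coderivation acts on one block at a time; `hL` then
    -- rewrites the result as operations of `q` inside that block.
    have hright : ∀ b : Fin m → List ((ℤ × V) × Dec), (∀ j, ∀ a ∈ b j, a ∈ l) →
        (if ∀ j, b j ≠ [] then
          app (afterCoder q' (mon (shift 𝒲))) ((List.ofFn fun j => dval 0 f 1 (b j)).map Prod.fst)
            ⊗ₜ[ℂ] (η * dec (List.ofFn fun j => dval 0 f 1 (b j))) else 0) =
        ∑ j, splitSum (b j) fun s u => if s = [] then 0 else if ∀ i, i ≠ j → b i ≠ [] then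
              (List.ofFn (Function.update (fun i => y (b i)) j
                (y (dval 1 q η s :: u)))).prod else 0 := by
      intro b hb
      have hdd : ∀ a ∈ List.ofFn fun j => dval 0 f 1 (b j), IsDec a := by
        intro a ha
        obtain ⟨j, rfl⟩ := (List.mem_ofFn' _ _).1 ha
        exact isDec_dval hone _ fun c hc => h1 c (hb j c hc)
      have hnil : ∀ j, b j = [] → (splitSum (b j) fun s u => if s = [] then 0 else
          if ∀ i, i ≠ j → b i ≠ [] then (List.ofFn (Function.update (fun i => y (b i)) j
                (y (dval 1 q η s :: u)))).prod else 0) = 0 := by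
        intro j hj
        rw [hj, splitSum, if_pos rfl]
      split_ifs with hall
      · have := app_afterCoder q' (mon (shift 𝒲)) hdd 1 η
        rw [one_mul] at this
        rw [this, splitSum_one]
        · rw [pickSum_congr (G := fun a t => dgen (shift 𝒲) (dval 1 q' η [a]) *
            (t.map (dgen (shift 𝒲))).prod), pickSum_ofFn]
          · refine Finset.sum_congr rfl fun j _ => ?_
            rw [← hL (b j) (hall j) (hb j)]
            have hpi : ∀ w, (List.ofFn (Function.update (fun i => y (b i)) j w)).prod =
                (MultilinearMap.mkPiAlgebraFin ℂ m (Sym (shift 𝒲) ⊗[ℂ] Dec)).toLinearMap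
                  (fun i => y (b i)) j w := fun w => by
              simp [MultilinearMap.toLinearMap_apply]
            change (List.ofFn (Function.update (fun i => y (b i)) j _)).prod = _
            rw [hpi]
            have hm := map_splitSum (((MultilinearMap.mkPiAlgebraFin ℂ m
              (Sym (shift 𝒲) ⊗[ℂ] Dec)).toLinearMap (fun i => y (b i)) j).toAddMonoidHom) (b j)
              fun s u => if s = [] then 0 else
                dgen (shift 𝒲) (dval 0 f 1 (dval 1 q η s :: u))
            simp only [LinearMap.toAddMonoidHom_coe] at hm
            rw [hm]
            refine splitSum_congr fun s u _ => ?_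
            split_ifs with hs h'
            · rw [map_zero]
            · rw [hpi]
            · exact absurd (fun i _ => hall i) h'
          · intro i j
            refine dgen_comm _ (isDec_dval hη _ fun a ha => ?_) (hdd _ ((List.mem_ofFn' _ _).2 ⟨j, rfl⟩))
            rw [List.mem_singleton.1 ha]
            exact hdd _ ((List.mem_ofFn' _ _).2 ⟨i, rfl⟩)
          · intro a t _
            rw [if_neg (List.cons_ne_nil _ _), one_mul]
            change ev (mon (shift 𝒲)) _ = _
            rw [ev_mon_cons, ev_mon]
        · intro s t hs
          split_ifs with hs0
          · rfl
          · rw [one_mul]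
            change ev (mon (shift 𝒲)) _ = _
            rw [ev_mon_cons, dgen_eq_zero, zero_mul]
            match s, hs, hs0 with
            | [a, b], _, _ => exact smul_zero _
            | a :: b :: c :: s, _, _ => rfl
      · symm
        refine Finset.sum_eq_zero fun j _ => ?_
        by_cases hj : b j = []
        · exact hnil j hj
        · rw [splitSum_congr (G := fun _ _ => 0), splitSum_zero]
          intro s u _
          rw [if_neg fun h : ∀ i, i ≠ j → b i ≠ [] => hall fun i => by
            by_cases hij : i = j
            · exact hij ▸ hj
            · exact h i hij, ite_self]
    rw [colSum_congr fun b hb _ => hright b hb, colSum_sum]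
    refine Finset.sum_congr rfl fun j _ => ?_
    -- Both sides are now sums over a block decomposition with a sublist `s` singled out in block
    -- `j`; the two orders of choosing are matched here.
    rw [← colSum_splitSum m j l fun s b => if s = [] then 0 else if ∀ i, i ≠ j → b i ≠ [] then
              (List.ofFn (Function.update (fun i => y (b i)) j
                (y (dval 1 q η s :: b j)))).prod else 0]
    refine colSum_congr fun b _ _ => splitSum_congr fun s u _ => ?_
    split_ifs with hs h3 h4 h4
    · rfl
    · rw [Function.update_self, update_comp, Function.update_idem]
    · exact absurd (fun i hij => by simpa [hij] using h3 i hij) h4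
    · exact absurd (fun i hij => by simpa [hij] using h4 i hij) h3
    · rfl

/-! ### Symmetry of sums over picked entries -/

section Pick

variable {α M : Type*} [AddCommMonoid M]

theorem pickSum_perm {l l' : List α} (hl : l.Perm l') {F : α → List α → M}
    (hF : ∀ a t t', t.Perm t' → F a t = F a t') : pickSum l F = pickSum l' F := by
  induction hl generalizing F with
  | nil => rfl
  | cons a h ih =>
    simp only [pickSum]
    rw [hF a _ _ h, ih (F := fun b t => F b (a :: t)) fun b t t' ht => hF _ _ _ (ht.cons a)]
  | swap a b l =>
    simp only [pickSum]
    rw [← add_assoc, ← add_assoc, add_comm (F b _)]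
    congr 1
    exact pickSum_congr fun c t _ => hF _ _ _ (List.Perm.swap _ _ _)
  | trans _ _ ih1 ih2 => rw [ih1 hF, ih2 hF]

theorem pickSum_comm (l : List α) (G : α → α → List α → M) :
    pickSum l (fun a t => pickSum t fun b u => G a b u) =
      pickSum l fun b t => pickSum t fun a u => G a b u := by
  induction l generalizing G with
  | nil => rfl
  | cons c l ih =>
    simp only [pickSum, pickSum_add]
    rw [ih fun a b u => G a b (c :: u)]
    abel

end Pick

/-! ### The polarized powers -/

section Word

variable {A : Type*} [Ring A]

/-- The coefficient of `t₁ ⋯ tₙ` in `(θ + t₁ a₁ + ⋯ + tₙ aₙ)^k`, for a list `a₁, …, aₙ`. -/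
def wordSum (θ : A) : ℕ → List A → A
  | 0, [] => 1
  | 0, _ :: _ => 0
  | k + 1, l => θ * wordSum θ k l + pickSum l fun a t => a * wordSum θ k t

theorem wordSum_succ (θ : A) (k : ℕ) (l : List A) :
    wordSum θ (k + 1) l = θ * wordSum θ k l + pickSum l fun a t => a * wordSum θ k t := by
  rw [wordSum]

theorem wordSum_zero_cons (θ a : A) (l : List A) : wordSum θ 0 (a :: l) = 0 := by rw [wordSum]

theorem wordSum_zero_nil (θ : A) : wordSum θ 0 [] = 1 := by rw [wordSum]

/-- The variables `tᵢ` are central, so the order in which they are listed is immaterial even though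
the letters need not commute. -/
theorem wordSum_perm (θ : A) (k : ℕ) {l l' : List A} (h : l.Perm l') :
    wordSum θ k l = wordSum θ k l' := by
  induction k generalizing l l' with
  | zero =>
    match l, l', h with
    | [], l', h => rw [h.nil_eq]
    | a :: l, [], h => exact absurd h (by simp)
    | a :: l, b :: l', h => rw [wordSum_zero_cons, wordSum_zero_cons]
  | succ k ih =>
    rw [wordSum_succ, wordSum_succ, ih h, pickSum_perm h]
    intro a t t' ht
    rw [ih ht]

theorem wordSum_cons_add (θ : A) (k : ℕ) (a b : A) (t : List A) :
    wordSum θ k ((a + b) :: t) = wordSum θ k (a :: t) + wordSum θ k (b :: t) := by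
  induction k generalizing t with
  | zero => simp [wordSum_zero_cons]
  | succ k ih =>
    simp only [wordSum_succ, pickSum, ih, mul_add, add_mul, pickSum_add]
    abel

/-- In each word `c` stands immediately to the left of `a` and moves to the front past `θ` and the
other letters. It need not commute with `a` itself. -/
theorem wordSum_cons_mul (θ : A) (k : ℕ) (c a : A) (t : List A) (hθ : Commute c θ)
    (ht : ∀ b ∈ t, Commute c b) : wordSum θ k ((c * a) :: t) = c * wordSum θ k (a :: t) := by
  induction k generalizing t with
  | zero => simp [wordSum_zero_cons]
  | succ k ih =>
    simp only [wordSum_succ, pickSum, mul_add]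
    rw [ih t ht, ← mul_assoc, ← hθ.eq, mul_assoc, mul_assoc]
    congr 2
    have h := map_pickSum (AddMonoidHom.mulLeft c) t fun b t => b * wordSum θ k (a :: t)
    simp only [AddMonoidHom.coe_mulLeft] at h
    rw [h]
    refine pickSum_congr fun b u hbu => ?_
    rw [ih u fun x hx => ht x (hbu.subset (by simp [hx])), ← mul_assoc,
      ← (ht b (hbu.subset (by simp))).eq, mul_assoc]

theorem wordSum_cons_smul [Algebra ℂ A] (θ : A) (k : ℕ) (c : ℂ) (a : A) (t : List A) :
    wordSum θ k ((c • a) :: t) = c • wordSum θ k (a :: t) := by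
  rw [Algebra.smul_def, Algebra.smul_def]
  exact wordSum_cons_mul _ _ _ _ _ (Algebra.commutes c θ) fun b _ => Algebra.commutes c b

theorem wordSum_cons_zero (θ : A) (k : ℕ) (t : List A) : wordSum θ k (0 :: t) = 0 := by
  simpa using wordSum_cons_mul θ k 0 0 t (Commute.zero_left _) fun _ _ => Commute.zero_left _

theorem wordSum_of_zero_mem (θ : A) (k : ℕ) {l : List A} (h : (0 : A) ∈ l) :
    wordSum θ k l = 0 := by
  classical
  rw [wordSum_perm θ k (List.perm_cons_erase h), wordSum_cons_zero]

theorem map_wordSum {B : Type*} [Ring B] (φ : A →+* B) (θ : A) (k : ℕ) (l : List A) :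
    φ (wordSum θ k l) = wordSum (φ θ) k (l.map φ) := by
  induction k generalizing l with
  | zero =>
    match l with
    | [] => simp [wordSum_zero_nil]
    | a :: l => simp [wordSum_zero_cons]
  | succ k ih =>
    rw [wordSum_succ, wordSum_succ, map_add, map_mul, ih, pickSum_map]
    congr 1
    have h := map_pickSum (φ : A →+ B) l fun a t => a * wordSum θ k t
    simp only [AddMonoidHom.coe_coe] at h
    rw [h]
    refine pickSum_congr fun a t _ => ?_
    rw [map_mul, ih]

theorem pickSum_mem {α S : Type*} [SetLike S A] [AddSubmonoidClass S A] {s : S} {l : List α}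
    {F : α → List α → A} (h : ∀ a t, (a :: t).Perm l → F a t ∈ s) : pickSum l F ∈ s := by
  induction l generalizing F with
  | nil => exact zero_mem s
  | cons a l ih =>
    exact add_mem (h a l (List.Perm.refl _)) (ih fun b t hbt =>
      h b (a :: t) ((List.Perm.swap a b t).trans (hbt.cons a)))

theorem wordSum_mem {S : Type*} [SetLike S A] [SubsemiringClass S A] (s : S) {θ : A} (hθ : θ ∈ s)
    (k : ℕ) {l : List A} (hl : ∀ a ∈ l, a ∈ s) : wordSum θ k l ∈ s := by
  induction k generalizing l with
  | zero =>
    match l with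
    | [] => rw [wordSum_zero_nil]; exact one_mem s
    | a :: l => rw [wordSum_zero_cons]; exact zero_mem s
  | succ k ih =>
    rw [wordSum_succ]
    exact add_mem (mul_mem hθ (ih hl)) (pickSum_mem fun a t hat =>
      mul_mem (hl a (hat.subset (by simp))) (ih fun b hb => hl b (hat.subset (by simp [hb]))))

theorem pickSum_rel {α R : Type*} [AddCommMonoid R] (D : R → A → Prop) (h0 : D 0 0)
    (hadd : ∀ a a' b b', D a a' → D b b' → D (a + b) (a' + b')) {l : List α}
    {F : α → List α → R} {F' : α → List α → A} (h : ∀ a t, (a :: t).Perm l → D (F a t) (F' a t)) :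
    D (pickSum l F) (pickSum l F') := by
  induction l generalizing F F' with
  | nil => exact h0
  | cons a l ih =>
    exact hadd _ _ _ _ (h a l (List.Perm.refl _)) (ih fun b t hbt =>
      h b (a :: t) ((List.Perm.swap a b t).trans (hbt.cons a)))

/-- The Leibniz rule for the polarized powers: here `D a a'` means that `a'` is the value of some
derivation on `a`, the value of `a` itself being `φ a`. -/
theorem wordSum_derivation {R : Type*} [Ring R] (φ : R →+* A) (D : R → A → Prop) (h0 : D 0 0)
    (h1 : D 1 0) (hadd : ∀ a a' b b', D a a' → D b b' → D (a + b) (a' + b'))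
    (hmul : ∀ a a' b b', D a a' → D b b' → D (a * b) (a' * φ b + φ a * b'))
    {θ : R} {θ' : A} (hθ : D θ θ') {δ : R → A} (k : ℕ) {l : List R} (hl : ∀ a ∈ l, D a (δ a)) :
    D (wordSum θ k l) (wordSum (φ θ) k (θ' :: l.map φ) +
      pickSum l fun b u => wordSum (φ θ) k (δ b :: u.map φ)) := by
  induction k generalizing l with
  | zero =>
    simp only [wordSum_zero_cons, pickSum_zero, add_zero]
    match l with
    | [] => rwa [wordSum_zero_nil]
    | a :: l => rwa [wordSum_zero_cons]
  | succ k ih =>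
    rw [wordSum_succ]
    -- The derivation hits the leading `θ`, something after it, a leading letter, or something after
    -- that letter. These are the terms of the product rule for one step of the recursion.
    have key : wordSum (φ θ) (k + 1) (θ' :: l.map φ) +
        (pickSum l fun b u => wordSum (φ θ) (k + 1) (δ b :: u.map φ)) =
        (θ' * φ (wordSum θ k l) + φ θ * (wordSum (φ θ) k (θ' :: l.map φ) +
          pickSum l fun b u => wordSum (φ θ) k (δ b :: u.map φ))) +
        pickSum l fun a t => δ a * φ (wordSum θ k t) + φ a * (wordSum (φ θ) k (θ' :: t.map φ) +
          pickSum t fun b u => wordSum (φ θ) k (δ b :: u.map φ)) := by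
      have hL : ∀ (c : A) (t : List R) (F : R → List R → A),
          pickSum t (fun b u => c * F b u) = c * pickSum t F := fun c t F =>
        (map_pickSum (AddMonoidHom.mulLeft c) t F).symm
      simp only [wordSum_succ, pickSum, pickSum_map, map_wordSum, pickSum_add, mul_add, ← hL]
      -- The words whose leading letter differs from the differentiated one are indexed by ordered
      -- pairs of entries, enumerated in opposite orders on the two sides.
      rw [pickSum_comm l fun a b u => φ b * wordSum (φ θ) k (δ a :: u.map φ)]
      abel
    rw [key]
    exact hadd _ _ _ _ (hmul _ _ _ _ hθ (ih hl)) (pickSum_rel D h0 hadd fun a t hat =>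
      hmul _ _ _ _ (hl a (hat.subset (by simp))) (ih fun b hb => hl b (hat.subset (by simp [hb]))))

/-- The commutator with `z` is a derivation. This is the infinitesimal form of the compatibility of
polarized powers with conjugation. -/
theorem commutator_wordSum (z θ : A) (k : ℕ) (l : List A) :
    z * wordSum θ k l - wordSum θ k l * z = wordSum θ k ((z * θ - θ * z) :: l) +
      pickSum l fun b u => wordSum θ k ((z * b - b * z) :: u) := by
  have h := wordSum_derivation (RingHom.id A) (fun a a' => z * a - a * z = a') (by simp) (by simp)
    (fun a a' b b' ha hb => by rw [← ha, ← hb]; noncomm_ring)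
    (fun a a' b b' ha hb => by rw [← ha, ← hb]; simp only [RingHom.id_apply]; noncomm_ring)
    (θ := θ) rfl (δ := fun b => z * b - b * z) k (l := l) (fun _ _ => rfl)
  simpa using h

open Classical in
/-- The polarized powers are the coefficients of the powers of `θ + ∑ tᵢ aᵢ`. -/
theorem coeff_pow_eq_wordSum {n : ℕ} (θ : A) (y : Fin n → A) (k : ℕ) (l : List (Fin n))
    (hl : l.Nodup) :
    ((AddMonoidAlgebra.single 0 θ + ∑ i, AddMonoidAlgebra.single (Finsupp.single i 1) (y i) :
      AddMonoidAlgebra A (Fin n →₀ ℕ)) ^ k).coeff (l.map fun i => Finsupp.single i 1).sum =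
      wordSum θ k (l.map y) := by
  induction k generalizing l with
  | zero =>
    rw [pow_zero, AddMonoidAlgebra.one_def, AddMonoidAlgebra.coeff_single]
    match l, hl with
    | [], _ => simp [wordSum_zero_nil]
    | i :: l, _ =>
      rw [List.map_cons, List.map_cons, wordSum_zero_cons, Finsupp.single_eq_of_ne]
      intro h
      have := DFunLike.congr_fun h i
      simp at this
  | succ k ih =>
    rw [pow_succ', add_mul, AddMonoidAlgebra.coeff_add, Finsupp.add_apply, Finset.sum_mul,
      AddMonoidAlgebra.coeff_sum, Finsupp.finsetSum_apply, wordSum_succ, pickSum_map,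
      AddMonoidAlgebra.coeff_single_zero_mul, ih l hl]
    congr 1
    have hcount : ∀ (l : List (Fin n)) (i : Fin n),
        (l.map fun i => (Finsupp.single i 1 : Fin n →₀ ℕ)).sum i = l.count i := by
      intro l i
      induction l with
      | nil => simp
      | cons j l ih2 =>
        rw [List.map_cons, List.sum_cons, Finsupp.add_apply, ih2, List.count_cons,
          Finsupp.single_apply, add_comm]
        simp
    -- For a list without repetitions, picking an entry is the same as summing over its entries,
    -- provided the summand ignores the order of the rest.
    have hsum : ∀ (l : List (Fin n)) (F : Fin n → List (Fin n) → A), l.Nodup →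
        (∀ i t t', t.Perm t' → F i t = F i t') →
        pickSum l F = ∑ i, if i ∈ l then F i (l.erase i) else 0 := by
      intro l
      induction l with
      | nil => intro F _ _; simp [pickSum]
      | cons j l ih2 =>
        intro F hnd hF
        rw [List.nodup_cons] at hnd
        rw [pickSum, ih2 (fun i t => F i (j :: t)) hnd.2 fun i t t' ht => hF _ _ _ (ht.cons j),
          ← Finset.add_sum_erase _ _ (Finset.mem_univ j),
          ← Finset.add_sum_erase (a := j) _ (fun i => if i ∈ j :: l then F i ((j :: l).erase i) else 0)
          (Finset.mem_univ j), if_neg hnd.1, zero_add]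
        simp only [List.mem_cons, true_or, if_true, List.erase_cons_head]
        congr 1
        refine Finset.sum_congr rfl fun i hi => ?_
        have hij : i ≠ j := Finset.ne_of_mem_erase hi
        simp only [hij, false_or]
        rw [List.erase_cons_tail (by simpa using hij.symm)]
    rw [hsum l _ hl fun i t t' ht => by rw [wordSum_perm θ k (ht.map y)]]
    refine Finset.sum_congr rfl fun i _ => ?_
    split_ifs with hi
    · rw [← ih (l.erase i) (hl.erase i)]
      rw [((List.perm_cons_erase hi).map fun i => (Finsupp.single i 1 : Fin n →₀ ℕ)).sum_eq,
        List.map_cons, List.sum_cons, AddMonoidAlgebra.coeff_single_mul_add]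
    -- If `i` is not in `l`, the wanted monomial does not contain `tᵢ`, so `tᵢ yᵢ` cannot be the
    -- first factor.
    · refine AddMonoidAlgebra.coeff_single_mul_of_forall_add_ne _ _ fun d hd => ?_
      have := DFunLike.congr_fun hd i
      rw [hcount, List.count_eq_zero_of_not_mem hi, Finsupp.add_apply, Finsupp.single_eq_same] at this
      omega

end Word

end LInf
namespace Hitchin
open LInf

/-! ### Bilinear identities checked on generators -/

section Spans

variable {A M : Type*} [Ring A] [Algebra ℂ A] [AddCommGroup M] [Module ℂ M]

theorem map_mul_mem_of_span (φ : A →ₗ[ℂ] M) {s t : Set A} {N : Submodule ℂ M}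
    (h : ∀ a ∈ s, ∀ b ∈ t, φ (a * b) ∈ N) {a b : A} (ha : a ∈ Submodule.span ℂ s)
    (hb : b ∈ Submodule.span ℂ t) : φ (a * b) ∈ N := by
  refine Submodule.span_induction₂ (p := fun y z _ _ => φ (y * z) ∈ N)
    ?_ ?_ ?_ ?_ ?_ ?_ ?_ ha hb
  · exact fun a b ha hb => h a ha b hb
  · intro y _; rw [zero_mul, map_zero]; exact zero_mem _
  · intro y _; rw [mul_zero, map_zero]; exact zero_mem _
  · intro x y z _ _ _ h1 h2; rw [add_mul, map_add]; exact add_mem h1 h2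
  · intro x y z _ _ _ h1 h2; rw [mul_add, map_add]; exact add_mem h1 h2
  · intro r x y _ _ h; rw [smul_mul_assoc, map_smul]; exact Submodule.smul_mem _ _ h
  · intro r x y _ _ h; rw [mul_smul_comm, map_smul]; exact Submodule.smul_mem _ _ h

theorem mul_mem_of_span {s t : Set A} {N : Submodule ℂ A}
    (h : ∀ a ∈ s, ∀ b ∈ t, a * b ∈ N) {a b : A} (ha : a ∈ Submodule.span ℂ s)
    (hb : b ∈ Submodule.span ℂ t) : a * b ∈ N :=
  map_mul_mem_of_span LinearMap.id h ha hb

/-- Two bilinear maps that agree on generators agree. -/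
theorem bilin_eq_of_span {P : Type*} [AddCommGroup P] [Module ℂ P] {s : Set M} {t : Set P}
    (φ ψ : M →ₗ[ℂ] P →ₗ[ℂ] A) (h : ∀ a ∈ s, ∀ b ∈ t, φ a b = ψ a b) {a : M} {b : P}
    (ha : a ∈ Submodule.span ℂ s) (hb : b ∈ Submodule.span ℂ t) : φ a b = ψ a b := by
  refine Submodule.span_induction₂ (p := fun y z _ _ => φ y z = ψ y z)
    ?_ ?_ ?_ ?_ ?_ ?_ ?_ ha hb
  · exact fun a b ha hb => h a ha b hb
  all_goals intros; simp_all

theorem map_mul_comm_of_span (φ : A →ₗ[ℂ] M) {s t : Set A}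
    (h : ∀ a ∈ s, ∀ b ∈ t, φ (a * b) = φ (b * a)) {a b : A} (ha : a ∈ Submodule.span ℂ s)
    (hb : b ∈ Submodule.span ℂ t) : φ (a * b) = φ (b * a) := by
  refine Submodule.span_induction₂ (p := fun y z _ _ => φ (y * z) = φ (z * y))
    ?_ ?_ ?_ ?_ ?_ ?_ ?_ ha hb
  · exact fun a b ha hb => h a ha b hb
  · intro y _; rw [zero_mul, mul_zero]
  · intro y _; rw [zero_mul, mul_zero]
  · intro x y z _ _ _ h1 h2; rw [add_mul, mul_add, map_add, map_add, h1, h2]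
  · intro x y z _ _ _ h1 h2; rw [add_mul, mul_add, map_add, map_add, h1, h2]
  · intro r x y _ _ h; rw [smul_mul_assoc, mul_smul_comm, map_smul, map_smul, h]
  · intro r x y _ _ h; rw [smul_mul_assoc, mul_smul_comm, map_smul, map_smul, h]

end Spans

section Fibre

variable {T E L : Type*} [AddCommGroup T] [Module ℂ T] [AddCommGroup E] [Module ℂ E]
  [AddCommGroup L] [Module ℂ L]

/-! ### The projections of the exterior algebra to its parts of degree `0` and `1` -/

/-- The map from the exterior algebra to the trivial square-zero extension of `ℂ` by `L` is an
algebra homomorphism with components `algebraMapInv` and `ιInv`. The formula is the product in that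
extension. -/
theorem ιInv_mul (a b : ExteriorAlgebra ℂ L) :
    ExteriorAlgebra.ιInv (a * b) = ExteriorAlgebra.algebraMapInv a • ExteriorAlgebra.ιInv b +
      ExteriorAlgebra.algebraMapInv b • ExteriorAlgebra.ιInv a := by
  let : Module ℂᵐᵒᵖ L := Module.compHom _ ((RingHom.id ℂ).fromOpposite mul_comm)
  have : IsCentralScalar ℂ L := ⟨fun r m => rfl⟩
  have hfst : ∀ a : ExteriorAlgebra ℂ L,
      (ExteriorAlgebra.toTrivSqZeroExt a).fst = ExteriorAlgebra.algebraMapInv a := by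
    intro a
    have h : (TrivSqZeroExt.fstHom ℂ ℂ L).comp ExteriorAlgebra.toTrivSqZeroExt =
        ExteriorAlgebra.algebraMapInv := by
      apply ExteriorAlgebra.hom_ext
      ext x
      simp [ExteriorAlgebra.algebraMapInv]
    exact DFunLike.congr_fun h a
  unfold ExteriorAlgebra.ιInv
  simp only [LinearMap.comp_apply, AlgHom.toLinearMap_apply, map_mul, TrivSqZeroExt.sndHom_apply,
    TrivSqZeroExt.snd_mul, hfst]
  rfl

theorem algebraMapInv_of_mem {q : ℕ} (hq : q ≠ 0) {l : ExteriorAlgebra ℂ L} (hl : l ∈ ⋀[ℂ]^q L) :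
    ExteriorAlgebra.algebraMapInv l = 0 := by
  obtain ⟨q, rfl⟩ := Nat.exists_eq_succ_of_ne_zero hq
  rw [ExteriorAlgebra.exteriorPower, pow_succ'] at hl
  refine Submodule.mul_induction_on hl ?_ fun x y hx hy => by rw [map_add, hx, hy, add_zero]
  rintro _ ⟨x, rfl⟩ n _
  rw [map_mul, ExteriorAlgebra.algebraMapInv, ExteriorAlgebra.lift_ι_apply]
  simp

theorem ιInv_of_mem {q : ℕ} (hq : q ≠ 1) {l : ExteriorAlgebra ℂ L} (hl : l ∈ ⋀[ℂ]^q L) :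
    ExteriorAlgebra.ιInv l = 0 := by
  match q with
  | 0 =>
    rw [ExteriorAlgebra.exteriorPower, pow_zero] at hl
    obtain ⟨r, rfl⟩ := Submodule.mem_one.1 hl
    -- The Leibniz rule for `1 * 1` forces the value at `1` to be twice itself.
    have h1 : ExteriorAlgebra.ιInv (1 : ExteriorAlgebra ℂ L) = 0 := by
      have := ιInv_mul (1 : ExteriorAlgebra ℂ L) 1
      simpa using this
    rw [Algebra.algebraMap_eq_smul_one, map_smul, h1, smul_zero]
  | q + 2 =>
    rw [ExteriorAlgebra.exteriorPower, pow_succ'] at hl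
    refine Submodule.mul_induction_on hl ?_ fun x y hx hy => by rw [map_add, hx, hy, add_zero]
    rintro m hm n hn
    rw [ιInv_mul, algebraMapInv_of_mem (Nat.succ_ne_zero q) hn,
      algebraMapInv_of_mem one_ne_zero (by rwa [ExteriorAlgebra.exteriorPower, pow_one]), zero_smul,
      zero_smul, add_zero]

/-! ### The grading of the fibre by the total degree -/

/-- The element `f ⊗ (η ⊗ l)` of the fibre. -/
def pure (f : Module.End ℂ E) (η : Forms T) (l : ExteriorAlgebra ℂ L) : EndFib T E L :=
  f ⊗ₜ[ℂ] (η ᵍ⊗ₜ[ℂ] l)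

theorem pure_mul_pure (f f' : Module.End ℂ E) (η : Forms T) {η' : Forms T} {l : ExteriorAlgebra ℂ L}
    (l' : ExteriorAlgebra ℂ L) {p q : ℕ} (hη' : η' ∈ ⋀[ℂ]^p (ConjDual T)) (hl : l ∈ ⋀[ℂ]^q L) :
    pure f η l * pure f' η' l' =
      (((q : ℤ) * p).negOnePow : ℤ) • pure (f * f') (η * η') (l * l') := by
  unfold pure
  rw [Algebra.TensorProduct.tmul_mul_tmul]
  have := GradedTensorProduct.tmul_coe_mul_coe_tmul (R := ℂ)
    (𝒜 := fun i : ℕ => ⋀[ℂ]^i (ConjDual T)) (ℬ := fun i : ℕ => ⋀[ℂ]^i L) η ⟨l, hl⟩ ⟨η', hη'⟩ l'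
  rw [this, ← TensorProduct.tmul_smul]
  congr 1

/-- The homogeneous elements `f ⊗ (η ⊗ l)` of total degree `n`. -/
def pureSet (T E L : Type*) [AddCommGroup T] [Module ℂ T] [AddCommGroup E] [Module ℂ E]
    [AddCommGroup L] [Module ℂ L] (n : ℤ) : Set (EndFib T E L) :=
  {z | ∃ (p q : ℕ) (f : Module.End ℂ E) (η : Forms T) (l : ExteriorAlgebra ℂ L), (p : ℤ) + q = n ∧
    η ∈ ⋀[ℂ]^p (ConjDual T) ∧ l ∈ ⋀[ℂ]^q L ∧ z = pure f η l}

/-- The part of total degree `n` of the fibre. -/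
def endTot (T E L : Type*) [AddCommGroup T] [Module ℂ T] [AddCommGroup E] [Module ℂ E]
    [AddCommGroup L] [Module ℂ L] (n : ℤ) : Submodule ℂ (EndFib T E L) :=
  Submodule.span ℂ (pureSet T E L n)

theorem endPart_le_endTot (p q : ℕ) : endPart T E L p q ≤ endTot T E L (p + q) := by
  refine Submodule.span_mono ?_
  rintro z ⟨f, η, l, hη, hl, rfl⟩
  exact ⟨p, q, f, η, l, rfl, hη, hl, rfl⟩

theorem span_pure_eq_top : Submodule.span ℂ {z | ∃ (f : Module.End ℂ E) (η : Forms T)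
    (l : ExteriorAlgebra ℂ L), z = pure f η l} = ⊤ := by
  rw [eq_top_iff]
  intro z _
  induction z using TensorProduct.induction_on with
  | zero => exact zero_mem _
  | add x y hx hy => exact add_mem (hx trivial) (hy trivial)
  | tmul f z =>
    have h : ∀ w : Forms T ⊗[ℂ] ExteriorAlgebra ℂ L, f ⊗ₜ[ℂ] (GradedTensorProduct.of ℂ
        (fun i : ℕ => ⋀[ℂ]^i (ConjDual T)) (fun i : ℕ => ⋀[ℂ]^i L) w) ∈
        Submodule.span ℂ {z | ∃ (f : Module.End ℂ E) (η : Forms T)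
          (l : ExteriorAlgebra ℂ L), z = pure f η l} := by
      intro w
      induction w using TensorProduct.induction_on with
      | zero => rw [map_zero, TensorProduct.tmul_zero]; exact zero_mem _
      | add x y hx hy => rw [map_add, TensorProduct.tmul_add]; exact add_mem hx hy
      | tmul η l => exact Submodule.subset_span ⟨f, η, l, rfl⟩
    exact h z

theorem endPart_mul {p q p' q' : ℕ} {y z : EndFib T E L} (hy : y ∈ endPart T E L p q)
    (hz : z ∈ endPart T E L p' q') : y * z ∈ endPart T E L (p + p') (q + q') := by
  refine mul_mem_of_span (A := EndFib T E L) ?_ hy hz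
  rintro _ ⟨f, η, l, hη, hl, rfl⟩ _ ⟨f', η', l', hη', hl', rfl⟩
  have := pure_mul_pure f f' η l' hη' hl
  unfold pure at this
  rw [this]
  refine zsmul_mem (Submodule.subset_span (s := {z | ∃ (f : Module.End ℂ E) (η : Forms T)
    (l : ExteriorAlgebra ℂ L), η ∈ ⋀[ℂ]^(p + p') (ConjDual T) ∧ l ∈ ⋀[ℂ]^(q + q') L ∧
      z = f ⊗ₜ[ℂ] (η ᵍ⊗ₜ[ℂ] l)}) ⟨f * f', η * η', l * l', ?_, ?_, rfl⟩) _
  · exact SetLike.GradedMul.mul_mem (A := fun i : ℕ => ⋀[ℂ]^i (ConjDual T)) hη hη'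
  · exact SetLike.GradedMul.mul_mem (A := fun i : ℕ => ⋀[ℂ]^i L) hl hl'

/-! ### Letters -/

variable (T L) in
/-- Forms with values in `⨀ L`, with decorations. -/
def Coef : Type _ := SymFib T L ⊗[ℂ] Dec

instance : Ring (Coef T L) := inferInstanceAs (Ring (SymFib T L ⊗[ℂ] Dec))

instance : Algebra ℂ (Coef T L) := inferInstanceAs (Algebra ℂ (SymFib T L ⊗[ℂ] Dec))

/-- `SymFib T L ⊗ Dec` as `Coef`. -/
def coef : SymFib T L ⊗[ℂ] Dec →ₗ[ℂ] Coef T L where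
  toFun z := z
  map_add' _ _ := rfl
  map_smul' _ _ := rfl

/-- The element `(η ⊗ s) ⊗ e`. -/
def mk (η : Forms T) (s : SymmetricAlgebra ℂ L) (e : Dec) : Coef T L := coef ((η ⊗ₜ s) ⊗ₜ e)

theorem mk_mul_mk (η η' : Forms T) (s s' : SymmetricAlgebra ℂ L) (e e' : Dec) :
    mk η s e * mk η' s' e' = mk (η * η') (s * s') (e * e') := by
  change (((η ⊗ₜ[ℂ] s) ⊗ₜ[ℂ] e : SymFib T L ⊗[ℂ] Dec) * ((η' ⊗ₜ[ℂ] s') ⊗ₜ[ℂ] e') :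
    SymFib T L ⊗[ℂ] Dec) = ((η * η') ⊗ₜ[ℂ] (s * s')) ⊗ₜ[ℂ] (e * e')
  rw [Algebra.TensorProduct.tmul_mul_tmul, Algebra.TensorProduct.tmul_mul_tmul]

theorem mk_one : (mk 1 1 1 : Coef T L) = 1 := rfl

variable (T L) in
/-- The trilinear map `mk`. -/
def mkHom : Forms T →ₗ[ℂ] SymmetricAlgebra ℂ L →ₗ[ℂ] Dec →ₗ[ℂ] Coef T L :=
  LinearMap.mk₂ ℂ (fun η s => coef ∘ₗ TensorProduct.mk ℂ (SymFib T L) Dec (η ⊗ₜ s))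
    (fun _ _ _ => by rw [TensorProduct.add_tmul, map_add, LinearMap.comp_add])
    (fun _ _ _ => by rw [← TensorProduct.smul_tmul', map_smul, LinearMap.comp_smul])
    (fun _ _ _ => by rw [TensorProduct.tmul_add, map_add, LinearMap.comp_add])
    (fun _ _ _ => by rw [TensorProduct.tmul_smul, map_smul, LinearMap.comp_smul])

theorem mkHom_apply (η : Forms T) (s : SymmetricAlgebra ℂ L) (e : Dec) :
    mkHom T L η s e = mk η s e := rfl

theorem zsmul_mk (a : ℤ) (η : Forms T) (s : SymmetricAlgebra ℂ L) (e : Dec) :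
    mk (a • η) s e = a • mk η s e := by
  rw [← mkHom_apply, ← mkHom_apply, map_zsmul, LinearMap.smul_apply, LinearMap.smul_apply]

theorem mk_zsmul (a : ℤ) (η : Forms T) (s : SymmetricAlgebra ℂ L) (e : Dec) :
    mk η s (a • e) = a • mk η s e := by
  rw [← mkHom_apply, ← mkHom_apply, map_zsmul]

theorem mk_zero_mid (η : Forms T) (e : Dec) : (mk η 0 e : Coef T L) = 0 := by
  rw [← mkHom_apply, map_zero, LinearMap.zero_apply]

variable (T E L) in
/-- The algebra in which the polarized traces are computed. -/
abbrev Letters : Type _ := Module.End ℂ E ⊗[ℂ] Coef T L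

/-- `f ⊗ (η ⊗ l) ↦ f ⊗ (η ⊗ l₁) ⊗ e`, where `l₁` is the part of degree `1` of `l`. -/
def letterOne (e : Dec) : EndFib T E L →ₗ[ℂ] Letters T E L :=
  TensorProduct.map LinearMap.id (coef ∘ₗ (TensorProduct.mk ℂ (SymFib T L) Dec).flip e ∘ₗ
    TensorProduct.map LinearMap.id (SymmetricAlgebra.ι ℂ L ∘ₗ ExteriorAlgebra.ιInv) ∘ₗ
      (GradedTensorProduct.of ℂ _ _).symm.toLinearMap)

/-- `f ⊗ (η ⊗ l) ↦ f ⊗ (η ⊗ l₀) ⊗ e`, where `l₀` is the part of degree `0` of `l`. -/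
def letterZero (e : Dec) : EndFib T E L →ₗ[ℂ] Letters T E L :=
  TensorProduct.map LinearMap.id (coef ∘ₗ (TensorProduct.mk ℂ (SymFib T L) Dec).flip e ∘ₗ
    TensorProduct.map LinearMap.id
      (Algebra.linearMap ℂ (SymmetricAlgebra ℂ L) ∘ₗ ExteriorAlgebra.algebraMapInv.toLinearMap) ∘ₗ
      (GradedTensorProduct.of ℂ _ _).symm.toLinearMap)

variable (T) in
/-- `f ⊗ l ↦ f ⊗ (1 ⊗ l) ⊗ 1`. -/
def letterHiggs : Module.End ℂ E ⊗[ℂ] L →ₗ[ℂ] Letters T E L :=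
  TensorProduct.map LinearMap.id (coef ∘ₗ (TensorProduct.mk ℂ (SymFib T L) Dec).flip 1 ∘ₗ
    TensorProduct.mk ℂ (Forms T) (SymmetricAlgebra ℂ L) 1 ∘ₗ SymmetricAlgebra.ι ℂ L)

theorem letterOne_pure (e : Dec) (f : Module.End ℂ E) (η : Forms T) (l : ExteriorAlgebra ℂ L) :
    letterOne e (pure f η l) =
      f ⊗ₜ[ℂ] mk η (SymmetricAlgebra.ι ℂ L (ExteriorAlgebra.ιInv l)) e := rfl

theorem letterZero_pure (e : Dec) (f : Module.End ℂ E) (η : Forms T) (l : ExteriorAlgebra ℂ L) :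
    letterZero e (pure f η l) = f ⊗ₜ[ℂ] mk η
      (algebraMap ℂ (SymmetricAlgebra ℂ L) (ExteriorAlgebra.algebraMapInv l)) e := rfl

theorem letterHiggs_tmul (f : Module.End ℂ E) (l : L) :
    letterHiggs T (f ⊗ₜ[ℂ] l) = f ⊗ₜ[ℂ] mk 1 (SymmetricAlgebra.ι ℂ L l) 1 := rfl

theorem inclHiggs_tmul (f : Module.End ℂ E) (l : L) :
    inclHiggs (f ⊗ₜ[ℂ] l) = pure f (1 : Forms T) (ExteriorAlgebra.ι ℂ l) := rfl

/-! ### Even elements -/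

variable (T L) in
/-- The elements `(η ⊗ s) ⊗ e` where `η` and `e` have the same parity. -/
def evenSet : Set (Coef T L) :=
  {c | ∃ (n : ℤ) (η : Forms T) (s : SymmetricAlgebra ℂ L) (e : Dec),
    η ∈ par _ n ∧ e ∈ par _ n ∧ c = mk η s e}

variable (T L) in
/-- The part of `(⋀ T̄^* ⊗ ⨀ L) ⊗ Dec` spanned by elements whose form part and decoration have the
same parity.  It is commutative. -/
def evenCoeff : Submodule ℂ (Coef T L) := Submodule.span ℂ (evenSet T L)

theorem mk_mem_evenCoeff {n : ℤ} {η : Forms T} (s : SymmetricAlgebra ℂ L)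
    {e : Dec} (hη : η ∈ par _ n) (he : e ∈ par _ n) : mk η s e ∈ evenCoeff T L :=
  Submodule.subset_span ⟨n, η, s, e, hη, he, rfl⟩

theorem evenCoeff_mul {c c' : Coef T L} (hc : c ∈ evenCoeff T L)
    (hc' : c' ∈ evenCoeff T L) : c * c' ∈ evenCoeff T L := by
  refine mul_mem_of_span ?_ hc hc'
  rintro _ ⟨n, η, s, e, hη, he, rfl⟩ _ ⟨n', η', s', e', hη', he', rfl⟩
  rw [mk_mul_mk]
  exact mk_mem_evenCoeff _ (mul_mem_par hη hη') (mul_mem_par he he')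

/-- The sign `(-1)^(n n')` occurs twice, once from the forms and once from the decorations. -/
theorem evenCoeff_comm {c c' : Coef T L} (hc : c ∈ evenCoeff T L)
    (hc' : c' ∈ evenCoeff T L) : c * c' = c' * c := by
  refine map_mul_comm_of_span LinearMap.id ?_ hc hc'
  rintro _ ⟨n, η, s, e, hη, he, rfl⟩ _ ⟨n', η', s', e', hη', he', rfl⟩
  rw [mk_mul_mk, mk_mul_mk, par_comm hη hη', par_comm he he', mul_comm s, mk_zsmul, zsmul_mk,
    smul_smul, sgn_mul_self, one_smul]

variable (T E L) in
/-- The elements `f ⊗ c` with `c` even. -/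
def evenLetterSet : Set (Letters T E L) :=
  {z | ∃ (f : Module.End ℂ E) (c : Coef T L), c ∈ evenCoeff T L ∧ z = f ⊗ₜ[ℂ] c}

variable (T E L) in
/-- The subalgebra `End E ⊗ evenCoeff`. -/
def evenLetters : Subalgebra ℂ (Letters T E L) :=
  (Submodule.span ℂ (evenLetterSet T E L)).toSubalgebra
    (Submodule.subset_span (s := evenLetterSet T E L) ⟨1, 1, mk_mem_evenCoeff 1 one_mem_par one_mem_par, rfl⟩)
    (fun y z hy hz => by
      refine mul_mem_of_span (A := Letters T E L) ?_ hy hz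
      rintro _ ⟨f, c, hc, rfl⟩ _ ⟨f', c', hc', rfl⟩
      rw [Algebra.TensorProduct.tmul_mul_tmul]
      exact Submodule.subset_span ⟨f * f', c * c', evenCoeff_mul hc hc', rfl⟩)

theorem mem_evenLetters {z : Letters T E L} : z ∈ evenLetters T E L ↔
    z ∈ Submodule.span ℂ (evenLetterSet T E L) := Iff.rfl

theorem tmul_mem_evenLetters (f : Module.End ℂ E) {n : ℤ} {η : Forms T} (s : SymmetricAlgebra ℂ L)
    {e : Dec} (hη : η ∈ par _ n) (he : e ∈ par _ n) :
    (f ⊗ₜ[ℂ] mk η s e : Letters T E L) ∈ evenLetters T E L :=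
  Submodule.subset_span ⟨f, _, mk_mem_evenCoeff s hη he, rfl⟩

/-- The trace `f ⊗ c ↦ tr(f) c`. -/
def traceMap (C : Type*) [AddCommGroup C] [Module ℂ C] : Module.End ℂ E ⊗[ℂ] C →ₗ[ℂ] C :=
  (TensorProduct.lid ℂ C).toLinearMap ∘ₗ TensorProduct.map (LinearMap.trace ℂ E) LinearMap.id

theorem traceMap_tmul {C : Type*} [AddCommGroup C] [Module ℂ C] (f : Module.End ℂ E) (c : C) :
    traceMap C (f ⊗ₜ[ℂ] c) = LinearMap.trace ℂ E f • c := rfl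

/-- The trace with coefficients is cyclic as soon as the coefficients commute; this is what the
restriction to even letters provides. -/
theorem traceMap_mul_comm {y z : Letters T E L} (hy : y ∈ evenLetters T E L)
    (hz : z ∈ evenLetters T E L) :
    traceMap (Coef T L) (y * z) = traceMap (Coef T L) (z * y) := by
  rw [mem_evenLetters] at hy hz
  refine map_mul_comm_of_span (A := Letters T E L) _ ?_ hy hz
  rintro _ ⟨f, c, hc, rfl⟩ _ ⟨f', c', hc', rfl⟩
  rw [Algebra.TensorProduct.tmul_mul_tmul, Algebra.TensorProduct.tmul_mul_tmul, traceMap_tmul,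
    traceMap_tmul, LinearMap.trace_mul_comm, evenCoeff_comm hc hc']

theorem letterHiggs_mem (θ : Module.End ℂ E ⊗[ℂ] L) : letterHiggs T θ ∈ evenLetters T E L := by
  induction θ using TensorProduct.induction_on with
  | zero => rw [map_zero]; exact zero_mem _
  | add x y hx hy => rw [map_add]; exact add_mem hx hy
  | tmul f l => exact tmul_mem_evenLetters f _ one_mem_par one_mem_par

/-- An element of degree `d` in `V[1]` has total degree `d + 1`. Its component of degree one in `L`
therefore has form degree `d`, which matches the parity of the decoration. -/
theorem letterOne_mem {d : ℤ} {e : Dec} (he : e ∈ par _ d) {y : EndFib T E L}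
    (hy : y ∈ endTot T E L (d + 1)) : letterOne e y ∈ evenLetters T E L := by
  refine Submodule.span_induction (p := fun y _ => letterOne e y ∈ evenLetters T E L) ?_ ?_ ?_ ?_ hy
  · rintro _ ⟨p, q, f, η, l, hpq, hη, hl, rfl⟩
    rw [letterOne_pure]
    by_cases hq : q = 1
    · subst hq
      obtain rfl : (p : ℤ) = d := by push_cast at hpq; linarith
      exact tmul_mem_evenLetters f _ (power_le_par p hη) he
    · rw [ιInv_of_mem hq hl, map_zero, mk_zero_mid, TensorProduct.tmul_zero]
      exact zero_mem _
  · rw [map_zero]; exact zero_mem _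
  · intro x y _ _ hx hy; rw [map_add]; exact add_mem hx hy
  · intro r x _ hx; rw [map_smul]; exact Subalgebra.smul_mem _ hx r

/-- Here no degree is spent on `L`. An argument of degree `d` in `V[1]` thus needs a decoration of
parity `d + 1`, which is its own decoration times the odd `η`. -/
theorem letterZero_mem {d : ℤ} {e : Dec} (he : e ∈ par _ d) {y : EndFib T E L}
    (hy : y ∈ endTot T E L d) : letterZero e y ∈ evenLetters T E L := by
  refine Submodule.span_induction (p := fun y _ => letterZero e y ∈ evenLetters T E L)
    ?_ ?_ ?_ ?_ hy
  · rintro _ ⟨p, q, f, η, l, hpq, hη, hl, rfl⟩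
    rw [letterZero_pure]
    by_cases hq : q = 0
    · subst hq
      obtain rfl : (p : ℤ) = d := by simpa using hpq
      exact tmul_mem_evenLetters f _ (power_le_par p hη) he
    · rw [algebraMapInv_of_mem hq hl, map_zero, mk_zero_mid, TensorProduct.tmul_zero]
      exact zero_mem _
  · rw [map_zero]; exact zero_mem _
  · intro x y _ _ hx hy; rw [map_add]; exact add_mem hx hy
  · intro r x _ hx; rw [map_smul]; exact Subalgebra.smul_mem _ hx r

end Fibre

/-! ### Extracting commuting factors from words; multilinearity -/

section Words

variable {A R : Type*} [Ring A] [Ring R]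

theorem wordSum_commuting (φ : A →+* R) (θ : A) (k : ℕ) {l : List (R × A)}
    (h : ∀ p ∈ l, ∀ a, Commute p.1 (φ a)) (h' : ∀ p ∈ l, ∀ q ∈ l, Commute p.1 q.1) :
    wordSum (φ θ) k (l.map fun p => p.1 * φ p.2) =
      (l.map Prod.fst).prod * φ (wordSum θ k (l.map Prod.snd)) := by
  -- The auxiliary list `u` holds the letters whose commuting factors have already been extracted.
  suffices H : ∀ u : List A, wordSum (φ θ) k ((l.map fun p => p.1 * φ p.2) ++ u.map φ) =
      (l.map Prod.fst).prod * φ (wordSum θ k (l.map Prod.snd ++ u)) by simpa using H []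
  induction l with
  | nil => intro u; simp [map_wordSum]
  | cons p l ih =>
    intro u
    have hl := ih (fun q hq => h q (List.mem_cons_of_mem _ hq))
      (fun q hq q' hq' => h' q (List.mem_cons_of_mem _ hq) q' (List.mem_cons_of_mem _ hq'))
    rw [List.map_cons, List.cons_append, wordSum_cons_mul _ _ _ _ _ (h p (by simp) θ), List.map_cons,
      List.prod_cons, mul_assoc]
    · congr 1
      have := hl (p.2 :: u)
      rw [List.map_cons, wordSum_perm _ _ List.perm_middle,
        wordSum_perm θ k (List.perm_middle (a := p.2))] at this
      exact this
    · intro b hb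
      rcases List.mem_append.1 hb with hb | hb
      · obtain ⟨q, hq, rfl⟩ := List.mem_map.1 hb
        exact (h' p (by simp) q (by simp [hq])).mul_right (h p (by simp) q.2)
      · obtain ⟨a, -, rfl⟩ := List.mem_map.1 hb
        exact h p (by simp) a

/-- Brings slot `i` to the head, so that the rules for the first letter of a word give linearity in
every slot. -/
theorem exists_ofFn_update_perm {α : Type*} {n : ℕ} (m : Fin n → α) (i : Fin n) :
    ∃ t : List α, ∀ x, (List.ofFn (Function.update m i x)).Perm (x :: t) := by
  refine ⟨((List.finRange n).erase i).map m, fun x => ?_⟩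
  rw [List.ofFn_eq_map]
  refine ((List.perm_cons_erase (List.mem_finRange i)).map _).trans ?_
  rw [List.map_cons, Function.update_self]
  refine List.Perm.cons x (List.Perm.of_eq (List.map_congr_left fun j hj => ?_))
  exact Function.update_of_ne (((List.nodup_finRange n).mem_erase_iff.1 hj).1) _ _

variable [Algebra ℂ A]

/-- The multilinear map given by `wordSum`. -/
def wordSumHom (θ : A) (k n : ℕ) : MultilinearMap ℂ (fun _ : Fin n => A) A where
  toFun y := wordSum θ k (List.ofFn y)
  map_update_add' {inst} m i x y := by
    obtain rfl : inst = instDecidableEqFin n := Subsingleton.elim _ _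
    obtain ⟨t, ht⟩ := exists_ofFn_update_perm m i
    rw [wordSum_perm _ _ (ht _), wordSum_perm _ _ (ht _), wordSum_perm _ _ (ht _),
      wordSum_cons_add]
  map_update_smul' {inst} m i c x := by
    obtain rfl : inst = instDecidableEqFin n := Subsingleton.elim _ _
    obtain ⟨t, ht⟩ := exists_ofFn_update_perm m i
    rw [wordSum_perm _ _ (ht _), wordSum_perm _ _ (ht _), wordSum_cons_smul]

theorem multilinear_eq_of_span {n : ℕ} {M N : Type*} [AddCommGroup M] [Module ℂ M]
    [AddCommGroup N] [Module ℂ N] (φ ψ : MultilinearMap ℂ (fun _ : Fin n => M) N)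
    {s : Fin n → Set M} (h : ∀ m : Fin n → M, (∀ i, m i ∈ s i) → φ m = ψ m) {m : Fin n → M}
    (hm : ∀ i, m i ∈ Submodule.span ℂ (s i)) : φ m = ψ m := by
  classical
  -- Induction on the set `S` of slots that range over the span, the remaining slots being
  -- restricted to generators.
  suffices H : ∀ (S : Finset (Fin n)) (m : Fin n → M), (∀ i ∈ S, m i ∈ Submodule.span ℂ (s i)) →
      (∀ i ∉ S, m i ∈ s i) → φ m = ψ m from
    H Finset.univ m (fun i _ => hm i) (fun i hi => absurd (Finset.mem_univ i) hi)
  intro S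
  induction S using Finset.induction_on with
  | empty => exact fun m _ hm => h m fun i => hm i (Finset.notMem_empty i)
  | insert j S hj ih =>
    intro m h1 h2
    have H : ∀ v ∈ Submodule.span ℂ (s j), φ (Function.update m j v) = ψ (Function.update m j v) := by
      intro v hv
      induction hv using Submodule.span_induction with
      | mem v hv =>
        refine ih _ (fun i hi => ?_) fun i hi => ?_
        · rw [Function.update_of_ne (ne_of_mem_of_not_mem hi hj)]
          exact h1 i (Finset.mem_insert_of_mem hi)
        · by_cases hij : i = j
          · subst hij; rwa [Function.update_self]
          · rw [Function.update_of_ne hij]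
            exact h2 i fun h => (Finset.mem_insert.1 h).elim hij hi
      | zero => rw [MultilinearMap.map_update_zero, MultilinearMap.map_update_zero]
      | add x y _ _ hx hy =>
        rw [MultilinearMap.map_update_add, MultilinearMap.map_update_add, hx, hy]
      | smul a x _ hx =>
        rw [MultilinearMap.map_update_smul, MultilinearMap.map_update_smul, hx]
    have := H (m j) (h1 j (Finset.mem_insert_self _ _))
    rwa [Function.update_eq_self] at this

end Words

/-! ### Traces of words with coefficients -/

section Trace

variable {E S C : Type*} [AddCommGroup E] [Module ℂ E] [Ring S] [Algebra ℂ S] [Ring C] [Algebra ℂ C]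

theorem traceMap_one_tmul_mul (j : S →ₐ[ℂ] C) (u : C) (a : Module.End ℂ E ⊗[ℂ] S) :
    traceMap C ((1 ⊗ₜ u) * Algebra.TensorProduct.map (AlgHom.id ℂ (Module.End ℂ E)) j a) =
      u * j (traceMap S a) := by
  induction a using TensorProduct.induction_on with
  | zero => simp
  | add x y hx hy => rw [map_add, mul_add, map_add, hx, hy, map_add, map_add, mul_add]
  | tmul f s =>
    rw [Algebra.TensorProduct.map_tmul, Algebra.TensorProduct.tmul_mul_tmul, one_mul, traceMap_tmul,
      traceMap_tmul, map_smul, mul_smul_comm]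
    rfl

/-- Coefficients that commute with everything in sight leave the trace as an ordered product. It is
applied to the tensor slots of the definition and to the decorated forms, which reduces both to one
trace in `End E ⊗ ⨀ L`. -/
theorem traceMap_wordSum (j : S →ₐ[ℂ] C) {n : ℕ} (u : Fin n → C) (f : Fin n → Module.End ℂ E)
    (s : Fin n → S) (θ : Module.End ℂ E ⊗[ℂ] S) (k : ℕ) (hj : ∀ i s, Commute (u i) (j s))
    (hu : ∀ i i', Commute (u i) (u i')) :
    traceMap C (wordSum (TensorProduct.map LinearMap.id j.toLinearMap θ) k
      (List.ofFn fun i => f i ⊗ₜ (u i * j (s i)))) =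
      (List.ofFn u).prod * j (traceMap S (wordSum θ k (List.ofFn fun i => f i ⊗ₜ s i))) := by
  have h := wordSum_commuting
    (Algebra.TensorProduct.map (AlgHom.id ℂ (Module.End ℂ E)) j).toRingHom θ k
    (l := List.ofFn fun i => ((1 : Module.End ℂ E) ⊗ₜ[ℂ] u i, f i ⊗ₜ[ℂ] s i)) (by
        intro p hp a
        obtain ⟨i, rfl⟩ := (List.mem_ofFn' _ _).1 hp
        change Commute (1 ⊗ₜ[ℂ] u i) (Algebra.TensorProduct.map (AlgHom.id ℂ (Module.End ℂ E)) j a)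
        induction a using TensorProduct.induction_on with
        | zero => rw [map_zero]; exact Commute.zero_right _
        | add x y hx hy => rw [map_add]; exact Commute.add_right hx hy
        | tmul f s =>
          unfold Commute SemiconjBy
          rw [Algebra.TensorProduct.map_tmul, Algebra.TensorProduct.tmul_mul_tmul,
            Algebra.TensorProduct.tmul_mul_tmul, one_mul, mul_one, (hj i s).eq]) (by
        intro p hp q hq
        obtain ⟨i, rfl⟩ := (List.mem_ofFn' _ _).1 hp
        obtain ⟨i', rfl⟩ := (List.mem_ofFn' _ _).1 hq
        unfold Commute SemiconjBy
        rw [Algebra.TensorProduct.tmul_mul_tmul, Algebra.TensorProduct.tmul_mul_tmul, (hu i i').eq])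
  simp only [List.map_ofFn, Function.comp_def] at h
  have hl : ∀ i, (1 ⊗ₜ[ℂ] u i) * (Algebra.TensorProduct.map (AlgHom.id ℂ (Module.End ℂ E)) j).toRingHom
      (f i ⊗ₜ[ℂ] s i) = f i ⊗ₜ[ℂ] (u i * j (s i)) := fun i => by
    change _ * (Algebra.TensorProduct.map (AlgHom.id ℂ (Module.End ℂ E)) j) _ = _
    rw [Algebra.TensorProduct.map_tmul, Algebra.TensorProduct.tmul_mul_tmul, one_mul]
    rfl
  simp only [hl] at h
  have hp := map_list_prod (Algebra.TensorProduct.includeRight (R := ℂ) (A := Module.End ℂ E)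
    (B := C)) (List.ofFn u)
  rw [List.map_ofFn] at hp
  have hp' : (List.ofFn fun i => (1 : Module.End ℂ E) ⊗ₜ[ℂ] u i).prod = 1 ⊗ₜ (List.ofFn u).prod :=
    hp.symm
  rw [hp'] at h
  exact (congrArg (traceMap C) h).trans (traceMap_one_tmul_mul j _ _)

end Trace

/-! ### The polarized trace as the trace of a sum over words in even letters -/

section Polarization

variable {T E L : Type*} [AddCommGroup T] [Module ℂ T] [AddCommGroup E] [Module ℂ E]
  [AddCommGroup L] [Module ℂ L]

theorem polTrace_eq_wordSum (k n : ℕ) (θ : Module.End ℂ E ⊗[ℂ] L) (y : Fin n → EndFib T E L) :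
    polTrace k n θ y =
      wedgeTrace n (wordSum (placeHiggs n θ) k (List.ofFn fun i => place i (y i))) := by
  unfold polTrace higgsPoly
  have := coeff_pow_eq_wordSum (placeHiggs n θ : Slots n T E L) (fun i => place i (y i)) k
    (List.finRange n) (List.nodup_finRange n)
  rw [← List.ofFn_eq_map, ← List.ofFn_eq_map, List.sum_ofFn] at this
  rw [this]

/-- The Higgs field with values in `⨀ L`. -/
def higgsSym : Module.End ℂ E ⊗[ℂ] L →ₗ[ℂ] Module.End ℂ E ⊗[ℂ] SymmetricAlgebra ℂ L :=
  TensorProduct.map LinearMap.id (SymmetricAlgebra.ι ℂ L)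

theorem prod_mulSingle {n : ℕ} {M : Type*} [Monoid M] (η : Fin n → M) :
    (List.ofFn fun i => Pi.mulSingle (M := fun _ => M) i (η i)).prod = η := by
  have h := Finset.noncommProd_toFinset (List.finRange n)
    (fun i => Pi.mulSingle (M := fun _ => M) i (η i))
    (fun i _ j _ _ => Pi.mulSingle_apply_commute η i j) (List.nodup_finRange n)
  rw [List.ofFn_eq_map, ← h]
  conv_rhs => rw [← Finset.noncommProd_mulSingle η]
  congr 1
  simp

theorem wedgeTrace_eq (n : ℕ) (z : Slots n T E L) : wedgeTrace n z =
    TensorProduct.map (PiTensorProduct.lift (MultilinearMap.mkPiAlgebraFin ℂ n (Forms T)))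
      LinearMap.id (traceMap ((⨂[ℂ] _ : Fin n, Forms T) ⊗[ℂ] SymmetricAlgebra ℂ L) z) := by
  induction z using TensorProduct.induction_on with
  | zero => rw [map_zero, map_zero, map_zero]
  | add x y hx hy => rw [map_add, map_add, map_add, hx, hy]
  | tmul f c => rw [traceMap_tmul, map_smul]; rfl

theorem tprod_single_commute {n : ℕ} (η : Fin n → Forms T) (i j : Fin n) :
    Commute (PiTensorProduct.singleAlgHom (R := ℂ) (A := fun _ : Fin n => Forms T) i (η i))
      (PiTensorProduct.singleAlgHom (R := ℂ) (A := fun _ : Fin n => Forms T) j (η j)) :=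
  (Pi.mulSingle_apply_commute η i j).tprod

theorem prod_tprod_single {n : ℕ} (η : Fin n → Forms T) :
    (List.ofFn fun i => PiTensorProduct.singleAlgHom (R := ℂ) (A := fun _ : Fin n => Forms T) i
      (η i)).prod = PiTensorProduct.tprod ℂ η := by
  conv_rhs => rw [← prod_mulSingle η]
  have := map_list_prod (PiTensorProduct.tprodMonoidHom ℂ (A := fun _ : Fin n => Forms T))
    (List.ofFn fun i => Pi.mulSingle (M := fun _ => Forms T) i (η i))
  rw [List.map_ofFn] at this
  exact this.symm

/-- Different tensor slots commute, so the forms come out as one pure tensor; only then are they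
multiplied, in the order of the slots. -/
theorem polTrace_pure (k : ℕ) {n : ℕ} (θ : Module.End ℂ E ⊗[ℂ] L) (f : Fin n → Module.End ℂ E)
    (η : Fin n → Forms T) (l : Fin n → ExteriorAlgebra ℂ L) :
    polTrace k n θ (fun i => pure (f i) (η i) (l i)) =
      (List.ofFn η).prod ⊗ₜ traceMap (SymmetricAlgebra ℂ L) (wordSum (higgsSym θ) k
        (List.ofFn fun i => f i ⊗ₜ SymmetricAlgebra.ι ℂ L (ExteriorAlgebra.ιInv (l i)))) := by
  have h := traceMap_wordSum (E := E) (C := (⨂[ℂ] _ : Fin n, Forms T) ⊗[ℂ] SymmetricAlgebra ℂ L)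
    Algebra.TensorProduct.includeRight
    (fun i => Algebra.TensorProduct.includeLeft (S := ℂ) (PiTensorProduct.singleAlgHom (R := ℂ)
      (A := fun _ : Fin n => Forms T) i (η i))) f
    (fun i => SymmetricAlgebra.ι ℂ L (ExteriorAlgebra.ιInv (l i))) (higgsSym θ) k
    (fun i s => by
      unfold Commute SemiconjBy
      rw [Algebra.TensorProduct.includeLeft_apply, Algebra.TensorProduct.includeRight_apply,
        Algebra.TensorProduct.tmul_mul_tmul, Algebra.TensorProduct.tmul_mul_tmul, one_mul, one_mul,
        mul_one, mul_one])
    (fun i j => (tprod_single_commute η i j).map _)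
  have hu := map_list_prod (Algebra.TensorProduct.includeLeft (R := ℂ) (S := ℂ)
    (A := (⨂[ℂ] _ : Fin n, Forms T)) (B := SymmetricAlgebra ℂ L)) (List.ofFn fun i =>
    PiTensorProduct.singleAlgHom (R := ℂ) (A := fun _ : Fin n => Forms T) i (η i))
  rw [prod_tprod_single, List.map_ofFn] at hu
  have hθ : TensorProduct.map LinearMap.id
      (Algebra.TensorProduct.includeRight : _ →ₐ[ℂ] (⨂[ℂ] _ : Fin n, Forms T) ⊗[ℂ]
        SymmetricAlgebra ℂ L).toLinearMap (higgsSym θ) = (placeHiggs n θ : Slots n T E L) := by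
    unfold higgsSym placeHiggs
    rw [← LinearMap.comp_apply, ← TensorProduct.map_comp]
    rfl
  rw [hθ] at h
  have hp : ∀ i, f i ⊗ₜ[ℂ] (Algebra.TensorProduct.includeLeft (S := ℂ) (PiTensorProduct.singleAlgHom
      (R := ℂ) (A := fun _ : Fin n => Forms T) i (η i)) * Algebra.TensorProduct.includeRight
      (SymmetricAlgebra.ι ℂ L (ExteriorAlgebra.ιInv (l i)))) =
      (place i (pure (f i) (η i) (l i)) : Slots n T E L) := fun i => by
    rw [Algebra.TensorProduct.includeLeft_apply, Algebra.TensorProduct.includeRight_apply,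
      Algebra.TensorProduct.tmul_mul_tmul, one_mul, mul_one]
    rfl
  simp only [hp] at h
  rw [polTrace_eq_wordSum, wedgeTrace_eq]
  refine (congrArg _ h).trans ?_
  have hu' : (List.ofFn fun i => Algebra.TensorProduct.includeLeft (S := ℂ) (B := SymmetricAlgebra ℂ L)
    (PiTensorProduct.singleAlgHom (R := ℂ) (A := fun _ : Fin n => Forms T) i (η i))).prod =
      PiTensorProduct.tprod ℂ η ⊗ₜ 1 := hu.symm
  rw [hu', Algebra.TensorProduct.includeRight_apply, Algebra.TensorProduct.tmul_mul_tmul, one_mul,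
    mul_one, TensorProduct.map_tmul, PiTensorProduct.lift.tprod, MultilinearMap.mkPiAlgebraFin_apply]
  rfl

/-- `s ↦ (1 ⊗ s) ⊗ 1`. -/
def symIncl (T L : Type*) [AddCommGroup T] [Module ℂ T] [AddCommGroup L] [Module ℂ L] :
    SymmetricAlgebra ℂ L →ₐ[ℂ] Coef T L :=
  ((Algebra.TensorProduct.includeLeft (S := ℂ)).comp Algebra.TensorProduct.includeRight :
    SymmetricAlgebra ℂ L →ₐ[ℂ] SymFib T L ⊗[ℂ] Dec)

theorem symIncl_apply (s : SymmetricAlgebra ℂ L) : symIncl T L s = mk 1 s 1 := rfl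

theorem map_symIncl_higgsSym (θ : Module.End ℂ E ⊗[ℂ] L) :
    TensorProduct.map LinearMap.id (symIncl T L).toLinearMap (higgsSym θ) = letterHiggs T θ := by
  unfold higgsSym letterHiggs
  rw [← LinearMap.comp_apply, ← TensorProduct.map_comp]
  rfl

theorem prod_mk (l : List (Forms T × Dec)) :
    (l.map fun p => (mk p.1 1 p.2 : Coef T L)).prod =
      mk (l.map Prod.fst).prod 1 (l.map Prod.snd).prod := by
  induction l with
  | nil => exact mk_one.symm
  | cons p l ih =>
    rw [List.map_cons, List.prod_cons, ih, mk_mul_mk, mul_one, List.map_cons, List.prod_cons,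
      List.map_cons, List.prod_cons]

/-- The set of all tuples of homogeneous elements is enough to determine multilinear maps. -/
theorem polTrace_tmul_pure (k : ℕ) {n : ℕ} (θ : Module.End ℂ E ⊗[ℂ] L) {d : Fin n → ℤ}
    {e : Fin n → Dec} (he : ∀ i, e i ∈ par _ (d i)) {y : Fin n → EndFib T E L}
    (hy : ∀ i, y i ∈ pureSet T E L (d i + 1)) :
    coef (polTrace k n θ y ⊗ₜ (List.ofFn e).prod) = traceMap (Coef T L)
      (wordSum (letterHiggs T θ) k (List.ofFn fun i => letterOne (e i) (y i))) := by
  choose p q f η l hpq hη hl hy using hy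
  obtain rfl : y = fun i => pure (f i) (η i) (l i) := funext hy
  rw [polTrace_pure]
  -- An argument whose degree in `L` is not one has zero letter, and both sides vanish.
  by_cases hq : ∃ i, q i ≠ 1
  · obtain ⟨i, hi⟩ := hq
    have h0 := ιInv_of_mem hi (hl i)
    rw [wordSum_of_zero_mem, wordSum_of_zero_mem, map_zero, map_zero, TensorProduct.tmul_zero,
      TensorProduct.zero_tmul, map_zero]
    · refine (List.mem_ofFn' _ _).2 ⟨i, ?_⟩
      beta_reduce
      rw [letterOne_pure, h0, map_zero, mk_zero_mid, TensorProduct.tmul_zero]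
    · refine (List.mem_ofFn' _ _).2 ⟨i, ?_⟩
      beta_reduce
      rw [h0, map_zero, TensorProduct.tmul_zero]
  · push Not at hq
    have hη' : ∀ i, η i ∈ par _ (d i) := fun i => by
      have := hpq i
      rw [hq i] at this
      have hd : (p i : ℤ) = d i := by push_cast at this; linarith
      exact hd ▸ power_le_par _ (hη i)
    -- When all arguments have degree one in `L`, each form has the parity of its decoration. The
    -- decorated forms are then even and commute, as the extraction lemma demands.
    have h := traceMap_wordSum (E := E) (symIncl T L) (fun i => mk (η i) 1 (e i)) f
      (fun i => SymmetricAlgebra.ι ℂ L (ExteriorAlgebra.ιInv (l i))) (higgsSym θ) k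
      (fun i s => by
        unfold Commute SemiconjBy
        rw [symIncl_apply, mk_mul_mk, mk_mul_mk, one_mul, mul_one, mul_one, one_mul, one_mul,
          mul_one])
      (fun i j => evenCoeff_comm (mk_mem_evenCoeff 1 (hη' i) (he i))
        (mk_mem_evenCoeff 1 (hη' j) (he j)))
    rw [map_symIncl_higgsSym] at h
    have hw : ∀ i, letterOne (e i) (pure (f i) (η i) (l i)) = f i ⊗ₜ[ℂ] (mk (η i) 1 (e i) *
        symIncl T L (SymmetricAlgebra.ι ℂ L (ExteriorAlgebra.ιInv (l i)))) := fun i => by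
      rw [letterOne_pure, symIncl_apply, mk_mul_mk, one_mul, mul_one, mul_one]
    simp only [hw]
    refine Eq.trans ?_ h.symm
    have := prod_mk (L := L) (List.ofFn fun i => (η i, e i))
    simp only [List.map_ofFn, Function.comp_def] at this
    rw [this, symIncl_apply, mk_mul_mk, one_mul, mul_one, mul_one]
    rfl

/-- The polarized trace as a multilinear map. -/
def polTraceHom (k n : ℕ) (θ : Module.End ℂ E ⊗[ℂ] L) :
    MultilinearMap ℂ (fun _ : Fin n => EndFib T E L) (SymFib T L) where
  toFun := polTrace k n θ
  map_update_add' {inst} m i x y := by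
    obtain rfl : inst = instDecidableEqFin n := Subsingleton.elim _ _
    simp only [polTrace_eq_wordSum]
    have h := ((wordSumHom (placeHiggs n θ : Slots n T E L) k n).map_update_add
      (fun i => place i (m i)) i (place i x) (place i y))
    rw [← map_add] at h
    have hu : ∀ x : EndFib T E L, Function.update (fun i => place i (m i) : Fin n → Slots n T E L) i
        (place i x) = fun j => place j (Function.update m i x j) := fun x => by
      funext j
      by_cases hj : j = i
      · subst hj; simp
      · simp [Function.update_of_ne hj]
    rw [hu, hu, hu] at h
    exact (congrArg (wedgeTrace n) h).trans (map_add _ _ _)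
  map_update_smul' {inst} m i c x := by
    obtain rfl : inst = instDecidableEqFin n := Subsingleton.elim _ _
    simp only [polTrace_eq_wordSum]
    have h := ((wordSumHom (placeHiggs n θ : Slots n T E L) k n).map_update_smul
      (fun i => place i (m i)) i c (place i x))
    rw [← map_smul] at h
    have hu : ∀ x : EndFib T E L, Function.update (fun i => place i (m i) : Fin n → Slots n T E L) i
        (place i x) = fun j => place j (Function.update m i x j) := fun x => by
      funext j
      by_cases hj : j = i
      · subst hj; simp
      · simp [Function.update_of_ne hj]
    rw [hu, hu] at h
    exact (congrArg (wedgeTrace n) h).trans (map_smul _ _ _)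

theorem polTraceHom_apply (k n : ℕ) (θ : Module.End ℂ E ⊗[ℂ] L) (y : Fin n → EndFib T E L) :
    polTraceHom k n θ y = polTrace k n θ y := rfl

/-- Multilinearity extends `polTrace_tmul_pure` from generators to all elements of the given
degrees. From here on the tensor slots are replaced by a single algebra in which the letters may be
permuted without sign. -/
theorem polTrace_tmul (k : ℕ) {n : ℕ} (θ : Module.End ℂ E ⊗[ℂ] L) {d : Fin n → ℤ}
    {e : Fin n → Dec} (he : ∀ i, e i ∈ par _ (d i)) {y : Fin n → EndFib T E L}
    (hy : ∀ i, y i ∈ endTot T E L (d i + 1)) :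
    coef (polTrace k n θ y ⊗ₜ (List.ofFn e).prod) = traceMap (Coef T L)
      (wordSum (letterHiggs T θ) k (List.ofFn fun i => letterOne (e i) (y i))) := by
  have := multilinear_eq_of_span
    ((coef ∘ₗ (TensorProduct.mk ℂ (SymFib T L) Dec).flip (List.ofFn e).prod).compMultilinearMap
      (polTraceHom k n θ))
    ((traceMap (Coef T L)).compMultilinearMap ((wordSumHom (A := Letters T E L) (letterHiggs T θ) k
      n).compLinearMap fun i => letterOne (e i)))
    (s := fun i => pureSet T E L (d i + 1)) (fun m hm => polTrace_tmul_pure k θ he hm) (m := y) hy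
  exact this

end Polarization

/-! ### Commutators as bilinear maps -/

section GradedCommutator

variable (A : Type*) [Ring A] [Algebra ℂ A]

/-- The graded commutator as a bilinear map. -/
def gradedCommHom (n m : ℤ) : A →ₗ[ℂ] A →ₗ[ℂ] A :=
  LinearMap.mul ℂ A - ((n * m).negOnePow : ℤ) • (LinearMap.mul ℂ A).flip

variable {A}

/-- The commutator as a bilinear map. -/
def commHom : A →ₗ[ℂ] A →ₗ[ℂ] A := LinearMap.mul ℂ A - (LinearMap.mul ℂ A).flip

/-- The bilinear map `(x, y) ↦ φ x * ψ y - ψ y * φ x`. -/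
def commBil {M P : Type*} [AddCommGroup M] [Module ℂ M] [AddCommGroup P] [Module ℂ P]
    (φ : M →ₗ[ℂ] A) (ψ : P →ₗ[ℂ] A) : M →ₗ[ℂ] P →ₗ[ℂ] A := commHom.compl₁₂ φ ψ

/-- A difference of two multiples of such maps. -/
def commBilSub {M P : Type*} [AddCommGroup M] [Module ℂ M] [AddCommGroup P] [Module ℂ P]
    (a b : ℤ) (φ φ' : M →ₗ[ℂ] A) (ψ ψ' : P →ₗ[ℂ] A) : M →ₗ[ℂ] P →ₗ[ℂ] A :=
  a • commBil φ ψ - b • commBil φ' ψ'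

theorem zsmul_commutator (a : ℤ) (x y : A) :
    (a • x) * y - y * (a • x) = a • (x * y - y * x) := by
  rw [smul_mul_assoc, mul_smul_comm, smul_sub]

theorem zsmul_sub_rev {G : Type*} [AddCommGroup G] (a : ℤ) (x y : G) :
    a • (x - y) = -(a • (y - x)) := by rw [← smul_neg, neg_sub]

theorem zsmul_sub_sub_rev {G : Type*} [AddCommGroup G] (a b : ℤ) (w x y : G) :
    a • w - b • (x - y) = a • w + b • (y - x) := by
  rw [zsmul_sub_rev, sub_neg_eq_add]

end GradedCommutator

/-! ### Brackets as commutators of letters, and the cancellation under the trace -/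

section Relation

variable {T E L : Type*} [AddCommGroup T] [Module ℂ T] [AddCommGroup E] [Module ℂ E]
  [AddCommGroup L] [Module ℂ L]

theorem tmul_mk_mul (f g : Module.End ℂ E) (α β : Forms T) (s t : SymmetricAlgebra ℂ L) (e e' : Dec) :
    (f ⊗ₜ[ℂ] mk α s e * g ⊗ₜ[ℂ] mk β t e' : Letters T E L) =
      (f * g) ⊗ₜ[ℂ] mk (α * β) (s * t) (e * e') := by
  rw [Algebra.TensorProduct.tmul_mul_tmul, mk_mul_mk]

theorem tmul_mk_zsmul (f : Module.End ℂ E) (α : Forms T) (s : SymmetricAlgebra ℂ L) (a : ℤ) (e : Dec) :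
    (f ⊗ₜ[ℂ] mk α s (a • e) : Letters T E L) = a • f ⊗ₜ[ℂ] mk α s e := by
  rw [mk_zsmul]
  exact map_zsmul (TensorProduct.mk ℂ _ (Coef T L) f) a (mk α s e)

theorem pure_gradedComm {p q p' q' : ℕ} {n m : ℤ} 
    (f g : Module.End ℂ E) {α β : Forms T} {l l' : ExteriorAlgebra ℂ L}
    (hα : α ∈ ⋀[ℂ]^p (ConjDual T)) (hl : l ∈ ⋀[ℂ]^q L) (hβ : β ∈ ⋀[ℂ]^p' (ConjDual T))
    (hl' : l' ∈ ⋀[ℂ]^q' L) :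
    gradedComm n m (pure f α l) (pure g β l') =
      (((q : ℤ) * p').negOnePow : ℤ) • pure (f * g) (α * β) (l * l') -
        ((n * m + q' * p).negOnePow : ℤ) • pure (g * f) (β * α) (l' * l) := by
  unfold gradedComm
  rw [pure_mul_pure f g α l' hβ hl, pure_mul_pure g f β l hα hl', smul_smul, Int.negOnePow_add,
    Units.val_mul]

/-- Multiplying by `θ` raises the degree in `L` by one, so only the component of `y` of degree zero
in `L` contributes. Moving `θ`, which is of total degree one, past the form part turns the graded
commutator into an ordinary one up to `(-1)^n`. -/
theorem letterOne_higgs {e : Dec} {n : ℤ} (θ : Module.End ℂ E ⊗[ℂ] L) {y : EndFib T E L}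
    (hy : y ∈ endTot T E L n) :
    letterOne e (gradedComm 1 n (inclHiggs θ) y) =
      -((n.negOnePow : ℤ) • (letterZero e y * letterHiggs T θ - letterHiggs T θ * letterZero e y)) := by
  have hθ : θ ∈ Submodule.span ℂ {z | ∃ (f : Module.End ℂ E) (l : L), f ⊗ₜ[ℂ] l = z} := by
    rw [TensorProduct.span_tmul_eq_top]; trivial
  have h := bilin_eq_of_span (M := Module.End ℂ E ⊗[ℂ] L) (P := EndFib T E L) (A := Letters T E L)
    (((gradedCommHom (EndFib T E L) 1 n).compr₂ (letterOne e)).comp inclHiggs)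
    ((n.negOnePow : ℤ) • commHom.compl₁₂ (letterHiggs T) (letterZero e)) (t := pureSet T E L n)
    ?_ hθ hy
  · refine Eq.trans h ?_
    exact zsmul_sub_rev (G := Letters T E L) _ _ _
  · rintro _ ⟨f, l, rfl⟩ _ ⟨p', q', g, β, m, hpq, hβ, hm, rfl⟩
    change letterOne e (gradedComm 1 n (inclHiggs (f ⊗ₜ[ℂ] l)) (pure g β m)) =
      (n.negOnePow : ℤ) • (letterHiggs T (f ⊗ₜ[ℂ] l) * letterZero e (pure g β m) -
        letterZero e (pure g β m) * letterHiggs T (f ⊗ₜ[ℂ] l))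
    have h1 : ExteriorAlgebra.ι ℂ l ∈ ⋀[ℂ]^1 L := by
      rw [ExteriorAlgebra.exteriorPower, pow_one]; exact ⟨l, rfl⟩
    have h0 : (1 : Forms T) ∈ ⋀[ℂ]^0 (ConjDual T) := by
      rw [ExteriorAlgebra.exteriorPower, pow_zero]; exact Submodule.one_le.1 le_rfl
    rw [inclHiggs_tmul, pure_gradedComm (p := 0) (q := 1) f g h0 h1 hβ hm, map_sub,
      map_zsmul, map_zsmul, letterOne_pure, letterOne_pure, letterHiggs_tmul, letterZero_pure,
      tmul_mk_mul, tmul_mk_mul, one_mul, mul_one, one_mul, mul_one, ιInv_mul, ιInv_mul]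
    have hi : ExteriorAlgebra.algebraMapInv (ExteriorAlgebra.ι ℂ l) = (0 : ℂ) :=
      algebraMapInv_of_mem one_ne_zero h1
    have hι : ExteriorAlgebra.ιInv (ExteriorAlgebra.ι ℂ l) = l := ExteriorAlgebra.ι_leftInverse l
    rw [hi, hι, zero_smul, zero_add, add_zero, map_smul]
    -- For `q' ≠ 0` both sides vanish; for `q' = 0` the total degree is the form degree, which fixes
    -- the sign.
    by_cases hq : q' = 0
    · subst hq
      obtain rfl : (p' : ℤ) = n := by simpa using hpq
      rw [Algebra.smul_def, mul_comm (SymmetricAlgebra.ι ℂ L l), smul_sub]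
      simp
    · rw [algebraMapInv_of_mem hq hm, zero_smul, map_zero, zero_mul,
        mul_zero]
      simp only [mk_zero_mid, TensorProduct.tmul_zero, smul_zero, sub_self]

theorem ιInv_mul_comm (a b : ExteriorAlgebra ℂ L) :
    ExteriorAlgebra.ιInv (a * b) = ExteriorAlgebra.ιInv (b * a) := by
  rw [ιInv_mul, ιInv_mul, add_comm]

/-- A product has degree one in `L` only if one factor has degree zero and the other degree one. The
two possibilities give the two commutators, each argument playing once the role of the element
commuted with and once that of the letter. -/
theorem letterOne_gradedComm {η e e' : Dec} {d d' : ℤ} (hη : η ∈ par _ 1) (he : e ∈ par _ d)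
    (he' : e' ∈ par _ d') {y z : EndFib T E L} (hy : y ∈ endTot T E L (d + 1))
    (hz : z ∈ endTot T E L (d' + 1)) :
    letterOne (η * (e * e')) (((d + 1).negOnePow : ℤ) • gradedComm (d + 1) (d' + 1) y z) =
      ((d + 1).negOnePow : ℤ) • (letterZero (η * e) y * letterOne e' z -
        letterOne e' z * letterZero (η * e) y) +
      ((d' + 1).negOnePow : ℤ) • (letterZero (η * e') z * letterOne e y -
        letterOne e y * letterZero (η * e') z) := by
  have h := bilin_eq_of_span (M := EndFib T E L) (P := EndFib T E L) (A := Letters T E L)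
    (((d + 1).negOnePow : ℤ) • (gradedCommHom (EndFib T E L) (d + 1) (d' + 1)).compr₂
      (letterOne (η * (e * e'))))
    (commBilSub (A := Letters T E L) ((d + 1).negOnePow : ℤ) ((d' + 1).negOnePow : ℤ)
      (letterZero (η * e)) (letterOne e) (letterOne e') (letterZero (η * e')))
    (s := pureSet T E L (d + 1)) (t := pureSet T E L (d' + 1)) ?_ hy hz
  · refine (map_zsmul (letterOne (η * (e * e'))) _ _).trans (Eq.trans h ?_)
    exact zsmul_sub_sub_rev (G := Letters T E L) _ _ _ _ _
  · rintro _ ⟨p, q, f, α, l, hpq, hα, hl, rfl⟩ _ ⟨p', q', g, β, m, hpq', hβ, hm, rfl⟩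
    change ((d + 1).negOnePow : ℤ) • letterOne (η * (e * e')) (gradedComm (d + 1) (d' + 1)
        (pure f α l) (pure g β m)) =
      ((d + 1).negOnePow : ℤ) • (letterZero (η * e) (pure f α l) * letterOne e' (pure g β m) -
        letterOne e' (pure g β m) * letterZero (η * e) (pure f α l)) -
      ((d' + 1).negOnePow : ℤ) • (letterOne e (pure f α l) * letterZero (η * e') (pure g β m) -
        letterZero (η * e') (pure g β m) * letterOne e (pure f α l))
    have hη1 : e * η = ((d * 1).negOnePow : ℤ) • (η * e) := par_comm he hη
    have hη2 : e' * η = ((d' * 1).negOnePow : ℤ) • (η * e') := par_comm he' hη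
    have hee : e' * e = ((d' * d).negOnePow : ℤ) • (e * e') := par_comm he' he
    -- All decorations are brought into the order `η e e'`, so that the remaining signs depend only
    -- on the parities of `d` and `d'`.
    have r1 : e' * (η * e) = (((d' * 1).negOnePow : ℤ) * ((d' * d).negOnePow : ℤ)) • (η * (e * e')) := by
      rw [← mul_assoc, hη2, smul_mul_assoc, mul_assoc, hee, mul_smul_comm, smul_smul]
    have r2 : e * (η * e') = ((d * 1).negOnePow : ℤ) • (η * (e * e')) := by
      rw [← mul_assoc, hη1, smul_mul_assoc, mul_assoc]
    have r3 : η * e' * e = ((d' * d).negOnePow : ℤ) • (η * (e * e')) := by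
      rw [mul_assoc, hee, mul_smul_comm]
    rw [pure_gradedComm f g hα hl hβ hm, map_sub,
      map_zsmul, map_zsmul, letterOne_pure, letterOne_pure, ιInv_mul_comm m l,
      letterOne_pure, letterOne_pure, letterZero_pure, letterZero_pure,
      tmul_mk_mul, tmul_mk_mul, tmul_mk_mul, tmul_mk_mul, r1, r2, r3, tmul_mk_zsmul, tmul_mk_zsmul,
      tmul_mk_zsmul, mul_assoc η e e', ιInv_mul, map_add, map_smul, map_smul, Algebra.smul_def,
      Algebra.smul_def, mul_comm _ (algebraMap _ _ _), mul_comm _ (algebraMap _ _ _)]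
    have hz : ∀ {q : ℕ} {l : ExteriorAlgebra ℂ L}, q ≠ 1 → l ∈ ⋀[ℂ]^q L →
      SymmetricAlgebra.ι ℂ L (ExteriorAlgebra.ιInv l) = 0 := fun hq hl => by
        rw [ιInv_of_mem hq hl, map_zero]
    have hz' : ∀ {q : ℕ} {l : ExteriorAlgebra ℂ L}, q ≠ 0 → l ∈ ⋀[ℂ]^q L →
      algebraMap ℂ (SymmetricAlgebra ℂ L) (ExteriorAlgebra.algebraMapInv l) = 0 := fun hq hl => by
        rw [algebraMapInv_of_mem hq hl, map_zero]
    -- Only the bidegrees with `(q, q')` equal to `(0, 1)` or `(1, 0)` give nonzero terms.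
    by_cases hq : q = 0
    · by_cases hq' : q' = 1
      · subst hq hq'
        rw [hz zero_ne_one hl, hz' one_ne_zero hm]
        have hp : (p : ℤ) = d + 1 := by simpa using hpq
        have hp' : (p' : ℤ) = d' := by push_cast at hpq'; linarith
        rw [hp, hp']
        simp only [mk_zero_mid, TensorProduct.tmul_zero, smul_zero, sub_self, mul_zero,
          add_zero, sub_zero, smul_sub, smul_smul]
        simp only [negOnePow_eq_ite, Int.even_add, Int.even_mul, Nat.cast_one, Nat.cast_zero,
          Int.not_even_one, zero_mul, one_mul, mul_one, iff_false]
        by_cases h1 : Even d <;> by_cases h2 : Even d' <;> simp [h1, h2, -zsmul_eq_mul]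
      · by_cases hq'' : q' = 0
        · rw [hz (hq ▸ zero_ne_one) hl, hz hq' hm]
          simp only [mk_zero_mid, TensorProduct.tmul_zero, smul_zero, sub_self, mul_zero,
            add_zero]
        · rw [hz (hq ▸ zero_ne_one) hl, hz hq' hm, hz' hq'' hm]
          simp only [mk_zero_mid, TensorProduct.tmul_zero, smul_zero, sub_self, mul_zero,
            add_zero]
    · by_cases hq1 : q = 1
      · by_cases hq' : q' = 0
        · subst hq1 hq'
          rw [hz zero_ne_one hm, hz' one_ne_zero hl]
          have hp : (p : ℤ) = d := by push_cast at hpq; linarith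
          have hp' : (p' : ℤ) = d' + 1 := by simpa using hpq'
          rw [hp, hp']
          simp only [mk_zero_mid, TensorProduct.tmul_zero, smul_zero, sub_self, mul_zero,
            zero_add, smul_sub, smul_smul]
          simp only [negOnePow_eq_ite, Int.even_add, Int.even_mul, Nat.cast_one, Nat.cast_zero,
            Int.not_even_one, zero_mul, one_mul, mul_one, add_zero, iff_false]
          by_cases h1 : Even d <;> by_cases h2 : Even d' <;> simp [h1, h2, -zsmul_eq_mul] <;> abel
        · rw [hz' hq hl, hz' hq' hm]
          simp only [mk_zero_mid, TensorProduct.tmul_zero, smul_zero, sub_self, zero_mul,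
            add_zero]
      · rw [hz' hq hl, hz hq1 hl]
        simp only [mk_zero_mid, TensorProduct.tmul_zero, smul_zero, sub_self, zero_mul, mul_zero,
            add_zero]

/-! ### The algebraic part of the relation -/

/-- The maps `g^k_n` on a fibre. -/
def polOps (θ : Module.End ℂ E ⊗[ℂ] L) (k : ℕ) : Ops (EndFib T E L) (SymFib T L) :=
  fun n y => polTrace k n θ fun i => (y i).2

/-- The letter of a decorated element. -/
def letter (a : (ℤ × EndFib T E L) × Dec) : Letters T E L := letterOne a.2 a.1.2

/-- The trace of the sum over the words. -/
def traceWord (θ : Module.End ℂ E ⊗[ℂ] L) (k : ℕ) (l : List (Letters T E L)) : Coef T L :=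
  traceMap (Coef T L) (wordSum (letterHiggs T θ) k l)

theorem traceWord_perm (θ : Module.End ℂ E ⊗[ℂ] L) (k : ℕ) {l l' : List (Letters T E L)}
    (h : l.Perm l') : traceWord θ k l = traceWord θ k l' := by
  unfold traceWord
  rw [wordSum_perm _ _ h]

theorem traceWord_cons_add (θ : Module.End ℂ E ⊗[ℂ] L) (k : ℕ) (a b : Letters T E L)
    (t : List (Letters T E L)) :
    traceWord θ k ((a + b) :: t) = traceWord θ k (a :: t) + traceWord θ k (b :: t) :=
  (congrArg (traceMap (Coef T L)) (wordSum_cons_add (letterHiggs T θ) k a b t)).trans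
    (map_add _ _ _)

theorem traceWord_cons_smul (θ : Module.End ℂ E ⊗[ℂ] L) (k : ℕ) (c : ℂ) (a : Letters T E L)
    (t : List (Letters T E L)) :
    traceWord θ k ((c • a) :: t) = c • traceWord θ k (a :: t) :=
  (congrArg (traceMap (Coef T L)) (wordSum_cons_smul (letterHiggs T θ) k c a t)).trans
    (map_smul _ _ _)

theorem traceWord_cons_neg (θ : Module.End ℂ E ⊗[ℂ] L) (k : ℕ) (a : Letters T E L)
    (t : List (Letters T E L)) :
    traceWord θ k ((-a) :: t) = - traceWord θ k (a :: t) := by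
  have h := traceWord_cons_smul θ k (-1) a t
  have h1 : (-1 : ℂ) • a = -a := neg_one_smul ℂ a
  rwa [h1, neg_one_smul] at h

theorem coef_app_polOps (θ : Module.End ℂ E ⊗[ℂ] L) (k : ℕ) {l : List ((ℤ × EndFib T E L) × Dec)}
    (hl : ∀ a ∈ l, IsDec a) (hl' : ∀ a ∈ l, a.1.2 ∈ endTot T E L (a.1.1 + 1)) :
    coef (app (polOps θ k) (l.map Prod.fst) ⊗ₜ dec l) = traceWord θ k (l.map letter) := by
  obtain ⟨n, x, rfl⟩ := exists_eq_ofFn l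
  rw [List.map_ofFn, app_ofFn, List.map_ofFn]
  unfold dec
  rw [List.map_ofFn]
  refine polTrace_tmul k θ (d := fun i => (x i).1.1) (fun i => ?_) (fun i => ?_)
  · exact hl _ ((List.mem_ofFn' _ _).2 ⟨i, rfl⟩)
  · exact hl' _ ((List.mem_ofFn' _ _).2 ⟨i, rfl⟩)

/-- The element by which the letters are commuted. -/
def gauge (η : Dec) (a : (ℤ × EndFib T E L) × Dec) : Letters T E L :=
  ((a.1.1 + 1).negOnePow : ℤ) • letterZero (η * a.2) a.1.2

theorem letter_mem {a : (ℤ × EndFib T E L) × Dec} (ha : IsDec a)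
    (ha' : a.1.2 ∈ endTot T E L (a.1.1 + 1)) : letter a ∈ evenLetters T E L := letterOne_mem ha ha'

theorem gauge_mem {η : Dec} (hη : η ∈ par _ 1) {a : (ℤ × EndFib T E L) × Dec} (ha : IsDec a)
    (ha' : a.1.2 ∈ endTot T E L (a.1.1 + 1)) : gauge η a ∈ evenLetters T E L := by
  unfold gauge
  rw [← Int.cast_smul_eq_zsmul ℂ]
  refine Subalgebra.smul_mem _ (letterZero_mem ?_ ha') _
  rw [add_comm]
  exact mul_mem_par hη ha

/-- For each `a` the two inner terms together form the trace of the commutator of `gauge η a` with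
the polarized power of the remaining letters. All elements involved are even, so this trace is zero.
-/
theorem trace_relation (θ : Module.End ℂ E ⊗[ℂ] L) (k : ℕ) {η : Dec} (hη : η ∈ par _ 1)
    {l : List ((ℤ × EndFib T E L) × Dec)}
    (hl : ∀ a ∈ l, IsDec a) (hl' : ∀ a ∈ l, a.1.2 ∈ endTot T E L (a.1.1 + 1)) :
    (pickSum l fun a t => traceWord θ k
      ((gauge η a * letterHiggs T θ - letterHiggs T θ * gauge η a) :: t.map letter)) +
    (pickSum l fun a t => pickSum t fun b u => traceWord θ k
      ((gauge η a * letter b - letter b * gauge η a) :: u.map letter)) = 0 := by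
  rw [← pickSum_add]
  refine Eq.trans (pickSum_congr fun a t hat => ?_) (pickSum_zero l)
  have ha : a ∈ l := hat.subset (by simp)
  have ht : ∀ b ∈ t, b ∈ l := fun b hb => hat.subset (by simp [hb])
  have h := commutator_wordSum (gauge η a) (letterHiggs T θ) k (t.map letter)
  have hW : wordSum (letterHiggs T θ) k (t.map letter) ∈ evenLetters T E L :=
    wordSum_mem (evenLetters T E L) (letterHiggs_mem θ) k fun b hb => by
      obtain ⟨c, hc, rfl⟩ := List.mem_map.1 hb
      exact letter_mem (hl c (ht c hc)) (hl' c (ht c hc))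
  have hc := traceMap_mul_comm (gauge_mem hη (hl a ha) (hl' a ha)) hW
  have h' := congrArg (traceMap (Coef T L)) h
  rw [map_sub, hc, sub_self, map_add, pickSum_map] at h'
  refine Eq.trans ?_ h'.symm
  congr 1
  exact (map_pickSum (traceMap (Coef T L)).toAddMonoidHom _ _).symm

/-! ### The relation, up to the derivative -/

variable {V : Type*} [AddCommGroup V] [Module ℂ V]

/-- The value of a decorated element. -/
def evalDec (φ : V → EndFib T E L) (a : (ℤ × V) × Dec) : (ℤ × EndFib T E L) × Dec :=
  ((a.1.1, φ a.1.2), a.2)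

theorem app_comp_eval (θ : Module.End ℂ E ⊗[ℂ] L) (k : ℕ) (φ : V → EndFib T E L)
    (l : List (ℤ × V)) : app (fun n y => polTrace k n θ fun i => φ (y i).2) l =
      app (polOps θ k) (l.map fun a => (a.1, φ a.2)) := by
  obtain ⟨n, x, rfl⟩ := exists_eq_ofFn l
  rw [List.map_ofFn, app_ofFn, app_ofFn]
  rfl

theorem coef_app_eval (θ : Module.End ℂ E ⊗[ℂ] L) (k : ℕ) (φ : V → EndFib T E L)
    {l : List ((ℤ × V) × Dec)} (hl : ∀ a ∈ l, IsDec a)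
    (hl' : ∀ a ∈ l, φ a.1.2 ∈ endTot T E L (a.1.1 + 1)) :
    coef (app (fun n y => polTrace k n θ fun i => φ (y i).2) (l.map Prod.fst) ⊗ₜ dec l) =
      traceWord θ k (l.map fun a => letter (evalDec φ a)) := by
  have h := coef_app_polOps θ k (l := l.map (evalDec φ))
    (fun a ha => by obtain ⟨b, hb, rfl⟩ := List.mem_map.1 ha; exact hl b hb)
    (fun a ha => by obtain ⟨b, hb, rfl⟩ := List.mem_map.1 ha; exact hl' b hb)
  rw [app_comp_eval, List.map_map]
  rw [List.map_map, List.map_map] at h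
  have hd : dec (l.map (evalDec φ)) = dec l := by
    unfold dec
    rw [List.map_map]
    rfl
  rw [hd] at h
  exact h

/-- The algebraic half of the component equation. The map `φ` is to be evaluation at a point in a
frame and `δ` the value of `∂̄` there; all contributions of `θ` and of the bracket cancel by
`trace_relation`, and only those of `δ` remain. -/
theorem coef_afterCoder (θ : Module.End ℂ E ⊗[ℂ] L) (k : ℕ) (φ : V →+ EndFib T E L)
    (δ : V → EndFib T E L) {𝒱 : ℤ → Submodule ℂ V} {d : ℤ → V → V} {br : ℤ → ℤ → V → V → V}
    (hD : IsDGLA 𝒱 d br) (hφ : ∀ n, ∀ v ∈ 𝒱 n, φ v ∈ endTot T E L n)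
    (hd : ∀ n, ∀ v ∈ 𝒱 n, φ (d n v) = δ v + gradedComm 1 n (inclHiggs θ) (φ v))
    (hbr : ∀ n m v w, φ (br n m v w) = gradedComm n m (φ v) (φ w))
    {η : Dec} (hη : η ∈ par _ 1) {l : List ((ℤ × V) × Dec)} (hl : ∀ a ∈ l, IsDec a)
    (hl' : ∀ a ∈ l, a.1.2 ∈ 𝒱 (a.1.1 + 1)) :
    coef (app (afterCoder (dglaOps d br) fun n y => polTrace k n θ fun i => φ (y i).2)
      (l.map Prod.fst) ⊗ₜ (η * dec l)) =
      - pickSum l fun a t => traceWord θ k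
        (letterOne (η * a.2) (δ a.1.2) :: t.map fun a => letter (evalDec φ a)) := by
  have h := app_afterCoder (dglaOps d br) (fun n y => polTrace k n θ fun i => φ (y i).2) hl 1 η
  rw [one_mul] at h
  set Y : (ℤ × V) × Dec → Letters T E L := fun a => letter (evalDec φ a) with hY
  set Z : (ℤ × V) × Dec → Letters T E L := fun a => gauge η (evalDec φ a) with hZ
  set Θ : Letters T E L := letterHiggs T θ with hΘ
  -- The coderivation is restricted to its unary and binary parts, the only ones that a differential
  -- graded Lie algebra has.
  let F : List ((ℤ × V) × Dec) → List ((ℤ × V) × Dec) → Coef T L := fun s t =>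
    if s.length = 1 ∨ s.length = 2 then traceWord θ k (letter (evalDec φ
      (dval 1 (dglaOps d br) η s)) :: t.map Y) else 0
  have hF : coef (app (afterCoder (dglaOps d br) fun n y => polTrace k n θ fun i => φ (y i).2)
      (l.map Prod.fst) ⊗ₜ (η * dec l)) = splitSum l F := by
    rw [h]
    refine (map_splitSum (coef (T := T) (L := L)).toAddMonoidHom l _).trans
      (splitSum_congr fun s t hst => ?_)
    have hs : ∀ a ∈ s, a ∈ l := fun a ha => hst.subset (by simp [ha])
    have ht : ∀ a ∈ t, a ∈ l := fun a ha => hst.subset (by simp [ha])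
    change coef _ = _
    by_cases h0 : s = []
    · subst h0
      rw [if_pos rfl, map_zero]
      exact (if_neg (by simp)).symm
    · rw [if_neg h0, one_mul]
      have hmem : app (dglaOps d br) (s.map Prod.fst) ∈
          𝒱 ((s.map fun a => a.1.1).sum + 1 + 1) := by
        have := hD.app_mem (l := s.map Prod.fst) (fun a ha => by
          obtain ⟨b, hb, rfl⟩ := List.mem_map.1 ha
          exact hl' b (hs b hb)) (by simpa using h0)
        rw [List.map_map] at this
        exact this
      have hc := coef_app_eval θ k φ (l := dval 1 (dglaOps d br) η s :: t) (fun a ha => by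
          rcases List.mem_cons.1 ha with rfl | ha
          · exact isDec_dval hη _ fun b hb => hl b (hs b hb)
          · exact hl a (ht a ha)) (fun a ha => by
          rcases List.mem_cons.1 ha with rfl | ha
          · exact hφ _ _ hmem
          · exact hφ _ _ (hl' a (ht a ha)))
      refine hc.trans ?_
      by_cases h12 : s.length = 1 ∨ s.length = 2
      · simp only [F, if_pos h12, List.map_cons]
        rfl
      · simp only [F, if_neg h12]
        have h3 : 3 ≤ (s.map Prod.fst).length := by
          have : s.length ≠ 0 := fun h => h0 (List.length_eq_zero_iff.1 h)
          rw [List.length_map]; omega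
        refine congrArg (traceMap (Coef T L)) (wordSum_of_zero_mem _ _ ?_) |>.trans (map_zero _)
        rw [List.map_cons]
        refine List.mem_cons.2 (Or.inl ?_)
        change 0 = letterOne _ (φ (app (dglaOps d br) (s.map Prod.fst)))
        rw [app_dglaOps_of_ge h3, map_zero, map_zero]
  -- The unary part splits into the contribution of `δ` and the commutator with `θ`; the minus sign
  -- of `q₁` cancels the one in `letterOne_higgs`.
  have h1 : splitSum l (fun s t => if s.length = 1 then F s t else 0) = pickSum l fun a t =>
      -traceWord θ k (letterOne (η * a.2) (δ a.1.2) :: t.map Y) +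
        traceWord θ k ((Z a * Θ - Θ * Z a) :: t.map Y) := by
    rw [splitSum_one _ _ fun s t hs => if_neg hs]
    refine pickSum_congr fun a t hat => ?_
    have ha : a ∈ l := hat.subset (by simp)
    simp only [F, List.length_singleton, true_or, if_true]
    have hL : letter (evalDec φ (dval 1 (dglaOps d br) η [a])) =
        -letterOne (η * a.2) (δ a.1.2) + (Z a * Θ - Θ * Z a) := by
      change letterOne (η * (a.2 * 1)) (φ (-d (a.1.1 + 1) a.1.2)) = _
      rw [mul_one, map_neg, hd _ _ (hl' a ha), neg_add, map_add, map_neg, map_neg]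
      congr 1
      rw [letterOne_higgs θ (hφ _ _ (hl' a ha))]
      have e1 : Z a = ((a.1.1 + 1).negOnePow : ℤ) • letterZero (η * a.2) (φ a.1.2) := rfl
      rw [e1]
      refine (neg_neg _).trans ?_
      exact (zsmul_commutator (A := Letters T E L) _ _ _).symm
    rw [hL, traceWord_cons_add, traceWord_cons_neg]
  let G : (ℤ × V) × Dec → (ℤ × V) × Dec → List ((ℤ × V) × Dec) → Coef T L := fun a b u =>
    traceWord θ k ((Z a * Y b - Y b * Z a) :: u.map Y)
  -- The binary part gives two commutators per unordered pair, that is, one for each ordered pair.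
  have h2 : splitSum l (fun s t => if s.length = 2 then F s t else 0) = pickSum l fun a t =>
      pickSum t fun b u => G a b u := by
    have hc : splitSum l (fun s t => if s.length = 2 then F s t else 0) = splitSum l fun s t =>
        match s with
        | [a, b] => G a b t + G b a t
        | _ => 0 := by
      refine splitSum_congr fun s t hst => ?_
      match s with
      | [] => rfl
      | [a] => rfl
      | a :: b :: c :: s => simp
      | [a, b] =>
        have ha : a ∈ l := hst.subset (by simp)
        have hb : b ∈ l := hst.subset (by simp)
        simp only [F, G, List.length_cons, List.length_nil, zero_add, Nat.reduceAdd, or_true, if_true]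
        rw [← traceWord_cons_add]
        congr 2
        change letterOne (η * (a.2 * (b.2 * 1))) (φ (((a.1.1 + 1).negOnePow : ℤ) •
          br (a.1.1 + 1) (b.1.1 + 1) a.1.2 b.1.2)) = _
        rw [mul_one, map_zsmul, hbr, letterOne_gradedComm hη (hl a ha) (hl b hb)
          (hφ _ _ (hl' a ha)) (hφ _ _ (hl' b hb))]
        exact congrArg₂ (· + ·) (zsmul_commutator (A := Letters T E L) _ _ _).symm
          (zsmul_commutator (A := Letters T E L) _ _ _).symm
    rw [hc]
    refine splitSum_two _ _ G (fun s t hs => ?_) (fun a b t => rfl)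
    match s, hs with
    | [], _ => rfl
    | [a], _ => rfl
    | a :: b :: c :: s, _ => rfl
    | [a, b], hs => exact absurd rfl hs
  rw [hF, splitSum_split F (fun s t h1 h2 => if_neg (by tauto)), h1, h2, pickSum_add]
  have hr := trace_relation θ k hη (l := l.map (evalDec φ))
    (fun a ha => by obtain ⟨b, hb, rfl⟩ := List.mem_map.1 ha; exact hl b hb)
    (fun a ha => by obtain ⟨b, hb, rfl⟩ := List.mem_map.1 ha; exact hφ _ _ (hl' b hb))
  rw [pickSum_map, pickSum_map] at hr
  simp only [pickSum_map, List.map_map] at hr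
  have hn := (map_pickSum (negAddMonoidHom (α := Coef T L)) l fun a t =>
    traceWord θ k (letterOne (η * a.2) (δ a.1.2) :: t.map Y)).symm
  simp only [negAddMonoidHom_apply] at hn
  rw [hn, add_assoc]
  exact (congrArg _ hr).trans (add_zero _)

end Relation

section Holomorphic

open MeasureTheory Complex Metric Topology

variable {B : Type*} [NormedAddCommGroup B] [NormedSpace ℂ B]

/-! ### Holomorphic functions of several variables are smooth -/

theorem hasDerivAt_line {f : B → ℂ} {z w : B} {ζ : ℂ} (hf : DifferentiableAt ℂ f (z + ζ • w)) :
    HasDerivAt (fun ξ : ℂ => f (z + ξ • w)) (fderiv ℂ f (z + ζ • w) w) ζ := by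
  have h1 : HasDerivAt (fun ξ : ℂ => z + ξ • w) w ζ := by
    simpa using ((hasDerivAt_id ζ).smul_const w).const_add z
  exact hf.hasFDerivAt.comp_hasDerivAt ζ h1

/-- Cauchy's estimate on the disc `z + ζw` with `‖ζw‖ ≤ R/4`, which stays in the large ball because
`z` lies in the ball of half its radius. -/
theorem norm_fderiv_le {f : B → ℂ} {z₀ : B} {R C : ℝ} (hR : 0 < R) (hC : 0 ≤ C)
    (hf : DifferentiableOn ℂ f (ball z₀ R)) (hb : ∀ z ∈ ball z₀ R, ‖f z‖ ≤ C) {z : B}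
    (hz : z ∈ ball z₀ (R / 2)) : ‖fderiv ℂ f z‖ ≤ C / (R / 4) := by
  refine ContinuousLinearMap.opNorm_le_bound _ (by positivity) fun w => ?_
  by_cases hw : w = 0
  · simp [hw]
  have hw' : 0 < ‖w‖ := norm_pos_iff.2 hw
  set ρ := R / 4 / ‖w‖ with hρ
  have hρ0 : 0 < ρ := by positivity
  have hmem : ∀ ζ ∈ closedBall (0 : ℂ) ρ, z + ζ • w ∈ ball z₀ R := fun ζ hζ => by
    rw [mem_ball, dist_eq_norm] at hz ⊢
    rw [mem_closedBall, dist_zero_right] at hζ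
    have h1 : ‖ζ • w‖ ≤ R / 4 := by
      rw [norm_smul]
      calc ‖ζ‖ * ‖w‖ ≤ ρ * ‖w‖ := by gcongr
        _ = R / 4 := by rw [hρ]; field_simp
    calc ‖z + ζ • w - z₀‖ = ‖(z - z₀) + ζ • w‖ := by congr 1; abel
      _ ≤ ‖z - z₀‖ + ‖ζ • w‖ := norm_add_le _ _
      _ < R := by linarith
  have hd : ∀ ζ ∈ closedBall (0 : ℂ) ρ, HasDerivAt (fun ξ : ℂ => f (z + ξ • w))
      (fderiv ℂ f (z + ζ • w) w) ζ := fun ζ hζ =>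
    hasDerivAt_line (hf.differentiableAt (isOpen_ball.mem_nhds (hmem ζ hζ)))
  have hD : DifferentiableOn ℂ (fun ξ : ℂ => f (z + ξ • w)) (closedBall 0 ρ) := fun ζ hζ =>
    (hd ζ hζ).differentiableAt.differentiableWithinAt
  have h := norm_deriv_le_of_forall_mem_sphere_norm_le hρ0 (hD.diffContOnCl_ball subset_rfl)
    fun ζ hζ => hb _ (hmem ζ (sphere_subset_closedBall hζ))
  rw [(hd 0 (by simp [hρ0.le])).deriv, zero_smul, add_zero] at h
  refine h.trans (le_of_eq ?_)
  rw [hρ]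
  field_simp

/-- The derivative in the fixed direction `v` is a Cauchy integral over a circle whose radius does
not depend on the base point, and the integral can be differentiated in that point. -/
theorem differentiableAt_fderiv_apply [FiniteDimensional ℂ B] {f : B → ℂ} {U : Set B}
    (hU : IsOpen U) (hf : DifferentiableOn ℂ f U) {z₀ : B} (hz₀ : z₀ ∈ U) (v : B) :
    DifferentiableAt ℂ (fun z => fderiv ℂ f z v) z₀ := by
  have : ProperSpace B := FiniteDimensional.proper ℂ B
  obtain ⟨R, hR, hRU⟩ := nhds_basis_closedBall.mem_iff.1 (hU.mem_nhds hz₀)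
  obtain ⟨C, hC⟩ := (isCompact_closedBall z₀ R).exists_bound_of_continuousOn
    (hf.continuousOn.mono hRU)
  have hC0 : 0 ≤ C := (norm_nonneg _).trans (hC z₀ (mem_closedBall_self hR.le))
  have hfR : DifferentiableOn ℂ f (ball z₀ R) := hf.mono (ball_subset_closedBall.trans hRU)
  have hb : ∀ z ∈ ball z₀ R, ‖f z‖ ≤ C := fun z hz => hC z (ball_subset_closedBall hz)
  -- The disc of radius `2r` in direction `v` moves a point by at most `R/4`, hence from the ball of
  -- radius `R/4` into that of radius `R/2`, where `norm_fderiv_le` applies. The summand `1` covers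
  -- `v = 0`.
  set r := R / (8 * (‖v‖ + 1)) with hr
  have hv : 0 < ‖v‖ + 1 := by positivity
  have hr0 : 0 < r := by positivity
  have hmem : ∀ z ∈ ball z₀ (R / 4), ∀ ζ ∈ ball (0 : ℂ) (2 * r), z + ζ • v ∈ ball z₀ (R / 2) := by
    intro z hz ζ hζ
    rw [mem_ball, dist_eq_norm] at hz ⊢
    rw [mem_ball, dist_zero_right] at hζ
    have h1 : ‖ζ • v‖ ≤ R / 4 := by
      rw [norm_smul]
      calc ‖ζ‖ * ‖v‖ ≤ (2 * r) * (‖v‖ + 1) := by gcongr; linarith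
        _ = R / 4 := by rw [hr]; field_simp; norm_num
    calc ‖z + ζ • v - z₀‖ = ‖(z - z₀) + ζ • v‖ := by congr 1; abel
      _ ≤ ‖z - z₀‖ + ‖ζ • v‖ := norm_add_le _ _
      _ < R / 2 := by linarith
  have hmem' : ∀ z ∈ ball z₀ (R / 4), ∀ θ : ℝ, z + circleMap 0 r θ • v ∈ ball z₀ (R / 2) :=
    fun z hz θ => hmem z hz _ (by
      rw [mem_ball, dist_zero_right, norm_circleMap_zero, abs_of_pos hr0]; linarith)
  have hsub : ball z₀ (R / 2) ⊆ ball z₀ R := ball_subset_ball (by linarith)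
  let K : ℝ → ℂ := fun θ => deriv (circleMap 0 r) θ * ((circleMap 0 r θ - 0) ^ 2)⁻¹
  have hK : Continuous K := by
    have h0 : ∀ θ : ℝ, (circleMap 0 r θ - 0) ^ 2 ≠ 0 := fun θ => by
      rw [sub_zero]
      exact pow_ne_zero 2 (circleMap_ne_center hr0.ne')
    simp only [K, deriv_circleMap]
    exact ((continuous_circleMap 0 r).mul continuous_const).mul
      ((((continuous_circleMap 0 r).sub continuous_const).pow 2).inv₀ h0)
  have hcauchy : ∀ z ∈ ball z₀ (R / 4), fderiv ℂ f z v =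
      (2 * Real.pi * I : ℂ)⁻¹ • ∫ θ : ℝ in 0..2 * Real.pi, K θ * f (z + circleMap 0 r θ • v) := by
    intro z hz
    have hd : ∀ ζ ∈ ball (0 : ℂ) (2 * r), HasDerivAt (fun ξ : ℂ => f (z + ξ • v))
        (fderiv ℂ f (z + ζ • v) v) ζ := fun ζ hζ =>
      hasDerivAt_line (hfR.differentiableAt (isOpen_ball.mem_nhds (hsub (hmem z hz ζ hζ))))
    have h := two_pi_I_inv_smul_circleIntegral_sub_sq_inv_smul_of_differentiable isOpen_ball
      (closedBall_subset_ball (by linarith : r < 2 * r))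
      (fun ζ hζ => (hd ζ hζ).differentiableAt.differentiableWithinAt) (mem_ball_self hr0)
    rw [(hd 0 (mem_ball_self (by linarith))).deriv, zero_smul, add_zero] at h
    rw [← h]
    unfold circleIntegral
    simp only [K, smul_eq_mul, mul_assoc]
  have hball : ball z₀ (R / 4) ∈ 𝓝 z₀ := ball_mem_nhds z₀ (by linarith)
  have hcont : ∀ z ∈ ball z₀ (R / 4), Continuous fun θ : ℝ => f (z + circleMap 0 r θ • v) :=
    fun z hz => (hfR.continuousOn.mono hsub).comp_continuous
      (continuous_const.add ((continuous_circleMap 0 r).smul continuous_const))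
      fun θ => hmem' z hz θ
  let : MeasurableSpace B := borel B
  have : BorelSpace B := ⟨rfl⟩
  -- The uniform bound on the derivative from Cauchy's estimate serves as the dominating function.
  have hint := intervalIntegral.hasFDerivAt_integral_of_dominated_of_fderiv_le (𝕜 := ℂ)
    (μ := volume) (a := 0) (b := 2 * Real.pi) (x₀ := z₀)
    (F := fun z θ => K θ * f (z + circleMap 0 r θ • v))
    (F' := fun z θ => K θ • fderiv ℂ f (z + circleMap 0 r θ • v))
    (bound := fun θ => ‖K θ‖ * (C / (R / 4))) hball
    (Filter.mem_of_superset hball fun z hz => (hK.mul (hcont z hz)).aestronglyMeasurable)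
    ((hK.mul (hcont z₀ (mem_of_mem_nhds hball))).intervalIntegrable _ _)
    (by
      refine hK.aestronglyMeasurable.smul (Measurable.aestronglyMeasurable ?_)
      exact (measurable_fderiv ℂ f).comp
        (continuous_const.add ((continuous_circleMap 0 r).smul continuous_const)).measurable)
    (Filter.Eventually.of_forall fun θ _ z hz => by
      rw [norm_smul]
      gcongr
      exact norm_fderiv_le hR hC0 hfR hb (hmem' z hz θ))
    ((hK.norm.mul continuous_const).intervalIntegrable _ _)
    (Filter.Eventually.of_forall fun θ _ z hz => by
      have h := (hfR.differentiableAt (isOpen_ball.mem_nhds (hsub (hmem' z hz θ)))).hasFDerivAt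
      have h2 := h.comp z ((hasFDerivAt_id z).add_const (circleMap 0 r θ • v))
      rw [ContinuousLinearMap.comp_id] at h2
      exact h2.const_smul (K θ))
  have hd : DifferentiableAt ℂ (fun z => (2 * Real.pi * I : ℂ)⁻¹ •
      ∫ θ : ℝ in 0..2 * Real.pi, K θ * f (z + circleMap 0 r θ • v)) z₀ :=
    hint.differentiableAt.fun_const_smul _
  exact hd.congr_of_eventuallyEq (Filter.mem_of_superset hball hcauchy)

/-- Induction on the order: each directional derivative is again complex differentiable on `U`. -/
theorem contDiffOn_of_differentiableOn [FiniteDimensional ℂ B] {f : B → ℂ} {U : Set B}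
    (hU : IsOpen U) (hf : DifferentiableOn ℂ f U) : ContDiffOn ℂ ∞ f U := by
  rw [contDiffOn_infty]
  intro n
  induction n generalizing f with
  | zero => exact contDiffOn_zero.2 hf.continuousOn
  | succ n ih =>
    rw [Nat.cast_add, Nat.cast_one, contDiffOn_succ_iff_fderiv_of_isOpen hU]
    refine ⟨hf, fun h => ?_, contDiffOn_clm_apply.2 fun v => ih fun z hz => ?_⟩
    · exact absurd h (WithTop.natCast_ne_top n)
    · exact (differentiableAt_fderiv_apply hU hf hz v).differentiableWithinAt

end Holomorphic

section Tens

variable {B M N P : Type*} [NormedAddCommGroup B] [NormedSpace ℂ B] [AddCommGroup M] [Module ℂ M]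
  [AddCommGroup N] [Module ℂ N] [AddCommGroup P] [Module ℂ P]

/-! ### Functions with values in a vector space that are finite sums of scalar functions -/

/-- On `U`, the function `g` is a finite sum `∑ cᵢ • mᵢ` with functions `cᵢ` from the class `C`. -/
inductive Tens (C : (B → ℂ) → Prop) (U : Set B) : (B → M) → Prop
  | zero : Tens C U fun _ => 0
  | smul (c : B → ℂ) (m : M) : C c → Tens C U fun z => c z • m
  | add (g h : B → M) : Tens C U g → Tens C U h → Tens C U fun z => g z + h z
  | congr (g h : B → M) : Set.EqOn g h U → Tens C U g → Tens C U h

theorem Tens.mono {C C' : (B → ℂ) → Prop} {U V : Set B} {g : B → M} (hg : Tens C U g)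
    (hC : ∀ c, C c → C' c) (hU : V ⊆ U) : Tens C' V g := by
  induction hg with
  | zero => exact .zero
  | smul c m hc => exact .smul c m (hC c hc)
  | add g h _ _ hg hh => exact .add g h hg hh
  | congr g h he _ hg => exact .congr g h (he.mono hU) hg

theorem Tens.map {C : (B → ℂ) → Prop} {U : Set B} {g : B → M} (hg : Tens C U g)
    (φ : M →ₗ[ℂ] N) : Tens C U fun z => φ (g z) := by
  induction hg with
  | zero => simpa using Tens.zero
  | smul c m hc => simpa using Tens.smul c (φ m) hc
  | add g h _ _ hg hh => simpa using Tens.add _ _ hg hh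
  | congr g h he _ hg => exact .congr _ _ (fun z hz => by simp [he hz]) hg

theorem Tens.bilin {C : (B → ℂ) → Prop} (hC : ∀ c c', C c → C c' → C fun z => c z * c' z)
    {U : Set B} {g : B → M} {h : B → N} (hg : Tens C U g) (hh : Tens C U h)
    (β : M →ₗ[ℂ] N →ₗ[ℂ] P) : Tens C U fun z => β (g z) (h z) := by
  induction hg with
  | zero => simpa using Tens.zero
  | smul c m hc =>
    induction hh with
    | zero => simpa using Tens.zero
    | smul c' n hc' => simpa [smul_smul] using Tens.smul _ (β m n) (hC _ _ hc' hc)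
    | add g h _ _ hg hh => simpa [smul_add] using Tens.add _ _ hg hh
    | congr g h he _ hg => exact .congr _ _ (fun z hz => by simp [he hz]) hg
  | add g h _ _ hg hh => simpa using Tens.add _ _ hg hh
  | congr g h he _ hg => exact .congr _ _ (fun z hz => by simp [he hz]) hg

theorem Tens.sum {C : (B → ℂ) → Prop} {U : Set B} {ι : Type*} (s : Finset ι) {g : ι → B → M}
    (hg : ∀ i ∈ s, Tens C U (g i)) : Tens C U fun z => ∑ i ∈ s, g i z := by
  classical
  induction s using Finset.induction_on with
  | empty => simpa using Tens.zero
  | insert i s hi ih =>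
    simp only [Finset.sum_insert hi]
    exact .add _ _ (hg i (by simp)) (ih fun j hj => hg j (by simp [hj]))

/-- A function with values in a finite-dimensional subspace is a finite sum. -/
theorem tens_of_forall_dual {C : (B → ℂ) → Prop} {U : Set B} {g : B → M} {S : Submodule ℂ M}
    (hS : S.FG) (hgS : ∀ z ∈ U, g z ∈ S) (hg : ∀ l : Module.Dual ℂ M, C fun z => l (g z)) :
    Tens C U g := by
  have : Module.Finite ℂ S := Module.Finite.iff_fg.2 hS
  let b := Module.finBasis ℂ S
  -- Coordinates on the subspace extend to functionals on all of `M`, for which the hypothesis gives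
  -- coefficients of class `C`.
  have hl : ∀ i, ∃ l : Module.Dual ℂ M, l ∘ₗ S.subtype = b.coord i := fun i =>
    LinearMap.exists_extend (b.coord i)
  choose l hl using hl
  refine .congr (fun z => ∑ i, l i (g z) • (b i : M)) g (fun z hz => ?_)
    (Tens.sum _ fun i _ => .smul _ _ (hg (l i)))
  have h : ∀ i, l i (g z) = b.coord i ⟨g z, hgS z hz⟩ := fun i =>
    LinearMap.congr_fun (hl i) ⟨g z, hgS z hz⟩
  simp only [h]
  refine Eq.trans ?_ (congrArg (Subtype.val) (b.sum_repr ⟨g z, hgS z hz⟩))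
  rw [AddSubmonoidClass.coe_finsetSum]
  rfl

/-- Finite sums with `C^∞` coefficients. -/
abbrev SmTens (U : Set B) (g : B → M) : Prop := Tens (fun c => ContDiffOn ℝ ∞ c U) U g

/-- Finite sums with holomorphic coefficients. -/
abbrev HolTens (U : Set B) (g : B → M) : Prop := Tens (fun c => ContDiffOn ℂ ∞ c U) U g

theorem HolTens.smTens {U : Set B} {g : B → M} (h : HolTens U g) : SmTens U g :=
  h.mono (fun _ hc => hc.restrict_scalars ℝ) subset_rfl

theorem SmTens.mono {U V : Set B} {g : B → M} (h : SmTens U g) (hV : V ⊆ U) : SmTens V g :=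
  Tens.mono h (fun _ hc => hc.mono hV) hV

theorem SmTens.bilin {U : Set B} {g : B → M} {h : B → N} (hg : SmTens U g) (hh : SmTens U h)
    (β : M →ₗ[ℂ] N →ₗ[ℂ] P) : SmTens U fun z => β (g z) (h z) :=
  Tens.bilin (fun _ _ hc hc' => hc.mul hc') hg hh β

theorem HolTens.bilin {U : Set B} {g : B → M} {h : B → N} (hg : HolTens U g) (hh : HolTens U h)
    (β : M →ₗ[ℂ] N →ₗ[ℂ] P) : HolTens U fun z => β (g z) (h z) :=
  Tens.bilin (fun _ _ hc hc' => hc.mul hc') hg hh β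

theorem holTens_const (U : Set B) (m : M) : HolTens U fun _ => m :=
  .congr _ _ (fun _ _ => one_smul ℂ m) (Tens.smul (fun _ => 1) m contDiffOn_const)

theorem SmTens.dual {U : Set B} {g : B → M} (hg : SmTens U g) (l : Module.Dual ℂ M) :
    ContDiffOn ℝ ∞ (fun z => l (g z)) U := by
  induction hg with
  | zero => simpa using contDiffOn_const
  | smul c m hc => simpa using hc.mul contDiffOn_const
  | add g h _ _ hg hh => simpa using hg.add hh
  | congr g h he _ hg => exact hg.congr fun z hz => by simp [he hz]

/-! ### Directional derivatives -/

/-- `D` is the derivative of `g` at `y` in the direction `v`, in the weak sense. -/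
def HasWD (g : B → M) (D : M) (y v : B) : Prop :=
  ∀ l : Module.Dual ℂ M, HasLineDerivAt ℝ (fun z => l (g z)) (l D) y v

/-- Linear functionals separate points, so a weak derivative is unique and the chosen value must be
it. -/
theorem HasWD.dirDeriv_eq {g : B → M} {D : M} {y v : B} (h : HasWD g D y v) :
    dirDeriv g y v = D := by
  have h' : HasWD g (dirDeriv g y v) y v := Classical.epsilon_spec (p := fun D =>
    ∀ l : Module.Dual ℂ M, HasLineDerivAt ℝ (fun z => l (g z)) (l D) y v) ⟨D, h⟩
  rw [← sub_eq_zero, ← Module.forall_dual_apply_eq_zero_iff ℂ]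
  intro l
  rw [map_sub, sub_eq_zero]
  exact (h' l).unique (h l)

theorem HasWD.congr {g h : B → M} {D : M} {y v : B} {U : Set B} (hg : HasWD g D y v) (hU : IsOpen U)
    (hy : y ∈ U) (he : Set.EqOn g h U) : HasWD h D y v := fun l =>
  (hg l).congr_of_eventuallyEq (Filter.eventuallyEq_of_mem (hU.mem_nhds hy)
    fun z hz => by rw [he hz])

theorem HasWD.add {g h : B → M} {D D' : M} {y v : B} (hg : HasWD g D y v) (hh : HasWD h D' y v) :
    HasWD (fun z => g z + h z) (D + D') y v := fun l => by
  have := HasDerivAt.fun_add (hg l) (hh l)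
  simpa [HasLineDerivAt] using this

theorem hasWD_smul {c : B → ℂ} {y : B} (hc : DifferentiableAt ℝ c y) (m : M) (v : B) :
    HasWD (fun z => c z • m) (fderiv ℝ c y v • m) y v := fun l => by
  have := (hc.hasFDerivAt.hasLineDerivAt v).mul_const (l m)
  simpa [HasLineDerivAt] using this

theorem SmTens.hasWD {U : Set B} (hU : IsOpen U) {g : B → M} (hg : SmTens U g) {y : B} (hy : y ∈ U)
    (v : B) : HasWD g (dirDeriv g y v) y v := by
  suffices h : ∃ D, HasWD g D y v by
    obtain ⟨D, h⟩ := h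
    rwa [h.dirDeriv_eq]
  induction hg with
  | zero => exact ⟨0, fun l => by simpa [HasLineDerivAt] using hasDerivAt_const _ _⟩
  | smul c m hc =>
    exact ⟨_, hasWD_smul ((hc.contDiffAt (hU.mem_nhds hy)).differentiableAt (by simp)) m v⟩
  | add g h _ _ hg hh =>
    obtain ⟨D, hD⟩ := hg
    obtain ⟨D', hD'⟩ := hh
    exact ⟨_, hD.add hD'⟩
  | congr g h he _ hg =>
    obtain ⟨D, hD⟩ := hg
    exact ⟨D, hD.congr hU hy he⟩

theorem HasWD.map {g : B → M} {D : M} {y v : B} (hg : HasWD g D y v) (φ : M →ₗ[ℂ] N) :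
    HasWD (fun z => φ (g z)) (φ D) y v := fun l => hg (l ∘ₗ φ)

end Tens

section Dbar

variable {B M N P : Type*} [NormedAddCommGroup B] [NormedSpace ℂ B] [FiniteDimensional ℂ B]
  [AddCommGroup M] [Module ℂ M] [AddCommGroup N] [Module ℂ N] [AddCommGroup P] [Module ℂ P]
  {U : Set B} {g h : B → M} {y : B}

local notation "ι₀" => Fin (Module.finrank ℂ B)

/-! ### The operators `∂/∂z̄ᵢ` -/

theorem dbarCoord_congr (hU : IsOpen U) (hg : SmTens U g) (hy : y ∈ U) (he : Set.EqOn g h U)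
    (i : ι₀) : dbarCoord i g y = dbarCoord i h y := by
  unfold dbarCoord
  rw [((hg.hasWD hU hy _).congr hU hy he).dirDeriv_eq, ((hg.hasWD hU hy _).congr hU hy he).dirDeriv_eq]

theorem dbarCoord_add (hU : IsOpen U) (hg : SmTens U g) (hh : SmTens U h) (hy : y ∈ U) (i : ι₀) :
    dbarCoord i (fun z => g z + h z) y = dbarCoord i g y + dbarCoord i h y := by
  unfold dbarCoord
  rw [((hg.hasWD hU hy _).add (hh.hasWD hU hy _)).dirDeriv_eq,
    ((hg.hasWD hU hy _).add (hh.hasWD hU hy _)).dirDeriv_eq]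
  module

theorem dbarCoord_map (hU : IsOpen U) (hg : SmTens U g) (hy : y ∈ U) (φ : M →ₗ[ℂ] N) (i : ι₀) :
    dbarCoord i (fun z => φ (g z)) y = φ (dbarCoord i g y) := by
  unfold dbarCoord
  rw [((hg.hasWD hU hy _).map φ).dirDeriv_eq, ((hg.hasWD hU hy _).map φ).dirDeriv_eq, map_smul,
    map_add, map_smul]

theorem dbarCoord_zero (y : B) (i : ι₀) : dbarCoord i (fun _ : B => (0 : M)) y = 0 := by
  have := dbarCoord_map (M := M) isOpen_univ (Tens.zero) (Set.mem_univ y) (0 : M →ₗ[ℂ] M) i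
  simpa using this

/-- `∂c/∂z̄ᵢ` for a scalar function `c`. -/
def dbarScalar (i : ι₀) (c : B → ℂ) (y : B) : ℂ :=
  (1 / 2 : ℂ) * (fderiv ℝ c y (Module.finBasis ℂ B i) +
    Complex.I * fderiv ℝ c y (Complex.I • Module.finBasis ℂ B i))

theorem dbarCoord_smul {c : B → ℂ} (hc : DifferentiableAt ℝ c y) (m : M) (i : ι₀) :
    dbarCoord i (fun z => c z • m) y = dbarScalar i c y • m := by
  unfold dbarCoord dbarScalar
  rw [(hasWD_smul hc m _).dirDeriv_eq, (hasWD_smul hc m _).dirDeriv_eq]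
  module

theorem contDiffOn_dbarScalar (hU : IsOpen U) {c : B → ℂ} (hc : ContDiffOn ℝ ∞ c U) (i : ι₀) :
    ContDiffOn ℝ ∞ (dbarScalar i c) U := by
  have h := hc.fderiv_of_isOpen (m := ∞) hU (by simp)
  unfold dbarScalar
  exact contDiffOn_const.mul ((h.clm_apply contDiffOn_const).add
    (contDiffOn_const.mul (h.clm_apply contDiffOn_const)))

theorem differentiableAt_of_contDiffOn (hU : IsOpen U) {c : B → ℂ} (hc : ContDiffOn ℝ ∞ c U)
    (hy : y ∈ U) : DifferentiableAt ℝ c y :=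
  (hc.contDiffAt (hU.mem_nhds hy)).differentiableAt (by simp)

theorem SmTens.dbarCoord (hU : IsOpen U) (hg : SmTens U g) (i : ι₀) :
    SmTens U (Hitchin.dbarCoord i g) := by
  induction hg with
  | zero => exact .congr _ _ (fun z _ => (dbarCoord_zero z i).symm) .zero
  | smul c m hc =>
    exact .congr _ _ (fun z hz => (dbarCoord_smul (differentiableAt_of_contDiffOn hU hc hz) m i).symm)
      (Tens.smul _ m (contDiffOn_dbarScalar hU hc i))
  | add g h hg hh hg' hh' =>
    exact .congr _ _ (fun z hz => (dbarCoord_add hU hg hh hz i).symm) (.add _ _ hg' hh')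
  | congr g h he hg hg' => exact .congr _ _ (fun z hz => dbarCoord_congr hU hg hz he i) hg'

theorem dbarScalar_mul {c c' : B → ℂ} (hc : DifferentiableAt ℝ c y) (hc' : DifferentiableAt ℝ c' y)
    (i : ι₀) : dbarScalar i (fun z => c z * c' z) y =
      dbarScalar i c y * c' y + c y * dbarScalar i c' y := by
  unfold dbarScalar
  rw [fderiv_fun_mul hc hc']
  simp
  ring

theorem dbarCoord_bilin (hU : IsOpen U) {h : B → N} (hg : SmTens U g) (hh : SmTens U h) (hy : y ∈ U)
    (β : M →ₗ[ℂ] N →ₗ[ℂ] P) (i : ι₀) :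
    dbarCoord i (fun z => β (g z) (h z)) y =
      β (dbarCoord i g y) (h y) + β (g y) (dbarCoord i h y) := by
  induction hg with
  | zero => simp [dbarCoord_zero]
  | smul c m hc =>
    have hc0 := differentiableAt_of_contDiffOn hU hc hy
    rw [dbarCoord_smul hc0]
    induction hh with
    | zero => simp [dbarCoord_zero]
    | smul c' n hc' =>
      have hc0' := differentiableAt_of_contDiffOn hU hc' hy
      rw [dbarCoord_smul hc0']
      have : (fun z => β (c z • m) (c' z • n)) = fun z => (c z * c' z) • β m n := by
        funext z; simp [smul_smul, mul_comm]
      rw [this, dbarCoord_smul (hc0.fun_mul hc0'), dbarScalar_mul hc0 hc0']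
      simp only [map_smul, LinearMap.smul_apply]
      module
    | add h h' hh hh' ih ih' =>
      have hb := fun h hh => SmTens.bilin (Tens.smul c m hc) (h := h) hh β
      simp only [map_add] at ih ih' ⊢
      rw [dbarCoord_add hU (hb _ hh) (hb _ hh') hy, ih, ih', dbarCoord_add hU hh hh' hy, map_add]
      abel
    | congr h h' he hh ih =>
      have hb := SmTens.bilin (Tens.smul c m hc) hh β
      rw [← he hy, ← dbarCoord_congr hU hh hy he, ← ih]
      exact (dbarCoord_congr hU hb hy (fun z hz => by simp [he hz]) i).symm
  | add g g' hg hg' ih ih' =>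
    have hb := fun g hg => SmTens.bilin (g := g) hg hh β
    simp only [map_add, LinearMap.add_apply] at ih ih' ⊢
    rw [dbarCoord_add hU (hb _ hg) (hb _ hg') hy, ih, ih', dbarCoord_add hU hg hg' hy, map_add,
      LinearMap.add_apply]
    abel
  | congr g g' he hg ih =>
    have hb := SmTens.bilin hg hh β
    rw [← he hy, ← dbarCoord_congr hU hg hy he, ← ih]
    exact (dbarCoord_congr hU hb hy (fun z hz => by simp [he hz]) i).symm

theorem dbarScalar_eq_zero {c : B → ℂ} (hc : DifferentiableAt ℂ c y) (i : ι₀) :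
    dbarScalar i c y = 0 := by
  unfold dbarScalar
  rw [hc.fderiv_restrictScalars ℝ]
  simp only [ContinuousLinearMap.coe_restrictScalars', map_smul, smul_eq_mul, ← mul_assoc,
    Complex.I_mul_I]
  ring

theorem dbarCoord_eq_zero (hU : IsOpen U) (hg : HolTens U g) (hy : y ∈ U) (i : ι₀) :
    dbarCoord i g y = 0 := by
  induction hg with
  | zero => exact dbarCoord_zero y i
  | smul c m hc =>
    have hd : DifferentiableAt ℂ c y :=
      (hc.contDiffAt (hU.mem_nhds hy)).differentiableAt (by simp)
    rw [dbarCoord_smul (hd.restrictScalars ℝ), dbarScalar_eq_zero hd, zero_smul]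
  | add g h hg hh ih ih' =>
    rw [dbarCoord_add hU (HolTens.smTens hg) (HolTens.smTens hh) hy, ih, ih', add_zero]
  | congr g h he hg ih => rw [← dbarCoord_congr hU (HolTens.smTens hg) hy he, ih]

/-- Expanding both sides in second real derivatives reduces the claim to their symmetry. -/
theorem dbarScalar_comm (hU : IsOpen U) {c : B → ℂ} (hc : ContDiffOn ℝ ∞ c U) (hy : y ∈ U)
    (i j : ι₀) : dbarScalar i (dbarScalar j c) y = dbarScalar j (dbarScalar i c) y := by
  have hd : DifferentiableAt ℝ (fderiv ℝ c) y :=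
    ((hc.fderiv_of_isOpen (m := ∞) hU (by simp)).contDiffAt (hU.mem_nhds hy)).differentiableAt
      (by simp)
  have hs : ∀ v w, fderiv ℝ (fderiv ℝ c) y v w = fderiv ℝ (fderiv ℝ c) y w v := fun v w =>
    (hc.contDiffAt (hU.mem_nhds hy)).isSymmSndFDerivAt (by
      rw [minSmoothness_of_isRCLikeNormedField]; exact WithTop.coe_le_coe.2 (le_top (a := (2 : ℕ∞)))) v w
  have hv : ∀ v w, fderiv ℝ (fun z => fderiv ℝ c z v) y w = fderiv ℝ (fderiv ℝ c) y w v := by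
    intro v w
    rw [fderiv_clm_apply hd (differentiableAt_const v)]
    simp
  have key : ∀ (j : ι₀) (w : B), fderiv ℝ (dbarScalar j c) y w = (1 / 2 : ℂ) *
      (fderiv ℝ (fderiv ℝ c) y w (Module.finBasis ℂ B j) +
      Complex.I * fderiv ℝ (fderiv ℝ c) y w (Complex.I • Module.finBasis ℂ B j)) := by
    intro j w
    have hd1 : ∀ v, DifferentiableAt ℝ (fun z => fderiv ℝ c z v) y := fun v =>
      hd.clm_apply (differentiableAt_const v)
    unfold dbarScalar
    rw [fderiv_const_mul ((hd1 _).fun_add ((hd1 _).const_mul _)), fderiv_fun_add (hd1 _)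
      ((hd1 _).const_mul _), fderiv_const_mul (hd1 _)]
    simp [hv]
    ring
  rw [dbarScalar, dbarScalar, key, key, key, key, hs (Module.finBasis ℂ B j) (Module.finBasis ℂ B i),
    hs (Module.finBasis ℂ B j) (Complex.I • Module.finBasis ℂ B i),
    hs (Complex.I • Module.finBasis ℂ B j) (Module.finBasis ℂ B i),
    hs (Complex.I • Module.finBasis ℂ B j) (Complex.I • Module.finBasis ℂ B i)]
  ring

theorem dbarCoord_comm (hU : IsOpen U) (hg : SmTens U g) (hy : y ∈ U) (i j : ι₀) :
    dbarCoord i (dbarCoord j g) y = dbarCoord j (dbarCoord i g) y := by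
  induction hg with
  | zero =>
    have h : ∀ j : ι₀, dbarCoord j (fun _ : B => (0 : M)) = fun _ => 0 := fun j =>
      funext fun z => dbarCoord_zero z j
    simp only [h]
  | smul c m hc =>
    have h : ∀ i j : ι₀, dbarCoord i (dbarCoord j fun z => c z • m) y =
        dbarScalar i (dbarScalar j c) y • m := fun i j => by
      rw [← dbarCoord_smul (differentiableAt_of_contDiffOn hU (contDiffOn_dbarScalar hU hc j) hy)]
      exact (dbarCoord_congr hU (Tens.smul _ m (contDiffOn_dbarScalar hU hc j)) hy (fun z hz =>
        (dbarCoord_smul (differentiableAt_of_contDiffOn hU hc hz) m j).symm) i).symm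
    rw [h, h, dbarScalar_comm hU hc hy]
  | add g h hg hh ih ih' =>
    have h : ∀ i j : ι₀, dbarCoord i (dbarCoord j fun z => g z + h z) y =
        dbarCoord i (dbarCoord j g) y + dbarCoord i (dbarCoord j h) y := fun i j => by
      rw [← dbarCoord_add hU (SmTens.dbarCoord hU hg j) (SmTens.dbarCoord hU hh j) hy]
      exact (dbarCoord_congr hU (.add _ _ (SmTens.dbarCoord hU hg j) (SmTens.dbarCoord hU hh j)) hy
        (fun z hz => (dbarCoord_add hU hg hh hz j).symm) i).symm
    rw [h, h, ih, ih']
  | congr g h he hg ih =>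
    have h : ∀ i j : ι₀, dbarCoord i (dbarCoord j h) y = dbarCoord i (dbarCoord j g) y :=
      fun i j => (dbarCoord_congr hU (SmTens.dbarCoord hU hg j) hy
        (fun z hz => dbarCoord_congr hU hg hz he j) i).symm
    rw [h, h, ih]

end Dbar

section Dol

variable {B : Type*} [NormedAddCommGroup B] [NormedSpace ℂ B] [FiniteDimensional ℂ B]
  {M N P : Type*} [AddCommGroup M] [Module ℂ M] [AddCommGroup N] [Module ℂ N]
  [AddCommGroup P] [Module ℂ P] {U : Set B} {y : B}

local notation "ι₀" => Fin (Module.finrank ℂ B)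

/-! ### The `(0,1)`-part of the differential -/

/-- The `(0,1)`-part of the differential of a scalar function. -/
def dbarForm (c : B → ℂ) (y : B) : ConjDual B where
  toFun v := (1 / 2 : ℂ) * (fderiv ℝ c y v + Complex.I * fderiv ℝ c y (Complex.I • v))
  map_add' v w := by simp only [smul_add, map_add]; ring
  map_smul' a v := by
    have h : ∀ v : B, a • v = a.re • v + a.im • (Complex.I • v) := fun v => by
      conv_lhs => rw [← Complex.re_add_im a]
      rw [add_smul, mul_smul]
      rfl
    have h2 : ∀ v : B, Complex.I • (Complex.I • v) = -v := fun v => by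
      rw [smul_smul, Complex.I_mul_I, neg_one_smul]
    have hs : ∀ (r : ℝ) (w : B), fderiv ℝ c y (r • w) = r • fderiv ℝ c y w :=
      fun r w => (fderiv ℝ c y).map_smul r w
    rw [smul_comm Complex.I a v, h v, h (Complex.I • v), h2, map_add, map_add, hs, hs, hs, hs, map_neg]
    have hI : Complex.I * Complex.I = -1 := Complex.I_mul_I
    have hc : starRingEnd ℂ a = a.re - a.im * Complex.I := by
      apply Complex.ext <;> simp
    simp only [hc, smul_eq_mul, Complex.real_smul]
    linear_combination ((1 / 2 : ℂ) * a.im * fderiv ℝ c y (Complex.I • v)) * hI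

theorem dbarForm_apply (c : B → ℂ) (y v : B) : dbarForm c y v =
    (1 / 2 : ℂ) * (fderiv ℝ c y v + Complex.I * fderiv ℝ c y (Complex.I • v)) := rfl

theorem conjDual_ext {φ ψ : ConjDual B}
    (h : ∀ i, φ (Module.finBasis ℂ B i) = ψ (Module.finBasis ℂ B i)) : φ = ψ :=
  (Module.finBasis ℂ B).ext h

theorem sum_dbarScalar_smul_dzbar (c : B → ℂ) (y : B) :
    ∑ i, dbarScalar i c y • dzbar B i = dbarForm c y := by
  refine conjDual_ext fun j => ?_
  rw [LinearMap.sum_apply]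
  simp only [LinearMap.smul_apply, smul_eq_mul]
  rw [Finset.sum_eq_single j]
  · simp [dzbar, dbarScalar, dbarForm_apply]
  · intro i _ hij
    simp [dzbar, Finsupp.single_eq_of_ne hij]
  · simp

/-- Chain rule: the derivative of `τ` is complex linear, so it commutes with multiplication by `√-1`
and respects the `(0,1)`-part. -/
theorem dbarForm_comp {c : B → ℂ} {τ : B → B} {z : B} (hτ : DifferentiableAt ℂ τ z)
    (hc : DifferentiableAt ℝ c (τ z)) :
    dbarForm (fun w => c (τ w)) z = ConjDual.pull (fderiv ℂ τ z : B →ₗ[ℂ] B) (dbarForm c (τ z)) := by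
  have h : fderiv ℝ (fun w => c (τ w)) z = (fderiv ℝ c (τ z)).comp (fderiv ℝ τ z) :=
    fderiv_comp z hc (hτ.restrictScalars ℝ)
  rw [hτ.fderiv_restrictScalars ℝ] at h
  refine LinearMap.ext fun v => ?_
  change dbarForm _ z v = dbarForm c (τ z) (fderiv ℂ τ z v)
  rw [dbarForm_apply, dbarForm_apply, h]
  simp

/-- A conjugate-linear functional as a continuous real-linear map. -/
def conjDualCLM (φ : ConjDual B) : B →L[ℝ] ℂ :=
  haveI : FiniteDimensional ℝ B := FiniteDimensional.complexToReal B
  LinearMap.toContinuousLinearMap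
    { toFun := φ
      map_add' := φ.map_add
      map_smul' := fun r v => by
        have h : r • v = (r : ℂ) • v := rfl
        rw [h, φ.map_smulₛₗ, Complex.conj_ofReal]
        rfl }

theorem conjDualCLM_apply (φ : ConjDual B) (v : B) : conjDualCLM φ v = φ v := rfl

/-- The differential of a conjugate-linear function is itself and is entirely of type `(0,1)`. Every
constant `(0,1)`-covector is therefore `∂̄`-exact. -/
theorem dbarForm_conjDual (φ : ConjDual B) (y : B) : dbarForm (fun z => φ z) y = φ := by
  have h : fderiv ℝ (fun z => φ z) y = conjDualCLM φ := (conjDualCLM φ).hasFDerivAt.fderiv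
  refine LinearMap.ext fun v => ?_
  rw [dbarForm_apply, h, conjDualCLM_apply, conjDualCLM_apply, φ.map_smulₛₗ, Complex.conj_I]
  simp only [smul_eq_mul]
  linear_combination (-(1 / 2 : ℂ) * φ v) * Complex.I_mul_I

/-! ### The Dolbeault operator on functions with values in a module over the `(0,*)`-covectors -/

/-- The operator `∑ᵢ W(dz̄ᵢ) ∂/∂z̄ᵢ`. -/
def dol (W : ConjDual B →ₗ[ℂ] Module.End ℂ M) (g : B → M) (y : B) : M :=
  ∑ i, W (dzbar B i) (dbarCoord i g y)

variable {W : ConjDual B →ₗ[ℂ] Module.End ℂ M} {W' : ConjDual B →ₗ[ℂ] Module.End ℂ N}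
  {W'' : ConjDual B →ₗ[ℂ] Module.End ℂ P} {g g' : B → M}

theorem dol_congr (hU : IsOpen U) (hg : SmTens U g) (hy : y ∈ U) (he : Set.EqOn g g' U) :
    dol W g y = dol W g' y := by
  unfold dol
  exact Finset.sum_congr rfl fun i _ => by rw [dbarCoord_congr hU hg hy he]

theorem dol_add (hU : IsOpen U) (hg : SmTens U g) (hg' : SmTens U g') (hy : y ∈ U) :
    dol W (fun z => g z + g' z) y = dol W g y + dol W g' y := by
  unfold dol
  rw [← Finset.sum_add_distrib]
  exact Finset.sum_congr rfl fun i _ => by rw [dbarCoord_add hU hg hg' hy, map_add]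

theorem dol_map (hU : IsOpen U) (hg : SmTens U g) (hy : y ∈ U) (Φ : M →ₗ[ℂ] N)
    (hΦ : ∀ φ m, Φ (W φ m) = W' φ (Φ m)) :
    dol W' (fun z => Φ (g z)) y = Φ (dol W g y) := by
  unfold dol
  rw [map_sum]
  exact Finset.sum_congr rfl fun i _ => by rw [dbarCoord_map hU hg hy, hΦ]

theorem dol_smul (hU : IsOpen U) (hg : SmTens U g) (hy : y ∈ U) (a : ℂ) :
    dol W (fun z => a • g z) y = a • dol W g y :=
  dol_map (W := W) (W' := W) hU hg hy (LinearMap.lsmul ℂ M a) fun φ m => ((W φ).map_smul a m).symm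

theorem SmTens.dol (hU : IsOpen U) (hg : SmTens U g) : SmTens U (Hitchin.dol W g) :=
  Tens.sum _ fun i _ => Tens.map (SmTens.dbarCoord hU hg i) (W (dzbar B i))

theorem dol_eq_zero (hU : IsOpen U) (hg : HolTens U g) (hy : y ∈ U) : dol W g y = 0 := by
  unfold dol
  exact Finset.sum_eq_zero fun i _ => by rw [dbarCoord_eq_zero hU hg hy, map_zero]

theorem dbarCoord_sum (hU : IsOpen U) (hy : y ∈ U) {κ : Type*} (s : Finset κ) {f : κ → B → M}
    (hf : ∀ k ∈ s, SmTens U (f k)) (i : ι₀) :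
    dbarCoord i (fun z => ∑ k ∈ s, f k z) y = ∑ k ∈ s, dbarCoord i (f k) y := by
  classical
  induction s using Finset.induction_on with
  | empty => simp [dbarCoord_zero]
  | insert k s hk ih =>
    simp only [Finset.sum_insert hk]
    rw [dbarCoord_add hU (hf k (by simp)) (Tens.sum s fun j hj => hf j (by simp [hj])) hy,
      ih fun j hj => hf j (by simp [hj])]

/-- Second derivatives are symmetric and the covector products anticommute, so the double sum equals
its own negative. -/
theorem dol_dol (hU : IsOpen U) (hg : SmTens U g) (hy : y ∈ U)
    (hW : ∀ φ ψ m, W φ (W ψ m) = - W ψ (W φ m)) : dol W (dol W g) y = 0 := by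
  have h : dol W (dol W g) y = ∑ i, ∑ j, W (dzbar B i) (W (dzbar B j)
      (dbarCoord i (dbarCoord j g) y)) := by
    unfold dol
    refine Finset.sum_congr rfl fun i _ => ?_
    rw [dbarCoord_sum hU hy _ (fun j _ => Tens.map (SmTens.dbarCoord hU hg j) (W (dzbar B j))),
      map_sum]
    exact Finset.sum_congr rfl fun j _ => by rw [dbarCoord_map hU (SmTens.dbarCoord hU hg j) hy]
  have h' : dol W (dol W g) y = - dol W (dol W g) y := by
    conv_lhs => rw [h, Finset.sum_comm]
    rw [h, ← Finset.sum_neg_distrib]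
    refine Finset.sum_congr rfl fun j _ => ?_
    rw [← Finset.sum_neg_distrib]
    refine Finset.sum_congr rfl fun i _ => ?_
    rw [hW, dbarCoord_comm hU hg hy]
  have h2 : (2 : ℂ) • dol W (dol W g) y = 0 := by
    rw [two_smul]
    nth_rw 2 [h']
    exact add_neg_cancel _
  exact (smul_eq_zero.1 h2).resolve_left two_ne_zero

/-- The sign `ε` depends on the degree of `g`, so the commutation rule `hβ'` is asked only for the
value of `g` at the given point. -/
theorem dol_bilin (hU : IsOpen U) {h : B → N} (hg : SmTens U g) (hh : SmTens U h) (hy : y ∈ U)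
    (β : M →ₗ[ℂ] N →ₗ[ℂ] P) (ε : ℂ) (hβ : ∀ φ m n, W'' φ (β m n) = β (W φ m) n)
    (hβ' : ∀ φ n, W'' φ (β (g y) n) = ε • β (g y) (W' φ n)) :
    dol W'' (fun z => β (g z) (h z)) y = β (dol W g y) (h y) + ε • β (g y) (dol W' h y) := by
  unfold dol
  rw [map_sum, LinearMap.sum_apply, map_sum, Finset.smul_sum, ← Finset.sum_add_distrib]
  exact Finset.sum_congr rfl fun i _ => by
    rw [dbarCoord_bilin hU hg hh hy, map_add, hβ, hβ']

theorem dol_bilin_right (hU : IsOpen U) {h : B → N} (hg : HolTens U g) (hh : SmTens U h) (hy : y ∈ U)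
    (β : M →ₗ[ℂ] N →ₗ[ℂ] P) (hβ : ∀ φ m n, W'' φ (β m n) = β m (W' φ n)) :
    dol W'' (fun z => β (g z) (h z)) y = β (g y) (dol W' h y) := by
  unfold dol
  rw [map_sum]
  exact Finset.sum_congr rfl fun i _ => by
    rw [dbarCoord_bilin hU (HolTens.smTens hg) hh hy, dbarCoord_eq_zero hU hg hy, map_zero,
      LinearMap.zero_apply, zero_add, hβ]

theorem dol_scalar (hU : IsOpen U) {c : B → ℂ} (hc : ContDiffOn ℝ ∞ c U) (hy : y ∈ U) (m : M) :
    dol W (fun z => c z • m) y = W (dbarForm c y) m := by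
  unfold dol
  rw [← sum_dbarScalar_smul_dzbar, map_sum, LinearMap.sum_apply]
  exact Finset.sum_congr rfl fun i _ => by
    rw [dbarCoord_smul (differentiableAt_of_contDiffOn hU hc hy), map_smul, map_smul,
      LinearMap.smul_apply]

/-! ### Change of charts -/

theorem SmTens.transform {V : Set B} (hg : SmTens U g) {τ : B → B} (hτ : ContDiffOn ℂ ∞ τ V)
    (hm : Set.MapsTo τ V U) {A : B → M →ₗ[ℂ] N} (hA : ∀ m, SmTens V fun z => A z m) :
    SmTens V fun z => A z (g (τ z)) := by
  have hτ' := hτ.restrict_scalars ℝ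
  induction hg with
  | zero => simpa using Tens.zero
  | smul c m hc =>
    simp only [map_smul]
    exact SmTens.bilin (Tens.smul (fun z => c (τ z)) (1 : ℂ) (hc.comp hτ' hm)) (hA m)
      (LinearMap.lsmul ℂ N) |> Tens.congr _ _ fun z _ => by simp
  | add g h _ _ hg hh => simpa using Tens.add _ _ hg hh
  | congr g h he _ hg => exact .congr _ _ (fun z hz => by simp [he (hm hz)]) hg

/-- On `c • m` the derivative falls either on `c ∘ τ`, giving the pullback of `∂̄c` by the chain
rule, or on the transition map `A`, where closedness makes it vanish. -/
theorem dol_transform {V : Set B} (hV : IsOpen V) (hU : IsOpen U) (hg : SmTens U g) {τ : B → B}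
    (hτ : ContDiffOn ℂ ∞ τ V) (hm : Set.MapsTo τ V U) {A : B → M →ₗ[ℂ] N}
    (hA : ∀ m, SmTens V fun z => A z m) (hy : y ∈ V) (hA' : ∀ m, dol W' (fun z => A z m) y = 0)
    (hW : ∀ φ m, A y (W φ m) = W' (ConjDual.pull (fderiv ℂ τ y : B →ₗ[ℂ] B) φ) (A y m)) :
    dol W' (fun z => A z (g (τ z))) y = A y (dol W g (τ y)) := by
  have hτ' := hτ.restrict_scalars ℝ
  have hτy : DifferentiableAt ℂ τ y := (hτ.contDiffAt (hV.mem_nhds hy)).differentiableAt (by simp)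
  induction hg with
  | zero =>
    have h0 : ∀ y, dol W (fun _ : B => (0 : M)) y = 0 := fun y =>
      Finset.sum_eq_zero fun i _ => by rw [dbarCoord_zero, map_zero]
    have h0' : ∀ y, dol W' (fun _ : B => (0 : N)) y = 0 := fun y =>
      Finset.sum_eq_zero fun i _ => by rw [dbarCoord_zero, map_zero]
    simp only [map_zero, h0, h0']
  | smul c m hc =>
    have hc' : ContDiffOn ℝ ∞ (fun z => c (τ z)) V := hc.comp hτ' hm
    simp only [map_smul]
    have h1 : dol W' (fun z => c (τ z) • A z m) y = W' (dbarForm (fun z => c (τ z)) y) (A y m) +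
        c (τ y) • dol W' (fun z => A z m) y := by
      unfold dol
      rw [← sum_dbarScalar_smul_dzbar, map_sum, LinearMap.sum_apply, Finset.smul_sum,
        ← Finset.sum_add_distrib]
      refine Finset.sum_congr rfl fun i _ => ?_
      have hb := dbarCoord_bilin hV (Tens.smul (fun z => c (τ z)) (1 : ℂ) hc') (hA m) hy
        (LinearMap.lsmul ℂ N) i
      simp only [LinearMap.lsmul_apply, smul_eq_mul, mul_one] at hb
      have h1 : dbarCoord i (fun z => c (τ z)) y = dbarScalar i (fun z => c (τ z)) y := by
        have := dbarCoord_smul (differentiableAt_of_contDiffOn hV hc' hy) (1 : ℂ) i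
        simpa using this
      rw [hb, h1, map_add, map_smul, map_smul, map_smul, LinearMap.smul_apply]
    rw [h1, hA', smul_zero, add_zero, dol_scalar hU hc (hm hy), hW,
      dbarForm_comp hτy (differentiableAt_of_contDiffOn hU hc (hm hy))]
  | add g h hg hh ih ih' =>
    simp only [map_add]
    rw [dol_add hV (SmTens.transform hg hτ hm hA) (SmTens.transform hh hτ hm hA) hy, ih, ih',
      dol_add hU hg hh (hm hy), map_add]
  | congr g h he hg ih =>
    rw [← dol_congr hU hg (hm hy) he, ← ih]
    exact (dol_congr hV (SmTens.transform hg hτ hm hA) hy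
      (fun z hz => by simp only [he (hm hz)])).symm

end Dol

/-! ### Pullbacks of constant forms along holomorphic maps are closed -/

section FormsTransform

variable {B : Type*} [NormedAddCommGroup B] [NormedSpace ℂ B] [FiniteDimensional ℂ B] {V : Set B}

variable (B) in
/-- The product with `(0,1)`-covectors. -/
def wedgeForms : ConjDual B →ₗ[ℂ] Module.End ℂ (Forms B) :=
  LinearMap.mul ℂ (Forms B) ∘ₗ ExteriorAlgebra.ι ℂ

theorem wedgeForms_apply (φ : ConjDual B) (η : Forms B) :
    wedgeForms B φ η = ExteriorAlgebra.ι ℂ φ * η := rfl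

theorem ι_mul_ι_anticomm {M : Type*} [AddCommGroup M] [Module ℂ M] (φ ψ : M) :
    ExteriorAlgebra.ι ℂ φ * ExteriorAlgebra.ι ℂ ψ = -(ExteriorAlgebra.ι ℂ ψ * ExteriorAlgebra.ι ℂ φ) :=
  eq_neg_of_add_eq_zero_left (ExteriorAlgebra.ι_add_mul_swap φ ψ)

/-- In degree one the pullback of `φ` is `∂̄(φ ∘ τ)`, hence smooth and closed by `∂̄² = 0`. Products
follow from the Leibniz rule, by induction over the exterior algebra. -/
theorem pullback_closed (hV : IsOpen V) {τ : B → B} (hτ : ContDiffOn ℂ ∞ τ V) (η : Forms B) :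
    SmTens V (fun z => ExteriorAlgebra.map (ConjDual.pull (fderiv ℂ τ z : B →ₗ[ℂ] B)) η) ∧
      ∀ z ∈ V, dol (wedgeForms B)
        (fun z => ExteriorAlgebra.map (ConjDual.pull (fderiv ℂ τ z : B →ₗ[ℂ] B)) η) z = 0 := by
  have hτ' := hτ.restrict_scalars ℝ
  have hd : ∀ z ∈ V, DifferentiableAt ℂ τ z := fun z hz =>
    (hτ.contDiffAt (hV.mem_nhds hz)).differentiableAt (by simp)
  have hι : ∀ φ : ConjDual B,
      SmTens V (fun z => ExteriorAlgebra.ι ℂ (ConjDual.pull (fderiv ℂ τ z : B →ₗ[ℂ] B) φ)) ∧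
      ∀ z ∈ V, dol (wedgeForms B) (fun z => ExteriorAlgebra.ι ℂ
        (ConjDual.pull (fderiv ℂ τ z : B →ₗ[ℂ] B) φ)) z = 0 := by
    intro φ
    have hφ : ContDiff ℝ ∞ (fun z => φ z) := (conjDualCLM φ).contDiff
    have hc : ContDiffOn ℝ ∞ (fun z => φ (τ z)) V := hφ.comp_contDiffOn hτ'
    have hg : SmTens V fun z => φ (τ z) • (1 : Forms B) := .smul _ _ hc
    have he : Set.EqOn (dol (wedgeForms B) fun z => φ (τ z) • (1 : Forms B))
        (fun z => ExteriorAlgebra.ι ℂ (ConjDual.pull (fderiv ℂ τ z : B →ₗ[ℂ] B) φ)) V := by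
      intro z hz
      rw [dol_scalar hV hc hz, wedgeForms_apply, mul_one,
        dbarForm_comp (c := fun z => φ z) (hd z hz) (hφ.contDiffAt.differentiableAt (by simp)),
        dbarForm_conjDual]
    have hs : SmTens V (dol (wedgeForms B) fun z => φ (τ z) • (1 : Forms B)) := SmTens.dol hV hg
    refine ⟨.congr _ _ he hs, fun z hz => ?_⟩
    rw [← dol_congr hV hs hz he]
    refine dol_dol hV hg hz fun φ ψ m => ?_
    simp only [wedgeForms_apply]
    rw [← mul_assoc, ι_mul_ι_anticomm, neg_mul, mul_assoc]
  induction η using CliffordAlgebra.left_induction with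
  | algebraMap r =>
    have : (fun z => ExteriorAlgebra.map (ConjDual.pull (fderiv ℂ τ z : B →ₗ[ℂ] B))
        (algebraMap ℂ (Forms B) r)) = fun _ => algebraMap ℂ (Forms B) r :=
      funext fun z => AlgHom.commutes _ r
    refine ⟨?_, fun z hz => ?_⟩
    · exact this ▸ HolTens.smTens (holTens_const V _)
    · exact (congrArg (fun f => dol (wedgeForms B) f z) this).trans
        (dol_eq_zero hV (holTens_const V _) hz)
  | add x y hx hy =>
    simp only [map_add]
    exact ⟨.add _ _ hx.1 hy.1, fun z hz => by
      rw [dol_add hV hx.1 hy.1 hz, hx.2 z hz, hy.2 z hz, add_zero]⟩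
  | ι_mul x φ hx =>
    have hm : ∀ z, ExteriorAlgebra.map (ConjDual.pull (fderiv ℂ τ z : B →ₗ[ℂ] B))
        (CliffordAlgebra.ι 0 φ * x) = LinearMap.mul ℂ (Forms B)
          (ExteriorAlgebra.ι ℂ (ConjDual.pull (fderiv ℂ τ z : B →ₗ[ℂ] B) φ))
          (ExteriorAlgebra.map (ConjDual.pull (fderiv ℂ τ z : B →ₗ[ℂ] B)) x) := fun z => by
      rw [map_mul]
      congr 1
      exact ExteriorAlgebra.map_apply_ι _ _
    simp only [hm]
    refine ⟨SmTens.bilin (hι φ).1 hx.1 _, fun z hz => ?_⟩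
    rw [dol_bilin (W := wedgeForms B) (W' := wedgeForms B) hV (hι φ).1 hx.1 hz _ (-1), (hι φ).2 z hz,
      hx.2 z hz]
    · simp
    · intro φ m n
      simp only [wedgeForms_apply, LinearMap.mul_apply', mul_assoc]
    · intro ψ n
      simp only [wedgeForms_apply, LinearMap.mul_apply']
      rw [← mul_assoc, ι_mul_ι_anticomm, neg_mul, mul_assoc, neg_one_smul]

end FormsTransform

section Functoriality

variable {T E L : Type*} [AddCommGroup T] [Module ℂ T] [AddCommGroup E] [Module ℂ E]
  [AddCommGroup L] [Module ℂ L]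
  {T' E' L' : Type*} [AddCommGroup T'] [Module ℂ T'] [AddCommGroup E'] [Module ℂ E']
  [AddCommGroup L'] [Module ℂ L']
  {T'' E'' L'' : Type*} [AddCommGroup T''] [Module ℂ T''] [AddCommGroup E''] [Module ℂ E'']
  [AddCommGroup L''] [Module ℂ L'']

/-! ### Functoriality of the fibres -/

theorem exteriorMap_mem (f : L →ₗ[ℂ] L') {p : ℕ} {a : ExteriorAlgebra ℂ L} (ha : a ∈ ⋀[ℂ]^p L) :
    ExteriorAlgebra.map f a ∈ ⋀[ℂ]^p L' := by
  have h : Submodule.map (ExteriorAlgebra.map f).toLinearMap (LinearMap.range (ExteriorAlgebra.ι ℂ)) ≤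
      LinearMap.range (ExteriorAlgebra.ι ℂ) := by
    rintro _ ⟨_, ⟨v, rfl⟩, rfl⟩
    exact ⟨f v, (ExteriorAlgebra.map_apply_ι f v).symm⟩
  have h' : ExteriorAlgebra.map f a ∈ Submodule.map (ExteriorAlgebra.map f).toLinearMap
      (LinearMap.range (ExteriorAlgebra.ι ℂ) ^ p) := ⟨a, ha, rfl⟩
  rw [Submodule.map_pow] at h'
  exact pow_le_pow_left' h p h'

theorem conjEnd_apply (e : E →ₗ[ℂ] E') (e' : E' →ₗ[ℂ] E) (f : Module.End ℂ E) (v : E') :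
    conjEnd e e' f v = e (f (e' v)) := rfl

/-- Conjugation as a homomorphism of algebras. -/
def conjAlg {e : E →ₗ[ℂ] E'} {e' : E' →ₗ[ℂ] E} (h : e' ∘ₗ e = LinearMap.id)
    (h' : e ∘ₗ e' = LinearMap.id) : Module.End ℂ E →ₐ[ℂ] Module.End ℂ E' :=
  AlgHom.ofLinearMap (conjEnd e e') (by
      ext v
      exact LinearMap.congr_fun h' v) (fun f g => by
    ext v
    have := LinearMap.congr_fun h (g (e' v))
    simp only [LinearMap.comp_apply, LinearMap.id_apply] at this
    simp only [conjEnd_apply, Module.End.mul_apply, this])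

theorem trace_conjEnd {e : E →ₗ[ℂ] E'} {e' : E' →ₗ[ℂ] E} (h : e' ∘ₗ e = LinearMap.id)
    (h' : e ∘ₗ e' = LinearMap.id) (f : Module.End ℂ E) :
    LinearMap.trace ℂ E' (conjEnd e e' f) = LinearMap.trace ℂ E f :=
  LinearMap.trace_conj' f (LinearEquiv.ofLinearMap e e' h' h)

theorem EndFib.map_pure (τ : T' →ₗ[ℂ] T) (e : E →ₗ[ℂ] E') (e' : E' →ₗ[ℂ] E) (l : L →ₗ[ℂ] L')
    (f : Module.End ℂ E) (η : Forms T) (a : ExteriorAlgebra ℂ L) :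
    EndFib.map τ e e' l (pure f η a) = pure (conjEnd e e' f)
      (ExteriorAlgebra.map (ConjDual.pull τ) η) (ExteriorAlgebra.map l a) := rfl

theorem linearMap_ext_pure {N : Type*} [AddCommGroup N] [Module ℂ N] {φ ψ : EndFib T E L →ₗ[ℂ] N}
    (h : ∀ f η l, φ (pure f η l) = ψ (pure f η l)) (z : EndFib T E L) : φ z = ψ z := by
  have hz : z ∈ Submodule.span ℂ {z | ∃ (f : Module.End ℂ E) (η : Forms T)
    (l : ExteriorAlgebra ℂ L), z = pure f η l} := by rw [span_pure_eq_top]; exact Submodule.mem_top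
  induction hz using Submodule.span_induction with
  | mem z hz => obtain ⟨f, η, l, rfl⟩ := hz; exact h f η l
  | zero => rw [map_zero, map_zero]
  | add x y _ _ hx hy => rw [map_add, map_add, hx, hy]
  | smul a x _ hx => rw [map_smul, map_smul, hx]

theorem exteriorMap_comp (f : L →ₗ[ℂ] L') (g : L' →ₗ[ℂ] L'') (a : ExteriorAlgebra ℂ L) :
    ExteriorAlgebra.map g (ExteriorAlgebra.map f a) = ExteriorAlgebra.map (g ∘ₗ f) a :=
  DFunLike.congr_fun (ExteriorAlgebra.map_comp_map f g) a

theorem exteriorMap_id (a : ExteriorAlgebra ℂ L) : ExteriorAlgebra.map LinearMap.id a = a :=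
  DFunLike.congr_fun (ExteriorAlgebra.map_id) a

theorem EndFib.map_map (τ : T' →ₗ[ℂ] T) (e : E →ₗ[ℂ] E') (e' : E' →ₗ[ℂ] E) (l : L →ₗ[ℂ] L')
    (τ' : T'' →ₗ[ℂ] T') (u : E' →ₗ[ℂ] E'') (u' : E'' →ₗ[ℂ] E') (m : L' →ₗ[ℂ] L'')
    (z : EndFib T E L) : EndFib.map τ' u u' m (EndFib.map τ e e' l z) =
      EndFib.map (τ ∘ₗ τ') (u ∘ₗ e) (e' ∘ₗ u') (m ∘ₗ l) z := by
  refine linearMap_ext_pure (φ := EndFib.map τ' u u' m ∘ₗ EndFib.map τ e e' l) (fun f η a => ?_) z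
  rw [LinearMap.comp_apply, EndFib.map_pure, EndFib.map_pure, EndFib.map_pure, exteriorMap_comp,
    exteriorMap_comp]
  rfl

theorem EndFib.map_id (z : EndFib T E L) :
    EndFib.map LinearMap.id LinearMap.id LinearMap.id LinearMap.id z = z := by
  refine linearMap_ext_pure (ψ := LinearMap.id) (fun f η a => ?_) z
  rw [EndFib.map_pure, exteriorMap_id]
  exact congrArg (fun η => pure f η a) (exteriorMap_id η)

theorem EndFib.map_mem (τ : T' →ₗ[ℂ] T) (e : E →ₗ[ℂ] E') (e' : E' →ₗ[ℂ] E) (l : L →ₗ[ℂ] L')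
    {p q : ℕ} {z : EndFib T E L} (hz : z ∈ endPart T E L p q) :
    EndFib.map τ e e' l z ∈ endPart T' E' L' p q := by
  refine Submodule.span_induction (p := fun z _ => EndFib.map τ e e' l z ∈ endPart T' E' L' p q)
    ?_ ?_ ?_ ?_ hz
  · rintro _ ⟨f, η, a, hη, ha, rfl⟩
    exact Submodule.subset_span ⟨_, _, _, exteriorMap_mem _ hη, exteriorMap_mem _ ha, rfl⟩
  · rw [map_zero]; exact zero_mem _
  · intro x y _ _ hx hy; rw [map_add]; exact add_mem hx hy
  · intro a x _ hx; rw [map_smul]; exact Submodule.smul_mem _ _ hx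

variable (T E L) in
/-- The elements `f ⊗ (η ⊗ l)` with `η` and `l` homogeneous. -/
def homogSet : Set (EndFib T E L) :=
  {z | ∃ (p q : ℕ) (f : Module.End ℂ E) (η : Forms T) (l : ExteriorAlgebra ℂ L),
    η ∈ ⋀[ℂ]^p (ConjDual T) ∧ l ∈ ⋀[ℂ]^q L ∧ z = pure f η l}

/-- The bilinear map `(η, l) ↦ f ⊗ (η ⊗ l)`. -/
def pureHom (f : Module.End ℂ E) : Forms T →ₗ[ℂ] ExteriorAlgebra ℂ L →ₗ[ℂ] EndFib T E L :=
  (TensorProduct.mk ℂ _ _).compr₂ (TensorProduct.mk ℂ _ _ f ∘ₗ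
    (GradedTensorProduct.of ℂ (fun i : ℕ => ⋀[ℂ]^i (ConjDual T)) (fun i : ℕ => ⋀[ℂ]^i L)).toLinearMap)

theorem pureHom_apply (f : Module.End ℂ E) (η : Forms T) (l : ExteriorAlgebra ℂ L) :
    pureHom f η l = pure f η l := rfl

theorem exterior_induction {P : Submodule ℂ (ExteriorAlgebra ℂ L)} (h : ∀ q, ⋀[ℂ]^q L ≤ P)
    (l : ExteriorAlgebra ℂ L) : l ∈ P := by
  have ht := (DirectSum.Decomposition.isInternal
    (fun i : ℕ => (⋀[ℂ]^i L : Submodule ℂ (ExteriorAlgebra ℂ L)))).submodule_iSup_eq_top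
  have : l ∈ ⨆ i : ℕ, (⋀[ℂ]^i L : Submodule ℂ (ExteriorAlgebra ℂ L)) := ht ▸ Submodule.mem_top
  exact iSup_le h this

theorem mem_span_homogSet (z : EndFib T E L) : z ∈ Submodule.span ℂ (homogSet T E L) := by
  have h : ∀ f η l, (pure f η l : EndFib T E L) ∈ Submodule.span ℂ (homogSet T E L) := by
    intro f η l
    have h1 : ∀ p, ∀ η ∈ ⋀[ℂ]^p (ConjDual T), ∀ l,
        (pure f η l : EndFib T E L) ∈ Submodule.span ℂ (homogSet T E L) := fun p η hη l =>
      exterior_induction (P := (Submodule.span ℂ (homogSet T E L)).comap (pureHom f η))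
        (fun q l hl => Submodule.subset_span ⟨p, q, f, η, l, hη, hl, rfl⟩) l
    exact exterior_induction (P := (Submodule.span ℂ (homogSet T E L)).comap ((pureHom f).flip l))
      (fun p η hη => h1 p η hη l) η
  have hz : z ∈ Submodule.span ℂ {z | ∃ (f : Module.End ℂ E) (η : Forms T)
    (l : ExteriorAlgebra ℂ L), z = pure f η l} := by rw [span_pure_eq_top]; exact Submodule.mem_top
  refine Submodule.span_le.2 ?_ hz
  rintro _ ⟨f, η, l, rfl⟩
  exact h f η l

theorem EndFib.map_mul (τ : T' →ₗ[ℂ] T) {e : E →ₗ[ℂ] E'} {e' : E' →ₗ[ℂ] E} (l : L →ₗ[ℂ] L')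
    (h : e' ∘ₗ e = LinearMap.id) (h' : e ∘ₗ e' = LinearMap.id) (y z : EndFib T E L) :
    EndFib.map τ e e' l (y * z) = EndFib.map τ e e' l y * EndFib.map τ e e' l z := by
  refine bilin_eq_of_span (M := EndFib T E L) (P := EndFib T E L) (A := EndFib T' E' L')
    ((LinearMap.mul ℂ (EndFib T E L)).compr₂ (EndFib.map τ e e' l))
    ((LinearMap.mul ℂ (EndFib T' E' L')).compl₁₂ (EndFib.map τ e e' l) (EndFib.map τ e e' l))
    ?_ (mem_span_homogSet y) (mem_span_homogSet z)
  rintro _ ⟨p, q, f, η, a, hη, ha, rfl⟩ _ ⟨p', q', f', η', a', hη', ha', rfl⟩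
  change EndFib.map τ e e' l (pure f η a * pure f' η' a') =
    EndFib.map τ e e' l (pure f η a) * EndFib.map τ e e' l (pure f' η' a')
  rw [pure_mul_pure f f' η a' hη' ha, map_zsmul, EndFib.map_pure, EndFib.map_pure, EndFib.map_pure,
    pure_mul_pure _ _ _ _ (exteriorMap_mem _ hη') (exteriorMap_mem _ ha),
    _root_.map_mul (ExteriorAlgebra.map _), _root_.map_mul (ExteriorAlgebra.map l)]
  have := _root_.map_mul (conjAlg h h') f f'
  have h2 : conjEnd e e' (f * f') = conjEnd e e' f * conjEnd e e' f' := this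
  rw [h2]

theorem EndFib.map_gradedComm (τ : T' →ₗ[ℂ] T) {e : E →ₗ[ℂ] E'} {e' : E' →ₗ[ℂ] E} (l : L →ₗ[ℂ] L')
    (h : e' ∘ₗ e = LinearMap.id) (h' : e ∘ₗ e' = LinearMap.id) (n m : ℤ) (y z : EndFib T E L) :
    EndFib.map τ e e' l (gradedComm n m y z) =
      gradedComm n m (EndFib.map τ e e' l y) (EndFib.map τ e e' l z) := by
  unfold gradedComm
  rw [map_sub, map_zsmul, EndFib.map_mul τ l h h', EndFib.map_mul τ l h h']

/-! ### Symmetric algebras -/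

/-- The homomorphism of symmetric algebras induced by a linear map. -/
abbrev symMap (l : L →ₗ[ℂ] L') : SymmetricAlgebra ℂ L →ₐ[ℂ] SymmetricAlgebra ℂ L' :=
  SymmetricAlgebra.lift (SymmetricAlgebra.ι ℂ L' ∘ₗ l)

theorem symMap_ι (l : L →ₗ[ℂ] L') (v : L) :
    symMap l (SymmetricAlgebra.ι ℂ L v) = SymmetricAlgebra.ι ℂ L' (l v) :=
  SymmetricAlgebra.lift_ι_apply _ _

theorem symMap_comp (f : L →ₗ[ℂ] L') (g : L' →ₗ[ℂ] L'') (a : SymmetricAlgebra ℂ L) :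
    symMap g (symMap f a) = symMap (g ∘ₗ f) a := by
  have : (symMap g).comp (symMap f) = symMap (g ∘ₗ f) := by
    apply SymmetricAlgebra.algHom_ext
    ext v
    change symMap g (symMap f (SymmetricAlgebra.ι ℂ L v)) = symMap (g ∘ₗ f) (SymmetricAlgebra.ι ℂ L v)
    rw [symMap_ι, symMap_ι, symMap_ι]
    rfl
  exact DFunLike.congr_fun this a

theorem symMap_id (a : SymmetricAlgebra ℂ L) : symMap LinearMap.id a = a := by
  have : symMap LinearMap.id = AlgHom.id ℂ (SymmetricAlgebra ℂ L) := by
    apply SymmetricAlgebra.algHom_ext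
    ext v
    change symMap LinearMap.id (SymmetricAlgebra.ι ℂ L v) = SymmetricAlgebra.ι ℂ L v
    rw [symMap_ι]
    rfl
  exact DFunLike.congr_fun this a

theorem symMap_mem (f : L →ₗ[ℂ] L') {p : ℕ} {a : SymmetricAlgebra ℂ L}
    (ha : a ∈ LinearMap.range (SymmetricAlgebra.ι ℂ L) ^ p) :
    symMap f a ∈ LinearMap.range (SymmetricAlgebra.ι ℂ L') ^ p := by
  have h : Submodule.map (symMap f).toLinearMap (LinearMap.range (SymmetricAlgebra.ι ℂ L)) ≤
      LinearMap.range (SymmetricAlgebra.ι ℂ L') := by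
    rintro _ ⟨_, ⟨v, rfl⟩, rfl⟩
    exact ⟨f v, (symMap_ι f v).symm⟩
  have h' : symMap f a ∈ Submodule.map (symMap f).toLinearMap
      (LinearMap.range (SymmetricAlgebra.ι ℂ L) ^ p) := ⟨a, ha, rfl⟩
  rw [Submodule.map_pow] at h'
  exact pow_le_pow_left' h p h'

theorem SymFib.map_tmul (τ : T' →ₗ[ℂ] T) (l : L →ₗ[ℂ] L') (η : Forms T) (s : SymmetricAlgebra ℂ L) :
    SymFib.map τ l (η ⊗ₜ s) = ExteriorAlgebra.map (ConjDual.pull τ) η ⊗ₜ symMap l s := rfl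

theorem SymFib.map_map (τ : T' →ₗ[ℂ] T) (l : L →ₗ[ℂ] L')
    (τ' : T'' →ₗ[ℂ] T') (m : L' →ₗ[ℂ] L'') (z : SymFib T L) :
    SymFib.map τ' m (SymFib.map τ l z) = SymFib.map (τ ∘ₗ τ') (m ∘ₗ l) z := by
  induction z using TensorProduct.induction_on with
  | zero => simp only [map_zero]
  | add x y hx hy => simp only [map_add, hx, hy]
  | tmul η s =>
    rw [SymFib.map_tmul, SymFib.map_tmul, SymFib.map_tmul, symMap_comp, exteriorMap_comp]
    rfl

theorem SymFib.map_id (z : SymFib T L) : SymFib.map LinearMap.id LinearMap.id z = z := by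
  induction z using TensorProduct.induction_on with
  | zero => simp only [map_zero]
  | add x y hx hy => simp only [map_add, hx, hy]
  | tmul η s =>
    rw [SymFib.map_tmul, symMap_id]
    exact congrArg (· ⊗ₜ[ℂ] s) (exteriorMap_id η)

theorem SymFib.map_mem (τ : T' →ₗ[ℂ] T) (l : L →ₗ[ℂ] L') {p k : ℕ} {z : SymFib T L}
    (hz : z ∈ symPart T L p k) : SymFib.map τ l z ∈ symPart T' L' p k := by
  refine Submodule.span_induction (p := fun z _ => SymFib.map τ l z ∈ symPart T' L' p k)
    ?_ ?_ ?_ ?_ hz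
  · rintro _ ⟨η, s, hη, hs, rfl⟩
    exact Submodule.subset_span ⟨_, _, exteriorMap_mem _ hη, symMap_mem _ hs, rfl⟩
  · rw [map_zero]; exact zero_mem _
  · intro x y _ _ hx hy; rw [map_add]; exact add_mem hx hy
  · intro a x _ hx; rw [map_smul]; exact Submodule.smul_mem _ _ hx

/-! ### Naturality of the polarized traces -/

theorem ιInv_exteriorMap (f : L →ₗ[ℂ] L') (a : ExteriorAlgebra ℂ L) :
    ExteriorAlgebra.ιInv (ExteriorAlgebra.map f a) = f (ExteriorAlgebra.ιInv a) := by
  refine exterior_induction (P := LinearMap.eqLocus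
    (ExteriorAlgebra.ιInv ∘ₗ (ExteriorAlgebra.map f).toLinearMap) (f ∘ₗ ExteriorAlgebra.ιInv))
    (fun q l hl => ?_) a
  change ExteriorAlgebra.ιInv (ExteriorAlgebra.map f l) = f (ExteriorAlgebra.ιInv l)
  by_cases hq : q = 1
  · subst hq
    rw [ExteriorAlgebra.exteriorPower, pow_one] at hl
    obtain ⟨v, rfl⟩ := hl
    rw [ExteriorAlgebra.map_apply_ι]
    exact (ExteriorAlgebra.ι_leftInverse _).trans
      (congrArg f (ExteriorAlgebra.ι_leftInverse v).symm)
  · rw [ιInv_of_mem hq hl, ιInv_of_mem hq (exteriorMap_mem f hl), map_zero]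

/-- The map induced on `End E ⊗ L`. -/
abbrev higgsMap (e : E →ₗ[ℂ] E') (e' : E' →ₗ[ℂ] E) (l : L →ₗ[ℂ] L') :
    Module.End ℂ E ⊗[ℂ] L →ₗ[ℂ] Module.End ℂ E' ⊗[ℂ] L' := TensorProduct.map (conjEnd e e') l

theorem EndFib.map_inclHiggs (τ : T' →ₗ[ℂ] T) (e : E →ₗ[ℂ] E') (e' : E' →ₗ[ℂ] E) (l : L →ₗ[ℂ] L')
    (θ : Module.End ℂ E ⊗[ℂ] L) :
    EndFib.map τ e e' l (inclHiggs θ) = inclHiggs (higgsMap e e' l θ) := by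
  induction θ using TensorProduct.induction_on with
  | zero => simp only [map_zero]
  | add x y hx hy => simp only [map_add, hx, hy]
  | tmul f v =>
    rw [inclHiggs_tmul, EndFib.map_pure, ExteriorAlgebra.map_apply_ι, map_one]
    rfl

/-- The induced map on `End E ⊗ ⨀ L` is an algebra homomorphism, so it carries words to words, and
the trace does not change under conjugation. Hence `g^k_n` may be computed in any frame. -/
theorem SymFib.map_polTrace (τ : T' →ₗ[ℂ] T) {e : E →ₗ[ℂ] E'} {e' : E' →ₗ[ℂ] E} (l : L →ₗ[ℂ] L')
    (h : e' ∘ₗ e = LinearMap.id) (h' : e ∘ₗ e' = LinearMap.id) (k : ℕ) {n : ℕ}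
    (θ : Module.End ℂ E ⊗[ℂ] L) (y : Fin n → EndFib T E L) :
    SymFib.map τ l (polTrace k n θ y) =
      polTrace k n (higgsMap e e' l θ) fun i => EndFib.map τ e e' l (y i) := by
  refine multilinear_eq_of_span ((SymFib.map τ l).compMultilinearMap (polTraceHom k n θ))
    ((polTraceHom k n (higgsMap e e' l θ)).compLinearMap fun _ => EndFib.map τ e e' l)
    (s := fun _ => {z | ∃ (f : Module.End ℂ E) (η : Forms T) (l : ExteriorAlgebra ℂ L),
      z = pure f η l}) (fun m hm => ?_) (m := y) fun i => by
    rw [span_pure_eq_top]; exact Submodule.mem_top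
  choose f η a hm using hm
  obtain rfl : m = fun i => pure (f i) (η i) (a i) := funext hm
  change SymFib.map τ l (polTrace k n θ fun i => pure (f i) (η i) (a i)) =
    polTrace k n (higgsMap e e' l θ) fun i => EndFib.map τ e e' l (pure (f i) (η i) (a i))
  simp only [EndFib.map_pure]
  rw [polTrace_pure, polTrace_pure, SymFib.map_tmul, map_list_prod, List.map_ofFn]
  congr 1
  let Φ := Algebra.TensorProduct.map (conjAlg h h') (symMap l)
  have hΦ : ∀ z : Module.End ℂ E ⊗[ℂ] SymmetricAlgebra ℂ L, symMap l (traceMap _ z) =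
      traceMap _ (Φ z) := by
    intro z
    induction z using TensorProduct.induction_on with
    | zero => simp only [map_zero]
    | add x y hx hy => rw [map_add, map_add, hx, hy, map_add, map_add]
    | tmul f s =>
      rw [Algebra.TensorProduct.map_tmul, traceMap_tmul, traceMap_tmul, map_smul]
      congr 1
      exact (trace_conjEnd h h' f).symm
  rw [hΦ]
  congr 1
  refine (map_wordSum Φ.toRingHom _ _ _).trans ?_
  have hθ : Φ (higgsSym θ) = higgsSym (higgsMap e e' l θ) := by
    induction θ using TensorProduct.induction_on with
    | zero => simp only [map_zero]
    | add x y hx hy => rw [map_add, map_add, hx, hy, map_add, map_add]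
    | tmul f v =>
      change conjEnd e e' f ⊗ₜ[ℂ] symMap l (SymmetricAlgebra.ι ℂ L v) = _
      rw [symMap_ι]
      rfl
  have hθ' : Φ.toRingHom (higgsSym θ) = higgsSym (higgsMap e e' l θ) := hθ
  rw [hθ', List.map_ofFn]
  congr 2
  funext i
  change conjEnd e e' (f i) ⊗ₜ[ℂ] symMap l (SymmetricAlgebra.ι ℂ L (ExteriorAlgebra.ιInv (a i))) = _
  rw [symMap_ι, ιInv_exteriorMap]

end Functoriality

section Degrees

variable {T E L : Type*} [AddCommGroup T] [Module ℂ T] [AddCommGroup E] [Module ℂ E]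
  [AddCommGroup L] [Module ℂ L]

/-! ### Degrees of the polarized traces -/

theorem polTrace_eq_zero (k : ℕ) {n : ℕ} (θ : Module.End ℂ E ⊗[ℂ] L) {y : Fin n → EndFib T E L}
    {i : Fin n} {p q : ℕ} (hi : y i ∈ endPart T E L p q) (hq : q ≠ 1) : polTrace k n θ y = 0 := by
  have hp : (place i (y i) : Slots n T E L) = 0 := by
    refine Submodule.span_induction (p := fun z _ => (place i z : Slots n T E L) = 0) ?_ ?_ ?_ ?_ hi
    · rintro _ ⟨f, η, l, hη, hl, rfl⟩
      change f ⊗ₜ[ℂ] (PiTensorProduct.singleAlgHom (R := ℂ) (A := fun _ : Fin n => Forms T) i η ⊗ₜ[ℂ]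
        SymmetricAlgebra.ι ℂ L (ExteriorAlgebra.ιInv l)) = 0
      rw [ιInv_of_mem hq hl, map_zero, TensorProduct.tmul_zero, TensorProduct.tmul_zero]
    · exact map_zero _
    · intro x y _ _ hx hy; rw [map_add, hx, hy, add_zero]
    · intro a x _ hx; rw [map_smul, hx, smul_zero]
  rw [polTrace_eq_wordSum, wordSum_of_zero_mem, map_zero]
  exact (List.mem_ofFn' _ _).2 ⟨i, hp⟩

theorem wordSum_mem_graded {A : Type*} [Ring A] [Algebra ℂ A] {S : Set A} {P : ℕ → Submodule ℂ A}
    (h1 : 1 ∈ P 0) (hP : ∀ k, ∀ a ∈ S, ∀ b ∈ P k, a * b ∈ P (k + 1)) {θ : A} (hθ : θ ∈ S)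
    (k : ℕ) {l : List A} (hl : ∀ a ∈ l, a ∈ S) : wordSum θ k l ∈ P k := by
  induction k generalizing l with
  | zero =>
    match l with
    | [] => rw [wordSum_zero_nil]; exact h1
    | a :: l => rw [wordSum_zero_cons]; exact zero_mem _
  | succ k ih =>
    rw [wordSum_succ]
    refine add_mem (hP k _ hθ _ (ih hl)) (pickSum_mem fun a t hat => ?_)
    exact hP k _ (hl a (hat.subset (by simp))) _ (ih fun b hb => hl b (hat.subset (by simp [hb])))

theorem list_prod_mem_exteriorPower {M : Type*} [AddCommGroup M] [Module ℂ M] {n : ℕ}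
    {η : Fin n → ExteriorAlgebra ℂ M} {p : Fin n → ℕ} (h : ∀ i, η i ∈ ⋀[ℂ]^(p i) M) :
    (List.ofFn η).prod ∈ ⋀[ℂ]^(∑ i, p i) M := by
  induction n with
  | zero => simp
  | succ n ih =>
    rw [List.ofFn_succ, List.prod_cons, Fin.sum_univ_succ]
    exact SetLike.GradedMul.mul_mem (A := fun i : ℕ => ⋀[ℂ]^i M) (h 0) (ih fun i => h i.succ)

theorem polTrace_mem (k : ℕ) {n : ℕ} (θ : Module.End ℂ E ⊗[ℂ] L) {y : Fin n → EndFib T E L}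
    {p : Fin n → ℕ} (hy : ∀ i, y i ∈ endPart T E L (p i) 1) :
    polTrace k n θ y ∈ symPart T L (∑ i, p i) k := by
  -- Membership becomes vanishing in the quotient, an identity of multilinear maps that can be
  -- checked on generators.
  rw [← polTraceHom_apply, ← Submodule.Quotient.mk_eq_zero]
  refine multilinear_eq_of_span ((Submodule.mkQ (symPart T L (∑ i, p i) k)).compMultilinearMap
    (polTraceHom k n θ)) 0 (fun m hm => ?_) hy
  choose f η l hη hl hm using hm
  obtain rfl : m = fun i => pure (f i) (η i) (l i) := funext hm
  change Submodule.Quotient.mk (polTrace k n θ fun i => pure (f i) (η i) (l i)) = _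
  rw [polTrace_pure]
  refine (Submodule.Quotient.mk_eq_zero _).2
    (Submodule.subset_span ⟨_, _, list_prod_mem_exteriorPower hη, ?_, rfl⟩)
  have hw := wordSum_mem_graded (A := Module.End ℂ E ⊗[ℂ] SymmetricAlgebra ℂ L)
    (S := Set.range (higgsSym (E := E) (L := L)))
    (P := fun k => Submodule.span ℂ {z | ∃ (f : Module.End ℂ E) (s : SymmetricAlgebra ℂ L),
      s ∈ LinearMap.range (SymmetricAlgebra.ι ℂ L) ^ k ∧ z = f ⊗ₜ[ℂ] s})
    (Submodule.subset_span ⟨1, 1, by rw [pow_zero]; exact Submodule.one_le.1 le_rfl, rfl⟩)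
    (by
      rintro k _ ⟨a, rfl⟩ b hb
      induction a using TensorProduct.induction_on with
      | zero => rw [map_zero, zero_mul]; exact zero_mem _
      | add x y hx hy => rw [map_add, add_mul]; exact add_mem hx hy
      | tmul g v =>
        refine mul_mem_of_span (s := {g ⊗ₜ SymmetricAlgebra.ι ℂ L v}) ?_
          (Submodule.subset_span rfl) hb
        rintro _ rfl _ ⟨f', s, hs, rfl⟩
        rw [Algebra.TensorProduct.tmul_mul_tmul]
        exact Submodule.subset_span ⟨_, _, by
          rw [pow_succ']; exact Submodule.mul_mem_mul ⟨v, rfl⟩ hs, rfl⟩)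
    (θ := higgsSym θ) ⟨θ, rfl⟩ k
    (l := List.ofFn fun i => f i ⊗ₜ SymmetricAlgebra.ι ℂ L (ExteriorAlgebra.ιInv (l i)))
    (fun a ha => by
      obtain ⟨i, rfl⟩ := (List.mem_ofFn' _ _).1 ha
      exact ⟨f i ⊗ₜ ExteriorAlgebra.ιInv (l i), rfl⟩)
  refine Submodule.span_induction (p := fun z _ => traceMap _ z ∈
    LinearMap.range (SymmetricAlgebra.ι ℂ L) ^ k) ?_ ?_ ?_ ?_ hw
  · rintro _ ⟨f, s, hs, rfl⟩
    rw [traceMap_tmul]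
    exact Submodule.smul_mem _ _ hs
  · rw [map_zero]; exact zero_mem _
  · intro x y _ _ hx hy; rw [map_add]; exact add_mem hx hy
  · intro a x _ hx; rw [map_smul]; exact Submodule.smul_mem _ _ hx

end Degrees

section GradedIdentities

variable {A : Type*} [Ring A]

/-! ### Identities for graded commutators -/

theorem gradedComm_symm (n m : ℤ) (x y : A) :
    gradedComm n m x y = -(((n * m).negOnePow : ℤ) • gradedComm m n y x) := by
  unfold gradedComm
  rw [smul_sub, mul_comm m n, smul_smul, sgn_mul_self, one_smul, neg_sub]

theorem gradedComm_jacobi (n m k : ℤ) (x y z : A) :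
    gradedComm n (m + k) x (gradedComm m k y z) =
      gradedComm (n + m) k (gradedComm n m x y) z +
        ((n * m).negOnePow : ℤ) • gradedComm m (n + k) y (gradedComm n k x z) := by
  unfold gradedComm
  simp only [negOnePow_eq_ite, Int.even_add, Int.even_mul]
  by_cases hn : Even n <;> by_cases hm : Even m <;> by_cases hk : Even k <;>
    simp [hn, hm, hk, -zsmul_eq_mul] <;> noncomm_ring

/-- The rules for `D` are assumed only at the elements involved, since `∂̄` is additive and a
derivation on smooth sections only. -/
theorem gradedComm_derivation (D : A → A) (n m : ℤ) {x y : A}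
    (hs : ∀ a : ℤ, D (x * y - a • (y * x)) = D (x * y) - a • D (y * x))
    (hxy : D (x * y) = D x * y + (n.negOnePow : ℤ) • (x * D y))
    (hyx : D (y * x) = D y * x + (m.negOnePow : ℤ) • (y * D x)) :
    D (gradedComm n m x y) =
      gradedComm (n + 1) m (D x) y + (n.negOnePow : ℤ) • gradedComm n (m + 1) x (D y) := by
  unfold gradedComm
  rw [hs, hxy, hyx]
  simp only [negOnePow_eq_ite, Int.even_add, Int.even_mul, Int.not_even_one, iff_false]
  by_cases hn : Even n <;> by_cases hm : Even m <;> simp [hn, hm, -zsmul_eq_mul] <;> abel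

/-- The terms with two adjacent factors `t` vanish, and the two terms `t x t` occur with opposite
signs. -/
theorem gradedComm_sq_zero (n : ℤ) {t : A} (ht : t * t = 0) (x : A) :
    gradedComm 1 (n + 1) t (gradedComm 1 n t x) = 0 := by
  unfold gradedComm
  have h1 : t * (t * x) = 0 := by rw [← mul_assoc, ht, zero_mul]
  have h2 : x * t * t = 0 := by rw [mul_assoc, ht, mul_zero]
  simp only [negOnePow_eq_ite, Int.even_add, Int.even_mul, Int.not_even_one, iff_false]
  by_cases hn : Even n <;>
    simp [hn, -zsmul_eq_mul, mul_sub, sub_mul, mul_add, add_mul, h1, h2, mul_assoc]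

theorem gradedComm_add_left (n m : ℤ) (x x' y : A) :
    gradedComm n m (x + x') y = gradedComm n m x y + gradedComm n m x' y := by
  unfold gradedComm
  rw [add_mul, mul_add, smul_add]
  abel

theorem gradedComm_add_right (n m : ℤ) (x y y' : A) :
    gradedComm n m x (y + y') = gradedComm n m x y + gradedComm n m x y' := by
  unfold gradedComm
  rw [add_mul, mul_add, smul_add]
  abel

theorem gradedComm_smul_left [Algebra ℂ A] (n m : ℤ) (a : ℂ) (x y : A) :
    gradedComm n m (a • x) y = a • gradedComm n m x y := by
  unfold gradedComm
  rw [smul_mul_assoc, mul_smul_comm, smul_sub, smul_comm]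

theorem gradedComm_smul_right [Algebra ℂ A] (n m : ℤ) (a : ℂ) (x y : A) :
    gradedComm n m x (a • y) = a • gradedComm n m x y := by
  unfold gradedComm
  rw [smul_mul_assoc, mul_smul_comm, smul_sub, smul_comm]

theorem gradedComm_mem_of {S : Type*} [SetLike S A] [AddSubgroupClass S A] {s : S} {n m : ℤ} {x y : A}
    (h : x * y ∈ s) (h' : y * x ∈ s) : gradedComm n m x y ∈ s := sub_mem h (zsmul_mem h' _)

/-- The mixed terms `D[t, x]` and `[t, Dx]` cancel because `t` is odd and closed; what remains is
`D²` and the square of the commutator with `t`. -/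
theorem differential_sq {D : A → A} (n : ℤ) {t x : A} (ht : t * t = 0) (hD : D (D x) = 0)
    (hadd : D (D x + gradedComm 1 n t x) = D (D x) + D (gradedComm 1 n t x))
    (hs : ∀ a : ℤ, D (t * x - a • (x * t)) = D (t * x) - a • D (x * t))
    (htx : D (t * x) = -(t * D x)) (hxt : D (x * t) = D x * t) :
    D (D x + gradedComm 1 n t x) + gradedComm 1 (n + 1) t (D x + gradedComm 1 n t x) = 0 := by
  rw [gradedComm_add_right, gradedComm_sq_zero n ht, hadd, hD]
  unfold gradedComm
  rw [hs, htx, hxt]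
  simp only [negOnePow_eq_ite, Int.even_add, Int.even_mul, Int.not_even_one, iff_false]
  by_cases hn : Even n <;> simp [hn, -zsmul_eq_mul]

theorem mul_mul_of_eq_zsmul {c x : A} {a : ℤ} (h : c * x = a • (x * c)) (y : A) :
    c * (x * y) = a • (x * (c * y)) := by
  rw [← mul_assoc, h, smul_mul_assoc, mul_assoc]

end GradedIdentities

/-! ### Graded symmetry of the polarized traces -/

section Symmetry

variable {T E L : Type*} [AddCommGroup T] [Module ℂ T] [AddCommGroup E] [Module ℂ E]
  [AddCommGroup L] [Module ℂ L]

theorem prod_perm {A : Type*} [Ring A] {n : ℕ} (d : Fin n → ℤ) (e : Fin n → A)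
    (h : ∀ i j, e i * e j = ((d i * d j).negOnePow : ℤ) • (e j * e i)) (σ : Equiv.Perm (Fin n)) :
    (List.ofFn fun i => e (σ i)).prod =
      koszul d (fun i => (σ.symm i : ℕ)) • (List.ofFn e).prod := by
  rw [← prod_blocks d e h σ.symm]
  congr 2
  funext j
  have hb : block e σ.symm j = [e (σ j)] := by
    have hf : (List.finRange n).filter (fun i => σ.symm i = j) = [σ j] := by
      refine List.perm_singleton.1 ((List.perm_ext_iff_of_nodup ((List.nodup_finRange n).filter _)
        (List.nodup_singleton _)).2 fun i => ?_)
      simp [Equiv.symm_apply_eq]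
    unfold block
    rw [hf]
    rfl
  rw [hb, List.prod_singleton]

theorem coef_eq_zero {z : SymFib T L ⊗[ℂ] Dec} (h : coef z = 0) : z = 0 := h

/-- After decoration the value is the trace of a sum over words, which ignores the order of the
letters. The sign is the one of permuting the decorations. -/
theorem polTrace_perm (k : ℕ) {n : ℕ} (θ : Module.End ℂ E ⊗[ℂ] L) {d : Fin n → ℤ}
    {y : Fin n → EndFib T E L} (hy : ∀ i, y i ∈ endTot T E L (d i + 1)) (σ : Equiv.Perm (Fin n)) :
    polTrace k n θ y = koszul d (fun i => (σ.symm i : ℕ)) • polTrace k n θ (fun i => y (σ i)) := by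
  obtain ⟨e, η, η', he, -, -, hne⟩ := exists_isDec (fun i => (d i, y i))
  have hne' : (List.ofFn e).prod ≠ 0 := right_ne_zero_of_mul (right_ne_zero_of_mul hne)
  rw [← sub_eq_zero]
  refine tmul_eq_zero_of_ne_zero hne' (coef_eq_zero ?_)
  rw [TensorProduct.sub_tmul, map_sub, sub_eq_zero, TensorProduct.smul_tmul, ← prod_perm d e
    (fun i j => par_comm (he i) (he j)) σ, polTrace_tmul k θ he hy,
    polTrace_tmul k θ (d := fun i => d (σ i)) (e := fun i => e (σ i)) (fun i => he (σ i))
      (y := fun i => y (σ i)) fun i => hy (σ i)]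
  refine traceWord_perm θ k ?_
  exact (σ.ofFn_comp_perm fun i => letterOne (e i) (y i)).symm

end Symmetry

section Wedge

variable {T E L : Type*} [AddCommGroup T] [Module ℂ T] [AddCommGroup E] [Module ℂ E]
  [AddCommGroup L] [Module ℂ L]
  {T' E' L' : Type*} [AddCommGroup T'] [Module ℂ T'] [AddCommGroup E'] [Module ℂ E']
  [AddCommGroup L'] [Module ℂ L']

/-! ### The product with `(0,1)`-covectors -/

/-- The inclusion of `End E ⊗ ⋀ L` into the fibre, as forms of degree zero, is an algebra
homomorphism. -/
theorem inclHiggs_sq {θ : Module.End ℂ E ⊗[ℂ] L}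
    (h : (TensorProduct.map LinearMap.id (ExteriorAlgebra.ι ℂ) θ :
      Module.End ℂ E ⊗[ℂ] ExteriorAlgebra ℂ L) ^ 2 = 0) :
    (inclHiggs θ * inclHiggs θ : EndFib T E L) = 0 := by
  let Φ := Algebra.TensorProduct.map (AlgHom.id ℂ (Module.End ℂ E))
    (GradedTensorProduct.includeRight (fun i : ℕ => ⋀[ℂ]^i (ConjDual T)) (fun i : ℕ => ⋀[ℂ]^i L))
  have hΦ : ∀ θ, Φ (TensorProduct.map LinearMap.id (ExteriorAlgebra.ι ℂ) θ) = inclHiggs θ := by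
    intro θ
    induction θ using TensorProduct.induction_on with
    | zero => simp only [map_zero]
    | add x y hx hy => rw [map_add, map_add, hx, hy, map_add]
    | tmul f l => rfl
  rw [← hΦ]
  refine (map_mul Φ _ _).symm.trans ?_
  rw [← pow_two, h, map_zero]

variable (T E L) in
/-- The product with `(0,1)`-covectors on `(0,*)`-forms with values in `End E ⊗ ⋀ L`. -/
def wedgeEnd : ConjDual T →ₗ[ℂ] Module.End ℂ (EndFib T E L) :=
  LinearMap.mul ℂ (EndFib T E L) ∘ₗ (pureHom 1).flip 1 ∘ₗ ExteriorAlgebra.ι ℂ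

variable (T L) in
/-- The product with `(0,1)`-covectors on `(0,*)`-forms with values in `⨀ L`. -/
def wedgeSym : ConjDual T →ₗ[ℂ] Module.End ℂ (SymFib T L) :=
  LinearMap.mul ℂ (SymFib T L) ∘ₗ (TensorProduct.mk ℂ _ _).flip 1 ∘ₗ ExteriorAlgebra.ι ℂ

theorem wedgeSym_tmul (φ : ConjDual T) (η : Forms T) (s : SymmetricAlgebra ℂ L) :
    wedgeSym T L φ (η ⊗ₜ s) = (ExteriorAlgebra.ι ℂ φ * η) ⊗ₜ s := by
  change (ExteriorAlgebra.ι ℂ φ ⊗ₜ[ℂ] (1 : SymmetricAlgebra ℂ L)) * (η ⊗ₜ[ℂ] s) = _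
  rw [Algebra.TensorProduct.tmul_mul_tmul, one_mul]

theorem one_mem_exteriorPower : (1 : ExteriorAlgebra ℂ L) ∈ ⋀[ℂ]^0 L :=
  SetLike.GradedOne.one_mem (A := fun i : ℕ => ⋀[ℂ]^i L)

theorem ι_mem_exteriorPower (v : L) : ExteriorAlgebra.ι ℂ v ∈ ⋀[ℂ]^1 L := by
  rw [ExteriorAlgebra.exteriorPower, pow_one]; exact ⟨v, rfl⟩

theorem wedgeEnd_pure (φ : ConjDual T) (f : Module.End ℂ E) (η : Forms T) (l : ExteriorAlgebra ℂ L) :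
    wedgeEnd T E L φ (pure f η l) = pure f (ExteriorAlgebra.ι ℂ φ * η) l := by
  refine exterior_induction (P := LinearMap.eqLocus (wedgeEnd T E L φ ∘ₗ (pureHom f).flip l)
    ((pureHom f).flip l ∘ₗ LinearMap.mulLeft ℂ (ExteriorAlgebra.ι ℂ φ))) (fun p η hη => ?_) η
  change pure 1 (ExteriorAlgebra.ι ℂ φ) 1 * pure f η l = pure f (ExteriorAlgebra.ι ℂ φ * η) l
  rw [pure_mul_pure 1 f _ l hη one_mem_exteriorPower, one_mul, one_mul]
  simp

theorem wedgeEnd_anticomm (φ ψ : ConjDual T) (z : EndFib T E L) :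
    wedgeEnd T E L φ (wedgeEnd T E L ψ z) = - wedgeEnd T E L ψ (wedgeEnd T E L φ z) := by
  refine linearMap_ext_pure (φ := wedgeEnd T E L φ ∘ₗ wedgeEnd T E L ψ)
    (ψ := -(wedgeEnd T E L ψ ∘ₗ wedgeEnd T E L φ)) (fun f η l => ?_) z
  rw [LinearMap.neg_apply, LinearMap.comp_apply, LinearMap.comp_apply, wedgeEnd_pure, wedgeEnd_pure,
    wedgeEnd_pure, wedgeEnd_pure, ← mul_assoc, ι_mul_ι_anticomm, neg_mul, mul_assoc]
  exact map_neg ((pureHom f).flip l) _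

theorem wedgeSym_anticomm (φ ψ : ConjDual T) (z : SymFib T L) :
    wedgeSym T L φ (wedgeSym T L ψ z) = - wedgeSym T L ψ (wedgeSym T L φ z) := by
  induction z using TensorProduct.induction_on with
  | zero => simp only [map_zero, neg_zero]
  | add x y hx hy => rw [map_add, map_add, map_add, map_add, hx, hy, neg_add]
  | tmul η s =>
    rw [wedgeSym_tmul, wedgeSym_tmul, wedgeSym_tmul, wedgeSym_tmul, ← mul_assoc, ι_mul_ι_anticomm,
      neg_mul, mul_assoc, TensorProduct.neg_tmul]

theorem wedgeEnd_mul (φ : ConjDual T) (y z : EndFib T E L) :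
    wedgeEnd T E L φ (y * z) = wedgeEnd T E L φ y * z :=
  (mul_assoc (G := EndFib T E L) _ _ _).symm

/-- A covector passing an element of bidegree `(p, q)` picks up `(-1)^p` from the form and `(-1)^q`
from `⋀ L`, so only the total degree matters. -/
theorem wedgeEnd_mul_right (φ : ConjDual T) {n : ℤ} {y : EndFib T E L} (hy : y ∈ endTot T E L n)
    (z : EndFib T E L) :
    wedgeEnd T E L φ (y * z) = (n.negOnePow : ℤ) • (y * wedgeEnd T E L φ z) := by
  have h : wedgeEnd T E L φ y = (n.negOnePow : ℤ) • (y * pure 1 (ExteriorAlgebra.ι ℂ φ) 1) := by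
    refine Submodule.span_induction (p := fun y _ => wedgeEnd T E L φ y = ((n.negOnePow : ℤ) •
      (LinearMap.mul ℂ (EndFib T E L)).flip (pure 1 (ExteriorAlgebra.ι ℂ φ) 1)) y) ?_ ?_ ?_ ?_ hy
    · rintro _ ⟨p, q, f, η, l, rfl, hη, hl, rfl⟩
      change _ = (((p + q : ℤ)).negOnePow : ℤ) • (pure f η l * pure 1 (ExteriorAlgebra.ι ℂ φ) 1)
      rw [wedgeEnd_pure, pure_mul_pure f 1 η 1 (ι_mem_exteriorPower φ) hl, mul_one, mul_one, smul_smul,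
        par_comm (power_le_par p hη) (ι_mem_par φ)]
      have : pure f (((p * 1 : ℤ).negOnePow : ℤ) • (ExteriorAlgebra.ι ℂ φ * η)) l =
        ((p * 1 : ℤ).negOnePow : ℤ) • (pure f (ExteriorAlgebra.ι ℂ φ * η) l : EndFib T E L) :=
        map_zsmul ((pureHom f).flip l) _ _
      rw [this, smul_smul, ← Units.val_mul, ← Units.val_mul, ← Int.negOnePow_add, ← Int.negOnePow_add,
        Int.negOnePow_even]
      · simp
      · push_cast
        exact ⟨p + q, by ring⟩
    · rw [map_zero, map_zero]
    · intro x y _ _ hx hy; rw [map_add, hx, hy, map_add]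
    · intro a x _ hx; rw [map_smul, hx, map_smul]
  exact mul_mul_of_eq_zsmul (A := EndFib T E L) h z

theorem wedgeEnd_mem (φ : ConjDual T) {p q : ℕ} {z : EndFib T E L} (hz : z ∈ endPart T E L p q) :
    wedgeEnd T E L φ z ∈ endPart T E L (p + 1) q := by
  rw [add_comm, ← zero_add q]
  exact endPart_mul (Submodule.subset_span ⟨_, _, _, ι_mem_exteriorPower φ, one_mem_exteriorPower, rfl⟩)
    hz

theorem wedgeSym_mem (φ : ConjDual T) {p k : ℕ} {z : SymFib T L} (hz : z ∈ symPart T L p k) :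
    wedgeSym T L φ z ∈ symPart T L (p + 1) k := by
  refine Submodule.span_induction (p := fun z _ => wedgeSym T L φ z ∈ symPart T L (p + 1) k)
    ?_ ?_ ?_ ?_ hz
  · rintro _ ⟨η, s, hη, hs, rfl⟩
    rw [wedgeSym_tmul]
    refine Submodule.subset_span ⟨_, s, ?_, hs, rfl⟩
    rw [add_comm]
    exact SetLike.GradedMul.mul_mem (A := fun i : ℕ => ⋀[ℂ]^i (ConjDual T)) (ι_mem_exteriorPower φ) hη
  · rw [map_zero]; exact zero_mem _
  · intro x y _ _ hx hy; rw [map_add]; exact add_mem hx hy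
  · intro a x _ hx; rw [map_smul]; exact Submodule.smul_mem _ _ hx

theorem EndFib.map_wedgeEnd (τ : T' →ₗ[ℂ] T) (e : E →ₗ[ℂ] E') (e' : E' →ₗ[ℂ] E) (l : L →ₗ[ℂ] L')
    (φ : ConjDual T) (z : EndFib T E L) : EndFib.map τ e e' l (wedgeEnd T E L φ z) =
      wedgeEnd T' E' L' (ConjDual.pull τ φ) (EndFib.map τ e e' l z) := by
  refine linearMap_ext_pure (φ := EndFib.map τ e e' l ∘ₗ wedgeEnd T E L φ)
    (ψ := wedgeEnd T' E' L' (ConjDual.pull τ φ) ∘ₗ EndFib.map τ e e' l) (fun f η a => ?_) z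
  rw [LinearMap.comp_apply, LinearMap.comp_apply, wedgeEnd_pure, EndFib.map_pure, EndFib.map_pure,
    wedgeEnd_pure, _root_.map_mul (ExteriorAlgebra.map _), ExteriorAlgebra.map_apply_ι]

theorem SymFib.map_wedgeSym (τ : T' →ₗ[ℂ] T) (l : L →ₗ[ℂ] L')
    (φ : ConjDual T) (z : SymFib T L) : SymFib.map τ l (wedgeSym T L φ z) =
      wedgeSym T' L' (ConjDual.pull τ φ) (SymFib.map τ l z) := by
  induction z using TensorProduct.induction_on with
  | zero => simp only [map_zero]
  | add x y hx hy => rw [map_add, map_add, hx, hy, map_add, map_add]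
  | tmul η s =>
    rw [wedgeSym_tmul, SymFib.map_tmul, SymFib.map_tmul, wedgeSym_tmul,
      map_mul (ExteriorAlgebra.map _), ExteriorAlgebra.map_apply_ι]

/-- With the odd decoration `η` the covector becomes an even coefficient, which can later be moved
through words without sign. -/
theorem letterOne_wedgeEnd (η e : Dec) (φ : ConjDual T) (z : EndFib T E L) :
    letterOne (η * e) (wedgeEnd T E L φ z) =
      ((1 ⊗ₜ[ℂ] mk (ExteriorAlgebra.ι ℂ φ) 1 η) * letterOne e z : Letters T E L) := by
  refine linearMap_ext_pure (φ := letterOne (η * e) ∘ₗ wedgeEnd T E L φ)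
    (ψ := LinearMap.mulLeft ℂ (1 ⊗ₜ[ℂ] mk (ExteriorAlgebra.ι ℂ φ) 1 η : Letters T E L) ∘ₗ letterOne e)
    (fun f α l => ?_) z
  rw [LinearMap.comp_apply, LinearMap.comp_apply, wedgeEnd_pure, letterOne_pure, letterOne_pure,
    LinearMap.mulLeft_apply, tmul_mk_mul, one_mul, one_mul]

theorem coef_wedgeSym (η e : Dec) (φ : ConjDual T) (z : SymFib T L) :
    coef (wedgeSym T L φ z ⊗ₜ (η * e)) = mk (ExteriorAlgebra.ι ℂ φ) 1 η * coef (z ⊗ₜ e) := by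
  induction z using TensorProduct.induction_on with
  | zero => rw [map_zero, TensorProduct.zero_tmul, TensorProduct.zero_tmul, map_zero, mul_zero]
  | add x y hx hy =>
    rw [map_add, TensorProduct.add_tmul, map_add, hx, hy, TensorProduct.add_tmul, map_add, mul_add]
  | tmul α s =>
    rw [wedgeSym_tmul]
    change mk _ _ _ = _ * mk α s e
    rw [mk_mul_mk, one_mul]

theorem traceMap_one_tmul_mul_left {C : Type*} [Ring C] [Algebra ℂ C] (c : C)
    (z : Module.End ℂ E ⊗[ℂ] C) : traceMap C ((1 ⊗ₜ c) * z) = c * traceMap C z := by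
  have := traceMap_one_tmul_mul (AlgHom.id ℂ C) c z
  simpa using this

/-! ### Finiteness -/

theorem conjDual_fg (B : Type*) [NormedAddCommGroup B] [NormedSpace ℂ B] [FiniteDimensional ℂ B] :
    (⊤ : Submodule ℂ (ConjDual B)).FG := by
  refine Submodule.fg_def.2 ⟨Set.range (dzbar B), Set.finite_range _, eq_top_iff.2 fun φ _ => ?_⟩
  have h : φ = ∑ i, φ (Module.finBasis ℂ B i) • dzbar B i := by
    refine conjDual_ext fun j => ?_
    rw [LinearMap.sum_apply, Finset.sum_eq_single j]
    · simp [dzbar]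
    · intro i _ hij
      simp [dzbar, Finsupp.single_eq_of_ne hij]
    · simp
  rw [h]
  exact Submodule.sum_mem _ fun i _ => Submodule.smul_mem _ _ (Submodule.subset_span ⟨i, rfl⟩)

theorem exteriorPower_fg (h : (⊤ : Submodule ℂ L).FG) (p : ℕ) :
    (⋀[ℂ]^p L : Submodule ℂ (ExteriorAlgebra ℂ L)).FG := by
  refine Submodule.FG.pow ?_ p
  rw [LinearMap.range_eq_map]
  exact h.map _

variable {B F G : Type*} [NormedAddCommGroup B] [NormedSpace ℂ B] [FiniteDimensional ℂ B]
  [AddCommGroup F] [Module ℂ F] [FiniteDimensional ℂ F] [AddCommGroup G] [Module ℂ G]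
  [FiniteDimensional ℂ G]

-- The fibre itself may be too large, but its part of fixed bidegree has finite dimension. This is
-- what allows componentwise smoothness to be upgraded by `tens_of_forall_dual`.
variable (B F G) in
theorem exists_fg_endPart (p q : ℕ) : ∃ S : Submodule ℂ (EndFib B F G), S.FG ∧
    endPart B F G p q ≤ S := by
  refine ⟨Submodule.map₂ (TensorProduct.mk ℂ _ _) (⊤ : Submodule ℂ (Module.End ℂ F))
    (Submodule.map (GradedTensorProduct.of ℂ (fun i : ℕ => ⋀[ℂ]^i (ConjDual B))
      (fun i : ℕ => ⋀[ℂ]^i G)).toLinearMap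
      (Submodule.map₂ (TensorProduct.mk ℂ _ _) (⋀[ℂ]^p (ConjDual B)) (⋀[ℂ]^q G))), ?_, ?_⟩
  · exact Submodule.FG.map₂ _ Module.Finite.fg_top ((Submodule.FG.map₂ _
      (exteriorPower_fg (conjDual_fg B) p) (exteriorPower_fg Module.Finite.fg_top q)).map _)
  · refine Submodule.span_le.2 ?_
    rintro _ ⟨f, η, l, hη, hl, rfl⟩
    exact Submodule.apply_mem_map₂ _ trivial ⟨_, Submodule.apply_mem_map₂ _ hη hl, rfl⟩

variable (B G) in
theorem exists_fg_symPart (p k : ℕ) : ∃ S : Submodule ℂ (SymFib B G), S.FG ∧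
    symPart B G p k ≤ S := by
  refine ⟨Submodule.map₂ (TensorProduct.mk ℂ _ _) (⋀[ℂ]^p (ConjDual B))
    (LinearMap.range (SymmetricAlgebra.ι ℂ G) ^ k), ?_, ?_⟩
  · refine Submodule.FG.map₂ _ (exteriorPower_fg (conjDual_fg B) p) (Submodule.FG.pow ?_ k)
    rw [LinearMap.range_eq_map]
    exact Module.Finite.fg_top.map _
  · refine Submodule.span_le.2 ?_
    rintro _ ⟨η, s, hη, hs, rfl⟩
    exact Submodule.apply_mem_map₂ _ hη hs

end Wedge

section SmoothWords

variable {B : Type*} [NormedAddCommGroup B] [NormedSpace ℂ B] {U : Set B}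
  {A : Type*} [Ring A] [Algebra ℂ A]

/-! ### Smoothness and derivatives of words -/

theorem SmTens.mul {g h : B → A} (hg : SmTens U g) (hh : SmTens U h) : SmTens U fun z => g z * h z :=
  SmTens.bilin hg hh (LinearMap.mul ℂ A)

variable (U A) in
/-- The smooth functions with values in an algebra. -/
def smoothFunctions : Subsemiring (B → A) where
  carrier := {g | SmTens U g}
  mul_mem' := SmTens.mul
  one_mem' := HolTens.smTens (holTens_const U 1)
  add_mem' := .add _ _
  zero_mem' := .zero

theorem wordSum_apply (Θ : B → A) (k : ℕ) (l : List (B → A)) (z : B) :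
    wordSum Θ k l z = wordSum (Θ z) k (l.map fun g => g z) :=
  map_wordSum (Pi.evalRingHom (fun _ : B => A) z) Θ k l

theorem SmTens.wordSum {Θ : B → A} (hΘ : SmTens U Θ) (k : ℕ) {n : ℕ} {Y : Fin n → B → A}
    (hY : ∀ i, SmTens U (Y i)) : SmTens U fun z => wordSum (Θ z) k (List.ofFn fun i => Y i z) := by
  have h : LInf.wordSum Θ k (List.ofFn Y) ∈ smoothFunctions U A :=
    wordSum_mem (smoothFunctions U A) hΘ k fun a ha => by
      obtain ⟨i, rfl⟩ := (List.mem_ofFn' _ _).1 ha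
      exact hY i
  have he : LInf.wordSum Θ k (List.ofFn Y) =
      fun z => LInf.wordSum (Θ z) k (List.ofFn fun i => Y i z) := by
    funext z
    rw [wordSum_apply, List.map_ofFn]
    rfl
  rw [← he]
  exact h

variable [FiniteDimensional ℂ B]

/-- `wordSum_derivation` applied to the relation "smooth on `U`, with this derivative at `y`".
Holomorphy of `Θ` removes the words in which `Θ` is differentiated. -/
theorem dbarCoord_wordSum (hU : IsOpen U) {y : B} (hy : y ∈ U) {Θ : B → A} (hΘ : HolTens U Θ) (k : ℕ)
    {n : ℕ} {Y : Fin n → B → A} (hY : ∀ i, SmTens U (Y i)) (i : Fin (Module.finrank ℂ B)) :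
    dbarCoord i (fun z => wordSum (Θ z) k (List.ofFn fun j => Y j z)) y =
      pickSum (List.finRange n) fun a t =>
        wordSum (Θ y) k (dbarCoord i (Y a) y :: t.map fun b => Y b y) := by
  have h := wordSum_derivation (Pi.evalRingHom (fun _ : B => A) y)
    (fun (g : B → A) g' => SmTens U g ∧ dbarCoord i g y = g') ⟨.zero, dbarCoord_zero y i⟩
    ⟨HolTens.smTens (holTens_const U 1), dbarCoord_eq_zero hU (holTens_const U 1) hy i⟩
    (fun a a' b b' ha hb => ⟨.add _ _ ha.1 hb.1, by
      rw [← ha.2, ← hb.2]; exact dbarCoord_add hU ha.1 hb.1 hy i⟩)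
    (fun a a' b b' ha hb => ⟨SmTens.mul ha.1 hb.1, by
      rw [← ha.2, ← hb.2]; exact dbarCoord_bilin hU ha.1 hb.1 hy (LinearMap.mul ℂ A) i⟩)
    (θ := Θ) (θ' := 0) ⟨HolTens.smTens hΘ, dbarCoord_eq_zero hU hΘ hy i⟩
    (δ := fun g => dbarCoord i g y) k (l := (List.finRange n).map Y) (fun a ha => by
      obtain ⟨j, -, rfl⟩ := List.mem_map.1 ha
      exact ⟨hY j, rfl⟩)
  have h2 := h.2
  rw [wordSum_cons_zero, zero_add, pickSum_map] at h2
  have he : wordSum Θ k ((List.finRange n).map Y) =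
      fun z => wordSum (Θ z) k (List.ofFn fun i => Y i z) := by
    funext z
    rw [wordSum_apply, List.map_map, List.ofFn_eq_map]
    rfl
  rw [he] at h2
  rw [h2]
  refine pickSum_congr fun a t _ => ?_
  rw [List.map_map]
  rfl

end SmoothWords

/-! ### The Leibniz rule for the polarized trace in a chart -/

section Model

variable {B : Type*} [NormedAddCommGroup B] [NormedSpace ℂ B] [FiniteDimensional ℂ B] {U : Set B}
  {y : B} {F G : Type*} [AddCommGroup F] [Module ℂ F] [AddCommGroup G] [Module ℂ G]

theorem SmTens.polTrace {θ : B → Module.End ℂ F ⊗[ℂ] G} (hθ : SmTens U θ) (k : ℕ) {n : ℕ}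
    {g : Fin n → B → EndFib B F G} (hg : ∀ i, SmTens U (g i)) :
    SmTens U fun z => polTrace k n (θ z) fun i => g i z := by
  simp only [polTrace_eq_wordSum]
  exact Tens.map (SmTens.wordSum (A := Slots n B F G) (Tens.map hθ (placeHiggs n)) k
    fun i => Tens.map (hg i) (place i)) (wedgeTrace n)

theorem pickSum_smul_sum {α κ M : Type*} [AddCommMonoid M] (l : List α) (s : Finset κ)
    (F : κ → α → List α → M) :
    ∑ i ∈ s, pickSum l (F i) = pickSum l fun a t => ∑ i ∈ s, F i a t := by
  classical
  induction s using Finset.induction_on with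
  | empty => simp [pickSum_zero]
  | insert i s hi ih => simp only [Finset.sum_insert hi, ih, pickSum_add]

theorem traceWord_cons_sum (θ : Module.End ℂ F ⊗[ℂ] G) (k : ℕ) {κ : Type*} (s : Finset κ)
    (a : κ → Letters B F G) (t : List (Letters B F G)) :
    traceWord θ k ((∑ i ∈ s, a i) :: t) = ∑ i ∈ s, traceWord θ k (a i :: t) := by
  classical
  induction s using Finset.induction_on with
  | empty =>
    simp only [Finset.sum_empty]
    exact (congrArg (traceMap _) (wordSum_cons_zero (A := Letters B F G) _ k t)).trans (map_zero _)
  | insert i s hi ih => rw [Finset.sum_insert hi, traceWord_cons_add, ih, Finset.sum_insert hi]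

theorem evenLetters_commute {c : Coef B G} (hc : c ∈ evenCoeff B G) {z : Letters B F G}
    (hz : z ∈ evenLetters B F G) : Commute ((1 : Module.End ℂ F) ⊗ₜ[ℂ] c) z := by
  rw [mem_evenLetters] at hz
  refine Submodule.span_induction (p := fun z _ => Commute ((1 : Module.End ℂ F) ⊗ₜ[ℂ] c) z)
    ?_ ?_ ?_ ?_ hz
  · rintro _ ⟨f, c', hc', rfl⟩
    unfold Commute SemiconjBy
    rw [Algebra.TensorProduct.tmul_mul_tmul, Algebra.TensorProduct.tmul_mul_tmul, one_mul, mul_one,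
      evenCoeff_comm hc hc']
  · exact Commute.zero_right _
  · exact fun x y _ _ hx hy => hx.add_right hy
  · exact fun a x _ hx => hx.smul_right a

/-- The analytic half of the component equation. Its right side has exactly the form of the terms
left over in `coef_afterCoder`, up to sign. -/
theorem coef_dol_polTrace (hU : IsOpen U) (hy : y ∈ U) {θ : B → Module.End ℂ F ⊗[ℂ] G}
    (hθ : HolTens U θ) (k : ℕ) {n : ℕ} {g : Fin n → B → EndFib B F G} (hg : ∀ i, SmTens U (g i))
    {d : Fin n → ℤ} (hgd : ∀ i, ∀ z ∈ U, g i z ∈ endTot B F G (d i + 1)) {e : Fin n → Dec}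
    (he : ∀ i, e i ∈ par _ (d i)) {η : Dec} (hη : η ∈ par _ 1) :
    coef (dol (wedgeSym B G) (fun z => polTrace k n (θ z) fun i => g i z) y ⊗ₜ
      (η * (List.ofFn e).prod)) = pickSum (List.finRange n) fun a t => traceWord (θ y) k
        (letterOne (η * e a) (dol (wedgeEnd B F G) (g a) y) ::
          t.map fun b => letterOne (e b) (g b y)) := by
  have hP : SmTens U fun z => polTrace k n (θ z) fun i => g i z :=
    SmTens.polTrace (HolTens.smTens hθ) k hg
  have hΘ : HolTens U fun z => letterHiggs B (θ z) := Tens.map hθ (letterHiggs B)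
  have hY : ∀ i, SmTens U fun z => letterOne (e i) (g i z) := fun i => Tens.map (hg i) _
  let Ψ : SymFib B G →ₗ[ℂ] Coef B G :=
    coef ∘ₗ (TensorProduct.mk ℂ (SymFib B G) Dec).flip (List.ofFn e).prod
  have h1 : ∀ i, Ψ (dbarCoord i (fun z => polTrace k n (θ z) fun i => g i z) y) =
      pickSum (List.finRange n) fun a t => traceWord (θ y) k
        (letterOne (e a) (dbarCoord i (g a) y) :: t.map fun b => letterOne (e b) (g b y)) := by
    intro i
    rw [← dbarCoord_map hU hP hy Ψ]
    have hE : Set.EqOn (fun z => Ψ (polTrace k n (θ z) fun i => g i z)) (fun z =>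
        traceMap (Coef B G) (wordSum (letterHiggs B (θ z)) k
          (List.ofFn fun i => letterOne (e i) (g i z)))) U := fun z hz =>
      polTrace_tmul k (θ z) he fun i => hgd i z hz
    rw [dbarCoord_congr hU (Tens.map hP Ψ) hy hE,
      dbarCoord_map hU (SmTens.wordSum (A := Letters B F G) (HolTens.smTens hΘ) k hY) hy]
    have h2 := dbarCoord_wordSum (A := Letters B F G) hU hy hΘ k hY i
    refine (congrArg (traceMap (Coef B G)) h2).trans ?_
    refine (map_pickSum (traceMap (Coef B G)).toAddMonoidHom _ _).trans
      (pickSum_congr fun a t _ => ?_)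
    rw [dbarCoord_map hU (hg a) hy]
    rfl
  have h3 : coef (dol (wedgeSym B G) (fun z => polTrace k n (θ z) fun i => g i z) y ⊗ₜ
      (η * (List.ofFn e).prod)) = ∑ i, mk (ExteriorAlgebra.ι ℂ (dzbar B i)) 1 η *
        Ψ (dbarCoord i (fun z => polTrace k n (θ z) fun i => g i z) y) := by
    unfold dol
    rw [TensorProduct.sum_tmul, map_sum]
    exact Finset.sum_congr rfl fun i _ => coef_wedgeSym _ _ _ _
  rw [h3]
  simp only [h1]
  -- The covector `dz̄ᵢ` decorated by `η` is even, so it commutes with all letters and can be moved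
  -- into the slot that was differentiated.
  have h4 : ∀ i : Fin (Module.finrank ℂ B), mk (ExteriorAlgebra.ι ℂ (dzbar B i)) 1 η *
      (pickSum (List.finRange n) fun a t => traceWord (θ y) k
        (letterOne (e a) (dbarCoord i (g a) y) :: t.map fun b => letterOne (e b) (g b y))) =
      pickSum (List.finRange n) fun a t => traceWord (θ y) k (letterOne (η * e a)
        (wedgeEnd B F G (dzbar B i) (dbarCoord i (g a) y)) ::
          t.map fun b => letterOne (e b) (g b y)) := by
    intro i
    have hev : mk (ExteriorAlgebra.ι ℂ (dzbar B i)) 1 η ∈ evenCoeff B G :=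
      mk_mem_evenCoeff 1 (ι_mem_par _) hη
    refine (map_pickSum (AddMonoidHom.mulLeft _) _ _).trans (pickSum_congr fun a t _ => ?_)
    rw [AddMonoidHom.coe_mulLeft, letterOne_wedgeEnd]
    unfold traceWord
    rw [← traceMap_one_tmul_mul_left]
    refine congrArg (traceMap (Coef B G)) (wordSum_cons_mul (A := Letters B F G) _ k _ _ _
      (evenLetters_commute hev (letterHiggs_mem _)) fun b hb => ?_).symm
    obtain ⟨j, -, rfl⟩ := List.mem_map.1 hb
    exact evenLetters_commute hev (letterOne_mem (he j) (hgd j y hy))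
  rw [Finset.sum_congr rfl fun i _ => h4 i, pickSum_smul_sum]
  refine pickSum_congr fun a t _ => ?_
  unfold dol
  rw [map_sum, traceWord_cons_sum]

end Model

section Frames

variable {B : Type*} [NormedAddCommGroup B] [NormedSpace ℂ B] [FiniteDimensional ℂ B]
  {X : Type*} [TopologicalSpace X] [ChartedSpace B X] [IsManifold 𝓘(ℂ, B) ω X]
  {M : Type*} [AddCommGroup M] [Module ℂ M] {Fib : X → Type*}
  [∀ x, AddCommGroup (Fib x)] [∀ x, Module ℂ (Fib x)]

/-! ### Holomorphic systems of frames -/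

variable (B) in
/-- The domain, in the chart at `x₁`, of the change from the chart and the frames around `x₁` to those
around `x₀`. -/
def transDom (dom : X → Set X) (x₀ x₁ : X) : Set B :=
  localDom B dom x₁ ∩ (extChartAt 𝓘(ℂ, B) x₁).symm ⁻¹' ((extChartAt 𝓘(ℂ, B) x₀).source ∩ dom x₀)

variable (B) in
/-- The change of charts. -/
def chartChange (x₀ x₁ : X) (z : B) : B :=
  extChartAt 𝓘(ℂ, B) x₀ ((extChartAt 𝓘(ℂ, B) x₁).symm z)

theorem isOpen_localDom {dom : X → Set X} (h : ∀ x, IsOpen (dom x)) (x₀ : X) :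
    IsOpen (localDom B dom x₀) :=
  (continuousOn_extChartAt_symm x₀).isOpen_inter_preimage (isOpen_extChartAt_target x₀) (h x₀)

theorem isOpen_transDom {dom : X → Set X} (h : ∀ x, IsOpen (dom x)) (x₀ x₁ : X) :
    IsOpen (transDom B dom x₀ x₁) :=
  ((continuousOn_extChartAt_symm x₁).mono Set.inter_subset_left).isOpen_inter_preimage
    (isOpen_localDom h x₁) ((isOpen_extChartAt_source x₀).inter (h x₀))

theorem mem_localDom {dom : X → Set X} (h : ∀ x, x ∈ dom x) (x : X) :
    extChartAt 𝓘(ℂ, B) x x ∈ localDom B dom x :=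
  ⟨mem_extChartAt_target x, by
    rw [Set.mem_preimage, extChartAt_to_inv]; exact h x⟩

theorem mem_transDom {dom : X → Set X} (h : ∀ x, x ∈ dom x) {x₁ : X} {z : B}
    (hz : z ∈ localDom B dom x₁) : z ∈ transDom B dom ((extChartAt 𝓘(ℂ, B) x₁).symm z) x₁ :=
  ⟨hz, mem_extChartAt_source _, h _⟩

theorem chartChange_mapsTo {dom : X → Set X} (x₀ x₁ : X) :
    Set.MapsTo (chartChange B x₀ x₁) (transDom B dom x₀ x₁) (localDom B dom x₀) := fun z hz =>
  ⟨(extChartAt 𝓘(ℂ, B) x₀).map_source hz.2.1, by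
    rw [Set.mem_preimage, chartChange, (extChartAt 𝓘(ℂ, B) x₀).left_inv hz.2.1]; exact hz.2.2⟩

theorem contDiffOn_chartChange {dom : X → Set X} (x₀ x₁ : X) :
    ContDiffOn ℂ ∞ (chartChange B x₀ x₁) (transDom B dom x₀ x₁) := by
  have h := contDiffOn_ext_coord_change (n := ω) (I := 𝓘(ℂ, B)) x₀ x₁
  refine (h.mono fun z hz => ?_).of_le le_top
  rw [PartialEquiv.trans_source]
  exact ⟨hz.1.1, hz.2.1⟩

/-- The expressions of `s` in the frames are finite sums of smooth functions. -/
def SmSec (loc : ∀ (_ x : X), Fib x →ₗ[ℂ] M) (dom : X → Set X) (s : ∀ x, Fib x) : Prop :=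
  ∀ x₀, SmTens (localDom B dom x₀) (localRep loc s x₀)

theorem SmSec.isSmooth {loc : ∀ (_ x : X), Fib x →ₗ[ℂ] M} {dom : X → Set X} {s : ∀ x, Fib x}
    (h : SmSec (B := B) loc dom s) : IsSmooth (B := B) loc dom s := fun x₀ l => SmTens.dual (h x₀) l

theorem SmSec.add {loc : ∀ (_ x : X), Fib x →ₗ[ℂ] M} {dom : X → Set X} {s t : ∀ x, Fib x}
    (hs : SmSec (B := B) loc dom s) (ht : SmSec (B := B) loc dom t) :
    SmSec (B := B) loc dom (s + t) := fun x₀ =>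
  .congr _ _ (fun _ _ => (LinearMap.map_add _ _ _).symm) (.add _ _ (hs x₀) (ht x₀))

theorem SmSec.smul {loc : ∀ (_ x : X), Fib x →ₗ[ℂ] M} {dom : X → Set X} {s : ∀ x, Fib x} (a : ℂ)
    (hs : SmSec (B := B) loc dom s) : SmSec (B := B) loc dom (a • s) := fun x₀ =>
  .congr _ _ (fun _ _ => (LinearMap.map_smul _ _ _).symm) (Tens.map (hs x₀) (LinearMap.lsmul ℂ M a))

theorem SmSec.zero {loc : ∀ (_ x : X), Fib x →ₗ[ℂ] M} {dom : X → Set X} :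
    SmSec (B := B) loc dom 0 := fun _ =>
  .congr _ _ (fun _ _ => (LinearMap.map_zero _).symm) .zero

/-- The frames are related by transition maps `A` that are smooth, `∂̄`-closed and compatible with the
product with `(0,1)`-covectors. -/
structure HolFrames (loc : ∀ (_ x : X), Fib x →ₗ[ℂ] M) (unloc : ∀ x, M →ₗ[ℂ] Fib x)
    (dom : X → Set X) (W : ConjDual B →ₗ[ℂ] Module.End ℂ M) (A : X → X → B → M →ₗ[ℂ] M) : Prop where
  isOpen_dom : ∀ x, IsOpen (dom x)
  mem_dom : ∀ x, x ∈ dom x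
  loc_unloc : ∀ x m, loc x x (unloc x m) = m
  unloc_loc : ∀ x v, unloc x (loc x x v) = v
  trans : ∀ x₀ x₁, ∀ z ∈ transDom B dom x₀ x₁, ∀ v,
    loc x₁ ((extChartAt 𝓘(ℂ, B) x₁).symm z) v =
      A x₀ x₁ z (loc x₀ ((extChartAt 𝓘(ℂ, B) x₁).symm z) v)
  smooth : ∀ x₀ x₁ m, SmTens (transDom B dom x₀ x₁) fun z => A x₀ x₁ z m
  closed : ∀ x₀ x₁ m, ∀ z ∈ transDom B dom x₀ x₁, dol W (fun z => A x₀ x₁ z m) z = 0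
  wedge : ∀ x₀ x₁, ∀ z ∈ transDom B dom x₀ x₁, ∀ φ m, A x₀ x₁ z (W φ m) =
    W (ConjDual.pull (fderiv ℂ (chartChange B x₀ x₁) z : B →ₗ[ℂ] B) φ) (A x₀ x₁ z m)
  anticomm : ∀ φ ψ m, W φ (W ψ m) = - W ψ (W φ m)

namespace HolFrames

variable {loc : ∀ (_ x : X), Fib x →ₗ[ℂ] M} {unloc : ∀ x, M →ₗ[ℂ] Fib x}
    {dom : X → Set X} {W : ConjDual B →ₗ[ℂ] Module.End ℂ M} {A : X → X → B → M →ₗ[ℂ] M}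
    (h : HolFrames loc unloc dom W A) {s t : ∀ x, Fib x}

include h

theorem localRep_eq (s : ∀ x, Fib x) {x₀ x₁ : X} {z : B} (hz : z ∈ transDom B dom x₀ x₁) :
    A x₀ x₁ z (localRep loc s x₀ (chartChange B x₀ x₁ z)) = localRep loc s x₁ z := by
  have hc : ∀ x', x' = (extChartAt 𝓘(ℂ, B) x₁).symm z →
      loc x₀ x' (s x') = loc x₀ _ (s ((extChartAt 𝓘(ℂ, B) x₁).symm z)) := by rintro _ rfl; rfl
  unfold localRep
  rw [h.trans x₀ x₁ z hz]
  exact congrArg _ (hc _ ((extChartAt 𝓘(ℂ, B) x₀).left_inv hz.2.1))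

/-- The operator `∂̄` in the chart and the frames around `x`, at `x`. -/
theorem loc_dbar (s : ∀ x, Fib x) (x : X) : loc x x (dbar loc unloc (fun φ m => W φ m) s x) =
    dol W (localRep loc s x) (extChartAt 𝓘(ℂ, B) x x) := h.loc_unloc x _

theorem ext {s t : ∀ x, Fib x} (hst : ∀ x, loc x x (s x) = loc x x (t x)) : s = t :=
  funext fun x => by rw [← h.unloc_loc x (s x), hst, h.unloc_loc]

/-- At each point `dbar` uses the chart and the frames of that very point. Comparing these with the
ones around `x₀` by `dol_transform` shows that `∂̄` has the expected expression throughout a chart.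
-/
theorem localRep_dbar (hs : SmSec (B := B) loc dom s) {x₀ : X} {z : B} (hz : z ∈ localDom B dom x₀) :
    localRep loc (dbar loc unloc (fun φ m => W φ m) s) x₀ z = dol W (localRep loc s x₀) z := by
  set x := (extChartAt 𝓘(ℂ, B) x₀).symm z with hx
  have hV : z ∈ transDom B dom x x₀ := mem_transDom h.mem_dom hz
  have ho := isOpen_transDom (B := B) h.isOpen_dom x x₀
  have h1 : localRep loc (dbar loc unloc (fun φ m => W φ m) s) x₀ z =
      A x x₀ z (dol W (localRep loc s x) (chartChange B x x₀ z)) := by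
    unfold localRep
    rw [h.trans x x₀ z hV, ← hx, h.loc_dbar]
    rfl
  have ht := SmTens.transform (hs x) (contDiffOn_chartChange x x₀) (chartChange_mapsTo x x₀)
    (h.smooth x x₀)
  rw [h1, ← dol_transform ho (isOpen_localDom h.isOpen_dom x) (hs x) (contDiffOn_chartChange x x₀)
    (chartChange_mapsTo x x₀) (h.smooth x x₀) hV (fun m => h.closed x x₀ m z hV)
    (fun φ m => h.wedge x x₀ z hV φ m)]
  exact dol_congr ho ht hV fun w hw => h.localRep_eq s hw

theorem smSec_dbar (hs : SmSec (B := B) loc dom s) :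
    SmSec (B := B) loc dom (dbar loc unloc (fun φ m => W φ m) s) := fun x₀ =>
  .congr _ _ (fun _ hz => (h.localRep_dbar hs hz).symm)
    (SmTens.dol (isOpen_localDom h.isOpen_dom x₀) (hs x₀))

theorem dbar_dbar (hs : SmSec (B := B) loc dom s) :
    dbar loc unloc (fun φ m => W φ m) (dbar loc unloc (fun φ m => W φ m) s) = 0 := by
  refine h.ext fun x => ?_
  have ho := isOpen_localDom (B := B) h.isOpen_dom x
  have hx := mem_localDom (B := B) h.mem_dom x
  rw [h.loc_dbar, dol_congr ho (h.smSec_dbar hs x) hx fun z hz => h.localRep_dbar hs hz,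
    dol_dol ho (hs x) hx h.anticomm]
  exact (map_zero _).symm

theorem dbar_add (hs : SmSec (B := B) loc dom s) (ht : SmSec (B := B) loc dom t) :
    dbar loc unloc (fun φ m => W φ m) (s + t) =
      dbar loc unloc (fun φ m => W φ m) s + dbar loc unloc (fun φ m => W φ m) t := by
  refine h.ext fun x => ?_
  have ho := isOpen_localDom (B := B) h.isOpen_dom x
  have hx := mem_localDom (B := B) h.mem_dom x
  rw [Pi.add_apply, map_add, h.loc_dbar, h.loc_dbar, h.loc_dbar, ← dol_add ho (hs x) (ht x) hx]
  exact dol_congr ho (hs.add ht x) hx fun z _ => LinearMap.map_add _ _ _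

theorem dbar_smul (a : ℂ) (hs : SmSec (B := B) loc dom s) :
    dbar loc unloc (fun φ m => W φ m) (a • s) = a • dbar loc unloc (fun φ m => W φ m) s := by
  refine h.ext fun x => ?_
  have ho := isOpen_localDom (B := B) h.isOpen_dom x
  have hx := mem_localDom (B := B) h.mem_dom x
  rw [Pi.smul_apply, map_smul, h.loc_dbar, h.loc_dbar, ← dol_smul ho (hs x) hx]
  exact dol_congr ho (hs.smul a x) hx fun z _ => LinearMap.map_smul _ _ _

/-- Smoothness can be tested in the frames around each point. -/
theorem isSmooth_of_local (hs : ∀ x, ∃ V, IsOpen V ∧ extChartAt 𝓘(ℂ, B) x x ∈ V ∧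
    V ⊆ localDom B dom x ∧ SmTens V (localRep loc s x)) : IsSmooth (B := B) loc dom s := by
  intro x₀ l z hz
  set x := (extChartAt 𝓘(ℂ, B) x₀).symm z with hx
  obtain ⟨V, hVo, hxV, hV, hsV⟩ := hs x
  have hz' : z ∈ transDom B dom x x₀ := mem_transDom h.mem_dom hz
  have ho := isOpen_transDom (B := B) h.isOpen_dom x x₀
  have hc := contDiffOn_chartChange (B := B) (dom := dom) x x₀
  have ho' : IsOpen (transDom B dom x x₀ ∩ chartChange B x x₀ ⁻¹' V) :=
    hc.continuousOn.isOpen_inter_preimage ho hVo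
  have ht : SmTens (transDom B dom x x₀ ∩ chartChange B x x₀ ⁻¹' V) (localRep loc s x₀) :=
    .congr _ _ (fun w hw => h.localRep_eq s hw.1)
      (SmTens.transform hsV (hc.mono Set.inter_subset_left) (fun w hw => hw.2)
        fun m => SmTens.mono (h.smooth x x₀ m) Set.inter_subset_left)
  exact ((SmTens.dual ht l).contDiffAt (ho'.mem_nhds ⟨hz', hxV⟩)).contDiffWithinAt

end HolFrames

end Frames

section Bundles

variable {B : Type*} [NormedAddCommGroup B] [NormedSpace ℂ B] [FiniteDimensional ℂ B]
  {X : Type*} [TopologicalSpace X] [ChartedSpace B X] [IsManifold 𝓘(ℂ, B) ω X]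
  {F : Type*} [NormedAddCommGroup F] [NormedSpace ℂ F] [FiniteDimensional ℂ F]
  {E : X → Type*} [TopologicalSpace (Bundle.TotalSpace F E)] [∀ x, AddCommGroup (E x)]
  [∀ x, Module ℂ (E x)] [∀ x, TopologicalSpace (E x)] [FiberBundle F E] [VectorBundle ℂ F E]
  {G : Type*} [NormedAddCommGroup G] [NormedSpace ℂ G] [FiniteDimensional ℂ G]
  {L : X → Type*} [TopologicalSpace (Bundle.TotalSpace G L)] [∀ x, AddCommGroup (L x)]
  [∀ x, Module ℂ (L x)] [∀ x, TopologicalSpace (L x)] [FiberBundle G L] [VectorBundle ℂ G L]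

/-! ### Frames of vector bundles -/

theorem toFrame_comp_fromFrame {x₀ x : X} (hx : x ∈ (trivializationAt F E x₀).baseSet) :
    toFrame F E x₀ x ∘ₗ fromFrame F E x₀ x = LinearMap.id :=
  LinearMap.ext fun v => (trivializationAt F E x₀).linearMapAt_symmₗ hx v

theorem fromFrame_comp_toFrame {x₀ x : X} (hx : x ∈ (trivializationAt F E x₀).baseSet) :
    fromFrame F E x₀ x ∘ₗ toFrame F E x₀ x = LinearMap.id :=
  LinearMap.ext fun v => (trivializationAt F E x₀).symmₗ_linearMapAt hx v

variable (F E) in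
/-- The change of frames, as a function in the chart at `y`. -/
def frameChange (x₀ x₁ y : X) (z : B) : Module.End ℂ F :=
  toFrame F E x₁ ((extChartAt 𝓘(ℂ, B) y).symm z) ∘ₗ fromFrame F E x₀ ((extChartAt 𝓘(ℂ, B) y).symm z)

theorem toFrame_fromFrame_eq {x₀ x₁ x : X} (hx : x ∈ (trivializationAt F E x₀).baseSet)
    (hx' : x ∈ (trivializationAt F E x₁).baseSet) : toFrame F E x₁ x ∘ₗ fromFrame F E x₀ x =
      (((trivializationAt F E x₀).coordChangeL ℂ (trivializationAt F E x₁) x : F ≃L[ℂ] F) :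
        F →ₗ[ℂ] F) := by
  refine LinearMap.ext fun v => ?_
  rw [LinearMap.comp_apply, toFrame, fromFrame, Bundle.Trivialization.linearMapAt_apply, if_pos hx',
    Bundle.Trivialization.symmₗ_apply _ hx]
  exact (Bundle.Trivialization.coordChangeL_apply _ _ ⟨hx, hx'⟩ v).symm

theorem holTens_frameChange [ContMDiffVectorBundle ω F E 𝓘(ℂ, B)] {x₀ x₁ y : X} {V : Set B}
    (hV : V ⊆ (extChartAt 𝓘(ℂ, B) y).target)
    (h₀ : ∀ z ∈ V, (extChartAt 𝓘(ℂ, B) y).symm z ∈ (trivializationAt F E x₀).baseSet)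
    (h₁ : ∀ z ∈ V, (extChartAt 𝓘(ℂ, B) y).symm z ∈ (trivializationAt F E x₁).baseSet) :
    HolTens V (frameChange (B := B) F E x₀ x₁ y) := by
  have hc : ContDiffOn ℂ ∞ (fun z => (((trivializationAt F E x₀).coordChangeL ℂ
      (trivializationAt F E x₁) ((extChartAt 𝓘(ℂ, B) y).symm z) : F ≃L[ℂ] F) : F →L[ℂ] F)) V := by
    have h := contMDiffOn_coordChangeL (n := ω) (IB := 𝓘(ℂ, B)) (trivializationAt F E x₀)
      (trivializationAt F E x₁)
    have h2 := h.comp ((contMDiffOn_extChartAt_symm (I := 𝓘(ℂ, B)) (n := ω) y).mono hV)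
      fun z hz => ⟨h₀ z hz, h₁ z hz⟩
    exact (contMDiffOn_iff_contDiffOn.1 h2).of_le le_top
  refine .congr (fun z => ((((trivializationAt F E x₀).coordChangeL ℂ
      (trivializationAt F E x₁) ((extChartAt 𝓘(ℂ, B) y).symm z) : F ≃L[ℂ] F) : F →L[ℂ] F) :
        F →ₗ[ℂ] F)) _ (fun z hz => (toFrame_fromFrame_eq (h₀ z hz) (h₁ z hz)).symm) ?_
  refine tens_of_forall_dual (S := ⊤) Module.Finite.fg_top (fun _ _ => trivial) fun l => ?_
  exact (LinearMap.toContinuousLinearMap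
    (l ∘ₗ (ContinuousLinearMap.coeLM ℂ : (F →L[ℂ] F) →ₗ[ℂ] F →ₗ[ℂ] F))).contDiff.comp_contDiffOn hc

/-- Both sides are the change of tangent coordinates from the chart at `x₁` to that at `x₀`; on the
right it factors through the preferred chart at the point itself. -/
theorem fderiv_chartChange {dom : X → Set X} {x₀ x₁ : X} {z : B} (hz : z ∈ transDom B dom x₀ x₁) :
    (fderiv ℂ (chartChange B x₀ x₁) z : B →ₗ[ℂ] B) =
      toChart B x₀ ((extChartAt 𝓘(ℂ, B) x₁).symm z) ∘ₗ
        fromChart B x₁ ((extChartAt 𝓘(ℂ, B) x₁).symm z) := by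
  set x := (extChartAt 𝓘(ℂ, B) x₁).symm z with hx
  have h1 : x ∈ (extChartAt 𝓘(ℂ, B) x₁).source := (extChartAt 𝓘(ℂ, B) x₁).map_target hz.1.1
  have h0 : x ∈ (extChartAt 𝓘(ℂ, B) x₀).source := hz.2.1
  have h1' : x ∈ (chartAt B x₁).source := by rwa [extChartAt_source] at h1
  have h0' : x ∈ (chartAt B x₀).source := by rwa [extChartAt_source] at h0
  refine LinearMap.ext fun v => ?_
  have hto : ∀ v, toChart B x₀ x v = tangentCoordChange 𝓘(ℂ, B) x x₀ x v := fun v => by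
    have := TangentBundle.continuousLinearMapAt_trivializationAt_eq_core (I := 𝓘(ℂ, B)) h0'
    exact DFunLike.congr_fun this v
  have hfrom : ∀ v, fromChart B x₁ x v = tangentCoordChange 𝓘(ℂ, B) x₁ x x v := fun v => by
    have := TangentBundle.symmL_trivializationAt_eq_core (I := 𝓘(ℂ, B)) h1'
    exact DFunLike.congr_fun this v
  rw [LinearMap.comp_apply, hto, hfrom, tangentCoordChange_comp ⟨⟨h1, mem_extChartAt_source x⟩, h0⟩,
    tangentCoordChange_def, hx, (extChartAt 𝓘(ℂ, B) x₁).right_inv hz.1.1]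
  change _ = fderivWithin ℂ (chartChange B x₀ x₁) (Set.range 𝓘(ℂ, B)) z v
  rw [ModelWithCorners.range_eq_univ, fderivWithin_univ]
  rfl

theorem fromChart_comp_toChart {x₀ x : X} (hx : x ∈ (extChartAt 𝓘(ℂ, B) x₀).source) :
    fromChart B x₀ x ∘ₗ toChart B x₀ x = LinearMap.id :=
  fromFrame_comp_toFrame (by rwa [TangentBundle.trivializationAt_baseSet, ← extChartAt_source 𝓘(ℂ, B)])

theorem toChart_comp_fromChart {x₀ x : X} (hx : x ∈ (extChartAt 𝓘(ℂ, B) x₀).source) :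
    toChart B x₀ x ∘ₗ fromChart B x₀ x = LinearMap.id :=
  toFrame_comp_fromFrame (by rwa [TangentBundle.trivializationAt_baseSet, ← extChartAt_source 𝓘(ℂ, B)])

/-! ### Functoriality of the exterior and the symmetric algebra in holomorphic families -/

theorem holTens_exteriorMap {V : Set B} {l : B → Module.End ℂ G} (hl : HolTens V l)
    (a : ExteriorAlgebra ℂ G) : HolTens V fun z => ExteriorAlgebra.map (l z) a := by
  induction a using CliffordAlgebra.left_induction with
  | algebraMap r =>
    exact .congr _ _ (fun z _ => (AlgHom.commutes (ExteriorAlgebra.map (l z)) r).symm)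
      (holTens_const V (algebraMap ℂ (ExteriorAlgebra ℂ G) r))
  | add x y hx hy => simpa only [map_add] using Tens.add _ _ hx hy
  | ι_mul x v hx =>
    have h := HolTens.bilin (Tens.map hl (ExteriorAlgebra.ι ℂ ∘ₗ LinearMap.applyₗ v)) hx
      (LinearMap.mul ℂ (ExteriorAlgebra ℂ G))
    refine .congr _ _ (fun z _ => ?_) h
    refine Eq.trans ?_ (map_mul (ExteriorAlgebra.map (l z)) _ _).symm
    exact congrArg (· * _) (ExteriorAlgebra.map_apply_ι (l z) v).symm

theorem holTens_symMap {V : Set B} {l : B → Module.End ℂ G} (hl : HolTens V l)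
    (a : SymmetricAlgebra ℂ G) : HolTens V fun z => symMap (l z) a := by
  induction a using SymmetricAlgebra.induction with
  | algebraMap r =>
    exact .congr _ _ (fun z _ => (AlgHom.commutes (symMap (l z)) r).symm)
      (holTens_const V (algebraMap ℂ (SymmetricAlgebra ℂ G) r))
  | add x y hx hy => simpa only [map_add] using Tens.add _ _ hx hy
  | ι v =>
    exact .congr _ _ (fun z _ => (symMap_ι (l z) v).symm)
      (Tens.map hl (SymmetricAlgebra.ι ℂ G ∘ₗ LinearMap.applyₗ v))
  | mul x y hx hy =>
    simp only [map_mul]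
    exact HolTens.bilin hx hy (LinearMap.mul ℂ (SymmetricAlgebra ℂ G))

/-- The product with endomorphisms from the left. -/
def endMul : Module.End ℂ F →ₗ[ℂ] EndFib B F G →ₗ[ℂ] EndFib B F G :=
  LinearMap.rTensorHom _ ∘ₗ LinearMap.mul ℂ (Module.End ℂ F)

theorem endMul_pure (f g : Module.End ℂ F) (η : Forms B) (l : ExteriorAlgebra ℂ G) :
    endMul f (pure g η l) = pure (f * g) η l := rfl

theorem wedgeEnd_endMul (φ : ConjDual B) (f : Module.End ℂ F) (m : EndFib B F G) :
    wedgeEnd B F G φ (endMul f m) = endMul f (wedgeEnd B F G φ m) := by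
  refine linearMap_ext_pure (φ := wedgeEnd B F G φ ∘ₗ endMul f)
    (ψ := endMul f ∘ₗ wedgeEnd B F G φ) (fun g η l => ?_) m
  rw [LinearMap.comp_apply, LinearMap.comp_apply, endMul_pure, wedgeEnd_pure, wedgeEnd_pure,
    endMul_pure]

/-- The factors acting on `End E` and `⋀ L` are holomorphic and invisible to `∂̄`; the form factor
is closed by `pullback_closed`. -/
theorem endFib_map_closed {V : Set B} (hV : IsOpen V) {τ : B → B} (hτ : ContDiffOn ℂ ∞ τ V)
    {e e' : B → Module.End ℂ F} (he : HolTens V e) (he' : HolTens V e') {l : B → Module.End ℂ G}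
    (hl : HolTens V l) (m : EndFib B F G) :
    SmTens V (fun z => EndFib.map (fderiv ℂ τ z : B →ₗ[ℂ] B) (e z) (e' z) (l z) m) ∧
      ∀ z ∈ V, dol (wedgeEnd B F G)
        (fun z => EndFib.map (fderiv ℂ τ z : B →ₗ[ℂ] B) (e z) (e' z) (l z) m) z = 0 := by
  have hm : m ∈ Submodule.span ℂ {z | ∃ (f : Module.End ℂ F) (η : Forms B)
    (l : ExteriorAlgebra ℂ G), z = pure f η l} := by rw [span_pure_eq_top]; trivial
  induction hm using Submodule.span_induction with
  | mem m hm =>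
    obtain ⟨f, η, a, rfl⟩ := hm
    obtain ⟨hs, hc⟩ := pullback_closed hV hτ η
    have hf : HolTens V fun z => conjEnd (e z) (e' z) f :=
      HolTens.bilin (HolTens.bilin he (holTens_const V f) (LinearMap.mul ℂ (Module.End ℂ F))) he'
        (LinearMap.mul ℂ (Module.End ℂ F))
    have ha := holTens_exteriorMap hl a
    have hs' := SmTens.bilin (HolTens.smTens ha) hs
      ((pureHom (1 : Module.End ℂ F)).flip : ExteriorAlgebra ℂ G →ₗ[ℂ] Forms B →ₗ[ℂ] EndFib B F G)
    have hE : ∀ z, EndFib.map (fderiv ℂ τ z : B →ₗ[ℂ] B) (e z) (e' z) (l z) (pure f η a) =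
        endMul (conjEnd (e z) (e' z) f) (((pureHom (1 : Module.End ℂ F)).flip :
          ExteriorAlgebra ℂ G →ₗ[ℂ] Forms B →ₗ[ℂ] EndFib B F G) (ExteriorAlgebra.map (l z) a)
          (ExteriorAlgebra.map (ConjDual.pull (fderiv ℂ τ z : B →ₗ[ℂ] B)) η)) := fun z => by
      rw [EndFib.map_pure, LinearMap.flip_apply, pureHom_apply, endMul_pure, mul_one]
    simp only [hE]
    refine ⟨SmTens.bilin (HolTens.smTens hf) hs' endMul, fun z hz => ?_⟩
    rw [dol_bilin_right (W' := wedgeEnd B F G) hV hf hs' hz endMul fun φ m n => wedgeEnd_endMul φ m n,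
      dol_bilin_right (W' := wedgeForms B) hV ha hs hz _ fun φ m n => wedgeEnd_pure φ 1 n m, hc z hz,
      map_zero, map_zero]
  | zero =>
    simp only [map_zero]
    exact ⟨.zero, fun z hz => dol_eq_zero hV .zero hz⟩
  | add x y _ _ hx hy =>
    simp only [map_add]
    exact ⟨.add _ _ hx.1 hy.1, fun z hz => by
      rw [dol_add hV hx.1 hy.1 hz, hx.2 z hz, hy.2 z hz, add_zero]⟩
  | smul a x _ hx =>
    simp only [map_smul]
    exact ⟨Tens.map hx.1 (LinearMap.lsmul ℂ _ a), fun z hz => by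
      rw [dol_smul hV hx.1 hz, hx.2 z hz, smul_zero]⟩

theorem symFib_map_closed {V : Set B} (hV : IsOpen V) {τ : B → B} (hτ : ContDiffOn ℂ ∞ τ V)
    {l : B → Module.End ℂ G} (hl : HolTens V l) (m : SymFib B G) :
    SmTens V (fun z => SymFib.map (fderiv ℂ τ z : B →ₗ[ℂ] B) (l z) m) ∧
      ∀ z ∈ V, dol (wedgeSym B G)
        (fun z => SymFib.map (fderiv ℂ τ z : B →ₗ[ℂ] B) (l z) m) z = 0 := by
  induction m using TensorProduct.induction_on with
  | tmul η a =>
    obtain ⟨hs, hc⟩ := pullback_closed hV hτ η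
    have ha := holTens_symMap hl a
    refine ⟨SmTens.bilin (HolTens.smTens ha) hs (TensorProduct.mk ℂ _ _).flip, fun z hz => ?_⟩
    have := dol_bilin_right (W'' := wedgeSym B G) (W' := wedgeForms B) hV ha hs hz
      (TensorProduct.mk ℂ _ _).flip fun φ m n => wedgeSym_tmul φ n m
    refine this.trans ?_
    rw [hc z hz, map_zero]
  | zero =>
    simp only [map_zero]
    exact ⟨.zero, fun z hz => dol_eq_zero hV .zero hz⟩
  | add x y hx hy =>
    simp only [map_add]
    exact ⟨.add _ _ hx.1 hy.1, fun z hz => by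
      rw [dol_add hV hx.1 hy.1 hz, hx.2 z hz, hy.2 z hz, add_zero]⟩

/-! ### The frames of the two bundles of forms -/

variable (B F E G L) in
/-- The transition maps of the bundle of `(0,*)`-forms with values in `End E ⊗ ⋀ L`. -/
def endTrans (x₀ x₁ : X) (z : B) : EndFib B F G →ₗ[ℂ] EndFib B F G :=
  EndFib.map (fderiv ℂ (chartChange B x₀ x₁) z : B →ₗ[ℂ] B) (frameChange F E x₀ x₁ x₁ z)
    (frameChange F E x₁ x₀ x₁ z) (frameChange G L x₀ x₁ x₁ z)

variable (B G L) in
/-- The transition maps of the bundle of `(0,*)`-forms with values in `⨀ L`. -/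
def symTrans (x₀ x₁ : X) (z : B) : SymFib B G →ₗ[ℂ] SymFib B G :=
  SymFib.map (fderiv ℂ (chartChange B x₀ x₁) z : B →ₗ[ℂ] B) (frameChange G L x₀ x₁ x₁ z)

variable (B F E G L) in
theorem holFrames_end [ContMDiffVectorBundle ω F E 𝓘(ℂ, B)] [ContMDiffVectorBundle ω G L 𝓘(ℂ, B)] :
    HolFrames (endLoc B F E G L) (endUnloc B F E G L) (frameDom F E G L) (wedgeEnd B F G)
      (endTrans B F E G L) := by
  have hclosed : ∀ x₀ x₁ : X, _ := fun x₀ x₁ =>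
    endFib_map_closed (isOpen_transDom (B := B) (dom := frameDom F E G L) (fun x =>
      (trivializationAt F E x).open_baseSet.inter (trivializationAt G L x).open_baseSet) x₀ x₁)
      (contDiffOn_chartChange x₀ x₁)
      (holTens_frameChange (E := E) (x₀ := x₀) (x₁ := x₁) (y := x₁) (fun z hz => hz.1.1)
        (fun z hz => hz.2.2.1) (fun z hz => hz.1.2.1))
      (holTens_frameChange (E := E) (x₀ := x₁) (x₁ := x₀) (y := x₁) (fun z hz => hz.1.1)
        (fun z hz => hz.1.2.1) (fun z hz => hz.2.2.1))
      (holTens_frameChange (E := L) (x₀ := x₀) (x₁ := x₁) (y := x₁) (fun z hz => hz.1.1)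
        (fun z hz => hz.2.2.2) (fun z hz => hz.1.2.2))
  refine ⟨fun x => (trivializationAt F E x).open_baseSet.inter (trivializationAt G L x).open_baseSet,
    fun x => ⟨mem_baseSet_trivializationAt F E x, mem_baseSet_trivializationAt G L x⟩,
    fun x m => ?_, fun x v => ?_, fun x₀ x₁ z hz v => ?_, fun x₀ x₁ m => (hclosed x₀ x₁ m).1,
    fun x₀ x₁ m => (hclosed x₀ x₁ m).2, fun x₀ x₁ z hz φ m => ?_, wedgeEnd_anticomm⟩
  · unfold endLoc endUnloc
    rw [EndFib.map_map, toFrame_comp_fromFrame (mem_baseSet_trivializationAt F E x),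
      toFrame_comp_fromFrame (mem_baseSet_trivializationAt G L x),
      toChart_comp_fromChart (mem_extChartAt_source x), EndFib.map_id]
  · unfold endLoc endUnloc
    rw [EndFib.map_map, fromFrame_comp_toFrame (mem_baseSet_trivializationAt F E x),
      fromFrame_comp_toFrame (mem_baseSet_trivializationAt G L x),
      fromChart_comp_toChart (mem_extChartAt_source x), EndFib.map_id]
  · unfold endLoc endTrans frameChange
    rw [EndFib.map_map, fderiv_chartChange hz, ← LinearMap.comp_assoc,
      fromChart_comp_toChart hz.2.1, LinearMap.comp_assoc, fromFrame_comp_toFrame hz.2.2.1,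
      ← LinearMap.comp_assoc, fromFrame_comp_toFrame hz.2.2.1, LinearMap.comp_assoc,
      fromFrame_comp_toFrame hz.2.2.2]
    rfl
  · exact EndFib.map_wedgeEnd _ _ _ _ φ m

variable (B G L) in
theorem holFrames_sym [ContMDiffVectorBundle ω G L 𝓘(ℂ, B)] :
    HolFrames (symLoc B G L) (symUnloc B G L) (fun x => (trivializationAt G L x).baseSet)
      (wedgeSym B G) (symTrans B G L) := by
  have hclosed : ∀ x₀ x₁ : X, _ := fun x₀ x₁ =>
    symFib_map_closed (isOpen_transDom (B := B) (dom := fun x => (trivializationAt G L x).baseSet)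
      (fun x => (trivializationAt G L x).open_baseSet) x₀ x₁)
      (contDiffOn_chartChange x₀ x₁)
      (holTens_frameChange (E := L) (x₀ := x₀) (x₁ := x₁) (y := x₁) (fun z hz => hz.1.1)
        (fun z hz => hz.2.2) (fun z hz => hz.1.2))
  refine ⟨fun x => (trivializationAt G L x).open_baseSet,
    fun x => mem_baseSet_trivializationAt G L x,
    fun x m => ?_, fun x v => ?_, fun x₀ x₁ z hz v => ?_, fun x₀ x₁ m => (hclosed x₀ x₁ m).1,
    fun x₀ x₁ m => (hclosed x₀ x₁ m).2, fun x₀ x₁ z hz φ m => ?_, wedgeSym_anticomm⟩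
  · unfold symLoc symUnloc
    rw [SymFib.map_map, toFrame_comp_fromFrame (mem_baseSet_trivializationAt G L x),
      toChart_comp_fromChart (mem_extChartAt_source x), SymFib.map_id]
  · unfold symLoc symUnloc
    rw [SymFib.map_map, fromFrame_comp_toFrame (mem_baseSet_trivializationAt G L x),
      fromChart_comp_toChart (mem_extChartAt_source x), SymFib.map_id]
  · unfold symLoc symTrans frameChange
    rw [SymFib.map_map, fderiv_chartChange hz, ← LinearMap.comp_assoc,
      fromChart_comp_toChart hz.2.1, LinearMap.comp_assoc, fromFrame_comp_toFrame hz.2.2]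
    rfl
  · exact SymFib.map_wedgeSym _ _ φ m

end Bundles

theorem left_distrib_of_ring {A : Type*} [Ring A] (x y z : A) : x * (y + z) = x * y + x * z :=
  mul_add x y z

theorem right_distrib_of_ring {A : Type*} [Ring A] (x y z : A) : (x + y) * z = x * z + y * z :=
  add_mul x y z

/-! ### The operators preserve subspaces of values -/

section Values

variable {B M N : Type*} [NormedAddCommGroup B] [NormedSpace ℂ B] [FiniteDimensional ℂ B]
  [AddCommGroup M] [Module ℂ M] [AddCommGroup N] [Module ℂ N] {U : Set B} {y : B} {g : B → M}

/-- Modulo `P` the function is zero on `U`, and so is its derivative. No closedness of `P` is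
involved, because the derivative commutes with every linear map. -/
theorem dbarCoord_mem (hU : IsOpen U) (hg : SmTens U g) (hy : y ∈ U) {P : Submodule ℂ M}
    (hP : ∀ z ∈ U, g z ∈ P) (i : Fin (Module.finrank ℂ B)) : dbarCoord i g y ∈ P := by
  rw [← Submodule.Quotient.mk_eq_zero]
  change P.mkQ (dbarCoord i g y) = 0
  rw [← dbarCoord_map hU hg hy, ← dbarCoord_zero (M := M ⧸ P) y i]
  exact dbarCoord_congr hU (Tens.map hg P.mkQ) hy
    (fun z hz => (Submodule.Quotient.mk_eq_zero P).2 (hP z hz)) i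

theorem dol_mem (hU : IsOpen U) (hg : SmTens U g) (hy : y ∈ U) {P Q : Submodule ℂ M}
    (hP : ∀ z ∈ U, g z ∈ P) {W : ConjDual B →ₗ[ℂ] Module.End ℂ M} (hW : ∀ φ, ∀ m ∈ P, W φ m ∈ Q) :
    dol W g y ∈ Q :=
  sum_mem fun i _ => hW _ _ (dbarCoord_mem hU hg hy hP i)

end Values

section Bundles

variable {B : Type*} [NormedAddCommGroup B] [NormedSpace ℂ B] [FiniteDimensional ℂ B]
  {X : Type*} [TopologicalSpace X] [ChartedSpace B X] [IsManifold 𝓘(ℂ, B) ω X]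
  {F : Type*} [NormedAddCommGroup F] [NormedSpace ℂ F] [FiniteDimensional ℂ F]
  {E : X → Type*} [TopologicalSpace (Bundle.TotalSpace F E)] [∀ x, AddCommGroup (E x)]
  [∀ x, Module ℂ (E x)] [∀ x, TopologicalSpace (E x)] [FiberBundle F E] [VectorBundle ℂ F E]
  {G : Type*} [NormedAddCommGroup G] [NormedSpace ℂ G] [FiniteDimensional ℂ G]
  {L : X → Type*} [TopologicalSpace (Bundle.TotalSpace G L)] [∀ x, AddCommGroup (L x)]
  [∀ x, Module ℂ (L x)] [∀ x, TopologicalSpace (L x)] [FiberBundle G L] [VectorBundle ℂ G L]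

/-! ### Smooth sections and the operators `∂̄` -/

theorem endDbar_eq (s : EndSec B E L) : endDbar B F E G L s = dbar (B := B) (endLoc B F E G L)
    (endUnloc B F E G L) (fun φ m => wedgeEnd B F G φ m) s := rfl

theorem symDbar_eq (s : SymSec B L) : symDbar B G L s = dbar (B := B) (symLoc B G L)
    (symUnloc B G L) (fun φ m => wedgeSym B G φ m) s := rfl

/-- Fixed bidegree confines the components to a finite-dimensional space, so testing smoothness
against functionals is as good as being a finite sum. -/
theorem mem_endForms {p q : ℕ} {s : EndSec B E L} : s ∈ endForms B F E G L p q ↔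
    SmSec (B := B) (endLoc B F E G L) (frameDom F E G L) s ∧
      ∀ x, s x ∈ endPart (TangentSpace 𝓘(ℂ, B) x) (E x) (L x) p q := by
  refine ⟨fun h => ⟨fun x₀ => ?_, h.2⟩, fun h => ⟨h.1.isSmooth, h.2⟩⟩
  obtain ⟨S, hS, hle⟩ := exists_fg_endPart B F G p q
  exact tens_of_forall_dual hS (fun z _ => hle (EndFib.map_mem _ _ _ _ (h.2 _))) (h.1 x₀)

theorem mem_symForms {p k : ℕ} {s : SymSec B L} : s ∈ symForms B G L p k ↔
    SmSec (B := B) (symLoc B G L) (fun x => (trivializationAt G L x).baseSet) s ∧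
      ∀ x, s x ∈ symPart (TangentSpace 𝓘(ℂ, B) x) (L x) p k := by
  refine ⟨fun h => ⟨fun x₀ => ?_, h.2⟩, fun h => ⟨h.1.isSmooth, h.2⟩⟩
  obtain ⟨S, hS, hle⟩ := exists_fg_symPart B G p k
  exact tens_of_forall_dual hS (fun z _ => hle (SymFib.map_mem _ _ (h.2 _))) (h.1 x₀)

theorem EndFib.map_mem_endTot {T E L T' E' L' : Type*} [AddCommGroup T] [Module ℂ T] [AddCommGroup E]
    [Module ℂ E] [AddCommGroup L] [Module ℂ L] [AddCommGroup T'] [Module ℂ T'] [AddCommGroup E']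
    [Module ℂ E'] [AddCommGroup L'] [Module ℂ L'] (τ : T' →ₗ[ℂ] T) (e : E →ₗ[ℂ] E') (e' : E' →ₗ[ℂ] E)
    (l : L →ₗ[ℂ] L') {n : ℤ} {z : EndFib T E L} (hz : z ∈ endTot T E L n) :
    EndFib.map τ e e' l z ∈ endTot T' E' L' n := by
  have h : endTot T E L n ≤ (endTot T' E' L' n).comap (EndFib.map τ e e' l) := by
    refine Submodule.span_le.2 ?_
    rintro _ ⟨p, q, f, η, a, hn, hη, ha, rfl⟩
    exact Submodule.subset_span ⟨p, q, _, _, _, hn, exteriorMap_mem _ hη, exteriorMap_mem _ ha, rfl⟩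
  exact h hz

/-- The additive step retains membership of both summands, hence their smoothness, without which
`∂̄` would not be additive. -/
theorem endGr_induction {n : ℤ} {C : EndSec B E L → Prop}
    (hC : ∀ p q : ℕ, (p : ℤ) + q = n → ∀ s ∈ endForms B F E G L p q, C s) (h0 : C 0)
    (hadd : ∀ s t, s ∈ endGr B F E G L n → t ∈ endGr B F E G L n → C s → C t → C (s + t))
    {s : EndSec B E L} (hs : s ∈ endGr B F E G L n) : C s := by
  have h0' : 0 ∈ endGr B F E G L n ∧ C 0 := ⟨zero_mem _, h0⟩
  have hadd' : ∀ s t, s ∈ endGr B F E G L n ∧ C s → t ∈ endGr B F E G L n ∧ C t →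
      s + t ∈ endGr B F E G L n ∧ C (s + t) := fun s t hs ht =>
    ⟨add_mem hs.1 ht.1, hadd s t hs.1 ht.1 hs.2 ht.2⟩
  refine (Submodule.iSup_induction (motive := fun s => s ∈ endGr B F E G L n ∧ C s) _ hs
    (fun p s hs => Submodule.iSup_induction (motive := fun s => s ∈ endGr B F E G L n ∧ C s) _ hs
      (fun q s hs => Submodule.iSup_induction (motive := fun s => s ∈ endGr B F E G L n ∧ C s) _ hs
        (fun hn s hs => ⟨?_, hC p q hn s hs⟩) h0' hadd') h0' hadd') h0' hadd').2
  exact Submodule.mem_iSup_of_mem p (Submodule.mem_iSup_of_mem q (Submodule.mem_iSup_of_mem hn hs))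

theorem endForms_le_endGr {p q : ℕ} {n : ℤ} (h : (p : ℤ) + q = n) :
    endForms B F E G L p q ≤ endGr B F E G L n := fun _ hs =>
  Submodule.mem_iSup_of_mem p (Submodule.mem_iSup_of_mem q (Submodule.mem_iSup_of_mem h hs))

theorem symGr_eq {k p : ℕ} {n : ℤ} (h : (p : ℤ) = n - 1) : symGr B G L k n = symForms B G L p k := by
  refine le_antisymm (iSup_le fun p' => iSup_le fun h' => ?_)
    fun _ hs => Submodule.mem_iSup_of_mem p (Submodule.mem_iSup_of_mem h hs)
  rw [show p' = p by omega]

/-- The shifted complex is zero below degree one. -/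
theorem symGr_cases (k : ℕ) (n : ℤ) : (∃ p : ℕ, (p : ℤ) = n - 1) ∨ symGr B G L k n = ⊥ := by
  by_cases h : ∃ p : ℕ, (p : ℤ) = n - 1
  · exact .inl h
  · exact .inr (le_bot_iff.1 (iSup_le fun p => iSup_le fun hp => (h ⟨p, hp⟩).elim))

theorem endGr_spec {n : ℤ} {s : EndSec B E L} (hs : s ∈ endGr B F E G L n) :
    SmSec (B := B) (endLoc B F E G L) (frameDom F E G L) s ∧
      ∀ x, s x ∈ endTot (TangentSpace 𝓘(ℂ, B) x) (E x) (L x) n := by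
  refine endGr_induction (C := fun s => SmSec (B := B) (endLoc B F E G L) (frameDom F E G L) s ∧
      ∀ x, s x ∈ endTot (TangentSpace 𝓘(ℂ, B) x) (E x) (L x) n) (fun p q hn s hs => ?_)
    ⟨SmSec.zero, fun x => zero_mem _⟩ (fun s t _ _ hs ht => ⟨hs.1.add ht.1, fun x => add_mem (hs.2 x) (ht.2 x)⟩) hs
  rw [mem_endForms] at hs
  exact ⟨hs.1, fun x => hn ▸ endPart_le_endTot p q (hs.2 x)⟩

variable (B F E G L) in
/-- `SmSec` for forms with values in `End E ⊗ ⋀ L`. -/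
abbrev EndSm (s : EndSec B E L) : Prop := SmSec (B := B) (endLoc B F E G L) (frameDom F E G L) s

theorem localRep_mul (s t : EndSec B E L) {x₀ : X} {z : B}
    (hz : z ∈ localDom B (frameDom F E G L) x₀) : localRep (B := B) (endLoc B F E G L) (s * t : EndSec B E L) x₀ z =
      localRep (endLoc B F E G L) s x₀ z * localRep (endLoc B F E G L) t x₀ z :=
  EndFib.map_mul _ _ (fromFrame_comp_toFrame hz.2.1) (toFrame_comp_fromFrame hz.2.1) _ _

theorem endLoc_mul (x : X) (y z : EndFib (TangentSpace 𝓘(ℂ, B) x) (E x) (L x)) :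
    endLoc B F E G L x x (y * z) = endLoc B F E G L x x y * endLoc B F E G L x x z :=
  EndFib.map_mul _ _ (fromFrame_comp_toFrame (mem_baseSet_trivializationAt F E x))
    (toFrame_comp_fromFrame (mem_baseSet_trivializationAt F E x)) _ _

theorem EndSm.mul {s t : EndSec B E L} (hs : EndSm B F E G L s) (ht : EndSm B F E G L t) :
    EndSm B F E G L (s * t) := fun x₀ =>
  .congr _ _ (fun _ hz => (localRep_mul s t hz).symm)
    (SmTens.mul (A := EndFib B F G) (hs x₀) (ht x₀))

theorem endForms_mul {p q p' q' : ℕ} {s t : EndSec B E L} (hs : s ∈ endForms B F E G L p q)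
    (ht : t ∈ endForms B F E G L p' q') : s * t ∈ endForms B F E G L (p + p') (q + q') := by
  rw [mem_endForms] at hs ht ⊢
  exact ⟨EndSm.mul hs.1 ht.1, fun x => endPart_mul (hs.2 x) (ht.2 x)⟩

theorem endGr_mul {n m : ℤ} {s t : EndSec B E L} (hs : s ∈ endGr B F E G L n)
    (ht : t ∈ endGr B F E G L m) : s * t ∈ endGr B F E G L (n + m) := by
  refine endGr_induction (C := fun s : EndSec B E L => (s * t : EndSec B E L) ∈ endGr B F E G L (n + m)) (fun p q hn s hs => ?_) ?_
    (fun s s' _ _ hs hs' => ?_) hs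
  · refine endGr_induction (C := fun t : EndSec B E L => (s * t : EndSec B E L) ∈ endGr B F E G L (n + m)) (fun p' q' hm t ht => ?_)
      ?_ (fun t t' _ _ ht ht' => ?_) ht
    · exact endForms_le_endGr (by push_cast; omega) (endForms_mul hs ht)
    · rw [mul_zero (M₀ := EndSec B E L)]; exact zero_mem _
    · rw [left_distrib_of_ring (A := EndSec B E L)]; exact add_mem ht ht'
  · rw [zero_mul (M₀ := EndSec B E L)]; exact zero_mem _
  · rw [right_distrib_of_ring (A := EndSec B E L)]; exact add_mem hs hs'

variable [ContMDiffVectorBundle ω F E 𝓘(ℂ, B)] [ContMDiffVectorBundle ω G L 𝓘(ℂ, B)]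

theorem endDbar_mem {p q : ℕ} {s : EndSec B E L} (hs : s ∈ endForms B F E G L p q) :
    endDbar B F E G L s ∈ endForms B F E G L (p + 1) q := by
  have h := holFrames_end B F E G L
  rw [mem_endForms] at hs ⊢
  refine ⟨h.smSec_dbar hs.1, fun x => EndFib.map_mem _ _ _ _ ?_⟩
  exact dol_mem (W := wedgeEnd B F G) (isOpen_localDom h.isOpen_dom x) (hs.1 x)
    (mem_localDom h.mem_dom x) (fun z _ => EndFib.map_mem _ _ _ _ (hs.2 _))
    fun φ m hm => wedgeEnd_mem φ hm

theorem symDbar_mem {p k : ℕ} {s : SymSec B L} (hs : s ∈ symForms B G L p k) :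
    symDbar B G L s ∈ symForms B G L (p + 1) k := by
  have h := holFrames_sym B G L
  rw [mem_symForms] at hs ⊢
  refine ⟨h.smSec_dbar hs.1, fun x => SymFib.map_mem _ _ ?_⟩
  exact dol_mem (W := wedgeSym B G) (isOpen_localDom h.isOpen_dom x) (hs.1 x)
    (mem_localDom h.mem_dom x) (fun z _ => SymFib.map_mem _ _ (hs.2 _))
    fun φ m hm => wedgeSym_mem φ hm

theorem endDbar_add {s t : EndSec B E L} (hs : EndSm B F E G L s) (ht : EndSm B F E G L t) :
    endDbar B F E G L (s + t) = endDbar B F E G L s + endDbar B F E G L t :=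
  (holFrames_end B F E G L).dbar_add hs ht

theorem endDbar_smul (a : ℂ) {s : EndSec B E L} (hs : EndSm B F E G L s) :
    endDbar B F E G L (a • s) = a • endDbar B F E G L s :=
  (holFrames_end B F E G L).dbar_smul a hs

theorem endDbar_endDbar {s : EndSec B E L} (hs : EndSm B F E G L s) :
    endDbar B F E G L (endDbar B F E G L s) = 0 :=
  (holFrames_end B F E G L).dbar_dbar hs

theorem endDbar_sub_zsmul (a : ℤ) {s t : EndSec B E L} (hs : EndSm B F E G L s)
    (ht : EndSm B F E G L t) :
    endDbar B F E G L (s - a • t) = endDbar B F E G L s - a • endDbar B F E G L t := by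
  have h : ∀ t : EndSec B E L, a • t = (a : ℂ) • t := fun t => (Int.cast_smul_eq_zsmul ℂ a t).symm
  have h' : ∀ s t : EndSec B E L, s - t = s + (-1 : ℂ) • t := fun s t => by
    rw [sub_eq_add_neg, ← neg_one_smul ℂ t]
  rw [h, h, h', h', endDbar_add hs ((ht.smul _).smul _), endDbar_smul _ (ht.smul _), endDbar_smul _ ht]

theorem endDbar_mul {n : ℤ} {s t : EndSec B E L} (hs : EndSm B F E G L s)
    (hsn : ∀ x, s x ∈ endTot (TangentSpace 𝓘(ℂ, B) x) (E x) (L x) n) (ht : EndSm B F E G L t) :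
    endDbar B F E G L (s * t) =
      endDbar B F E G L s * t + (n.negOnePow : ℤ) • (s * endDbar B F E G L t) := by
  have h := holFrames_end B F E G L
  refine h.ext fun x => ?_
  have ho := isOpen_localDom (B := B) h.isOpen_dom x
  have hx := mem_localDom (B := B) h.mem_dom x
  have hl : ∀ s : EndSec B E L, localRep (B := B) (endLoc B F E G L) s x (extChartAt 𝓘(ℂ, B) x x) =
      endLoc B F E G L x x (s x) := fun s => by
    unfold localRep; rw [extChartAt_to_inv]
  rw [Pi.add_apply, Pi.smul_apply, Pi.mul_apply, Pi.mul_apply, map_add, map_zsmul, endLoc_mul,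
    endLoc_mul, endDbar_eq, endDbar_eq, endDbar_eq, h.loc_dbar, h.loc_dbar, h.loc_dbar,
    dol_congr ho (EndSm.mul hs ht x) hx fun z hz => localRep_mul s t hz]
  have := dol_bilin (W := wedgeEnd B F G) (W' := wedgeEnd B F G) (W'' := wedgeEnd B F G) ho (hs x)
    (ht x) hx (LinearMap.mul ℂ (EndFib B F G)) ((n.negOnePow : ℤ) : ℂ)
    (fun φ y z => wedgeEnd_mul φ y z) (fun φ z => ?_)
  · refine this.trans ?_
    rw [Int.cast_smul_eq_zsmul, hl, hl]
    rfl
  · rw [Int.cast_smul_eq_zsmul]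
    exact wedgeEnd_mul_right φ (EndFib.map_mem_endTot _ _ _ _ (hsn _)) z

end Bundles

/-- To the derivation `D` the inner derivation `[t, ·]` is added; it satisfies the Leibniz rule by
the graded Jacobi identity. -/
theorem twisted_derivation {A : Type*} [Ring A] {D : A → A} (n m : ℤ) {t x y : A}
    (h : D (gradedComm n m x y) =
      gradedComm (n + 1) m (D x) y + (n.negOnePow : ℤ) • gradedComm n (m + 1) x (D y)) :
    D (gradedComm n m x y) + gradedComm 1 (n + m) t (gradedComm n m x y) =
      gradedComm (n + 1) m (D x + gradedComm 1 n t x) y +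
        (n.negOnePow : ℤ) • gradedComm n (m + 1) x (D y + gradedComm 1 m t y) := by
  rw [h, gradedComm_jacobi, gradedComm_add_left, gradedComm_add_right, smul_add, add_comm 1 n,
    add_comm 1 m, one_mul]
  abel

section Bundles

variable {B : Type*} [NormedAddCommGroup B] [NormedSpace ℂ B] [FiniteDimensional ℂ B]
  {X : Type*} [TopologicalSpace X] [ChartedSpace B X] [IsManifold 𝓘(ℂ, B) ω X]
  {F : Type*} [NormedAddCommGroup F] [NormedSpace ℂ F] [FiniteDimensional ℂ F]
  {E : X → Type*} [TopologicalSpace (Bundle.TotalSpace F E)] [∀ x, AddCommGroup (E x)]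
  [∀ x, Module ℂ (E x)] [∀ x, TopologicalSpace (E x)] [FiberBundle F E] [VectorBundle ℂ F E]
  {G : Type*} [NormedAddCommGroup G] [NormedSpace ℂ G] [FiniteDimensional ℂ G]
  {L : X → Type*} [TopologicalSpace (Bundle.TotalSpace G L)] [∀ x, AddCommGroup (L x)]
  [∀ x, Module ℂ (L x)] [∀ x, TopologicalSpace (L x)] [FiberBundle G L] [VectorBundle ℂ G L]

/-! ### The Higgs field as a form -/

variable (B) in
/-- The Higgs field, as a form with values in `End E ⊗ L`. -/
def higgsForm (θ : HiggsSec E L) : EndSec B E L := fun x => inclHiggs (θ x)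

theorem holTens_higgs {θ : HiggsSec E L} (hθ : IsHolomorphicHiggs B F E G L θ) (x₀ : X) :
    HolTens (localDom B (frameDom F E G L) x₀) (localRep (higgsLoc F E G L) θ x₀) :=
  tens_of_forall_dual (S := ⊤) Module.Finite.fg_top (fun _ _ => trivial) fun l =>
    contDiffOn_of_differentiableOn (isOpen_localDom (fun x =>
      (trivializationAt F E x).open_baseSet.inter (trivializationAt G L x).open_baseSet) x₀) (hθ x₀ l)

theorem inclHiggs_mem {T E L : Type*} [AddCommGroup T] [Module ℂ T] [AddCommGroup E] [Module ℂ E]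
    [AddCommGroup L] [Module ℂ L] (θ : Module.End ℂ E ⊗[ℂ] L) :
    (inclHiggs θ : EndFib T E L) ∈ endPart T E L 0 1 := by
  induction θ using TensorProduct.induction_on with
  | zero => rw [map_zero]; exact zero_mem _
  | add x y hx hy => rw [map_add]; exact add_mem hx hy
  | tmul f v =>
    rw [inclHiggs_tmul]
    exact Submodule.subset_span ⟨_, _, _, one_mem_exteriorPower, ι_mem_exteriorPower v, rfl⟩

theorem localRep_higgsForm (θ : HiggsSec E L) (x₀ : X) (z : B) :
    localRep (B := B) (endLoc B F E G L) (higgsForm B θ) x₀ z =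
      inclHiggs (localRep (higgsLoc F E G L) θ x₀ z) := EndFib.map_inclHiggs _ _ _ _ _

theorem holTens_higgsForm {θ : HiggsSec E L} (hθ : IsHolomorphicHiggs B F E G L θ) (x₀ : X) :
    HolTens (localDom B (frameDom F E G L) x₀)
      (localRep (endLoc B F E G L) (higgsForm B θ) x₀) :=
  .congr _ _ (fun z _ => (localRep_higgsForm θ x₀ z).symm) (Tens.map (holTens_higgs hθ x₀) inclHiggs)

theorem higgsForm_mem {θ : HiggsSec E L} (hθ : IsHolomorphicHiggs B F E G L θ) :
    higgsForm B θ ∈ endGr B F E G L 1 := by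
  refine endForms_le_endGr (p := 0) (q := 1) rfl (mem_endForms.2 ⟨fun x₀ => ?_, fun x =>
    inclHiggs_mem _⟩)
  exact HolTens.smTens (holTens_higgsForm hθ x₀)

theorem higgsForm_mul_self {θ : HiggsSec E L} (h : IsIntegrable θ) :
    higgsForm B θ * higgsForm B θ = 0 := funext fun x => inclHiggs_sq (h x)

variable [ContMDiffVectorBundle ω F E 𝓘(ℂ, B)] [ContMDiffVectorBundle ω G L 𝓘(ℂ, B)]

theorem endDbar_higgsForm {θ : HiggsSec E L} (hθ : IsHolomorphicHiggs B F E G L θ) :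
    endDbar B F E G L (higgsForm B θ) = 0 := by
  have h := holFrames_end B F E G L
  refine h.ext fun x => ?_
  rw [endDbar_eq, h.loc_dbar, dol_eq_zero (isOpen_localDom h.isOpen_dom x) (holTens_higgsForm hθ x)
    (mem_localDom h.mem_dom x)]
  exact (map_zero _).symm

theorem endDbar_mem_endGr {n : ℤ} {s : EndSec B E L} (hs : s ∈ endGr B F E G L n) :
    endDbar B F E G L s ∈ endGr B F E G L (n + 1) := by
  refine endGr_induction (C := fun s => endDbar B F E G L s ∈ endGr B F E G L (n + 1))
    (fun p q hn s hs => ?_) ?_ (fun s t hs ht hs' ht' => ?_) hs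
  · exact endForms_le_endGr (by push_cast; omega) (endDbar_mem hs)
  · have := endDbar_smul (B := B) (F := F) (E := E) (G := G) (L := L) 0 (s := 0) SmSec.zero
    rw [zero_smul, zero_smul] at this
    rw [this]
    exact zero_mem _
  · rw [endDbar_add (endGr_spec hs).1 (endGr_spec ht).1]
    exact add_mem hs' ht'

/-! ### The two differential graded Lie algebras -/

theorem gradedComm_mem_endGr {n m : ℤ} {s t : EndSec B E L} (hs : s ∈ endGr B F E G L n)
    (ht : t ∈ endGr B F E G L m) : gradedComm n m s t ∈ endGr B F E G L (n + m) :=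
  gradedComm_mem_of (endGr_mul hs ht) (add_comm m n ▸ endGr_mul ht hs)

theorem endDiff_eq (θ : HiggsSec E L) (n : ℤ) (s : EndSec B E L) : endDiff B F E G L θ n s =
    endDbar B F E G L s + gradedComm 1 n (higgsForm B θ) s := rfl

/-- Holomorphy gives `∂̄θ = 0`, so the mixed terms of `d²` cancel; integrability gives `θ · θ = 0`,
so the bracket with `θ` squares to zero. The remaining axioms are identities for graded commutators.
-/
theorem isDGLA_end {θ : HiggsSec E L} (hθ : IsHolomorphicHiggs B F E G L θ) (hθθ : IsIntegrable θ) :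
    IsDGLA (endGr B F E G L) (endDiff B F E G L θ) gradedComm where
  d_mem n v hv := by
    refine add_mem (endDbar_mem_endGr hv) ?_
    rw [add_comm n 1]
    exact gradedComm_mem_endGr (higgsForm_mem hθ) hv
  d_add n v hv w hw := by
    rw [endDiff_eq, endDiff_eq, endDiff_eq, endDbar_add (endGr_spec hv).1 (endGr_spec hw).1,
      gradedComm_add_right (A := EndSec B E L)]
    exact add_add_add_comm _ _ _ _
  d_smul n a v hv := by
    rw [endDiff_eq, endDiff_eq, endDbar_smul a (endGr_spec hv).1,
      gradedComm_smul_right (A := EndSec B E L), smul_add]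
  br_mem n m v hv w hw := gradedComm_mem_endGr hv hw
  br_add n m v _ w _ u _ := gradedComm_add_left (A := EndSec B E L) n m v w u
  br_smul n m a v _ u _ := gradedComm_smul_left (A := EndSec B E L) n m a v u
  br_symm n m v _ w _ := gradedComm_symm (A := EndSec B E L) n m v w
  jacobi n m k u _ v _ w _ := gradedComm_jacobi (A := EndSec B E L) n m k u v w
  d_d n v hv := by
    have ht := endGr_spec (higgsForm_mem hθ)
    have hv' := endGr_spec hv
    have htx : endDbar B F E G L (higgsForm B θ * v) = -(higgsForm B θ * endDbar B F E G L v) := by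
      rw [endDbar_mul ht.1 ht.2 hv'.1, endDbar_higgsForm hθ, zero_mul (M₀ := EndSec B E L), zero_add]
      simp
    have hxt : endDbar B F E G L (v * higgsForm B θ) = endDbar B F E G L v * higgsForm B θ := by
      rw [endDbar_mul hv'.1 hv'.2 ht.1, endDbar_higgsForm hθ, mul_zero (M₀ := EndSec B E L),
        smul_zero, add_zero]
    exact differential_sq (A := EndSec B E L) n (higgsForm_mul_self hθθ) (endDbar_endDbar hv'.1)
      (endDbar_add (endGr_spec (endDbar_mem_endGr hv)).1
        (endGr_spec (gradedComm_mem_endGr (higgsForm_mem hθ) hv)).1)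
      (fun a => endDbar_sub_zsmul a (EndSm.mul ht.1 hv'.1) (EndSm.mul hv'.1 ht.1)) htx hxt
  d_br n m v hv w hw := by
    have hv' := endGr_spec hv
    have hw' := endGr_spec hw
    exact twisted_derivation (A := EndSec B E L) n m (gradedComm_derivation _ n m
      (fun a => endDbar_sub_zsmul a (EndSm.mul hv'.1 hw'.1) (EndSm.mul hw'.1 hv'.1))
      (endDbar_mul hv'.1 hv'.2 hw'.1) (endDbar_mul hw'.1 hw'.2 hv'.1))

theorem symGr_spec {k : ℕ} {n : ℤ} {s : SymSec B L} (hs : s ∈ symGr B G L k n) :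
    SmSec (B := B) (symLoc B G L) (fun x => (trivializationAt G L x).baseSet) s := by
  obtain ⟨p, hp⟩ | h := symGr_cases (B := B) (G := G) (L := L) k n
  · rw [symGr_eq hp, mem_symForms] at hs
    exact hs.1
  · rw [h, Submodule.mem_bot] at hs
    subst hs
    exact SmSec.zero

theorem symDbar_zero : symDbar B G L 0 = 0 := by
  have := (holFrames_sym B G L).dbar_smul 0 (s := 0) SmSec.zero
  rw [zero_smul, zero_smul] at this
  exact this

theorem isDGLA_sym (k : ℕ) :
    IsDGLA (symGr B G L k) (fun _ => symDbar B G L) fun _ _ _ _ => 0 where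
  d_mem n v hv := by
    obtain ⟨p, hp⟩ | h := symGr_cases (B := B) (G := G) (L := L) k n
    · rw [symGr_eq hp] at hv
      rw [symGr_eq (p := p + 1) (by push_cast; omega)]
      exact symDbar_mem hv
    · rw [h, Submodule.mem_bot] at hv
      rw [hv, symDbar_zero]
      exact zero_mem _
  d_add n v hv w hw := (holFrames_sym B G L).dbar_add (symGr_spec hv) (symGr_spec hw)
  d_smul n a v hv := (holFrames_sym B G L).dbar_smul a (symGr_spec hv)
  d_d n v hv := (holFrames_sym B G L).dbar_dbar (symGr_spec hv)
  br_mem _ _ _ _ _ _ := zero_mem _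
  br_add _ _ _ _ _ _ _ _ := (add_zero _).symm
  br_smul _ _ _ _ _ _ _ := (smul_zero _).symm
  br_symm _ _ _ _ _ _ := by rw [smul_zero, neg_zero]
  d_br _ _ _ _ _ _ := by rw [smul_zero, add_zero, symDbar_zero]
  jacobi _ _ _ _ _ _ _ _ _ := by rw [smul_zero, add_zero]

end Bundles

theorem map_afterCoder {V U U' : Type*} [AddCommGroup U] [AddCommGroup U'] (q : Ops V V) (Φ : Ops V U)
    (ψ : U →+ U') {n : ℕ} (x : Fin n → ℤ × V) :
    ψ (afterCoder q Φ n x) = afterCoder q (fun n y => ψ (Φ n y)) n x := by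
  unfold afterCoder
  rw [map_sum]
  exact Finset.sum_congr rfl fun S _ => map_zsmul _ _ _

theorem snd_update {V : Type*} {n : ℕ} (x : Fin n → ℤ × V) (i : Fin n) (d : ℤ) (v : V) :
    (fun j => (Function.update x i (d, v) j).2) = Function.update (fun j => (x j).2) i v :=
  Function.comp_update Prod.snd x i (d, v)

section Bundles

variable {B : Type*} [NormedAddCommGroup B] [NormedSpace ℂ B] [FiniteDimensional ℂ B]
  {X : Type*} [TopologicalSpace X] [ChartedSpace B X] [IsManifold 𝓘(ℂ, B) ω X]
  {F : Type*} [NormedAddCommGroup F] [NormedSpace ℂ F] [FiniteDimensional ℂ F]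
  {E : X → Type*} [TopologicalSpace (Bundle.TotalSpace F E)] [∀ x, AddCommGroup (E x)]
  [∀ x, Module ℂ (E x)] [∀ x, TopologicalSpace (E x)] [FiberBundle F E] [VectorBundle ℂ F E]
  {G : Type*} [NormedAddCommGroup G] [NormedSpace ℂ G] [FiniteDimensional ℂ G]
  {L : X → Type*} [TopologicalSpace (Bundle.TotalSpace G L)] [∀ x, AddCommGroup (L x)]
  [∀ x, Module ℂ (L x)] [∀ x, TopologicalSpace (L x)] [FiberBundle G L] [VectorBundle ℂ G L]

/-! ### The maps `g^k_n` -/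

variable (B) in
/-- The map `g^k_n` as a multilinear map. -/
def hitchinHom (θ : HiggsSec E L) (k n : ℕ) :
    MultilinearMap ℂ (fun _ : Fin n => EndSec B E L) (SymSec B L) :=
  MultilinearMap.pi fun x => (polTraceHom k n (θ x)).compLinearMap fun _ => LinearMap.proj x

theorem hitchinOps_eq (θ : HiggsSec E L) (k n : ℕ) (y : Fin n → ℤ × EndSec B E L) :
    hitchinOps B θ k n y = hitchinHom B θ k n fun i => (y i).2 := rfl

theorem endGr_le_span (n : ℤ) : endGr B F E G L n ≤ Submodule.span ℂ
    {s | ∃ p q : ℕ, (p : ℤ) + q = n ∧ s ∈ endForms B F E G L p q} :=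
  iSup_le fun p => iSup_le fun q => iSup_le fun h _ hs => Submodule.subset_span ⟨p, q, h, hs⟩

theorem localRep_hitchinHom (θ : HiggsSec E L) (k : ℕ) {n : ℕ} (s : Fin n → EndSec B E L) {x₀ : X}
    {z : B} (hz : z ∈ localDom B (frameDom F E G L) x₀) :
    localRep (B := B) (symLoc B G L) (hitchinHom B θ k n s) x₀ z =
      polTrace k n (localRep (higgsLoc F E G L) θ x₀ z)
        fun i => localRep (endLoc B F E G L) (s i) x₀ z :=
  SymFib.map_polTrace _ _ (fromFrame_comp_toFrame hz.2.1) (toFrame_comp_fromFrame hz.2.1) k _ _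

theorem symLoc_hitchinHom (θ : HiggsSec E L) (k : ℕ) {n : ℕ} (s : Fin n → EndSec B E L) (x : X) :
    symLoc B G L x x (hitchinHom B θ k n s x) =
      polTrace k n (higgsLoc F E G L x x (θ x)) fun i => endLoc B F E G L x x (s i x) :=
  SymFib.map_polTrace _ _ (fromFrame_comp_toFrame (mem_baseSet_trivializationAt F E x))
    (toFrame_comp_fromFrame (mem_baseSet_trivializationAt F E x)) k _ _

variable [ContMDiffVectorBundle ω F E 𝓘(ℂ, B)] [ContMDiffVectorBundle ω G L 𝓘(ℂ, B)]

theorem isSmooth_hitchinHom {θ : HiggsSec E L} (hθ : IsHolomorphicHiggs B F E G L θ) (k : ℕ) {n : ℕ}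
    {s : Fin n → EndSec B E L} (hs : ∀ i, EndSm B F E G L (s i)) :
    IsSmooth (B := B) (symLoc B G L) (fun x₀ => (trivializationAt G L x₀).baseSet)
      (hitchinHom B θ k n s) := by
  have h := holFrames_end B F E G L
  refine (holFrames_sym B G L).isSmooth_of_local fun x => ⟨localDom B (frameDom F E G L) x,
    isOpen_localDom h.isOpen_dom x, mem_localDom h.mem_dom x, fun z hz => ⟨hz.1, hz.2.2⟩, ?_⟩
  exact .congr _ _ (fun z hz => (localRep_hitchinHom θ k s hz).symm)
    (SmTens.polTrace (HolTens.smTens (holTens_higgs hθ x)) k fun i => hs i x)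

theorem hitchinHom_mem {θ : HiggsSec E L} (hθ : IsHolomorphicHiggs B F E G L θ) (k : ℕ) {n : ℕ}
    {s : Fin n → EndSec B E L} {d : Fin n → ℤ} (hs : ∀ i, s i ∈ endGr B F E G L (d i + 1)) :
    hitchinHom B θ k n s ∈ symGr B G L k (∑ i, d i + 1) := by
  rw [← Submodule.Quotient.mk_eq_zero]
  refine multilinear_eq_of_span ((Submodule.mkQ (symGr B G L k (∑ i, d i + 1))).compMultilinearMap
    (hitchinHom B θ k n)) 0 (fun m hm => ?_) fun i => endGr_le_span _ (hs i)
  refine (Submodule.Quotient.mk_eq_zero _).2 ?_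
  choose p q hpq hm using hm
  -- Unless all arguments have degree one in `L` the value is zero. If they do, the form degrees
  -- equal the degrees in `M[1]`, and their sum is the degree of the value before the shift.
  by_cases hq : ∃ i, q i ≠ 1
  · obtain ⟨i, hi⟩ := hq
    have h0 : hitchinHom B θ k n m = 0 :=
      funext fun x => polTrace_eq_zero k (θ x) (i := i) ((mem_endForms.1 (hm i)).2 x) hi
    rw [h0]
    exact zero_mem _
  · push Not at hq
    have hd : ∀ i, d i = p i := fun i => by have := hpq i; rw [hq i] at this; push_cast at this; omega
    rw [symGr_eq (p := ∑ i, p i) (by push_cast; simp [hd])]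
    refine ⟨isSmooth_hitchinHom hθ k fun i => (mem_endForms.1 (hm i)).1, fun x =>
      polTrace_mem k (θ x) fun i => ?_⟩
    have := (mem_endForms.1 (hm i)).2 x
    rwa [hq i] at this

theorem isSymMap_hitchinOps {θ : HiggsSec E L} (hθ : IsHolomorphicHiggs B F E G L θ) (k n : ℕ) :
    IsSymMap (shift (endGr B F E G L)) (shift (symGr B G L k)) 0 (hitchinOps B θ k n) where
  mem x hx := by
    rw [add_zero]
    exact hitchinHom_mem hθ k hx
  map_add x _ i v _ w _ := by
    rw [hitchinOps_eq, hitchinOps_eq, hitchinOps_eq, snd_update, snd_update, snd_update]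
    exact (hitchinHom B θ k n).map_update_add _ _ _ _
  map_smul x _ i a v _ := by
    rw [hitchinOps_eq, hitchinOps_eq, snd_update, snd_update]
    exact (hitchinHom B θ k n).map_update_smul _ _ _ _
  symm x hx σ := funext fun z =>
    polTrace_perm k (θ z) (fun i => (endGr_spec (hx i)).2 z) σ

/-- Evaluated at a point, in the chart and frames of that point and after decoration, both sides
become the sum of the words with one argument replaced by its `∂̄`. The left side does so by
`coef_afterCoder`, the right side by `coef_dol_polTrace`. -/
theorem afterCoder_hitchinOps {θ : HiggsSec E L} (hθ : IsHolomorphicHiggs B F E G L θ)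
    (hθθ : IsIntegrable θ) (k : ℕ) {n : ℕ} {x : Fin n → ℤ × EndSec B E L}
    (hx : Homog (shift (endGr B F E G L)) x) :
    afterCoder (endOps B F E G L θ) (hitchinOps B θ k) n x =
      -symDbar B G L (hitchinOps B θ k n x) := by
  have hE := holFrames_end B F E G L
  have hS := holFrames_sym B G L
  refine hS.ext fun p => ?_
  have ho := isOpen_localDom (B := B) hE.isOpen_dom p
  have hp := mem_localDom (B := B) hE.mem_dom p
  have hs : ∀ i, SmTens (localDom B (frameDom F E G L) p)
    (localRep (endLoc B F E G L) (x i).2 p) := fun i => (endGr_spec (hx i)).1 p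
  have hloc : ∀ s : EndSec B E L, localRep (B := B) (endLoc B F E G L) s p
      (extChartAt 𝓘(ℂ, B) p p) = endLoc B F E G L p p (s p) := fun s => by
    unfold localRep; rw [extChartAt_to_inv]
  have hlocθ : localRep (B := B) (higgsLoc F E G L) θ p (extChartAt 𝓘(ℂ, B) p p) =
      higgsLoc F E G L p p (θ p) := by
    unfold localRep; rw [extChartAt_to_inv]
  let φ : EndSec B E L →+ EndFib B F G :=
    (endLoc B F E G L p p).toAddMonoidHom.comp (Pi.evalAddMonoidHom _ p)
  let ψ : SymSec B L →+ SymFib B G :=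
    (symLoc B G L p p).toAddMonoidHom.comp (Pi.evalAddMonoidHom _ p)
  have h1 : symLoc B G L p p (afterCoder (endOps B F E G L θ) (hitchinOps B θ k) n x p) =
      afterCoder (endOps B F E G L θ) (fun n y => polTrace k n (higgsLoc F E G L p p (θ p))
        fun i => φ (y i).2) n x := by
    refine (map_afterCoder _ _ ψ x).trans ?_
    congr 1
    funext n y
    exact symLoc_hitchinHom θ k (fun i => (y i).2) p
  have h2 : symLoc B G L p p ((-symDbar B G L (hitchinOps B θ k n x)) p) =
      -dol (wedgeSym B G) (fun z => polTrace k n (localRep (higgsLoc F E G L) θ p z)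
        fun i => localRep (endLoc B F E G L) (x i).2 p z) (extChartAt 𝓘(ℂ, B) p p) := by
    rw [Pi.neg_apply, map_neg, symDbar_eq, hS.loc_dbar]
    congr 1
    exact (dol_congr ho (SmTens.polTrace (HolTens.smTens (holTens_higgs hθ p)) k hs) hp
      fun z hz => (localRep_hitchinHom θ k (fun i => (x i).2) hz).symm).symm
  rw [h1, h2, ← sub_eq_zero, sub_neg_eq_add]
  obtain ⟨e, η, η', he, hη, -, hne⟩ := exists_isDec x
  refine tmul_eq_zero_of_ne_zero (right_ne_zero_of_mul hne) (coef_eq_zero ?_)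
  rw [TensorProduct.add_tmul, map_add, coef_dol_polTrace ho hp (holTens_higgs hθ p) k hs
    (d := fun i => (x i).1)
    (fun i z _ => EndFib.map_mem_endTot _ _ _ _ ((endGr_spec (hx i)).2 _)) he hη]
  have h := coef_afterCoder (higgsLoc F E G L p p (θ p)) k φ
    (fun v => dol (wedgeEnd B F G) (localRep (endLoc B F E G L) v p) (extChartAt 𝓘(ℂ, B) p p))
    (isDGLA_end hθ hθθ) (fun n v hv => EndFib.map_mem_endTot _ _ _ _ ((endGr_spec hv).2 p))
    (fun n v hv => ?_) (fun n m v w => ?_) hη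
    (l := (List.finRange n).map fun i => (x i, e i)) (fun a ha => ?_) (fun a ha => ?_)
  · have hl : ((List.finRange n).map fun i => (x i, e i)).map Prod.fst = List.ofFn x := by
      rw [List.map_map, List.ofFn_eq_map]; rfl
    have hdec : dec ((List.finRange n).map fun i => (x i, e i)) = (List.ofFn e).prod := by
      unfold dec
      rw [List.map_map, List.ofFn_eq_map]; rfl
    rw [hl, hdec, app_ofFn, pickSum_map] at h
    -- Only the identification of the letters remains: the local representatives at the centre of
    -- the chart are the components at the point.
    rw [endOps, h, neg_add_eq_zero]
    refine pickSum_congr fun a t _ => ?_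
    rw [hlocθ, List.map_map]
    congr 2
    refine List.map_congr_left fun b _ => ?_
    rw [hloc]
    rfl
  · change endLoc B F E G L p p (endDbar B F E G L v p + gradedComm 1 n (higgsForm B θ) v p) = _
    rw [map_add, endDbar_eq, hE.loc_dbar]
    congr 1
    refine (EndFib.map_gradedComm _ _
      (fromFrame_comp_toFrame (mem_baseSet_trivializationAt F E p))
      (toFrame_comp_fromFrame (mem_baseSet_trivializationAt F E p)) _ _ _ _).trans ?_
    exact congrArg (fun t => gradedComm 1 n t _) (EndFib.map_inclHiggs _ _ _ _ _)
  · exact EndFib.map_gradedComm _ _ (fromFrame_comp_toFrame (mem_baseSet_trivializationAt F E p))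
      (toFrame_comp_fromFrame (mem_baseSet_trivializationAt F E p)) _ _ _ _
  · obtain ⟨i, -, rfl⟩ := List.mem_map.1 ha
    exact he i
  · obtain ⟨i, -, rfl⟩ := List.mem_map.1 ha
    exact hx i

end Bundles

end Hitchin
end

theorem proposition7p3
    {B : Type*} [NormedAddCommGroup B] [NormedSpace ℂ B] [FiniteDimensional ℂ B]
    {X : Type*} [TopologicalSpace X] [T2Space X] [CompactSpace X] [ChartedSpace B X]
    [IsManifold 𝓘(ℂ, B) ω X]
    {F : Type*} [NormedAddCommGroup F] [NormedSpace ℂ F] [FiniteDimensional ℂ F]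
    {E : X → Type*} [TopologicalSpace (Bundle.TotalSpace F E)] [∀ x, AddCommGroup (E x)]
    [∀ x, Module ℂ (E x)] [∀ x, TopologicalSpace (E x)] [FiberBundle F E] [VectorBundle ℂ F E]
    [ContMDiffVectorBundle ω F E 𝓘(ℂ, B)]
    {G : Type*} [NormedAddCommGroup G] [NormedSpace ℂ G] [FiniteDimensional ℂ G]
    {L : X → Type*} [TopologicalSpace (Bundle.TotalSpace G L)] [∀ x, AddCommGroup (L x)]
    [∀ x, Module ℂ (L x)] [∀ x, TopologicalSpace (L x)] [FiberBundle G L] [VectorBundle ℂ G L]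
    [ContMDiffVectorBundle ω G L 𝓘(ℂ, B)]
    (θ : ∀ x, Module.End ℂ (E x) ⊗[ℂ] L x)
    (hθ : Hitchin.IsHolomorphicHiggs B F E G L θ)
    (hθθ : Hitchin.IsIntegrable θ)
    (k : ℕ) (hk : 1 ≤ k) (hkr : k ≤ Module.finrank ℂ F) :
    LInf.IsLInftyMorphism
      (Hitchin.endGr B F E G L) (Hitchin.endOps B F E G L θ)
      (Hitchin.symGr B G L k) (Hitchin.symOps B G L)
      (Hitchin.hitchinOps B θ k) := by
  exact LInf.isLInftyMorphism_of_abelian (Hitchin.isDGLA_end hθ hθθ).isLInftyAlgebra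
    (Hitchin.isDGLA_sym k) (fun n _ => Hitchin.isSymMap_hitchinOps hθ k n)
    fun _ _ _ hx => Hitchin.afterCoder_hitchinOps hθ hθθ k hx
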